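/- **Setting.** Let $p$ be an odd prime, $M\ge 1$, $k$ a finite field with $p^{N_0}$ elements, $\mathcal K=k((t_0))$, $W_M(k)=W(k)/p^M$, and $O(\mathcal K)=W_M(k)((t))$ with $\mathfrak m(\mathcal K)=tW_M(k)[[t]]$. Let $\sigma$ act on $O(\mathcal K)$ by Frobenius on $W_M(k)$ and by $\sigma t=t^p$, and put $\mathrm{Tr}\,\alpha=\sum_{0\le n<N_0}\sigma^n\alpha$ on $W_M(k)$. Fix $\alpha_0\in W_M(k)$ with $\mathrm{Tr}\,\alpha_0=1$ and $\mathbb Z/p^M$-bases $\{\beta_i\}$, $\{\gamma_i\}$, $1\le i\le N_0$, of $W_M(k)$ with $\mathrm{Tr}(\beta_i\gamma_j)=\delta_{ij}$. For $\alpha\in W(k)$ let $E(\alpha,X)=\exp\bigl(\sum_{n\ge 0}\sigma^n(\alpha)X^{p^n}/p^n\bigr)\in W(k)[[X]]$; write $E(\alpha,t_0^a)\in k[[t_0]]$ for the value at $t_0^a$ of its reduction modulo $p$. Let $\mathcal L$ be the free profinite Lie $\mathbb Z/p^M$-algebra with module of generators $\mathcal K^*/\mathcal K^{*p^M}$, modulo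 the closure of the ideal of commutators of order $\ge p$. For $R=W_M(k)$ and $R=O(\mathcal K)$ let $\mathcal L_k$, resp. $\mathcal L_{\mathcal K}$, be the completed tensor product $\mathcal L\,\hat\otimes\,R$ (the inverse limit of $(\mathcal L/I)\otimes R$ over open ideals $I$), on which $\sigma$ acts through $R$. Let $\circ$ be the Campbell–Hausdorff operation. Let $D_0$ be the class of $t_0$ and, for $a\ge 1$ prime to $p$, let $D_{a0}=\sum_i\gamma_i\,E(\beta_i,t_0^a)^{1/a}\in\mathcal L_k$ (with any lifts of $\beta_i$ to $W(k)$). Put $$e=\alpha_0D_0+\sum_{a\ge1,\ (a,p)=1}t^{-a}D_{a0}\in\mathcal L_{\mathcal K}.$$ Let $[p](X)\in\mathbb Z_p[[X]]$ be multiplication by $p$ in the formal group over $\mathbb Z_p$ with logarithm $X+X^p/p+X^{p^2}/p^2+\cdots$. Let $S_0\in\mathfrak m(\mathcal K)$ with $S_0\not\equiv0\bmod p$, let $S=[p]^M(S_0)$ ($M$-fold iterate), and let $e^*$ be the $t_0$-adic order of $S\bmod p$. Let $\mathrm{Im}\,\iota=\{\sum_{a\ge1,(a,p)=1}\alpha_at^a\mid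 \alpha_a\in W_M(k)\}$, identified with $\mathcal U/\mathcal U^{p^M}$, $\mathcal U=1+t_0k[[t_0]]$, by $\prod_aE(\alpha_a,t_0^a)\leftrightarrow\sum_a\alpha_at^a$. Put $(\mathcal K^*/\mathcal K^{*p^M})^{(1)}=\mathcal K^*/\mathcal K^{*p^M}$ and, for $s\ge1$, $(\mathcal K^*/\mathcal K^{*p^M})^{(s+1)}=(\mathrm{Im}\,\iota)S^s$. Let $\{\mathcal L(s)\}_{s\ge1}$ be the minimal decreasing filtration of $\mathcal L$ by closed ideals such that $\mathcal L(1)=\mathcal L$, $[\mathcal L(s_1),\mathcal L(s_2)]\subset\mathcal L(s_1+s_2)$ for all $s_1,s_2\ge1$, and $\mathcal L(s)\supset(\mathcal K^*/\mathcal K^{*p^M})^{(s)}$ for all $s\ge1$. Let $\mathcal N=\sum_{s\ge1}S^{-s}\mathcal L(s)_{\mathfrak m(\mathcal K)}\subset\mathcal L_{\mathcal K}$ be the set of convergent sums of elements of $S^{-s}\mathcal L(s)_{\mathfrak m(\mathcal K)}$, where $\mathcal L(s)_{\mathfrak m(\mathcal K)}=\mathcal L(s)\,\hat\otimes\,\mathfrak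 m(\mathcal K)$. **Statement.** There are $V_{(0)}\in\mathcal L$, $x\in S\mathcal N$ and $V_{(b,m)}\in\mathcal L_k$ ($m\ge1$, $1\le b<e^*$, $\gcd(b,p)=1$), with $V_{(b,m)}$ converging to $0$, such that $$e^\dagger:=\sum_{(b,m)}S^{-m}t^bV_{(b,m)}+\alpha_0V_{(0)}\in\mathcal N\quad\text{and}\quad e^\dagger=(-\sigma x)\circ e\circ x.\qquad(*)$$ For every choice of such elements satisfying $(*)$: 1. the elements $V_{(b,m),i}:=\sum_{0\le n<N_0}\sigma^n(\beta_i)\,\sigma^n(V_{(b,m)})$ lie in $\mathcal L$, and together with $V_{(0)}$ they form a system of free topological generators of $\mathcal L$ as a profinite Lie $\mathbb Z/p^M$-algebra of nilpotent class $<p$; 2. if $\mathrm{wt}$ is the weight function on $\mathcal L$ given by $\mathrm{wt}(V_{(b,m),i})=m$ and $\mathrm{wt}(V_{(0)})=1$ (so $\mathrm{wt}(l)\ge s$ means that $l$ is a convergent sum of $\mathbb Z/p^M$-multiples of iterated commutators of these generators of total weight $\ge s$), then for every $s\ge1$ $$\mathcal L(s)=\{l\in\mathcal L\mid \mathrm{wt}(l)\ge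 s\}.$$ -/

import Mathlib

open scoped TensorProduct PowerSeries LaurentSeries

noncomputable section

namespace NilpotentArtinSchreier

/-! ### Truncated Witt vectors, the lift `O(𝒦)` and Frobenius -/

section Coefficients

variable (p : ℕ) [Fact p.Prime] (M : ℕ) (k : Type*) [Field k] [CharP k p]

/-- `W_M(k) = W(k) / p^M`, the Witt vectors of length `M` of a perfect field `k`. -/
def WM : Type _ := WittVector p k ⧸ Ideal.span {((p : WittVector p k) ^ M)}

instance : CommRing (WM p M k) :=
  inferInstanceAs (CommRing (WittVector p k ⧸ Ideal.span {((p : WittVector p k) ^ M)}))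

/-- The projection `W(k) → W_M(k)`. -/
def toWM : WittVector p k →+* WM p M k := Ideal.Quotient.mk _

theorem toWM_surjective : Function.Surjective (toWM p M k) := Ideal.Quotient.mk_surjective

theorem WM_cast_eq_zero : ((p ^ M : ℕ) : WM p M k) = 0 := by
  have h : toWM p M k ((p : WittVector p k) ^ M) = 0 :=
    Ideal.Quotient.eq_zero_iff_mem.mpr (Ideal.mem_span_singleton_self _)
  rw [map_pow, map_natCast] at h
  rw [Nat.cast_pow, h]

/-- The unique ring homomorphism `ℤ/p^M → W_M(k)`. -/
def zmodToWM : ZMod (p ^ M) →+* WM p M k :=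
  (Ideal.Quotient.lift (Ideal.span {((p ^ M : ℕ) : ℤ)}) (Int.castRingHom (WM p M k)) (by
    intro a ha
    obtain ⟨c, rfl⟩ := Ideal.mem_span_singleton'.mp ha
    have h := WM_cast_eq_zero p M k
    rw [map_mul, map_natCast, h, mul_zero])).comp
    (Int.quotientSpanNatEquivZMod (p ^ M)).symm.toRingHom

instance : Algebra (ZMod (p ^ M)) (WM p M k) := (zmodToWM p M k).toAlgebra

/-- Frobenius `σ` on `W_M(k)`. -/
def frobWM : WM p M k →+* WM p M k :=
  Ideal.quotientMap _ (WittVector.frobenius : WittVector p k →+* WittVector p k) (by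
    rw [Ideal.span_singleton_le_iff_mem, Ideal.mem_comap, map_pow, map_natCast]
    exact Ideal.mem_span_singleton_self _)

/-- `Tr : W_M(k) → W_M(k)`, `Tr α = ∑_{0 ≤ n < N₀} σⁿ α`, where `k` has `p^N₀` elements. -/
def trWM (N₀ : ℕ) (a : WM p M k) : WM p M k :=
  ∑ n ∈ Finset.range N₀, (frobWM p M k)^[n] a

/-- `O(𝒦) = W_M(k)((t))`, the lift modulo `p^M` of `𝒦 = k((t₀))`. -/
def OK : Type _ := LaurentSeries (WM p M k)

instance : CommRing (OK p M k) := inferInstanceAs (CommRing (LaurentSeries (WM p M k)))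

/-- The constants `W_M(k) → O(𝒦)`. -/
def constOK : WM p M k →+* OK p M k := (HahnSeries.C : WM p M k →+* LaurentSeries (WM p M k))

instance : Algebra (ZMod (p ^ M)) (OK p M k) :=
  ((constOK p M k).comp (zmodToWM p M k)).toAlgebra

/-- `σ` on `O(𝒦)`: Frobenius on the coefficients and `σ t = t^p`. -/
def frobOK : OK p M k →+* OK p M k :=
  show LaurentSeries (WM p M k) →+* LaurentSeries (WM p M k) from (HahnSeries.embDomainRingHom (AddMonoidHom.mulLeft (p : ℤ))
    (fun _ _ h => mul_left_cancel₀ (Nat.cast_ne_zero.mpr (Fact.out : p.Prime).ne_zero) h)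
    (fun _ _ => mul_le_mul_iff_right₀ (Nat.cast_pos.mpr (Fact.out : p.Prime).pos))).comp
  { toFun := fun f => f.map (frobWM p M k)
    map_one' := by
      ext i
      by_cases hi : i = 0 <;> simp [HahnSeries.coeff_one, hi]
    map_mul' := fun f g => HahnSeries.map_mul (frobWM p M k : WM p M k →ₙ+* WM p M k)
    map_zero' := by ext; simp
    map_add' := fun f g => by ext; simp }

/-- `𝔪(𝒦) = t W_M(k)[[t]] ⊆ O(𝒦)`. -/
def mK : Set (OK p M k) := {f | ∀ j : ℤ, j ≤ 0 → HahnSeries.coeff (f : LaurentSeries (WM p M k)) j = 0}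

end Coefficients

/-! ### The series `[p]`, the element `S` and the number `e*` -/

section ElementS

variable (p : ℕ) [Fact p.Prime] (M : ℕ) (k : Type*) [Field k] [CharP k p]

/-- The logarithm `X + X^p/p + X^{p²}/p² + …`. -/
def logSeries : ℚ_[p]⟦X⟧ :=
  PowerSeries.mk fun n => if n = p ^ Nat.log p n then ((n : ℚ_[p]))⁻¹ else 0

/-- The isogeny `[p]` of the formal group over `ℤ_p` with logarithm `logSeries p`: the unique
series `P` over `ℤ_p` without constant term such that `log (P(X)) = p log X`. -/
def mulP : ℤ_[p]⟦X⟧ :=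
  Classical.epsilon fun P : ℤ_[p]⟦X⟧ => PowerSeries.constantCoeff P = 0 ∧
    (logSeries p).subst (P.map PadicInt.Coe.ringHom) = (p : ℚ_[p]) • logSeries p

/-- `[p]` with coefficients reduced to `W_M(k)`. -/
def mulPWM : (WM p M k)⟦X⟧ :=
  (mulP p).map ((zmodToWM p M k).comp (PadicInt.toZModPow M))

/-- `S = [p]^M (S₀)`, the `M`-fold iterate of `[p]` applied to `S₀ ∈ t W_M(k)[[t]]`. -/
def serS (S₀ : (WM p M k)⟦X⟧) : (WM p M k)⟦X⟧ :=
  (fun f : (WM p M k)⟦X⟧ => ((mulPWM p M k).subst f : (WM p M k)⟦X⟧))^[M] S₀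

/-- `e*`: the `t₀`-adic order of `S mod p`, i.e. the least `n` such that the `n`-th coefficient of
`S` is not divisible by `p`. -/
def eStar (S : (WM p M k)⟦X⟧) : ℕ :=
  sInf {n | ¬ ((p : WM p M k) ∣ PowerSeries.coeff n S)}

/-- A power series over `W_M(k)` in `t` as an element of `O(𝒦)`. -/
def toOK (f : (WM p M k)⟦X⟧) : OK p M k := HahnSeries.ofPowerSeries ℤ (WM p M k) f

/-- The element `S^{-m}` of `O(𝒦)` (`S` is invertible in `O(𝒦)` as soon as `S mod p ≠ 0`). -/
def invS (S : (WM p M k)⟦X⟧) (m : ℕ) : OK p M k := Ring.inverse (toOK p M k S) ^ m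

/-- `t^j ∈ O(𝒦)`. -/
def tPow (j : ℤ) : OK p M k := HahnSeries.single j (1 : WM p M k)

end ElementS

/-! ### The Shafarevich function and units of `𝒦 = k((t₀))` -/

section Units

variable (p : ℕ) [Fact p.Prime] (M : ℕ) (k : Type*) [Field k] [CharP k p]

/-- The series `α X + σ(α) X^p / p + σ²(α) X^{p²} / p² + …` over `Frac W(k)`. -/
def shafExponent (α : WittVector p k) : (FractionRing (WittVector p k))⟦X⟧ :=
  PowerSeries.mk fun n => if n = p ^ Nat.log p n then
    algebraMap (WittVector p k) (FractionRing (WittVector p k)) ((WittVector.frobenius : WittVector p k →+* WittVector p k)^[Nat.log p n] α)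
      * ((n : FractionRing (WittVector p k)))⁻¹ else 0

/-- The Shafarevich function `E(α, X) = exp (α X + σ(α) X^p / p + …) ∈ W(k)[[X]]`: the unique
series over `W(k)` which becomes this exponential over `Frac W(k)`. -/
def shaf (α : WittVector p k) : (WittVector p k)⟦X⟧ :=
  Classical.epsilon fun F : (WittVector p k)⟦X⟧ =>
    F.map (algebraMap (WittVector p k) (FractionRing (WittVector p k))) =
      (PowerSeries.mk fun n => ((n.factorial : FractionRing (WittVector p k)))⁻¹).subst (shafExponent p k α)

/-- `E(α, t₀^a) ∈ k[[t₀]]`, for `a ≥ 1`. -/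
def shafAt (α : WittVector p k) (a : ℕ) : k⟦X⟧ :=
  ((shaf p k α).map WittVector.constantCoeff).subst (PowerSeries.X ^ a : k⟦X⟧)

/-- A nonzero power series as an element of `𝒦^*` (and `1` for the zero series). -/
def toUnit (f : k⟦X⟧) : (k⸨X⸩)ˣ :=
  open Classical in
  if h : (HahnSeries.ofPowerSeries ℤ k f : k⸨X⸩) ≠ 0 then Units.mk0 _ h else 1

/-- `u = ∏_{a ≥ 1, (a,p)=1} E(α_a, t₀^a)`, a `t₀`-adically convergent product
(note that `E(α, t₀^a) ≡ 1 mod t₀^a`). -/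
def IsShafProd (u : (k⸨X⸩)ˣ) (α : ℕ → WittVector p k) : Prop :=
  ∃ f : k⟦X⟧, (u : k⸨X⸩) = HahnSeries.ofPowerSeries ℤ k f ∧
    ∀ n : ℕ, (PowerSeries.X : k⟦X⟧) ^ (n + 1) ∣
      f - ∏ a ∈ (Finset.Icc 1 n).filter (fun a => a.Coprime p), shafAt p k (α a) a

/-- `Im ι = {∑_{a ≥ 1, (a,p)=1} α_a t^a | α_a ∈ W_M(k)}`. -/
def imIota : Set ((WM p M k)⟦X⟧) := {g | ∀ n, p ∣ n → PowerSeries.coeff n g = 0}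

/-- `ι (∏_a E(α_a, t₀^a)) = ∑_a α_a t^a`, the sums over `a ≥ 1` prime to `p`. -/
def iotaSeries (α : ℕ → WittVector p k) : (WM p M k)⟦X⟧ :=
  PowerSeries.mk fun a => if p ∣ a then 0 else toWM p M k (α a)

/-- The subsets of `𝒦^*` whose images in `𝒦^*/𝒦^{*p^M}` are the submodules
`(𝒦^*/𝒦^{*p^M})^{(s)}`, `s ≥ 1`: everything for `s = 1`, and `(Im ι) S^{s-1}`, under the
identification `ι` of `𝒰/𝒰^{p^M}` with `Im ι`, for `s ≥ 2`. The index `0` is not used. -/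
def unitFil (S : (WM p M k)⟦X⟧) : ℕ → Set (k⸨X⸩)ˣ
  | 0 => Set.univ
  | 1 => Set.univ
  | s + 2 => {u | ∃ α : ℕ → WittVector p k, IsShafProd p k u α ∧
      ∃ g ∈ imIota p M k, iotaSeries p M k α = g * S ^ (s + 1)}

end Units

/-! ### The Lie algebra `ℒ` -/

section LieAlg

variable (p : ℕ) [Fact p.Prime] (M : ℕ) (k : Type*) [Field k] [CharP k p]

/-- The free Lie `ℤ/p^M`-algebra on the set `𝒦^*`. -/
abbrev FreeL : Type _ := FreeLieAlgebra (ZMod (p ^ M)) (k⸨X⸩)ˣ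

/-- The ideal generated by the relations making `𝒦^* → ℒ` a homomorphism of groups (which then
factors through `𝒦^*/𝒦^{*p^M}`, the coefficients being `ℤ/p^M`), by the units `≡ 1 mod t₀^{n+1}`,
and by all commutators of order `≥ p`. -/
def lvlIdeal (n : ℕ) : LieIdeal (ZMod (p ^ M)) (FreeL p M k) :=
  LieSubmodule.lieSpan (ZMod (p ^ M)) (FreeL p M k)
    ({x | ∃ u v : (k⸨X⸩)ˣ, x = FreeLieAlgebra.of _ (u * v) -
        (FreeLieAlgebra.of _ u + FreeLieAlgebra.of _ v)} ∪
     {x | ∃ u : (k⸨X⸩)ˣ, (∃ f : k⟦X⟧, (u : k⸨X⸩) = HahnSeries.ofPowerSeries ℤ k f ∧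
        (PowerSeries.X : k⟦X⟧) ^ (n + 1) ∣ f - 1) ∧ x = FreeLieAlgebra.of _ u}) ⊔
  LieModule.lowerCentralSeries (ZMod (p ^ M)) (FreeL p M k) (FreeL p M k) (p - 1)

/-- The `n`-th finite layer of `ℒ`: the free Lie `ℤ/p^M`-algebra of nilpotent class `< p` on the
finite module `𝒦^*/(1 + t₀^{n+1}k[[t₀]])𝒦^{*p^M}`. -/
abbrev Lvl (n : ℕ) : Type _ := FreeL p M k ⧸ lvlIdeal p M k n

theorem lvlIdeal_succ_le (n : ℕ) : lvlIdeal p M k (n + 1) ≤ lvlIdeal p M k n := by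
  refine sup_le_sup_right (LieSubmodule.lieSpan_mono (Set.union_subset_union_right _ ?_)) _
  rintro x ⟨u, ⟨f, hf, hd⟩, rfl⟩
  exact ⟨u, ⟨f, hf, (pow_dvd_pow _ (Nat.le_succ _)).trans hd⟩, rfl⟩

/-- The transition maps `Lvl (n+1) → Lvl n`. -/
def trans (n : ℕ) : Lvl p M k (n + 1) →ₗ[ZMod (p ^ M)] Lvl p M k n :=
  Submodule.factor (p := (lvlIdeal p M k (n + 1)).toSubmodule)
    (p' := (lvlIdeal p M k n).toSubmodule) (lvlIdeal_succ_le p M k n)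

theorem trans_lie (n : ℕ) (x y : Lvl p M k (n + 1)) :
    trans p M k n ⁅x, y⁆ = ⁅trans p M k n x, trans p M k n y⁆ := by
  obtain ⟨x, rfl⟩ := LieSubmodule.Quotient.surjective_mk' _ x
  obtain ⟨y, rfl⟩ := LieSubmodule.Quotient.surjective_mk' _ y
  rfl

/-- `ℒ = lim Lvl n`: the free profinite Lie `ℤ/p^M`-algebra with module of generators
`𝒦^*/𝒦^{*p^M}`, modulo the closure of the ideal of commutators of order `≥ p`. -/
def LcalSub : Submodule (ZMod (p ^ M)) (∀ n, Lvl p M k n) where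
  carrier := {x | ∀ n, trans p M k n (x (n + 1)) = x n}
  add_mem' hx hy n := by simp [hx n, hy n]
  zero_mem' n := by simp
  smul_mem' c x hx n := by simp [hx n]

/-- `ℒ` as a type. -/
abbrev Lcal : Type _ := LcalSub p M k

instance : LieRing (Lcal p M k) where
  bracket x y := ⟨fun n => ⁅x.1 n, y.1 n⁆, fun n => by rw [trans_lie, x.2 n, y.2 n]⟩
  add_lie x y z := Subtype.ext (funext fun n => add_lie (x.1 n) (y.1 n) (z.1 n))
  lie_add x y z := Subtype.ext (funext fun n => lie_add (x.1 n) (y.1 n) (z.1 n))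
  lie_self x := Subtype.ext (funext fun n => lie_self (x.1 n))
  leibniz_lie x y z := Subtype.ext (funext fun n => leibniz_lie (x.1 n) (y.1 n) (z.1 n))

instance : LieAlgebra (ZMod (p ^ M)) (Lcal p M k) where
  lie_smul c x y := Subtype.ext (funext fun n => lie_smul c (x.1 n) (y.1 n))

/-- The class in `Lvl n` of the generator attached to `u ∈ 𝒦^*`. -/
def genLvl (n : ℕ) (u : (k⸨X⸩)ˣ) : Lvl p M k n :=
  LieSubmodule.Quotient.mk (FreeLieAlgebra.of (ZMod (p ^ M)) u)

/-- The canonical map `𝒦^* → 𝒦^*/𝒦^{*p^M} ⊆ ℒ`. -/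
def gen (u : (k⸨X⸩)ˣ) : Lcal p M k := ⟨fun n => genLvl p M k n u, fun _ => rfl⟩

/-- Closedness of a subset of `ℒ` for the inverse limit topology. -/
def IsClosedInL (I : Set (Lcal p M k)) : Prop :=
  ∀ l : Lcal p M k, (∀ n, ∃ c ∈ I, c.1 n = l.1 n) → l ∈ I

/-- The (completed) extension of scalars `ℒ_R = lim (R ⊗ Lvl n)`, as a subgroup of the product. -/
def LR (R : Type*) [CommRing R] [Algebra (ZMod (p ^ M)) R] :
    AddSubgroup (∀ n, R ⊗[ZMod (p ^ M)] Lvl p M k n) where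
  carrier := {x | ∀ n, (trans p M k n).lTensor R (x (n + 1)) = x n}
  add_mem' hx hy n := by simp [hx n, hy n]
  zero_mem' n := by simp
  neg_mem' hx n := by simp [hx n]

/-- The map `R ⊗ Lvl n → R' ⊗ Lvl n` induced by a ring homomorphism `f : R → R'`. -/
def scalarMap {R R' : Type*} [CommRing R] [Algebra (ZMod (p ^ M)) R] [CommRing R']
    [Algebra (ZMod (p ^ M)) R'] (f : R →+* R') (n : ℕ) :
    R ⊗[ZMod (p ^ M)] Lvl p M k n →ₗ[ZMod (p ^ M)] R' ⊗[ZMod (p ^ M)] Lvl p M k n :=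
  (f.toAddMonoidHom.toZModLinearMap (p ^ M)).rTensor (Lvl p M k n)

end LieAlg

/-! ### The filtration `{ℒ(s)}` -/

section Filtration

variable (p : ℕ) [Fact p.Prime] (M : ℕ) (k : Type*) [Field k] [CharP k p]

/-- Decreasing central filtrations `{F(s)}_{s ≥ 1}` of `ℒ` by closed ideals, with `F(1) = ℒ` and
`F(s) ⊇ (𝒦^*/𝒦^{*p^M})^{(s)}`. -/
structure IsAdmissibleFiltration (S : (WM p M k)⟦X⟧)
    (F : ℕ → LieIdeal (ZMod (p ^ M)) (Lcal p M k)) : Prop where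
  closed : ∀ s, 1 ≤ s → IsClosedInL p M k (F s : Set (Lcal p M k))
  one : F 1 = ⊤
  anti : ∀ s, 1 ≤ s → F (s + 1) ≤ F s
  central : ∀ s₁ s₂, 1 ≤ s₁ → 1 ≤ s₂ → ∀ x ∈ F s₁, ∀ y ∈ F s₂, ⁅x, y⁆ ∈ F (s₁ + s₂)
  contains : ∀ s, 1 ≤ s → ∀ u ∈ unitFil p M k S s, gen p M k u ∈ F s

/-- `ℒ(s)`, `s ≥ 1`: the `s`-th term of the minimal filtration as above. -/
def Lfil (S : (WM p M k)⟦X⟧) (s : ℕ) : LieIdeal (ZMod (p ^ M)) (Lcal p M k) :=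
  sInf {I | ∃ F, IsAdmissibleFiltration p M k S F ∧ I = F s}

/-- `𝒩 = ∑_{s ≥ 1} S^{-s} ℒ(s)_{𝔪(𝒦)} ⊆ ℒ_𝒦`, where the sum means the set of convergent sums,
equivalently the closure of the algebraic sum. -/
def Ncal (S : (WM p M k)⟦X⟧) : Set (∀ n, OK p M k ⊗[ZMod (p ^ M)] Lvl p M k n) :=
  {y | y ∈ LR p M k (OK p M k) ∧ ∀ n, y n ∈ AddSubgroup.closure
    {z | ∃ s, 1 ≤ s ∧ ∃ f ∈ mK p M k, ∃ l ∈ Lfil p M k S s,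
      z = (invS p M k S s * f) ⊗ₜ[ZMod (p ^ M)] l.1 n}}

end Filtration

/-! ### The Campbell–Hausdorff operation -/

section CampbellHausdorff

variable (R L : Type*) [CommRing R] [LieRing L] [LieAlgebra R L]

attribute [local instance 100] LieRing.ofAssociativeRing

/-- The augmentation ideal of the enveloping algebra of `L`. -/
def augIdeal : Submodule R (UniversalEnvelopingAlgebra R L) :=
  LinearMap.ker (UniversalEnvelopingAlgebra.lift R (0 : L →ₗ⁅R⁆ R)).toLinearMap

/-- The truncated exponential `1 + x + … + x^{p-1}/(p-1)!`. -/
def truncExp (p : ℕ) (x : L) : UniversalEnvelopingAlgebra R L :=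
  ∑ j ∈ Finset.range p,
    Ring.inverse ((j.factorial : ℕ) : R) • (UniversalEnvelopingAlgebra.ι R x) ^ j

/-- `z = l₁ ∘ l₂ ∘ … ∘ l_r`, for a Lie algebra `L` of nilpotent class `< p`: the product of the
truncated exponentials of the `lᵢ` equals that of `z` modulo the `p`-th power of the augmentation
ideal of the enveloping algebra. -/
def IsCHProd (p : ℕ) (l : List L) (z : L) : Prop :=
  (l.map (truncExp R L p)).prod - truncExp R L p z ∈ augIdeal R L ^ p

end CampbellHausdorff

/-! ### The elements `e`, `e†` and the weight function -/

section Elements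

variable (p : ℕ) [Fact p.Prime] (M : ℕ) (k : Type*) [Field k] [CharP k p]

/-- The component in `W_M(k) ⊗ Lvl n` of `D_{a0} ∈ ℒ_k`, `a ≥ 1` prime to `p`:
`D_{a0} = ∑_i γ_i E(β_i, t₀^a)^{1/a}`, where `{β_i}` and `{γ_i}` are bases of `W_M(k)` dual for the
trace form. Equivalently, `E(α, t₀^a)^{1/a} = ∑_{n mod N₀} σⁿ(α) σⁿ(D_{a0})` for all `α`. -/
def elemD {N₀ : ℕ} (β γ : Fin N₀ → WM p M k) (a n : ℕ) : WM p M k ⊗[ZMod (p ^ M)] Lvl p M k n :=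
  ∑ i, γ i ⊗ₜ[ZMod (p ^ M)] ((a : ZMod (p ^ M))⁻¹ •
    genLvl p M k n (toUnit k (shafAt p k (Function.surjInv (toWM_surjective p M k) (β i)) a)))

/-- `e = α₀ D₀ + ∑_{a ≥ 1, (a,p)=1} t^{-a} D_{a0} ∈ ℒ_𝒦`, where `D₀` is the class of `t₀`. In each
`O(𝒦) ⊗ Lvl n` only finitely many terms are nonzero. -/
def elemE {N₀ : ℕ} (α₀ : WM p M k) (β γ : Fin N₀ → WM p M k) (n : ℕ) :
    OK p M k ⊗[ZMod (p ^ M)] Lvl p M k n :=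
  constOK p M k α₀ ⊗ₜ[ZMod (p ^ M)] genLvl p M k n (toUnit k PowerSeries.X) +
    ∑ᶠ a : {a : ℕ // 1 ≤ a ∧ a.Coprime p},
      tPow p M k (-(a.1 : ℤ)) • scalarMap p M k (constOK p M k) n (elemD p M k β γ a.1 n)

/-- The pairs `(b, m)` with `1 ≤ b < e*`, `gcd(b, p) = 1`, `m ≥ 1`. -/
abbrev Idx (eS : ℕ) : Type := {x : ℕ × ℕ // 1 ≤ x.1 ∧ x.1 < eS ∧ x.1.Coprime p ∧ 1 ≤ x.2}

/-- `e† = ∑_{(b,m)} S^{-m} t^b V_{(b,m)} + α₀ V_{(0)}`. -/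
def elemEDag (S : (WM p M k)⟦X⟧) (α₀ : WM p M k)
    (V : Idx p (eStar p M k S) → LR p M k (WM p M k)) (V₀ : Lcal p M k) (n : ℕ) :
    OK p M k ⊗[ZMod (p ^ M)] Lvl p M k n :=
  (∑ᶠ i, (invS p M k S i.1.2 * tPow p M k (i.1.1 : ℤ)) •
      scalarMap p M k (constOK p M k) n ((V i).1 n)) +
    constOK p M k α₀ ⊗ₜ[ZMod (p ^ M)] V₀.1 n

/-- The elements `V_{(b,m)} ∈ ℒ_k`, `V_{(0)} ∈ ℒ` (with `V_{(b,m)} → 0`, so that `e†` makes sense)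
and `x ∈ S𝒩` satisfy `e† ∈ 𝒩` and `e† = (-σx) ∘ e ∘ x`. -/
structure IsGaugeData {N₀ : ℕ} (S : (WM p M k)⟦X⟧) (α₀ : WM p M k) (β γ : Fin N₀ → WM p M k)
    (V : Idx p (eStar p M k S) → LR p M k (WM p M k)) (V₀ : Lcal p M k)
    (x : ∀ n, OK p M k ⊗[ZMod (p ^ M)] Lvl p M k n) : Prop where
  tendsto_zero : ∀ n, {i | (V i).1 n ≠ 0}.Finite
  mem_SN : ∃ y ∈ Ncal p M k S, ∀ n, x n = toOK p M k S • y n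
  dag_mem : elemEDag p M k S α₀ V V₀ ∈ Ncal p M k S
  gauge : ∀ n, IsCHProd (OK p M k) (OK p M k ⊗[ZMod (p ^ M)] Lvl p M k n) p
    [-(scalarMap p M k (frobOK p M k) n (x n)), elemE p M k α₀ β γ n, x n]
    (elemEDag p M k S α₀ V V₀ n)

/-- The family `v` consists of the elements `V_{(b,m),i} = ∑_{n mod N₀} σⁿ(β_i) σⁿ(V_{(b,m)})`
of `ℒ = (ℒ_k)^{σ = id}` and of `V_{(0)}` (at the index `none`). -/
def IsGeneratorFamily {N₀ : ℕ} {eS : ℕ} (β : Fin N₀ → WM p M k)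
    (V : Idx p eS → LR p M k (WM p M k)) (V₀ : Lcal p M k)
    (v : Option (Idx p eS × Fin N₀) → Lcal p M k) : Prop :=
  v none = V₀ ∧ ∀ (j : Idx p eS) (i : Fin N₀) (n : ℕ),
    (1 : WM p M k) ⊗ₜ[ZMod (p ^ M)] (v (some (j, i))).1 n =
      ∑ r ∈ Finset.range N₀, (frobWM p M k)^[r] (β i) •
        (scalarMap p M k (frobWM p M k) n)^[r] ((V j).1 n)

/-- `v` is a system of free topological generators of `ℒ`, i.e. `ℒ` is free on `v` among
profinite Lie `ℤ/p^M`-algebras of nilpotent class `< p`: `v` converges to `0`, and every family `h`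
of elements, almost all zero, of a finite Lie `ℤ/p^M`-algebra `H` of nilpotent class `< p` is the
image of `v` under a unique continuous homomorphism. -/
def IsFreeTopGenerators {ι : Type*} (v : ι → Lcal p M k) : Prop :=
  (∀ n, {i | (v i).1 n ≠ 0}.Finite) ∧
  ∀ (H : Type) [LieRing H] [LieAlgebra (ZMod (p ^ M)) H] [Finite H],
    LieModule.lowerCentralSeries (ZMod (p ^ M)) H H (p - 1) = ⊥ →
    ∀ h : ι → H, {i | h i ≠ 0}.Finite →
      ∃! φ : Lcal p M k →ₗ⁅ZMod (p ^ M)⁆ H,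
        (∃ n, ∀ l : Lcal p M k, l.1 n = 0 → φ l = 0) ∧ ∀ i, φ (v i) = h i

variable {p M k}

/-- `IsMonomial v w d x`: `x` is an iterated commutator of members of the family `v`, and `d` is
its weight, the sum of the weights `w` of the members involved. -/
inductive IsMonomial {ι : Type*} (v : ι → Lcal p M k) (w : ι → ℕ) : ℕ → Lcal p M k → Prop
  | gen (i : ι) : IsMonomial v w (w i) (v i)
  | lie {a b : ℕ} {x y : Lcal p M k} :
      IsMonomial v w a x → IsMonomial v w b y → IsMonomial v w (a + b) ⁅x, y⁆

/-- The closed `ℤ/p^M`-submodule of `ℒ` generated by the commutators of weight `≥ s` in `v`. -/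
def weightGE {ι : Type*} (v : ι → Lcal p M k) (w : ι → ℕ) (s : ℕ) : Set (Lcal p M k) :=
  {l | ∀ n, ∃ c ∈ AddSubgroup.closure {x | ∃ d, s ≤ d ∧ IsMonomial v w d x}, c.1 n = l.1 n}

/-- The weight function on `ℒ` attached to the weights `w` of the free generators `v`: the weight
of `l` is the largest `s` (or `∞`) such that `l` is a convergent sum of multiples of commutators of
weight `≥ s`. -/
def wt {ι : Type*} (v : ι → Lcal p M k) (w : ι → ℕ) (l : Lcal p M k) : ℕ∞ :=
  sSup {d | ∃ s : ℕ, d = (s : ℕ∞) ∧ l ∈ weightGE v w s}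

/-- The weights of the generators: `wt (V_{(b,m),i}) = m` and `wt (V_{(0)}) = 1`. -/
def genWeight {eS N₀ : ℕ} : Option (Idx p eS × Fin N₀) → ℕ
  | none => 1
  | some (j, _) => j.1.2

end Elements

end NilpotentArtinSchreier

end

set_option linter.unusedSectionVars false

noncomputable section

namespace NilpotentArtinSchreier

/-! The theorem is a duality between units and Laurent series, lifted through brackets. Modulo
brackets the gauge equation reads `e† ≡ e + x - σx`, so `e†` is a normal form of `e` modulo `(σ -
1)O(𝒦)`. The normal form comes from the decomposition of `O(𝒦)` into the `S^{-m} t^b W_M(k)`, the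
line `α₀ ℤ/p^M`, and `σ - 1` applied to normalized series (`sumMap_bijective`). All its projections
respect the order of pole along `S` (`decomposition_of_mem_Pole`). Two properties of `S = [p]^M(S₀)`
make this work: its derivative is zero modulo `p^M`, and `S = σS'` with `S'` dividing `S`
(`exists_frobPS_eq_serS`).

Contracting `e` with a functional on `O(𝒦)` produces the class of a unit in each layer (`con_e`).
Under this correspondence the coefficient functionals at `S^{-m} t^b` give units in the `m`-th step
of the unit filtration (`exists_unit_of_P`), and for `m ≥ 2` every unit of that step comes from a
functional that kills all poles of order `< m` (`exists_functional_of_mem_unitFil`). Both directions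
rest on the fact that `t d/dt` commutes with multiplication by `S^m`.

Existence: starting from `z = e`, solve `σξ - ξ = z - Πz`, where `Π` projects onto the normal form,
and replace `z` by `(-σξ) ∘ z ∘ ξ`. The error `z - Πz` moves one step down the lower central series
each time (`gaugeStep_mem`). After `p - 1` steps it is zero, because the class is `< p`.

For an arbitrary solution, `e† ∈ 𝒩` puts each `V_{(b,m),i}` in `ℒ(m)`, so commutators of weight `≥
s` lie in `ℒ(s)`. The converse inclusion is proved modulo deeper and deeper terms of the lower
central series (`LL_le_FC`). If it is known modulo one term, the brackets in the gauge equation are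
under control modulo the next. Hence `Πe` has coefficients in the weight filtration at that depth,
and so do the units recovered from it by contraction. The weight filtration is then admissible at
that depth, and the minimality of `ℒ(s)` applies.

Freeness: modulo commutators the generators are contractions of `e` with functionals dual to the
elements `S^{-m} t^b γ_j` and `α₀`. A homomorphism with prescribed values is therefore built by
correcting values on units, one term of the lower central series of the target at a time
(`exists_lieHom_improve`). Uniqueness is the case `s = 1` of the equality of filtrations.

Two supporting theories precede this. The relation `IsCHProd` in the enveloping algebra is shown to
be the graph of an operation `CH` defined by an element of the free Lie algebra; an Euler derivation
is used both to construct that element (`exists_freeCH`) and to separate truncated exponentials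
(`eq_of_truncExp_sub_mem`). The functions `E(α, t₀^a)` are shown to be integral and to parametrize
the principal units (`exists_shafProd`, `p_pow_dvd_of_shafProd`). Throughout, `lcs 0` is the whole
algebra, so `lcs (p - 1) = ⊥` means class `< p`. -/

/-! ### The Euler derivation of a free Lie algebra -/

section Euler

variable {R : Type*} [CommRing R]

/-- The Lie algebra `L ⊕ εL` of dual numbers over `L`. -/
def DualLie (L : Type*) : Type _ := L × L

variable {L : Type*} [LieRing L] [LieAlgebra R L]

instance : AddCommGroup (DualLie L) := inferInstanceAs (AddCommGroup (L × L))

instance : Module R (DualLie L) := inferInstanceAs (Module R (L × L))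

instance : LieRing (DualLie L) where
  bracket x y := (⁅x.1, y.1⁆, ⁅x.2, y.1⁆ + ⁅x.1, y.2⁆)
  add_lie x y z := Prod.ext (add_lie x.1 y.1 z.1) (by
    change ⁅x.2 + y.2, z.1⁆ + ⁅x.1 + y.1, z.2⁆ = (⁅x.2, z.1⁆ + ⁅x.1, z.2⁆) + (⁅y.2, z.1⁆ + ⁅y.1, z.2⁆)
    simp only [add_lie]; abel)
  lie_add x y z := Prod.ext (lie_add x.1 y.1 z.1) (by
    change ⁅x.2, y.1 + z.1⁆ + ⁅x.1, y.2 + z.2⁆ = (⁅x.2, y.1⁆ + ⁅x.1, y.2⁆) + (⁅x.2, z.1⁆ + ⁅x.1, z.2⁆)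
    simp only [lie_add]; abel)
  lie_self x := Prod.ext (lie_self x.1) (by
    change ⁅x.2, x.1⁆ + ⁅x.1, x.2⁆ = 0
    rw [← lie_skew x.1 x.2]; abel)
  leibniz_lie x y z := Prod.ext (leibniz_lie x.1 y.1 z.1) (by
    change ⁅x.2, ⁅y.1, z.1⁆⁆ + ⁅x.1, ⁅y.2, z.1⁆ + ⁅y.1, z.2⁆⁆ =
      (⁅⁅x.2, y.1⁆ + ⁅x.1, y.2⁆, z.1⁆ + ⁅⁅x.1, y.1⁆, z.2⁆) +
      (⁅y.2, ⁅x.1, z.1⁆⁆ + ⁅y.1, ⁅x.2, z.1⁆ + ⁅x.1, z.2⁆⁆)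
    simp only [add_lie, lie_add, leibniz_lie x.2 y.1 z.1, leibniz_lie x.1 y.2 z.1,
      leibniz_lie x.1 y.1 z.2]
    abel)

instance : LieAlgebra R (DualLie L) where
  lie_smul c x y := Prod.ext (lie_smul c x.1 y.1) (by
    change ⁅x.2, c • y.1⁆ + ⁅x.1, c • y.2⁆ = c • (⁅x.2, y.1⁆ + ⁅x.1, y.2⁆)
    simp only [lie_smul, smul_add])

/-- The elements satisfying `P` form a Lie subalgebra `K`. Lifting the generators into `K` and
including back fixes every generator, hence is the identity, so `K` is everything. -/
theorem freeLie_induction {X : Type*} {P : FreeLieAlgebra R X → Prop}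
    (of : ∀ x, P (FreeLieAlgebra.of R x)) (zero : P 0) (add : ∀ a b, P a → P b → P (a + b))
    (smul : ∀ (c : R) a, P a → P (c • a)) (lie : ∀ a b, P a → P b → P ⁅a, b⁆)
    (z : FreeLieAlgebra R X) : P z := by
  let K : LieSubalgebra R (FreeLieAlgebra R X) :=
    { carrier := {a | P a}
      add_mem' := fun {a b} => add a b
      zero_mem' := zero
      smul_mem' := fun c a => smul c a
      lie_mem' := fun {a b} => lie a b }
  let f : FreeLieAlgebra R X →ₗ⁅R⁆ K := FreeLieAlgebra.lift R fun x => ⟨_, of x⟩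
  have h : K.incl.comp f = LieHom.id := FreeLieAlgebra.hom_ext fun x => by
    simp [f, FreeLieAlgebra.lift_of_apply]
  have := congrArg (fun g : FreeLieAlgebra R X →ₗ⁅R⁆ FreeLieAlgebra R X => g z) h
  simp only [LieHom.comp_apply, LieHom.id_apply] at this
  rw [← this]
  exact (f z).2

variable (R)

/-- The Lie homomorphism `z ↦ z + ε E(z)` from a free Lie algebra to its dual numbers, where `E` is
the derivation that fixes the generators. -/
def freeDual (X : Type*) : FreeLieAlgebra R X →ₗ⁅R⁆ DualLie (FreeLieAlgebra R X) :=
  FreeLieAlgebra.lift R fun x => (show DualLie (FreeLieAlgebra R X) from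
    (FreeLieAlgebra.of R x, FreeLieAlgebra.of R x))

/-- The derivation of a free Lie algebra that fixes the generators. -/
def freeEuler (X : Type*) : FreeLieAlgebra R X →ₗ[R] FreeLieAlgebra R X where
  toFun z := (freeDual R X z).2
  map_add' a b := by rw [map_add]; rfl
  map_smul' c a := by rw [map_smul]; rfl

theorem freeDual_of {X : Type*} (x : X) :
    freeDual R X (FreeLieAlgebra.of R x) = (FreeLieAlgebra.of R x, FreeLieAlgebra.of R x) :=
  FreeLieAlgebra.lift_of_apply _ x

theorem freeEuler_of {X : Type*} (x : X) :
    freeEuler R X (FreeLieAlgebra.of R x) = FreeLieAlgebra.of R x :=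
  congrArg Prod.snd (freeDual_of R x)

/-- The first component of `freeDual` is the identity, so compatibility with brackets, read in the
`ε`-component, is the Leibniz rule. -/
theorem freeEuler_lie {X : Type*} (a b : FreeLieAlgebra R X) :
    freeEuler R X ⁅a, b⁆ = ⁅freeEuler R X a, b⁆ + ⁅a, freeEuler R X b⁆ := by
  have h1 : ∀ z, (freeDual R X z).1 = z := by
    intro z
    induction z using freeLie_induction with
    | of x => exact congrArg Prod.fst (freeDual_of R x)
    | zero => rw [map_zero]; rfl
    | add a b ha hb => rw [map_add]; exact congrArg₂ (· + ·) ha hb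
    | smul c a ha => rw [map_smul]; exact congrArg (c • ·) ha
    | lie a b ha hb => rw [LieHom.map_lie]; exact congrArg₂ (⁅·, ·⁆) ha hb
  change (freeDual R X ⁅a, b⁆).2 = ⁅(freeDual R X a).2, b⁆ + ⁅a, (freeDual R X b).2⁆
  rw [LieHom.map_lie]
  change ⁅(freeDual R X a).2, (freeDual R X b).1⁆ + ⁅(freeDual R X a).1, (freeDual R X b).2⁆ = _
  rw [h1, h1]

end Euler

/-! ### Truncated exponentials in filtered algebras -/

section TruncatedExp

variable {R : Type*} [CommRing R]

/-- The inverse of `n!`. -/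
def ifac (R : Type*) [CommRing R] (n : ℕ) : R := Ring.inverse ((n.factorial : ℕ) : R)

theorem isUnit_factorial {p : ℕ} (hR : ∀ j, 1 ≤ j → j < p → IsUnit (j : R)) (n : ℕ) (hn : n < p) :
    IsUnit ((n.factorial : ℕ) : R) := by
  induction n with
  | zero => simp
  | succ n ih =>
    rw [Nat.factorial_succ, Nat.cast_mul]
    exact (hR _ (by omega) hn).mul (ih (by omega))

theorem fac_mul_ifac {p : ℕ} (hR : ∀ j, 1 ≤ j → j < p → IsUnit (j : R)) {n : ℕ} (hn : n < p) :
    ((n.factorial : ℕ) : R) * ifac R n = 1 :=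
  Ring.mul_inverse_cancel _ (isUnit_factorial hR n hn)

theorem ifac_zero : ifac R 0 = 1 := by simp [ifac]

theorem ifac_one : ifac R 1 = 1 := by simp [ifac]

/-- This turns binomial expansions into products of truncated exponentials while dividing only by
integers below `p`. -/
theorem ifac_mul_choose {p : ℕ} (hR : ∀ j, 1 ≤ j → j < p → IsUnit (j : R)) {i j : ℕ}
    (h : i + j < p) : ifac R (i + j) * (((i + j).choose i : ℕ) : R) = ifac R i * ifac R j := by
  have h1 := fac_mul_ifac hR h
  have h2 := fac_mul_ifac hR (show i < p by omega)
  have h3 := fac_mul_ifac hR (show j < p by omega)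
  have h4 : (((i + j).choose i : ℕ) : R) * (i.factorial : ℕ) * (j.factorial : ℕ) =
      ((i + j).factorial : ℕ) := by
    have := Nat.choose_mul_factorial_mul_factorial (Nat.le_add_right i j)
    rw [Nat.add_sub_cancel_left] at this
    exact_mod_cast congrArg (Nat.cast (R := R)) this
  calc ifac R (i + j) * (((i + j).choose i : ℕ) : R)
      = ifac R (i + j) * (((i + j).choose i : ℕ) : R) * (((i.factorial : ℕ) : R) * ifac R i) *
        (((j.factorial : ℕ) : R) * ifac R j) := by rw [h2, h3]; ring
    _ = ((((i + j).choose i : ℕ) : R) * (i.factorial : ℕ) * (j.factorial : ℕ)) * ifac R (i + j) *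
        (ifac R i * ifac R j) := by ring
    _ = _ := by rw [h4, h1, one_mul]

variable {A : Type*} [Ring A] [Algebra R A]

variable (R) in
/-- The truncated exponential in an associative algebra. -/
def texp (p : ℕ) (x : A) : A := ∑ j ∈ Finset.range p, ifac R j • x ^ j

theorem map_texp {B : Type*} [Ring B] [Algebra R B] (f : A →ₐ[R] B) (p : ℕ) (x : A) :
    f (texp R p x) = texp R p (f x) := by
  simp [texp, map_sum, map_smul, map_pow]

variable {I : Submodule R A} (hl : ∀ a, ∀ x ∈ I, a * x ∈ I) (hr : ∀ a, ∀ x ∈ I, x * a ∈ I)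

include hl in
theorem mul_mem_pow_left {n : ℕ} (hn : n ≠ 0) {x : A} (hx : x ∈ I ^ n) (a : A) : a * x ∈ I ^ n := by
  obtain ⟨n, rfl⟩ := Nat.exists_eq_succ_of_ne_zero hn
  rw [Nat.succ_eq_add_one, pow_succ'] at hx ⊢
  induction hx using Submodule.mul_induction_on' with
  | mem_mul_mem m hm n hn => rw [← mul_assoc]; exact Submodule.mul_mem_mul (hl _ _ hm) hn
  | add x _ y _ hx hy => rw [mul_add]; exact add_mem hx hy

include hr in
theorem mul_mem_pow_right {n : ℕ} (hn : n ≠ 0) {x : A} (hx : x ∈ I ^ n) (a : A) :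
    x * a ∈ I ^ n := by
  obtain ⟨n, rfl⟩ := Nat.exists_eq_succ_of_ne_zero hn
  rw [Nat.succ_eq_add_one, pow_succ] at hx ⊢
  induction hx using Submodule.mul_induction_on' with
  | mem_mul_mem m hm n hn =>
    rw [mul_assoc]
    have := hm
    exact Submodule.mul_mem_mul this (hr _ _ hn)
  | add x _ y _ hx hy => rw [add_mul]; exact add_mem hx hy

include hl in
theorem pow_le_pow_of_ideal {m n : ℕ} (hm : m ≠ 0) (h : m ≤ n) : I ^ n ≤ I ^ m := by
  induction n, h using Nat.le_induction with
  | base => exact le_rfl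
  | succ n hmn ih =>
    refine le_trans ?_ ih
    rw [pow_succ']
    exact Submodule.mul_le.mpr fun a _ b hb => mul_mem_pow_left hl (by omega) hb a

theorem mul_mem_pow_add {m n : ℕ} {x y : A} (hx : x ∈ I ^ m) (hy : y ∈ I ^ n) :
    x * y ∈ I ^ (m + n) := by
  rw [pow_add]; exact Submodule.mul_mem_mul hx hy

/-- Right bracketing with `y`. -/
def rbr (y : A) : A →ₗ[R] A := LinearMap.mulRight R y - LinearMap.mulLeft R y

theorem rbr_apply (y z : A) : rbr (R := R) y z = z * y - y * z := rfl

include hl hr in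
theorem rbr_pow_mem {y z : A} (hy : y ∈ I) {m : ℕ} (hm : m ≠ 0) (hz : z ∈ I ^ m) (j : ℕ) :
    (rbr (R := R) y ^ j) z ∈ I ^ (m + j) := by
  induction j with
  | zero => simpa using hz
  | succ j ih =>
    rw [pow_succ', Module.End.mul_apply, rbr_apply, ← add_assoc]
    have hy1 : y ∈ I ^ 1 := by simpa using hy
    refine sub_mem (mul_mem_pow_add ih hy1) ?_
    rw [add_comm]
    exact mul_mem_pow_add hy1 ih

/-- Right multiplication by `y` is left multiplication by `y` plus `rbr y`, and these two operators
commute, so the binomial theorem applies. -/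
theorem mul_pow_eq_sum (y z : A) (n : ℕ) :
    z * y ^ n = ∑ ij ∈ Finset.HasAntidiagonal.antidiagonal n, (n.choose ij.1 : ℕ) • (y ^ ij.1 * (rbr (R := R) y ^ ij.2) z) := by
  have hc : Commute (LinearMap.mulLeft R y) (rbr (R := R) y) := by
    refine LinearMap.ext fun w => ?_
    simp [rbr_apply, mul_sub, mul_assoc]
  have h := congrArg (fun f : A →ₗ[R] A => f z) (hc.add_pow' n)
  have h2 : LinearMap.mulLeft R y + rbr (R := R) y = LinearMap.mulRight R y := by
    rw [rbr]; abel
  rw [h2] at h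
  simpa [LinearMap.sum_apply, LinearMap.pow_mulRight, LinearMap.pow_mulLeft] using h

theorem sum_range_antidiag {M : Type*} [AddCommMonoid M] (f : ℕ → ℕ → M) (p : ℕ) :
    ∑ n ∈ Finset.range p, ∑ ij ∈ Finset.HasAntidiagonal.antidiagonal n, f ij.1 ij.2 =
      ∑ i ∈ Finset.range p, ∑ j ∈ Finset.range (p - i), f i j := by
  rw [Finset.sum_sigma', Finset.sum_sigma']
  refine Finset.sum_bij' (fun x _ => ⟨x.2.1, x.2.2⟩) (fun x _ => ⟨x.1 + x.2, (x.1, x.2)⟩) ?_ ?_ ?_ ?_ ?_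
  · rintro ⟨n, i, j⟩ h
    simp only [Finset.mem_sigma, Finset.mem_range, Finset.HasAntidiagonal.mem_antidiagonal] at h ⊢
    omega
  · rintro ⟨i, j⟩ h
    simp only [Finset.mem_sigma, Finset.mem_range, Finset.HasAntidiagonal.mem_antidiagonal] at h ⊢
    exact ⟨show i + j < p by omega, trivial⟩
  · rintro ⟨n, i, j⟩ h
    simp only [Finset.mem_sigma, Finset.mem_range, Finset.HasAntidiagonal.mem_antidiagonal] at h
    obtain ⟨_, rfl⟩ := h
    rfl
  · rintro ⟨i, j⟩ h; rfl
  · rintro ⟨n, i, j⟩ h; rfl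

variable {p : ℕ} (hR : ∀ j, 1 ≤ j → j < p → IsUnit (j : R))

theorem texp_mul_sum_sub {c : ℕ → A} (y : A) {q : ℕ} :
    texp R p y * (∑ j ∈ Finset.range q, c j) =
      ∑ i ∈ Finset.range p, ∑ j ∈ Finset.range q, ifac R i • (y ^ i * c j) := by
  simp [texp, Finset.sum_mul_sum]

-- A term with `i + j + 1 ≥ p` has at least `p` factors in `I`, since the iterated bracket alone
-- contributes `j + 1`. So a product of two truncated sums may be cut down to a triangle. The two
-- values `q = p` and `q = p - 1` serve conjugation by an exponential and differentiation of one.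
include hl hr in
theorem sum_rect_sub_sum_triangle_mem (hp : p ≠ 0) {y z : A} (hy : y ∈ I) (hz : z ∈ I) {q : ℕ} (hqp : q ≤ p)
    (hpq : p ≤ q + 1) (c : ℕ → ℕ → R) :
    (∑ i ∈ Finset.range p, ∑ j ∈ Finset.range q, c i j • (y ^ i * (rbr (R := R) y ^ j) z)) -
      (∑ i ∈ Finset.range q, ∑ j ∈ Finset.range (q - i), c i j • (y ^ i * (rbr (R := R) y ^ j) z))
      ∈ I ^ p := by
  have hmem : ∀ i j, p ≤ i + j + 1 → c i j • (y ^ i * (rbr (R := R) y ^ j) z) ∈ I ^ p := by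
    intro i j hij
    refine Submodule.smul_mem _ _ ?_
    have h1 : (rbr (R := R) y ^ j) z ∈ I ^ (1 + j) :=
      rbr_pow_mem hl hr hy one_ne_zero (by simpa using hz) j
    have h2 : y ^ i * (rbr (R := R) y ^ j) z ∈ I ^ (i + (1 + j)) :=
      mul_mem_pow_add (Submodule.pow_mem_pow _ hy i) h1
    exact pow_le_pow_of_ideal hl hp (by omega) h2
  have hsub : ∑ i ∈ Finset.range q, ∑ j ∈ Finset.range (q - i),
      c i j • (y ^ i * (rbr (R := R) y ^ j) z) =
      ∑ i ∈ Finset.range p, ∑ j ∈ Finset.range (q - i),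
        c i j • (y ^ i * (rbr (R := R) y ^ j) z) := by
    refine Finset.sum_subset (Finset.range_mono hqp) fun i _ hi => ?_
    have : q - i = 0 := by simp at hi; omega
    simp [this]
  rw [hsub, ← Finset.sum_sub_distrib]
  refine sum_mem fun i _ => ?_
  rw [← Finset.sum_sdiff (Finset.range_mono (Nat.sub_le q i)), add_sub_cancel_right]
  refine sum_mem fun j hj => hmem i j ?_
  simp at hj
  omega

include hl hr hR in
/-- `z exp(y) = exp(y) e^{-ad y}(z)`. -/
theorem mul_texp_sub_mem (hp : p ≠ 0) {y z : A} (hy : y ∈ I) (hz : z ∈ I) :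
    z * texp R p y -
      texp R p y * (∑ j ∈ Finset.range p, ifac R j • (rbr (R := R) y ^ j) z) ∈ I ^ p := by
  rw [texp_mul_sum_sub, ← neg_mem_iff, neg_sub]
  have h : z * texp R p y = ∑ i ∈ Finset.range p, ∑ j ∈ Finset.range (p - i),
      (ifac R i * ifac R j) • (y ^ i * (rbr (R := R) y ^ j) z) := by
    rw [← sum_range_antidiag fun i j => (ifac R i * ifac R j) • (y ^ i * (rbr (R := R) y ^ j) z),
      texp, Finset.mul_sum]
    refine Finset.sum_congr rfl fun n hn => ?_
    rw [mul_smul_comm, mul_pow_eq_sum (R := R), Finset.smul_sum]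
    refine Finset.sum_congr rfl fun ij hij => ?_
    obtain ⟨i, j⟩ := ij
    rw [Finset.HasAntidiagonal.mem_antidiagonal] at hij
    simp only at hij ⊢
    subst hij
    rw [← ifac_mul_choose hR (by simpa using hn), mul_smul, Nat.cast_smul_eq_nsmul]
  rw [h]
  simpa only [mul_smul_comm, smul_smul] using
    sum_rect_sub_sum_triangle_mem hl hr hp hy hz le_rfl (Nat.le_succ p)
      (fun i j => ifac R i * ifac R j)

variable (D : A →ₗ[R] A) (hD : ∀ a b, D (a * b) = D a * b + a * D b)

-- Moving `y` across an iterated bracket costs one more bracket, and Pascal's rule collects the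
-- terms. The coefficient is a binomial of `n + 1` although `i + j = n`; after division by `(n +
-- 1)!` this leaves `1 / (i! (j + 1)!)`.
include hD in
theorem derivation_pow (y : A) (n : ℕ) :
    D (y ^ (n + 1)) = ∑ ij ∈ Finset.HasAntidiagonal.antidiagonal n,
      ((n + 1).choose ij.1 : ℕ) • (y ^ ij.1 * (rbr (R := R) y ^ ij.2) (D y)) := by
  induction n with
  | zero => simp
  | succ n ih =>
    rw [pow_succ, hD, ih, Finset.sum_mul, Finset.Nat.sum_antidiagonal_eq_sum_range_succ_mk,
      Finset.Nat.sum_antidiagonal_eq_sum_range_succ_mk]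
    have key : ∀ i, i < n + 1 → ((n + 1).choose i : ℕ) • (y ^ i * (rbr (R := R) y ^ (n - i)) (D y)) * y =
      ((n + 1).choose i : ℕ) • (y ^ (i + 1) * (rbr (R := R) y ^ (n - i)) (D y)) +
      ((n + 1).choose i : ℕ) • (y ^ i * (rbr (R := R) y ^ (n + 1 - i)) (D y)) := by
      intro i hi
      rw [show n + 1 - i = (n - i) + 1 by omega, pow_succ' (rbr (R := R) y), Module.End.mul_apply,
        rbr_apply]
      simp only [mul_sub, smul_sub, smul_mul_assoc, pow_succ, mul_assoc]
      abel
    rw [Finset.sum_congr rfl fun i hi => key i (by simpa using hi), Finset.sum_add_distrib,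
      Finset.sum_range_succ' _ (n + 1)]
    have h2 : ∀ i, ((n + 1 + 1).choose (i + 1) : ℕ) •
        (y ^ (i + 1) * (rbr (R := R) y ^ (n + 1 - (i + 1))) (D y)) =
        ((n + 1).choose i : ℕ) • (y ^ (i + 1) * (rbr (R := R) y ^ (n - i)) (D y)) +
        ((n + 1).choose (i + 1) : ℕ) • (y ^ (i + 1) * (rbr (R := R) y ^ (n + 1 - (i + 1))) (D y)) := by
      intro i
      rw [Nat.choose_succ_succ, add_smul, Nat.add_sub_add_right]
    simp only [h2]
    rw [Finset.sum_add_distrib, add_assoc, add_assoc]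
    congr 1
    have h3 := Finset.sum_range_succ' (fun i => ((n + 1).choose i : ℕ) •
      (y ^ i * (rbr (R := R) y ^ (n + 1 - i)) (D y))) (n + 1)
    rw [Finset.sum_range_succ] at h3
    simp only [Nat.choose_self, one_smul, Nat.sub_self, pow_zero, Module.End.one_apply,
      Nat.choose_zero_right] at h3 ⊢
    rw [h3]

include hD hl hr hR in
/-- `D(exp(y)) = exp(y) ((1 - e^{-ad y}) / ad y)(D y)`. -/
theorem derivation_texp_sub_mem (hp : p ≠ 0) {y : A} (hy : y ∈ I) (hDy : D y ∈ I) :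
    D (texp R p y) -
      texp R p y * (∑ j ∈ Finset.range (p - 1), ifac R (j + 1) • (rbr (R := R) y ^ j) (D y))
      ∈ I ^ p := by
  rw [texp_mul_sum_sub, ← neg_mem_iff, neg_sub]
  have h : D (texp R p y) = ∑ i ∈ Finset.range (p - 1), ∑ j ∈ Finset.range (p - 1 - i),
      (ifac R i * ifac R (j + 1)) • (y ^ i * (rbr (R := R) y ^ j) (D y)) := by
    have h1 : D 1 = 0 := by simpa using hD 1 1
    obtain ⟨q, rfl⟩ := Nat.exists_eq_succ_of_ne_zero hp
    rw [Nat.succ_sub_one, ← sum_range_antidiag fun i j => (ifac R i * ifac R (j + 1)) •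
        (y ^ i * (rbr (R := R) y ^ j) (D y)),
      texp, map_sum, Finset.sum_range_succ']
    simp only [map_smul, pow_zero, h1, smul_zero, add_zero]
    refine Finset.sum_congr rfl fun n hn => ?_
    rw [derivation_pow D hD, Finset.smul_sum]
    refine Finset.sum_congr rfl fun ij hij => ?_
    obtain ⟨i, j⟩ := ij
    rw [Finset.HasAntidiagonal.mem_antidiagonal] at hij
    simp only at hij ⊢
    subst hij
    rw [← ifac_mul_choose hR (by simp at hn; omega), mul_smul, Nat.cast_smul_eq_nsmul, add_assoc]
  rw [h]
  simpa only [mul_smul_comm, smul_smul] using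
    sum_rect_sub_sum_triangle_mem hl hr hp hy hDy (Nat.sub_le p 1) (by omega)
      (fun i j => ifac R i * ifac R (j + 1))

-- As `exp(y)` is `1` modulo `I`, multiplication by it changes `u ∈ I ^ i` only by an element of `I
-- ^ (i + 1)`. The depth of `u` therefore climbs step by step to that of the product.
include hl in
theorem mem_pow_of_texp_mul_mem {y u : A} (hy : y ∈ I) (hu : u ∈ I) {k : ℕ} (hk : k ≠ 0)
    (hp : p ≠ 0) (h : texp R p y * u ∈ I ^ k) : u ∈ I ^ k := by
  have h1 : ∀ i, 1 ≤ i → i ≤ k → u ∈ I ^ i := by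
    intro i hi
    induction i, hi using Nat.le_induction with
    | base => intro _; simpa using hu
    | succ i hi ih =>
      intro hik
      have hui := ih (by omega)
      obtain ⟨q, rfl⟩ := Nat.exists_eq_succ_of_ne_zero hp
      have h2 : texp R (q + 1) y * u = (∑ j ∈ Finset.range q, ifac R (j + 1) • (y ^ j * (y * u))) + u := by
        rw [texp, Finset.sum_range_succ', add_mul, Finset.sum_mul]
        simp [ifac_zero, pow_succ, mul_assoc]
      have h3 : (∑ j ∈ Finset.range q, ifac R (j + 1) • (y ^ j * (y * u))) ∈ I ^ (i + 1) := by
        refine sum_mem fun j _ => Submodule.smul_mem _ _ (mul_mem_pow_left hl (by omega) ?_ _)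
        rw [add_comm]
        exact mul_mem_pow_add (by simpa using hy) hui
      have h4 := pow_le_pow_of_ideal hl (by omega) hik h
      rw [Nat.succ_eq_add_one, h2] at h4
      exact (add_mem_cancel_left h3).mp h4
  exact h1 k (by omega) le_rfl

include hl hr in
theorem texp_mul_sub_mem {y u : A} (hy : y ∈ I) {k : ℕ} (hu : u ∈ I ^ k)
    (hp : p ≠ 0) : texp R p y * u - u ∈ I ^ (k + 1) := by
  obtain ⟨q, rfl⟩ := Nat.exists_eq_succ_of_ne_zero hp
  have h2 : texp R (q + 1) y * u - u = (∑ j ∈ Finset.range q, ifac R (j + 1) • (y ^ j * (y * u))) := by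
    rw [texp, Finset.sum_range_succ', add_mul, Finset.sum_mul]
    simp [ifac_zero, pow_succ, mul_assoc]
  rw [Nat.succ_eq_add_one, h2]
  refine sum_mem fun j _ => Submodule.smul_mem _ _ (mul_mem_pow_left hl (by omega) ?_ _)
  rw [add_comm]
  exact mul_mem_pow_add (by simpa using hy) hu

-- In a difference of powers of exponent at least two, every word contains `u` and a further factor
-- from `I`; only the linear term of the exponential survives.
include hl hr in
theorem texp_add_sub_mem {y u : A} (hy : y ∈ I) {k : ℕ} (hu : u ∈ I ^ k) (hk : k ≠ 0)
    (hp : 2 ≤ p) : texp R p (y + u) - texp R p y - u ∈ I ^ (k + 1) := by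
  have hk1 : I ^ k ≤ I := by simpa using pow_le_pow_of_ideal hl one_ne_zero (by omega : 1 ≤ k)
  have h1 : ∀ j, (y + u) ^ (j + 2) - y ^ (j + 2) ∈ I ^ (k + 1) := by
    have h0 : ∀ j, (y + u) ^ (j + 1) - y ^ (j + 1) ∈ I ^ k := by
      intro j
      induction j with
      | zero => simpa using hu
      | succ j ih =>
        have : (y + u) ^ (j + 1 + 1) - y ^ (j + 1 + 1) =
          (y + u) ^ (j + 1) * u + ((y + u) ^ (j + 1) - y ^ (j + 1)) * y := by
          rw [pow_succ (y + u), pow_succ y (j + 1)]; noncomm_ring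
        rw [this]
        exact add_mem (mul_mem_pow_left hl hk hu _) (mul_mem_pow_right hr hk ih _)
    intro j
    have : (y + u) ^ (j + 2) - y ^ (j + 2) =
      (y + u) ^ (j + 1) * u + ((y + u) ^ (j + 1) - y ^ (j + 1)) * y := by
      rw [pow_succ (y + u), pow_succ y (j + 1)]; noncomm_ring
    rw [this]
    refine add_mem ?_ (mul_mem_pow_add (h0 j) (by simpa using hy))
    rw [add_comm]
    refine mul_mem_pow_add ?_ hu
    have := pow_le_pow_of_ideal hl one_ne_zero (by omega : 1 ≤ j + 1)
      (Submodule.pow_mem_pow _ (add_mem hy (hk1 hu)) (j + 1))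
    exact this
  obtain ⟨q, rfl⟩ := Nat.exists_eq_add_of_le' hp
  have h2 : texp R (q + 2) (y + u) - texp R (q + 2) y - u =
      ∑ j ∈ Finset.range q, ifac R (j + 2) • ((y + u) ^ (j + 2) - y ^ (j + 2)) := by
    simp only [texp, Finset.sum_range_succ', smul_sub, Finset.sum_sub_distrib]
    simp [ifac_zero, ifac_one]
    abel
  rw [h2]
  exact sum_mem fun j _ => Submodule.smul_mem _ _ (h1 j)

end TruncatedExp

/-! ### The universal Campbell–Hausdorff element -/

section CampbellHausdorffSeries

attribute [local instance 100] LieRing.ofAssociativeRing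

variable (R : Type*) [CommRing R] (X : Type*)

/-- The algebra homomorphism `a ↦ a + ε D(a)` from a free algebra to its dual numbers, where `D` is
the derivation that fixes the generators. -/
def freeAlgDual : FreeAlgebra R X →ₐ[R] TrivSqZeroExt (FreeAlgebra R X) (FreeAlgebra R X) :=
  FreeAlgebra.lift R fun x =>
    TrivSqZeroExt.inl (FreeAlgebra.ι R x) + TrivSqZeroExt.inr (FreeAlgebra.ι R x)

/-- The derivation of a free algebra that fixes the generators. -/
def freeAlgEuler : FreeAlgebra R X →ₗ[R] FreeAlgebra R X :=
  (TrivSqZeroExt.sndHom (FreeAlgebra R X) (FreeAlgebra R X)).restrictScalars R ∘ₗ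
    (freeAlgDual R X).toLinearMap

theorem freeAlgEuler_apply (a : FreeAlgebra R X) : freeAlgEuler R X a = (freeAlgDual R X a).snd :=
  rfl

theorem fst_freeAlgDual (a : FreeAlgebra R X) : (freeAlgDual R X a).fst = a := by
  have h : (TrivSqZeroExt.fstHom R (FreeAlgebra R X) (FreeAlgebra R X)).comp (freeAlgDual R X) =
      AlgHom.id R _ := by
    ext x
    simp [freeAlgDual]
  exact congrArg (fun f : FreeAlgebra R X →ₐ[R] FreeAlgebra R X => f a) h

theorem freeAlgEuler_mul (a b : FreeAlgebra R X) :
    freeAlgEuler R X (a * b) = freeAlgEuler R X a * b + a * freeAlgEuler R X b := by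
  simp only [freeAlgEuler_apply, map_mul, TrivSqZeroExt.snd_mul, fst_freeAlgDual, smul_eq_mul,
    MulOpposite.smul_eq_mul_unop, MulOpposite.unop_op]
  abel

theorem freeAlgEuler_ι (x : X) : freeAlgEuler R X (FreeAlgebra.ι R x) = FreeAlgebra.ι R x := by
  simp [freeAlgEuler_apply, freeAlgDual]

theorem freeAlgEuler_algebraMap (r : R) :
    freeAlgEuler R X (algebraMap R (FreeAlgebra R X) r) = 0 := by
  have h1 : freeAlgEuler R X 1 = 0 := by simpa using freeAlgEuler_mul R X 1 1
  rw [Algebra.algebraMap_eq_smul_one, map_smul, h1, smul_zero]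

/-- The augmentation ideal of a free algebra. -/
def freeAug : Submodule R (FreeAlgebra R X) :=
  LinearMap.ker (FreeAlgebra.algebraMapInv (R := R) (X := X)).toLinearMap

theorem mem_freeAug {a : FreeAlgebra R X} :
    a ∈ freeAug R X ↔ FreeAlgebra.algebraMapInv a = 0 := Iff.rfl

theorem freeAug_mul_left (a x : FreeAlgebra R X) (hx : x ∈ freeAug R X) : a * x ∈ freeAug R X := by
  rw [mem_freeAug] at hx ⊢; rw [map_mul, hx, mul_zero]

theorem freeAug_mul_right (a x : FreeAlgebra R X) (hx : x ∈ freeAug R X) : x * a ∈ freeAug R X := by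
  rw [mem_freeAug] at hx ⊢; rw [map_mul, hx, zero_mul]

theorem ι_mem_freeAug (x : X) : FreeAlgebra.ι R x ∈ freeAug R X := by
  simp [mem_freeAug, FreeAlgebra.algebraMapInv]

/-- The Euler derivation multiplies degree `d` by `d`; to first order it is the projection `a ↦ a -
ε(a)`. For products, expand around the augmentations: all cross terms are products of two elements
of the augmentation ideal. -/
theorem freeAlgEuler_sub_mem_aux (a : FreeAlgebra R X) : freeAlgEuler R X a ∈ freeAug R X ∧
    freeAlgEuler R X a - (a - algebraMap R _ (FreeAlgebra.algebraMapInv a)) ∈ freeAug R X ^ 2 := by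
  induction a using FreeAlgebra.induction with
  | grade0 r => simp [freeAlgEuler_algebraMap, FreeAlgebra.algebraMap_leftInverse r]
  | grade1 x =>
    refine ⟨by rw [freeAlgEuler_ι]; exact ι_mem_freeAug R X x, ?_⟩
    rw [freeAlgEuler_ι, (mem_freeAug R X).mp (ι_mem_freeAug R X x)]
    simp
  | add a b ha hb =>
    refine ⟨by rw [map_add]; exact add_mem ha.1 hb.1, ?_⟩
    convert add_mem ha.2 hb.2 using 1
    simp only [map_add]; abel
  | mul a b ha hb =>
    set ε := FreeAlgebra.algebraMapInv (R := R) (X := X) with hε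
    have hsub : ∀ c, c - algebraMap R _ (ε c) ∈ freeAug R X := by
      intro c
      rw [mem_freeAug, map_sub, hε, FreeAlgebra.algebraMap_leftInverse, sub_self]
    refine ⟨by
      rw [freeAlgEuler_mul]
      exact add_mem (freeAug_mul_right R X _ _ ha.1) (freeAug_mul_left R X _ _ hb.1), ?_⟩
    have h1 : freeAlgEuler R X (a * b) - (a * b - algebraMap R _ (ε (a * b))) =
      ε b • (freeAlgEuler R X a - (a - algebraMap R _ (ε a))) +
      ε a • (freeAlgEuler R X b - (b - algebraMap R _ (ε b))) +
      (freeAlgEuler R X a * (b - algebraMap R _ (ε b)) +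
       (a - algebraMap R _ (ε a)) * freeAlgEuler R X b -
       (a - algebraMap R _ (ε a)) * (b - algebraMap R _ (ε b))) := by
      rw [freeAlgEuler_mul, map_mul, map_mul]
      simp only [Algebra.smul_def, mul_sub, sub_mul]
      rw [Algebra.commutes (ε b) (freeAlgEuler R X a), Algebra.commutes (ε b) a,
        Algebra.commutes (ε b) (algebraMap R _ (ε a))]
      abel
    rw [h1]
    have h2 : ∀ u ∈ freeAug R X, ∀ v ∈ freeAug R X, u * v ∈ freeAug R X ^ 2 := by
      intro u hu v hv
      rw [pow_two]; exact Submodule.mul_mem_mul hu hv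
    exact add_mem (add_mem (Submodule.smul_mem _ _ ha.2) (Submodule.smul_mem _ _ hb.2))
      (sub_mem (add_mem (h2 _ ha.1 _ (hsub b)) (h2 _ (hsub a) _ hb.1)) (h2 _ (hsub a) _ (hsub b)))

theorem freeAlgEuler_sub_nsmul_mem {k : ℕ} (hk : k ≠ 0) {a : FreeAlgebra R X}
    (ha : a ∈ freeAug R X ^ k) : freeAlgEuler R X a - k • a ∈ freeAug R X ^ (k + 1) := by
  obtain ⟨k, rfl⟩ := Nat.exists_eq_succ_of_ne_zero hk
  rw [Nat.succ_eq_add_one] at *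
  have h1 : ∀ a ∈ freeAug R X, freeAlgEuler R X a - a ∈ freeAug R X ^ 2 := by
    intro a ha
    have := (freeAlgEuler_sub_mem_aux R X a).2
    rw [(mem_freeAug R X).mp ha] at this
    simpa using this
  induction k generalizing a with
  | zero => simpa using h1 a (by simpa using ha)
  | succ k ih =>
    rw [pow_succ' _ (k + 1)] at ha
    induction ha using Submodule.mul_induction_on' with
    | mem_mul_mem u hu v hv =>
      have h2 : freeAlgEuler R X (u * v) - (k + 1 + 1) • (u * v) =
        (freeAlgEuler R X u - u) * v + u * (freeAlgEuler R X v - (k + 1) • v) := by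
        rw [freeAlgEuler_mul, succ_nsmul _ (k + 1)]
        simp only [sub_mul, mul_sub, mul_smul_comm]
        abel
      rw [h2]
      refine add_mem ?_ ?_
      · rw [show k + 1 + 1 + 1 = 2 + (k + 1) by ring]
        exact mul_mem_pow_add (h1 u hu) hv
      · rw [show k + 1 + 1 + 1 = 1 + (k + 1 + 1) by ring]
        exact mul_mem_pow_add (by simpa using hu) (ih (by omega) hv)
    | add u _ v _ hu hv =>
      convert add_mem hu hv using 1
      rw [map_add, smul_add]; abel

/-- The embedding of the free Lie algebra in the free algebra. -/
def freeLieToAlg : FreeLieAlgebra R X →ₗ⁅R⁆ FreeAlgebra R X :=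
  FreeLieAlgebra.lift R (FreeAlgebra.ι R)

theorem freeLieToAlg_of (x : X) : freeLieToAlg R X (FreeLieAlgebra.of R x) = FreeAlgebra.ι R x :=
  FreeLieAlgebra.lift_of_apply _ x

theorem freeLieToAlg_mem (z : FreeLieAlgebra R X) : freeLieToAlg R X z ∈ freeAug R X := by
  induction z using freeLie_induction with
  | of x => rw [freeLieToAlg_of]; exact ι_mem_freeAug R X x
  | zero => rw [map_zero]; exact zero_mem _
  | add a b ha hb => rw [map_add]; exact add_mem ha hb
  | smul c a ha => rw [map_smul]; exact Submodule.smul_mem _ _ ha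
  | lie a b ha hb =>
    rw [LieHom.map_lie, LieRing.of_associative_ring_bracket]
    exact sub_mem (freeAug_mul_left R X _ _ hb) (freeAug_mul_left R X _ _ ha)

theorem freeAlgEuler_freeLieToAlg (z : FreeLieAlgebra R X) :
    freeAlgEuler R X (freeLieToAlg R X z) = freeLieToAlg R X (freeEuler R X z) := by
  induction z using freeLie_induction with
  | of x => rw [freeEuler_of, freeLieToAlg_of, freeAlgEuler_ι]
  | zero => simp
  | add a b ha hb => simp only [map_add, ha, hb]
  | smul c a ha => simp only [map_smul, ha]
  | lie a b ha hb =>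
    rw [freeEuler_lie, map_add]
    simp only [LieHom.map_lie, LieRing.of_associative_ring_bracket, map_sub, freeAlgEuler_mul, ha, hb]
    abel

variable {R X}

/-- The module spanned by the brackets of a Lie algebra. -/
def brackets (R L : Type*) [CommRing R] [LieRing L] [LieAlgebra R L] : Submodule R L :=
  Submodule.span R {z | ∃ a b : L, z = ⁅a, b⁆}

theorem lie_mem_brackets {L : Type*} [LieRing L] [LieAlgebra R L] (a b : L) :
    ⁅a, b⁆ ∈ brackets R L := Submodule.subset_span ⟨a, b, rfl⟩

theorem freeEuler_sub_mem_brackets (z : FreeLieAlgebra R X) :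
    freeEuler R X z - z ∈ brackets R (FreeLieAlgebra R X) := by
  induction z using freeLie_induction with
  | of x => rw [freeEuler_of, sub_self]; exact zero_mem _
  | zero => rw [map_zero, sub_self]; exact zero_mem _
  | add a b ha hb => rw [map_add, add_sub_add_comm]; exact add_mem ha hb
  | smul c a ha => rw [map_smul, ← smul_sub]; exact Submodule.smul_mem _ _ ha
  | lie a b ha hb =>
    rw [freeEuler_lie]
    exact sub_mem (add_mem (lie_mem_brackets _ _) (lie_mem_brackets _ _)) (lie_mem_brackets _ _)

/-- Right bracketing in a Lie algebra. -/
def lieRight {L : Type*} [LieRing L] [LieAlgebra R L] (h : L) : L →ₗ[R] L :=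
  -(LieAlgebra.ad R L h)

theorem lieRight_apply {L : Type*} [LieRing L] [LieAlgebra R L] (h z : L) :
    lieRight (R := R) h z = ⁅z, h⁆ := by
  rw [← lie_skew]; rfl

theorem freeLieToAlg_lieRight_pow (h z : FreeLieAlgebra R X) (j : ℕ) :
    freeLieToAlg R X ((lieRight (R := R) h ^ j) z) =
      (rbr (R := R) (freeLieToAlg R X h) ^ j) (freeLieToAlg R X z) := by
  induction j with
  | zero => simp
  | succ j ih =>
    rw [pow_succ', pow_succ', Module.End.mul_apply, Module.End.mul_apply, lieRight_apply,
      LieHom.map_lie, ih, rbr_apply, LieRing.of_associative_ring_bracket]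

theorem sum_lieRight_sub_mem_brackets {L : Type*} [LieRing L] [LieAlgebra R L] (h z : L) {q : ℕ}
    (hq : q ≠ 0) (c : ℕ → R) (hc : c 0 = 1) :
    (∑ j ∈ Finset.range q, c j • (lieRight (R := R) h ^ j) z) - z ∈ brackets R L := by
  obtain ⟨q, rfl⟩ := Nat.exists_eq_succ_of_ne_zero hq
  rw [Nat.succ_eq_add_one, Finset.sum_range_succ']
  simp only [hc, pow_zero, Module.End.one_apply, one_smul, add_sub_cancel_right]
  refine sum_mem fun j _ => Submodule.smul_mem _ _ ?_
  rw [pow_succ', Module.End.mul_apply, lieRight_apply]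
  exact lie_mem_brackets _ _

/-- The Campbell–Hausdorff element in the free Lie algebra on two generators, modulo the `p`-th
power of the augmentation ideal. -/
theorem exists_freeCH {p : ℕ} (hp : 2 ≤ p) (hR : ∀ j, 1 ≤ j → j < p → IsUnit (j : R)) :
    ∃ H : FreeLieAlgebra R (Fin 2),
      H - (FreeLieAlgebra.of R 0 + FreeLieAlgebra.of R 1) ∈ brackets R (FreeLieAlgebra R (Fin 2)) ∧
      texp R p (FreeAlgebra.ι R (0 : Fin 2)) * texp R p (FreeAlgebra.ι R (1 : Fin 2)) -
        texp R p (freeLieToAlg R (Fin 2) H) ∈ freeAug R (Fin 2) ^ p := by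
  set I := freeAug R (Fin 2) with hI
  set φ := freeLieToAlg R (Fin 2) with hφ
  set x := FreeAlgebra.ι R (0 : Fin 2) with hx
  set y := FreeAlgebra.ι R (1 : Fin 2) with hy
  set a := FreeLieAlgebra.of R (0 : Fin 2) with ha
  set b := FreeLieAlgebra.of R (1 : Fin 2) with hb
  set D := freeAlgEuler R (Fin 2) with hDdef
  set E := freeEuler R (Fin 2) with hE
  have hl := freeAug_mul_left R (Fin 2)
  have hr := freeAug_mul_right R (Fin 2)
  have hD := freeAlgEuler_mul R (Fin 2)
  have hxI : x ∈ I := ι_mem_freeAug R _ 0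
  have hyI : y ∈ I := ι_mem_freeAug R _ 1
  have hφI : ∀ z, φ z ∈ I := freeLieToAlg_mem R _
  have hφa : φ a = x := freeLieToAlg_of R _ 0
  have hφb : φ b = y := freeLieToAlg_of R _ 1
  have hp0 : p ≠ 0 := by omega
  -- logarithmic derivatives
  set Ψ : FreeLieAlgebra R (Fin 2) → FreeLieAlgebra R (Fin 2) := fun h =>
    ∑ j ∈ Finset.range (p - 1), ifac R (j + 1) • (lieRight (R := R) h ^ j) (E h) with hΨ
  set ρ : FreeLieAlgebra R (Fin 2) :=
    (∑ j ∈ Finset.range p, ifac R j • (lieRight (R := R) b ^ j) a) + b with hρ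
  have hDexp : ∀ h, D (texp R p (φ h)) - texp R p (φ h) * φ (Ψ h) ∈ I ^ p := by
    intro h
    have := derivation_texp_sub_mem hl hr hR D hD hp0 (hφI h) (by
      rw [hDdef, hφ, freeAlgEuler_freeLieToAlg]; exact hφI _)
    convert this using 3
    simp only [hΨ, map_sum, map_smul, hφ, freeLieToAlg_lieRight_pow]
    rw [← freeAlgEuler_freeLieToAlg]
  have hDgen : ∀ i : Fin 2, D (texp R p (FreeAlgebra.ι R i)) -
      texp R p (FreeAlgebra.ι R i) * FreeAlgebra.ι R i ∈ I ^ p := by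
    intro i
    have := derivation_texp_sub_mem hl hr hR D hD hp0 (ι_mem_freeAug R _ i) (by
      rw [hDdef, freeAlgEuler_ι]; exact ι_mem_freeAug R _ i)
    convert this using 3
    obtain ⟨q, rfl⟩ := Nat.exists_eq_add_of_le' hp
    rw [show q + 2 - 1 = q + 1 by omega, Finset.sum_range_succ', Finset.sum_eq_zero]
    · simp [ifac_one, hDdef, freeAlgEuler_ι]
    · intro j _
      rw [pow_succ, Module.End.mul_apply, hDdef, freeAlgEuler_ι, rbr_apply, sub_self, map_zero,
        smul_zero]
  set g := texp R p x * texp R p y with hg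
  have hDg : D g - g * φ ρ ∈ I ^ p := by
    have h1 := mul_mem_pow_right hr hp0 (hDgen 0) (texp R p y)
    have h2 := mul_mem_pow_left hl hp0 (hDgen 1) (texp R p x)
    have h3 := mul_mem_pow_left hl hp0 (mul_texp_sub_mem hl hr hR hp0 hyI hxI) (texp R p x)
    convert add_mem (add_mem h1 h2) h3 using 1
    have h4 : φ ρ = (∑ j ∈ Finset.range p, ifac R j • (rbr (R := R) y ^ j) x) + y := by
      rw [hρ, map_add, hφb, map_sum]
      simp only [map_smul, hφ, freeLieToAlg_lieRight_pow]
      rw [← hφ, hφa, hφb]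
    rw [h4, hg, hDdef, freeAlgEuler_mul]
    simp only [← hx, ← hy]
    noncomm_ring
  -- Successive approximation. If `d = g - exp H` lies in `I ^ (j + 1)`, then `D d ≡ (j + 1) d`
  -- modulo `I ^ (j + 2)`. The logarithmic derivatives give `D d ≡ ρ - Ψ H` modulo the same power.
  -- So the missing term is `(j + 1)⁻¹ (ρ - Ψ H)`, a Lie element, and `j + 1 < p` is invertible.
  have step : ∀ j, j < p → ∃ H, H - (a + b) ∈ brackets R (FreeLieAlgebra R (Fin 2)) ∧
      g - texp R p (φ H) ∈ I ^ (j + 1) := by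
    intro j
    induction j with
    | zero =>
      intro _
      refine ⟨a + b, by rw [sub_self]; exact zero_mem _, ?_⟩
      have h1 : ∀ z ∈ I, FreeAlgebra.algebraMapInv (texp R p z) = 1 := by
        intro z hz
        rw [map_texp, (mem_freeAug R _).mp hz]
        obtain ⟨q, rfl⟩ := Nat.exists_eq_succ_of_ne_zero hp0
        simp [texp, Finset.sum_range_succ', ifac_zero]
      rw [zero_add, pow_one, hI, mem_freeAug, map_sub, hg, map_mul, h1 x hxI, h1 y hyI,
        h1 _ (hφI _)]
      simp
    | succ j ih =>
      intro hj
      obtain ⟨H, hH, hgH⟩ := ih (by omega)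
      have hunit := hR (j + 1) (by omega) hj
      obtain ⟨c, hc⟩ := hunit.exists_left_inv
      set Δ := c • (ρ - Ψ H) with hΔ
      -- The linear parts cancel: that of `ρ` is `a + b`, and that of `Ψ H` is the linear part of
      -- `H`, again `a + b`. Hence the correction never disturbs the first condition on `H`.
      have hρΨ : ρ - Ψ H ∈ brackets R (FreeLieAlgebra R (Fin 2)) := by
        have h1 := sum_lieRight_sub_mem_brackets b a hp0 (ifac R) ifac_zero
        have h2 := sum_lieRight_sub_mem_brackets H (E H) (show p - 1 ≠ 0 by omega)
          (fun j => ifac R (j + 1)) ifac_one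
        have h3 := freeEuler_sub_mem_brackets H
        convert sub_mem (sub_mem (sub_mem h1 h2) h3) hH using 1
        simp only [hρ, hΨ, hE]
        abel
      refine ⟨H + Δ, ?_, ?_⟩
      · rw [add_sub_right_comm]
        exact add_mem hH (Submodule.smul_mem _ _ hρΨ)
      · have h1 : D (g - texp R p (φ H)) - ((g - texp R p (φ H)) * φ ρ + texp R p (φ H) * φ (ρ - Ψ H)) ∈ I ^ p := by
          convert sub_mem hDg (hDexp H) using 1
          rw [map_sub, map_sub]
          noncomm_ring
        have h2 : I ^ p ≤ I ^ (j + 1 + 1) := pow_le_pow_of_ideal hl (by omega) (by omega)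
        have h3 : (g - texp R p (φ H)) * φ ρ ∈ I ^ (j + 1 + 1) :=
          mul_mem_pow_add hgH (by simpa using hφI ρ)
        have h4 := freeAlgEuler_sub_nsmul_mem R (Fin 2) (by omega) hgH
        have h5 : texp R p (φ H) * φ (ρ - Ψ H) - (j + 1) • (g - texp R p (φ H)) ∈ I ^ (j + 1 + 1) := by
          have := add_mem (sub_mem h4 (h2 h1)) (neg_mem h3)
          convert this using 1
          simp only [hDdef]
          abel
        have h6 : texp R p (φ H) * φ (ρ - Ψ H) ∈ I ^ (j + 1) := by
          have := add_mem (pow_le_pow_of_ideal hl (by omega) (by omega) h5)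
            (Submodule.smul_of_tower_mem (I ^ (j + 1)) (j + 1) hgH)
          simpa using this
        have h7 : φ (ρ - Ψ H) ∈ I ^ (j + 1) :=
          mem_pow_of_texp_mul_mem hl (hφI H) (hφI _) (by omega) hp0 h6
        have h8 := texp_mul_sub_mem hl hr (hφI H) h7 hp0
        have h9 : φ Δ - (g - texp R p (φ H)) ∈ I ^ (j + 1 + 1) := by
          have := Submodule.smul_mem _ c (sub_mem h5 h8)
          convert this using 1
          rw [hΔ, map_smul, sub_sub_sub_cancel_left, smul_sub, ← Nat.cast_smul_eq_nsmul R, smul_smul, hc, one_smul]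
        have h10 : φ Δ ∈ I ^ (j + 1) := by
          rw [hΔ, map_smul]; exact Submodule.smul_mem _ _ h7
        have h11 := texp_add_sub_mem hl hr (hφI H) h10 (by omega) hp
        have := neg_mem (add_mem h9 h11)
        convert this using 1
        rw [map_add]
        abel
  obtain ⟨H, h1, h2⟩ := step (p - 1) (by omega)
  exact ⟨H, h1, by rwa [Nat.sub_add_cancel (by omega)] at h2⟩

end CampbellHausdorffSeries

/-! ### The Campbell–Hausdorff operation in Lie algebras -/

section CHProduct

attribute [local instance 100] LieRing.ofAssociativeRing

/-- A choice of the Campbell–Hausdorff element in the free Lie algebra on two generators. -/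
def freeCH (R : Type*) [CommRing R] (p : ℕ) : FreeLieAlgebra R (Fin 2) :=
  Classical.epsilon fun H =>
      H - (FreeLieAlgebra.of R 0 + FreeLieAlgebra.of R 1) ∈ brackets R (FreeLieAlgebra R (Fin 2)) ∧
      texp R p (FreeAlgebra.ι R (0 : Fin 2)) * texp R p (FreeAlgebra.ι R (1 : Fin 2)) -
        texp R p (freeLieToAlg R (Fin 2) H) ∈ freeAug R (Fin 2) ^ p

variable {R : Type*} [CommRing R] {p : ℕ}

theorem freeCH_spec (hp : 2 ≤ p) (hR : ∀ j, 1 ≤ j → j < p → IsUnit (j : R)) :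
    freeCH R p - (FreeLieAlgebra.of R 0 + FreeLieAlgebra.of R 1) ∈
        brackets R (FreeLieAlgebra R (Fin 2)) ∧
      texp R p (FreeAlgebra.ι R (0 : Fin 2)) * texp R p (FreeAlgebra.ι R (1 : Fin 2)) -
        texp R p (freeLieToAlg R (Fin 2) (freeCH R p)) ∈ freeAug R (Fin 2) ^ p :=
  Classical.epsilon_spec (exists_freeCH hp hR)

variable {L L' : Type*} [LieRing L] [LieAlgebra R L] [LieRing L'] [LieAlgebra R L']

variable (R p) in
/-- The Campbell–Hausdorff operation `a ∘ b`. -/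
def CH (a b : L) : L := FreeLieAlgebra.lift R ![a, b] (freeCH R p)

theorem map_CH (f : L →ₗ⁅R⁆ L') (a b : L) : f (CH R p a b) = CH R p (f a) (f b) := by
  have : f.comp (FreeLieAlgebra.lift R ![a, b]) = FreeLieAlgebra.lift R ![f a, f b] := by
    refine FreeLieAlgebra.hom_ext fun i => ?_
    rw [LieHom.comp_apply, FreeLieAlgebra.lift_of_apply, FreeLieAlgebra.lift_of_apply]
    fin_cases i <;> rfl
  exact congrArg (fun g : FreeLieAlgebra R (Fin 2) →ₗ⁅R⁆ L' => g (freeCH R p)) this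

/-- If `a ∈ N`, `b ∈ J ⊆ N`, `[N, J] ⊆ J' ⊆ J`, then `a ∘ b - a - b ∈ J'`. -/
theorem CH_sub_mem (hp : 2 ≤ p) (hR : ∀ j, 1 ≤ j → j < p → IsUnit (j : R)) {J J' : Submodule R L}
    {a b : L} (hb : b ∈ J) (haJ : ∀ y ∈ J, ⁅a, y⁆ ∈ J') (hJJ : ∀ x ∈ J, ∀ y ∈ J, ⁅x, y⁆ ∈ J')
    (hJ' : J' ≤ J) : CH R p a b - (a + b) ∈ J' := by
  set f := FreeLieAlgebra.lift R ![a, b] with hf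
  -- The image of the free Lie algebra lies in `R a + J`. Since `[a, a] = 0`, a bracket of two such
  -- elements lies in `J'`, and the Campbell–Hausdorff element differs from its linear part by
  -- brackets only.
  have h1 : ∀ z, ∃ c : R, f z - c • a ∈ J := by
    intro z
    induction z using freeLie_induction with
    | of i =>
      rw [hf, FreeLieAlgebra.lift_of_apply]
      fin_cases i
      · exact ⟨1, by simp⟩
      · exact ⟨0, by simpa using hb⟩
    | zero => exact ⟨0, by simp⟩
    | add x y hx hy =>
      obtain ⟨c, hc⟩ := hx
      obtain ⟨d, hd⟩ := hy
      refine ⟨c + d, ?_⟩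
      convert add_mem hc hd using 1
      rw [map_add, add_smul]; abel
    | smul r x hx =>
      obtain ⟨c, hc⟩ := hx
      refine ⟨r * c, ?_⟩
      convert J.smul_mem r hc using 1
      rw [map_smul, smul_sub, mul_smul]
    | lie x y hx hy =>
      obtain ⟨c, hc⟩ := hx
      obtain ⟨d, hd⟩ := hy
      refine ⟨0, ?_⟩
      have h2 : ⁅f x, f y⁆ = ⁅f x - c • a, f y - d • a⁆ + c • ⁅a, f y - d • a⁆ - d • ⁅a, f x - c • a⁆ := by
        simp only [sub_lie, lie_sub, smul_lie, lie_smul, lie_self, smul_zero, sub_zero]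
        rw [← lie_skew (f x) a, smul_neg]
        abel
      rw [zero_smul, sub_zero, LieHom.map_lie, h2]
      exact sub_mem (add_mem (hJ' (hJJ _ hc _ hd)) (J.smul_mem _ (hJ' (haJ _ hd))))
        (J.smul_mem _ (hJ' (haJ _ hc)))
  have h2 : ∀ x y : FreeLieAlgebra R (Fin 2), f ⁅x, y⁆ ∈ J' := by
    intro x y
    obtain ⟨c, hc⟩ := h1 x
    obtain ⟨d, hd⟩ := h1 y
    have h2 : ⁅f x, f y⁆ = ⁅f x - c • a, f y - d • a⁆ + c • ⁅a, f y - d • a⁆ - d • ⁅a, f x - c • a⁆ := by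
      simp only [sub_lie, lie_sub, smul_lie, lie_smul, lie_self, smul_zero, sub_zero]
      rw [← lie_skew (f x) a, smul_neg]
      abel
    rw [LieHom.map_lie, h2]
    exact sub_mem (add_mem (hJJ _ hc _ hd) (J'.smul_mem _ (haJ _ hd))) (J'.smul_mem _ (haJ _ hc))
  have h3 : ∀ z ∈ brackets R (FreeLieAlgebra R (Fin 2)), f z ∈ J' := by
    intro z hz
    induction hz using Submodule.span_induction with
    | mem z hz => obtain ⟨x, y, rfl⟩ := hz; exact h2 x y
    | zero => rw [map_zero]; exact zero_mem _
    | add x y _ _ hx hy => rw [map_add]; exact add_mem hx hy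
    | smul c x _ hx => rw [map_smul]; exact J'.smul_mem _ hx
  have h4 := h3 _ (freeCH_spec hp hR).1
  rw [map_sub, map_add, hf, FreeLieAlgebra.lift_of_apply, FreeLieAlgebra.lift_of_apply] at h4
  exact h4

/-! ### Enveloping algebras -/

variable {O : Type*} [CommRing O] [LieAlgebra O L]

theorem uea_induction {P : UniversalEnvelopingAlgebra O L → Prop}
    (hC : ∀ r, P (algebraMap O (UniversalEnvelopingAlgebra O L) r)) (hι : ∀ x, P (UniversalEnvelopingAlgebra.ι O x))
    (add : ∀ a b, P a → P b → P (a + b)) (mul : ∀ a b, P a → P b → P (a * b))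
    (u : UniversalEnvelopingAlgebra O L) : P u := by
  let K : Subalgebra O (UniversalEnvelopingAlgebra O L) :=
    { carrier := {a | P a}
      add_mem' := fun {a b} => add a b
      mul_mem' := fun {a b} => mul a b
      algebraMap_mem' := hC }
  let g : L →ₗ⁅O⁆ K :=
    { toFun := fun x => ⟨UniversalEnvelopingAlgebra.ι O x, hι x⟩
      map_add' := fun x y => Subtype.ext (map_add _ x y)
      map_smul' := fun c x => Subtype.ext (map_smul _ c x)
      map_lie' := fun {x y} => Subtype.ext (LieHom.map_lie _ x y) }
  have h : K.val.comp (UniversalEnvelopingAlgebra.lift O g) =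
      AlgHom.id O (UniversalEnvelopingAlgebra O L) := by
    refine UniversalEnvelopingAlgebra.hom_ext O ?_
    ext x
    simp [g]
  have := congrArg (fun f : UniversalEnvelopingAlgebra O L →ₐ[O] UniversalEnvelopingAlgebra O L => f u) h
  simp only [AlgHom.comp_apply, AlgHom.id_apply] at this
  rw [← this]
  exact (UniversalEnvelopingAlgebra.lift O g u).2

/-- The augmentation of the enveloping algebra. -/
def ueaAug (O L : Type*) [CommRing O] [LieRing L] [LieAlgebra O L] :
    UniversalEnvelopingAlgebra O L →ₐ[O] O :=
  UniversalEnvelopingAlgebra.lift O (0 : L →ₗ⁅O⁆ O)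

theorem mem_augIdeal {u : UniversalEnvelopingAlgebra O L} : u ∈ augIdeal O L ↔ ueaAug O L u = 0 :=
  Iff.rfl

theorem ueaAug_ι (x : L) : ueaAug O L (UniversalEnvelopingAlgebra.ι O x) = 0 := by
  simp [ueaAug]

theorem augIdeal_mul_left (a x : UniversalEnvelopingAlgebra O L) (hx : x ∈ augIdeal O L) :
    a * x ∈ augIdeal O L := by
  rw [mem_augIdeal] at hx ⊢; rw [map_mul, hx, mul_zero]

theorem augIdeal_mul_right (a x : UniversalEnvelopingAlgebra O L) (hx : x ∈ augIdeal O L) :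
    x * a ∈ augIdeal O L := by
  rw [mem_augIdeal] at hx ⊢; rw [map_mul, hx, zero_mul]

theorem truncExp_eq_texp (x : L) :
    truncExp O L p x = texp O p (UniversalEnvelopingAlgebra.ι O x) := rfl

variable [Algebra R O] [IsScalarTower R O L]

/-- The enveloping algebra is taken over `O`, whereas `CH` lives over `R`. The universal congruence
is carried over by the `R`-algebra map from the free algebra; the two versions of the truncated
exponential agree because inverses of factorials are unique. -/
theorem truncExp_mul_truncExp_sub_mem (hp : 2 ≤ p) (hR : ∀ j, 1 ≤ j → j < p → IsUnit (j : R))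
    (a b : L) : truncExp O L p a * truncExp O L p b - truncExp O L p (CH R p a b) ∈
      augIdeal O L ^ p := by
  let _ : Algebra R (UniversalEnvelopingAlgebra O L) :=
    ((algebraMap O (UniversalEnvelopingAlgebra O L)).comp (algebraMap R O)).toAlgebra'
      fun c x => Algebra.commutes (algebraMap R O c) x
  have hsm : ∀ (c : R) (u : UniversalEnvelopingAlgebra O L), c • u = algebraMap R O c • u := by
    intro c u
    rw [Algebra.smul_def, Algebra.smul_def]; rfl
  set f : FreeAlgebra R (Fin 2) →ₐ[R] UniversalEnvelopingAlgebra O L :=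
    FreeAlgebra.lift R ![UniversalEnvelopingAlgebra.ι O a, UniversalEnvelopingAlgebra.ι O b] with hf
  have hf0 : f (FreeAlgebra.ι R 0) = UniversalEnvelopingAlgebra.ι O a := by simp [hf]
  have hf1 : f (FreeAlgebra.ι R 1) = UniversalEnvelopingAlgebra.ι O b := by simp [hf]
  have hlie : ∀ z, f (freeLieToAlg R (Fin 2) z) =
      UniversalEnvelopingAlgebra.ι O (FreeLieAlgebra.lift R ![a, b] z) := by
    intro z
    induction z using freeLie_induction with
    | of i =>
      rw [freeLieToAlg_of, FreeLieAlgebra.lift_of_apply]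
      fin_cases i
      · exact hf0
      · exact hf1
    | zero => simp
    | add x y hx hy => simp only [map_add, hx, hy]
    | smul c x hx =>
      rw [map_smul, map_smul, map_smul, hx, hsm, ← map_smul, algebraMap_smul]
    | lie x y hx hy =>
      simp only [LieHom.map_lie, LieRing.of_associative_ring_bracket, map_sub, map_mul, hx, hy]
  have haug : ∀ u ∈ freeAug R (Fin 2), f u ∈ augIdeal O L := by
    have h : ∀ u, ueaAug O L (f u) = algebraMap R O (FreeAlgebra.algebraMapInv u) := by
      intro u
      induction u using FreeAlgebra.induction with
      | grade0 r =>
        rw [f.commutes, FreeAlgebra.algebraMap_leftInverse]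
        exact (ueaAug O L).commutes _
      | grade1 i =>
        rw [(mem_freeAug R _).mp (ι_mem_freeAug R _ i), map_zero]
        fin_cases i
        · exact (congrArg _ hf0).trans (ueaAug_ι a)
        · exact (congrArg _ hf1).trans (ueaAug_ι b)
      | add u v hu hv => simp only [map_add, hu, hv]
      | mul u v hu hv => simp only [map_mul, hu, hv]
    intro u hu
    rw [mem_augIdeal, h, (mem_freeAug R _).mp hu, map_zero]
  have hpow : ∀ n, ∀ u ∈ freeAug R (Fin 2) ^ n, f u ∈ augIdeal O L ^ n := by
    intro n
    induction n with
    | zero =>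
      intro u hu
      rw [pow_zero] at hu ⊢
      obtain ⟨c, rfl⟩ := Submodule.mem_one.mp hu
      rw [f.commutes]
      exact Submodule.mem_one.mpr ⟨algebraMap R O c, rfl⟩
    | succ n ih =>
      intro u hu
      rw [pow_succ] at hu ⊢
      induction hu using Submodule.mul_induction_on' with
      | mem_mul_mem m hm n hn =>
        rw [map_mul]; exact Submodule.mul_mem_mul (ih _ hm) (haug _ hn)
      | add x _ y _ hx hy => rw [map_add]; exact add_mem hx hy
  have hexp : ∀ u : UniversalEnvelopingAlgebra O L, texp R p u = texp O p u := by
    intro u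
    refine Finset.sum_congr rfl fun j hj => ?_
    rw [hsm]
    congr 1
    have h1 := fac_mul_ifac hR (Finset.mem_range.mp hj)
    have h2 := congrArg (algebraMap R O) h1
    rw [map_mul, map_natCast, map_one] at h2
    have hu : IsUnit ((j.factorial : ℕ) : O) := IsUnit.of_mul_eq_one _ h2
    have h3 : ((j.factorial : ℕ) : O) * ifac O j = 1 := Ring.mul_inverse_cancel _ hu
    exact hu.mul_left_cancel (h2.trans h3.symm)
  have := hpow p _ (freeCH_spec hp hR).2
  rw [map_sub, map_mul, map_texp, map_texp, map_texp, hf0, hf1, hlie, hexp, hexp, hexp] at this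
  exact this

theorem isCHProd_three (hp : 2 ≤ p) (hR : ∀ j, 1 ≤ j → j < p → IsUnit (j : R)) (a b c : L) :
    IsCHProd O L p [a, b, c] (CH R p (CH R p a b) c) := by
  have h1 := mul_mem_pow_right augIdeal_mul_right (by omega)
    (truncExp_mul_truncExp_sub_mem (O := O) hp hR a b) (truncExp O L p c)
  have h2 := truncExp_mul_truncExp_sub_mem (O := O) hp hR (CH R p a b) c
  have := add_mem h1 h2
  simp only [IsCHProd, List.map_cons, List.map_nil, List.prod_cons, List.prod_nil, mul_one]
  convert this using 1
  noncomm_ring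

end CHProduct

/-! ### Uniqueness of logarithms -/

section Log

attribute [local instance 100] LieRing.ofAssociativeRing

variable {O : Type*} [CommRing O] {L : Type*} [LieRing L] [LieAlgebra O L]

/-- The lower central series. -/
abbrev lcs (O L : Type*) [CommRing O] [LieRing L] [LieAlgebra O L] (j : ℕ) : LieIdeal O L :=
  LieModule.lowerCentralSeries O L L j

theorem lie_mem_lcs_succ {j : ℕ} (x : L) {y : L} (hy : y ∈ lcs O L j) : ⁅x, y⁆ ∈ lcs O L (j + 1) := by
  rw [lcs, LieModule.lowerCentralSeries_succ]
  exact LieSubmodule.lie_mem_lie (LieSubmodule.mem_top x) hy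

theorem lcs_succ_induction {j : ℕ} {P : ∀ z : L, z ∈ lcs O L (j + 1) → Prop}
    (lie : ∀ (x y : L) (hy : y ∈ lcs O L j), P ⁅x, y⁆ (lie_mem_lcs_succ x hy))
    (zero : P 0 (zero_mem _)) (add : ∀ a ha b hb, P a ha → P b hb → P (a + b) (add_mem ha hb))
    (smul : ∀ (c : O) a ha, P a ha → P (c • a) ((lcs O L (j + 1)).toSubmodule.smul_mem c ha))
    {z : L} (hz : z ∈ lcs O L (j + 1)) : P z hz := by
  suffices h : ∃ hz, P z hz from h.2
  rw [lcs, LieModule.lowerCentralSeries_succ, ← LieSubmodule.mem_toSubmodule,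
    LieSubmodule.lieIdeal_oper_eq_linear_span'] at hz
  induction hz using Submodule.span_induction with
  | mem z hz =>
    obtain ⟨x, _, y, hy, rfl⟩ := hz
    exact ⟨_, lie x y hy⟩
  | zero => exact ⟨_, zero⟩
  | add a b _ _ ha hb => exact ⟨_, add _ _ _ _ ha.2 hb.2⟩
  | smul c a _ ha => exact ⟨_, smul _ _ _ ha.2⟩

/-- The index of `lcs` is one less than the length of commutators, whence the `+ 1`; the induction
is the Jacobi identity. -/
theorem lie_mem_lcs_add {i j : ℕ} {x y : L} (hx : x ∈ lcs O L i) (hy : y ∈ lcs O L j) :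
    ⁅x, y⁆ ∈ lcs O L (i + j + 1) := by
  induction i generalizing x y j with
  | zero => rw [zero_add]; exact lie_mem_lcs_succ x hy
  | succ i ih =>
    induction hx using lcs_succ_induction with
    | lie u v hv =>
      have : ⁅⁅u, v⁆, y⁆ = ⁅u, ⁅v, y⁆⁆ - ⁅v, ⁅u, y⁆⁆ := by
        rw [leibniz_lie u v y]; abel
      rw [this, show i + 1 + j + 1 = i + j + 1 + 1 by ring]
      refine sub_mem (lie_mem_lcs_succ u (ih hv hy)) ?_
      have := ih hv (lie_mem_lcs_succ u hy)
      rwa [show i + (j + 1) + 1 = i + j + 1 + 1 by ring] at this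
    | zero => rw [zero_lie]; exact zero_mem _
    | add a _ b _ ha hb => rw [add_lie]; exact add_mem ha hb
    | smul c a _ ha => rw [smul_lie]; exact (lcs O L _).toSubmodule.smul_mem c ha

theorem lcs_antitone {i j : ℕ} (h : i ≤ j) : lcs O L j ≤ lcs O L i :=
  LieModule.antitone_lowerCentralSeries O L L h

variable (E : L →ₗ[O] L) (hE : ∀ x y, E ⁅x, y⁆ = ⁅E x, y⁆ + ⁅x, E y⁆)
  (hE1 : ∀ x, E x - x ∈ lcs O L 1)

-- A derivation that is the identity on the abelianization multiplies a commutator of length `j + 1`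
-- by `j + 1`, modulo longer ones.
include hE hE1 in
theorem euler_sub_nsmul_mem_lcs {j : ℕ} {x : L} (hx : x ∈ lcs O L j) :
    E x - (j + 1) • x ∈ lcs O L (j + 1) := by
  induction j generalizing x with
  | zero => simpa using hE1 x
  | succ j ih =>
    induction hx using lcs_succ_induction with
    | lie u v hv =>
      have : E ⁅u, v⁆ - (j + 1 + 1) • ⁅u, v⁆ = ⁅E u - u, v⁆ + ⁅u, E v - (j + 1) • v⁆ := by
        rw [hE, succ_nsmul]
        simp only [sub_lie, lie_sub, lie_nsmul]
        abel
      rw [this]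
      refine add_mem ?_ (lie_mem_lcs_succ u (ih hv))
      have := lie_mem_lcs_add (hE1 u) hv
      rwa [show 1 + j + 1 = j + 1 + 1 by ring] at this
    | zero => simp
    | add a _ b _ ha hb =>
      convert add_mem ha hb using 1
      rw [map_add, smul_add]; abel
    | smul c a _ ha =>
      convert (lcs O L _).toSubmodule.smul_mem c ha using 1
      rw [map_smul, smul_sub, smul_comm]; rfl

/-- The representation of `L` on `L ⊕ O` attached to a derivation. -/
def eulerRep : L →ₗ⁅O⁆ Module.End O (L × O) where
  toFun l :=
    { toFun := fun m => (⁅l, m.1⁆ + m.2 • E l, 0)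
      map_add' := fun m m' => Prod.ext (by
        simp only [Prod.fst_add, Prod.snd_add, lie_add, add_smul]; abel) (add_zero 0).symm
      map_smul' := fun c m => Prod.ext (by
        simp only [Prod.smul_fst, Prod.smul_snd, lie_smul, smul_eq_mul, mul_smul, smul_add,
          RingHom.id_apply]) (smul_zero c).symm }
  map_add' l l' := LinearMap.ext fun m => Prod.ext (by
    change ⁅l + l', m.1⁆ + m.2 • E (l + l') = (⁅l, m.1⁆ + m.2 • E l) + (⁅l', m.1⁆ + m.2 • E l')
    simp only [add_lie, map_add, smul_add]; abel) (add_zero 0).symm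
  map_smul' c l := LinearMap.ext fun m => Prod.ext (by
    change ⁅c • l, m.1⁆ + m.2 • E (c • l) = c • (⁅l, m.1⁆ + m.2 • E l)
    rw [smul_lie, map_smul, smul_add, smul_comm]) (smul_zero c).symm
  -- Compatibility with brackets is exactly the Leibniz rule for `E`. The point of this module is
  -- that `l` sends `(0, 1)` to `(E l, 0)`, so the action of the enveloping algebra on one vector
  -- recovers elements of `L`; it plays the role of the Poincaré–Birkhoff–Witt theorem.
  map_lie' {l l'} := LinearMap.ext fun m => Prod.ext (by
    change ⁅⁅l, l'⁆, m.1⁆ + m.2 • E ⁅l, l'⁆ =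
      (⁅l, ⁅l', m.1⁆ + m.2 • E l'⁆ + (0 : O) • E l) - (⁅l', ⁅l, m.1⁆ + m.2 • E l⁆ + (0 : O) • E l')
    rw [hE, lie_lie, ← lie_skew (E l) l']
    simp only [lie_add, lie_smul, smul_add, smul_neg, zero_smul]
    abel) (sub_zero 0).symm

theorem eulerRep_apply (l : L) (m : L × O) : eulerRep E hE l m = (⁅l, m.1⁆ + m.2 • E l, 0) := rfl

variable (O L) in
/-- The filtration `L ⊕ O ⊇ C₁ ⊇ C₂ ⊇ …` of `L ⊕ O`. -/
def eulerFil : ℕ → Submodule O (L × O)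
  | 0 => ⊤
  | j + 1 => (lcs O L j).toSubmodule.prod ⊥

theorem mem_eulerFil_succ {j : ℕ} {m : L × O} :
    m ∈ eulerFil O L (j + 1) ↔ m.1 ∈ lcs O L j ∧ m.2 = 0 := Iff.rfl

theorem eulerFil_antitone {i j : ℕ} (h : i ≤ j) : eulerFil O L j ≤ eulerFil O L i := by
  rcases i with _ | i
  · exact le_top
  · obtain ⟨j, rfl⟩ := Nat.exists_eq_add_of_le' (show 1 ≤ j by omega)
    intro m hm
    rw [mem_eulerFil_succ] at hm ⊢
    exact ⟨lcs_antitone (by omega) hm.1, hm.2⟩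

include hE1 in
theorem eulerRep_mem {i j : ℕ} {l : L} (hl : l ∈ lcs O L j) {m : L × O}
    (hm : m ∈ eulerFil O L i) : eulerRep E hE l m ∈ eulerFil O L (i + j + 1) := by
  rw [eulerRep_apply, mem_eulerFil_succ]
  refine ⟨?_, rfl⟩
  rcases i with _ | i
  · rw [zero_add]
    refine add_mem ?_ ((lcs O L _).toSubmodule.smul_mem _ ?_)
    · exact lcs_antitone (by omega) (lie_mem_lcs_add hl (show m.1 ∈ lcs O L 0 from trivial))
    · have := euler_sub_nsmul_mem_lcs E hE hE1 hl
      have h2 := add_mem (lcs_antitone (Nat.le_succ j) this)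
        ((lcs O L j).toSubmodule.smul_of_tower_mem (j + 1) hl)
      simpa using h2
  · rw [mem_eulerFil_succ] at hm
    rw [hm.2, zero_smul, add_zero, show i + 1 + j = j + i + 1 by ring]
    exact lie_mem_lcs_add hl hm.1

/-- The action of the enveloping algebra on `L ⊕ O`. -/
def eulerAct : UniversalEnvelopingAlgebra O L →ₐ[O] Module.End O (L × O) :=
  UniversalEnvelopingAlgebra.lift O (eulerRep E hE)

-- Generators `ι x` push the filtration down by one step and constants act as scalars. Hence an
-- element of the `n`-th power of the augmentation ideal pushes it down by `n` steps.
include hE1 in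
theorem eulerAct_sub_mem (u : UniversalEnvelopingAlgebra O L) : ∀ {i : ℕ} {m : L × O},
    m ∈ eulerFil O L i → eulerAct E hE u m - ueaAug O L u • m ∈ eulerFil O L (i + 1) := by
  induction u using uea_induction with
  | hC r =>
    intro i m _
    rw [AlgHom.commutes, AlgHom.commutes, Module.algebraMap_end_apply, Algebra.algebraMap_self_apply, sub_self]
    exact zero_mem _
  | hι x =>
    intro i m hm
    rw [ueaAug_ι, zero_smul, sub_zero, eulerAct, UniversalEnvelopingAlgebra.lift_ι_apply]
    exact eulerRep_mem E hE hE1 (j := 0) trivial hm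
  | add a b ha hb =>
    intro i m hm
    convert add_mem (ha hm) (hb hm) using 1
    rw [map_add, map_add, add_smul, LinearMap.add_apply]; abel
  | mul a b ha hb =>
    intro i m hm
    have h0 : eulerAct E hE b m ∈ eulerFil O L i := by
      have := add_mem (eulerFil_antitone (Nat.le_succ i) (hb hm))
        (Submodule.smul_mem _ (ueaAug O L b) hm)
      rwa [sub_add_cancel] at this
    convert add_mem (ha h0) (Submodule.smul_mem _ (ueaAug O L a) (hb hm)) using 1
    rw [map_mul, map_mul, Module.End.mul_apply, smul_sub, mul_smul]
    abel

include hE1 in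
theorem eulerAct_mem_of_mem_pow {n : ℕ} {u : UniversalEnvelopingAlgebra O L}
    (hu : u ∈ augIdeal O L ^ n) {i : ℕ} {m : L × O} (hm : m ∈ eulerFil O L i) :
    eulerAct E hE u m ∈ eulerFil O L (i + n) := by
  induction n generalizing u i m with
  | zero =>
    rw [pow_zero] at hu
    obtain ⟨c, rfl⟩ := Submodule.mem_one.mp hu
    rw [AlgHom.commutes, Module.algebraMap_end_apply]
    exact Submodule.smul_mem _ _ hm
  | succ n ih =>
    rw [pow_succ] at hu
    induction hu using Submodule.mul_induction_on' with
    | mem_mul_mem a ha b hb =>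
      rw [map_mul, Module.End.mul_apply, show i + (n + 1) = i + 1 + n by ring]
      refine ih ha ?_
      have := eulerAct_sub_mem E hE hE1 b hm
      rwa [mem_augIdeal.mp hb, zero_smul, sub_zero] at this
    | add x _ y _ hx hy => rw [map_add]; exact add_mem hx hy

include hE hE1 in
/-- The truncated exponential is injective modulo the `p`-th power of the augmentation ideal. -/
theorem eq_of_truncExp_sub_mem {p : ℕ} (hp : 2 ≤ p) (hO : ∀ j, 1 ≤ j → j < p → IsUnit (j : O))
    (hL : lcs O L (p - 1) = ⊥) {z z' : L}
    (h : truncExp O L p z - truncExp O L p z' ∈ augIdeal O L ^ p) : z = z' := by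
  set Z := eulerRep E hE z with hZ
  set Z' := eulerRep E hE z' with hZ'
  have hmem : ∀ l i m, m ∈ eulerFil O L i → eulerRep E hE l m ∈ eulerFil O L (i + 1) :=
    fun l i m hm => eulerRep_mem E hE hE1 (j := 0) trivial hm
  have hpowmem : ∀ l n i m, m ∈ eulerFil O L i → (eulerRep E hE l ^ n) m ∈ eulerFil O L (i + n) := by
    intro l n
    induction n with
    | zero => intro i m hm; simpa using hm
    | succ n ih =>
      intro i m hm
      rw [pow_succ', Module.End.mul_apply]
      exact hmem l _ _ (ih i m hm)
  have hexp : ∀ l, eulerAct E hE (truncExp O L p l) = texp O p (eulerRep E hE l) := by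
    intro l
    rw [truncExp_eq_texp, map_texp, eulerAct, UniversalEnvelopingAlgebra.lift_ι_apply]
  have h0 : (texp O p Z - texp O p Z') (0, 1) ∈ eulerFil O L p := by
    have := eulerAct_mem_of_mem_pow E hE hE1 h (i := 0) (m := ((0 : L), (1 : O))) trivial
    rwa [zero_add, map_sub, hexp, hexp] at this
  -- Let both exponentials act on `(0, 1)`. If `z - z'` lies in `lcs j`, powers of exponent at least
  -- two differ only one step deeper, so the linear term `E (z - z') ≡ (j + 1)(z - z')` must itself
  -- lie one step deeper. Since `j + 1 < p` is invertible, so does `z - z'`.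
  have key : ∀ j, j < p → z - z' ∈ lcs O L j := by
    intro j
    induction j with
    | zero => intro _; trivial
    | succ j ih =>
      intro hj
      have hδ := ih (by omega)
      have hpow : ∀ n, ∀ m, (Z ^ (n + 1) - Z' ^ (n + 1)) m ∈ eulerFil O L (j + 1 + n) := by
        intro n
        induction n with
        | zero =>
          intro m
          have := eulerRep_mem E hE hE1 hδ (i := 0) (m := m) trivial
          rw [zero_add, map_sub] at this
          simpa using this
        | succ n ihn =>
          intro m
          have : (Z ^ (n + 1 + 1) - Z' ^ (n + 1 + 1)) m =
            Z ((Z ^ (n + 1) - Z' ^ (n + 1)) m) + eulerRep E hE (z - z') ((Z' ^ (n + 1)) m) := by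
            rw [pow_succ' Z (n + 1), pow_succ' Z' (n + 1), map_sub]
            simp only [LinearMap.sub_apply, Module.End.mul_apply, map_sub]
            abel
          rw [this]
          refine add_mem (hmem z _ _ (ihn m)) ?_
          have h1 := hpowmem z' (n + 1) 0 m trivial
          have h2 := eulerRep_mem E hE hE1 hδ h1
          rwa [show 0 + (n + 1) + j + 1 = j + 1 + (n + 1) by ring] at h2
      obtain ⟨q, rfl⟩ := Nat.exists_eq_add_of_le' hp
      have h1 : (texp O (q + 2) Z - texp O (q + 2) Z') (0, 1) =
        (∑ n ∈ Finset.range q, ifac O (n + 2) • (Z ^ (n + 2) - Z' ^ (n + 2)) (0, 1)) +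
          (Z - Z') (0, 1) := by
        simp only [texp, Finset.sum_range_succ', LinearMap.sub_apply, LinearMap.add_apply,
          LinearMap.sum_apply, LinearMap.smul_apply, smul_sub, Finset.sum_sub_distrib, zero_add,
          pow_zero, pow_one, ifac_zero, ifac_one, one_smul, add_assoc, Nat.reduceAdd]
        abel
      have h2 : (∑ n ∈ Finset.range q, ifac O (n + 2) • (Z ^ (n + 2) - Z' ^ (n + 2)) (0, 1)) ∈
          eulerFil O L (j + 2) := by
        refine sum_mem fun n _ => Submodule.smul_mem _ _ ?_
        exact eulerFil_antitone (by omega) (hpow (n + 1) (0, 1))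
      have h3 := eulerFil_antitone (show j + 2 ≤ q + 2 by omega) h0
      rw [h1, add_mem_cancel_left h2, hZ, hZ', ← map_sub, eulerRep_apply, mem_eulerFil_succ] at h3
      have h4 : E (z - z') ∈ lcs O L (j + 1) := by simpa using h3.1
      have h5 := sub_mem h4 (euler_sub_nsmul_mem_lcs E hE hE1 hδ)
      rw [sub_sub_cancel] at h5
      obtain ⟨c, hc⟩ := (hO (j + 1) (by omega) hj).exists_left_inv
      have h6 := (lcs O L (j + 1)).toSubmodule.smul_mem c h5
      rwa [← Nat.cast_smul_eq_nsmul O, smul_smul, hc, one_smul] at h6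
  have := key (p - 1) (by omega)
  rw [hL, LieSubmodule.mem_bot] at this
  exact sub_eq_zero.mp this

include hE hE1 in
theorem IsCHProd.unique {p : ℕ} (hp : 2 ≤ p) (hO : ∀ j, 1 ≤ j → j < p → IsUnit (j : O))
    (hL : lcs O L (p - 1) = ⊥) {l : List L} {z z' : L} (h : IsCHProd O L p l z)
    (h' : IsCHProd O L p l z') : z = z' := by
  refine eq_of_truncExp_sub_mem E hE hE1 hp hO hL ?_
  have := sub_mem h' h
  rwa [sub_sub_sub_cancel_left] at this

end Log

/-! ### Lower central series, base change and the finite layers -/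

section LowerCentral

variable {R : Type*} [CommRing R] {L L' : Type*} [LieRing L] [LieAlgebra R L] [LieRing L']
  [LieAlgebra R L']

theorem map_mem_lcs (f : L →ₗ⁅R⁆ L') {j : ℕ} {x : L} (hx : x ∈ lcs R L j) : f x ∈ lcs R L' j := by
  induction j generalizing x with
  | zero => trivial
  | succ j ih =>
    induction hx using lcs_succ_induction with
    | lie x y hy => rw [LieHom.map_lie]; exact lie_mem_lcs_succ _ (ih hy)
    | zero => rw [map_zero]; exact zero_mem _
    | add a _ b _ ha hb => rw [map_add]; exact add_mem ha hb
    | smul c a _ ha => rw [map_smul]; exact (lcs R L' _).toSubmodule.smul_mem c ha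

theorem exists_mem_lcs_of_surjective (f : L →ₗ⁅R⁆ L') (hf : Function.Surjective f) {j : ℕ} {x : L'}
    (hx : x ∈ lcs R L' j) : ∃ y ∈ lcs R L j, f y = x := by
  induction j generalizing x with
  | zero => obtain ⟨y, rfl⟩ := hf x; exact ⟨y, trivial, rfl⟩
  | succ j ih =>
    induction hx using lcs_succ_induction with
    | lie x y hy =>
      obtain ⟨u, rfl⟩ := hf x
      obtain ⟨v, hv, rfl⟩ := ih hy
      exact ⟨⁅u, v⁆, lie_mem_lcs_succ u hv, LieHom.map_lie f u v⟩
    | zero => exact ⟨0, zero_mem _, map_zero f⟩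
    | add a _ b _ ha hb =>
      obtain ⟨u, hu, rfl⟩ := ha
      obtain ⟨v, hv, rfl⟩ := hb
      exact ⟨u + v, add_mem hu hv, map_add f u v⟩
    | smul c a _ ha =>
      obtain ⟨u, hu, rfl⟩ := ha
      exact ⟨c • u, (lcs R L _).toSubmodule.smul_mem c hu, map_smul f c u⟩

variable (A : Type*) [CommRing A] [Algebra R A]

theorem lcs_baseChange (j : ℕ) : lcs A (A ⊗[R] L) j = (lcs R L j).baseChange A := by
  induction j with
  | zero => simp [lcs]
  | succ j ih =>
    rw [lcs, LieModule.lowerCentralSeries_succ, lcs, LieModule.lowerCentralSeries_succ,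
      LieSubmodule.lie_baseChange]
    rw [lcs, lcs] at ih
    rw [ih, LieSubmodule.baseChange_top]

theorem tmul_mem_lcs {j : ℕ} (a : A) {x : L} (hx : x ∈ lcs R L j) :
    a ⊗ₜ[R] x ∈ lcs A (A ⊗[R] L) j := by
  rw [lcs_baseChange]; exact LieSubmodule.tmul_mem_baseChange_of_mem a hx

theorem IsCHProd.unique_baseChange {E : L →ₗ[R] L} (hE : ∀ x y, E ⁅x, y⁆ = ⁅E x, y⁆ + ⁅x, E y⁆)
    (hE1 : ∀ x, E x - x ∈ lcs R L 1) {p : ℕ} (hp : 2 ≤ p)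
    (hR : ∀ j, 1 ≤ j → j < p → IsUnit (j : R)) (hL : lcs R L (p - 1) = ⊥)
    {l : List (A ⊗[R] L)} {z z' : A ⊗[R] L} (h : IsCHProd A (A ⊗[R] L) p l z)
    (h' : IsCHProd A (A ⊗[R] L) p l z') : z = z' := by
  refine IsCHProd.unique (E.baseChange A) ?_ ?_ hp ?_ ?_ h h'
  · intro x y
    induction x using TensorProduct.induction_on with
    | zero => simp
    | add u v hu hv => simp only [add_lie, map_add, hu, hv]; abel
    | tmul a x =>
      induction y using TensorProduct.induction_on with
      | zero => simp
      | add u v hu hv => simp only [lie_add, map_add, hu, hv]; abel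
      | tmul b y =>
        simp only [LieAlgebra.ExtendScalars.bracket_tmul, LinearMap.baseChange_tmul, hE,
          TensorProduct.tmul_add]
  · intro x
    induction x using TensorProduct.induction_on with
    | zero => simp
    | add u v hu hv => rw [map_add, add_sub_add_comm]; exact add_mem hu hv
    | tmul a x =>
      rw [LinearMap.baseChange_tmul, ← TensorProduct.tmul_sub]
      exact tmul_mem_lcs A a (hE1 x)
  · intro j h1 h2
    have := (hR j h1 h2).map (algebraMap R A)
    rwa [map_natCast] at this
  · rw [lcs_baseChange, hL, LieSubmodule.baseChange_bot]

end LowerCentral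

section Layers

variable (p : ℕ) [Fact p.Prime] (M : ℕ) (k : Type*) [Field k] [CharP k p]

theorem isUnit_natCast_zmod {j : ℕ} (hj : 1 ≤ j) (hjp : j < p) : IsUnit (j : ZMod (p ^ M)) := by
  rw [ZMod.isUnit_iff_coprime]
  refine Nat.Coprime.pow_right _ (Nat.Coprime.symm ?_)
  rw [Nat.Prime.coprime_iff_not_dvd Fact.out]
  exact Nat.not_dvd_of_pos_of_lt (by omega) hjp

/-- The projection of the free Lie algebra to the `n`-th layer. -/
def toLvl (n : ℕ) : FreeL p M k →ₗ⁅ZMod (p ^ M)⁆ Lvl p M k n where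
  __ := (LieSubmodule.Quotient.mk' (lvlIdeal p M k n) : FreeL p M k →ₗ[ZMod (p ^ M)] Lvl p M k n)
  map_lie' {x y} := LieSubmodule.Quotient.mk_bracket _ x y

theorem toLvl_surjective (n : ℕ) : Function.Surjective (toLvl p M k n) :=
  LieSubmodule.Quotient.surjective_mk' _

theorem toLvl_of (n : ℕ) (u : (k⸨X⸩)ˣ) :
    toLvl p M k n (FreeLieAlgebra.of _ u) = genLvl p M k n u := rfl

theorem toLvl_eq_zero (n : ℕ) (x : FreeL p M k) : toLvl p M k n x = 0 ↔ x ∈ lvlIdeal p M k n :=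
  LieSubmodule.Quotient.mk_eq_zero _

theorem genLvl_mul (n : ℕ) (u v : (k⸨X⸩)ˣ) :
    genLvl p M k n (u * v) = genLvl p M k n u + genLvl p M k n v := by
  rw [← sub_eq_zero, ← toLvl_of, ← toLvl_of, ← toLvl_of, ← map_add, ← map_sub, toLvl_eq_zero]
  exact (le_sup_left : _ ≤ lvlIdeal p M k n) (LieSubmodule.subset_lieSpan (Or.inl ⟨u, v, rfl⟩))

theorem genLvl_eq_zero (n : ℕ) (u : (k⸨X⸩)ˣ) (f : k⟦X⟧)
    (hu : (u : k⸨X⸩) = HahnSeries.ofPowerSeries ℤ k f)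
    (hf : (PowerSeries.X : k⟦X⟧) ^ (n + 1) ∣ f - 1) : genLvl p M k n u = 0 := by
  rw [← toLvl_of, toLvl_eq_zero]
  exact (le_sup_left : _ ≤ lvlIdeal p M k n)
    (LieSubmodule.subset_lieSpan (Or.inr ⟨u, ⟨f, hu, hf⟩, rfl⟩))

theorem lcs_lvl_eq_bot (n : ℕ) : lcs (ZMod (p ^ M)) (Lvl p M k n) (p - 1) = ⊥ := by
  rw [eq_bot_iff]
  intro x hx
  obtain ⟨y, hy, rfl⟩ := exists_mem_lcs_of_surjective _ (toLvl_surjective p M k n) hx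
  rw [LieSubmodule.mem_bot, toLvl_eq_zero]
  exact (le_sup_right : _ ≤ lvlIdeal p M k n) hy

/-- Homomorphisms out of the `n`-th layer, from homomorphisms `𝒦^* → H`. -/
theorem exists_lvl_lift {H : Type*} [LieRing H] [LieAlgebra (ZMod (p ^ M)) H]
    (hH : lcs (ZMod (p ^ M)) H (p - 1) = ⊥) (δ : (k⸨X⸩)ˣ → H)
    (hmul : ∀ u v, δ (u * v) = δ u + δ v) (n : ℕ)
    (hone : ∀ u : (k⸨X⸩)ˣ, ∀ f : k⟦X⟧, (u : k⸨X⸩) = HahnSeries.ofPowerSeries ℤ k f →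
      (PowerSeries.X : k⟦X⟧) ^ (n + 1) ∣ f - 1 → δ u = 0) :
    ∃ φ : Lvl p M k n →ₗ⁅ZMod (p ^ M)⁆ H, ∀ u, φ (genLvl p M k n u) = δ u := by
  set F : FreeL p M k →ₗ⁅ZMod (p ^ M)⁆ H := FreeLieAlgebra.lift _ δ with hF
  have hker : lvlIdeal p M k n ≤ F.ker := by
    refine sup_le (LieSubmodule.lieSpan_le.mpr ?_) ?_
    · rintro x (⟨u, v, rfl⟩ | ⟨u, ⟨f, hf, hd⟩, rfl⟩)
      · rw [SetLike.mem_coe, LieHom.mem_ker, map_sub, map_add, hF]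
        simp only [FreeLieAlgebra.lift_of_apply]
        rw [hmul, sub_self]
      · rw [SetLike.mem_coe, LieHom.mem_ker, hF, FreeLieAlgebra.lift_of_apply]
        exact hone u f hf hd
    · intro x hx
      have := map_mem_lcs F hx
      rw [hH] at this
      exact this
  refine ⟨{ __ := (lvlIdeal p M k n).toSubmodule.liftQ (F : FreeL p M k →ₗ[ZMod (p ^ M)] H) hker
            map_lie' := ?_ }, fun u => ?_⟩
  · intro x y
    obtain ⟨x, rfl⟩ := toLvl_surjective p M k n x
    obtain ⟨y, rfl⟩ := toLvl_surjective p M k n y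
    rw [← LieHom.map_lie]
    exact LieHom.map_lie F x y
  · exact FreeLieAlgebra.lift_of_apply _ u

theorem lvl_induction {n : ℕ} {P : Lvl p M k n → Prop} (gen : ∀ u, P (genLvl p M k n u))
    (zero : P 0) (add : ∀ a b, P a → P b → P (a + b))
    (smul : ∀ (c : ZMod (p ^ M)) a, P a → P (c • a)) (lie : ∀ a b, P a → P b → P ⁅a, b⁆)
    (z : Lvl p M k n) : P z := by
  obtain ⟨z, rfl⟩ := toLvl_surjective p M k n z
  induction z using freeLie_induction with
  | of u => exact gen u
  | zero => rw [map_zero]; exact zero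
  | add a b ha hb => rw [map_add]; exact add _ _ ha hb
  | smul c a ha => rw [map_smul]; exact smul _ _ ha
  | lie a b ha hb => rw [LieHom.map_lie]; exact lie _ _ ha hb

/-- The relations defining a layer are either linear in the generators, where the Euler derivation
acts as the identity, or a full term of the lower central series, which it preserves. So it descends
to the quotient. -/
theorem exists_lvl_euler (n : ℕ) : ∃ E : Lvl p M k n →ₗ[ZMod (p ^ M)] Lvl p M k n,
    (∀ x y, E ⁅x, y⁆ = ⁅E x, y⁆ + ⁅x, E y⁆) ∧
    ∀ x, E x - x ∈ lcs (ZMod (p ^ M)) (Lvl p M k n) 1 := by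
  set D := freeEuler (ZMod (p ^ M)) (k⸨X⸩)ˣ with hD
  have hDlcs : ∀ j, ∀ x ∈ lcs (ZMod (p ^ M)) (FreeL p M k) j, D x ∈ lcs (ZMod (p ^ M)) (FreeL p M k) j := by
    intro j
    induction j with
    | zero => intro x _; trivial
    | succ j ih =>
      intro x hx
      induction hx using lcs_succ_induction with
      | lie x y hy =>
        rw [hD, freeEuler_lie]
        exact add_mem (lie_mem_lcs_succ _ hy) (lie_mem_lcs_succ _ (ih y hy))
      | zero => rw [map_zero]; exact zero_mem _
      | add a _ b _ ha hb => rw [map_add]; exact add_mem ha hb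
      | smul c a _ ha =>
        rw [map_smul]; exact (lcs (ZMod (p ^ M)) (FreeL p M k) _).toSubmodule.smul_mem c ha
  have hDI : lvlIdeal p M k n ≤ lvlIdeal p M k n ∧ ∀ x ∈ lvlIdeal p M k n, D x ∈ lvlIdeal p M k n := by
    refine ⟨le_rfl, ?_⟩
    let K : LieIdeal (ZMod (p ^ M)) (FreeL p M k) :=
      { carrier := {x | x ∈ lvlIdeal p M k n ∧ D x ∈ lvlIdeal p M k n}
        add_mem' := fun {a b} ha hb => ⟨add_mem ha.1 hb.1, by rw [map_add]; exact add_mem ha.2 hb.2⟩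
        zero_mem' := ⟨zero_mem _, by rw [map_zero]; exact zero_mem _⟩
        smul_mem' := fun c x hx => ⟨(lvlIdeal p M k n).toSubmodule.smul_mem c hx.1, by
          rw [map_smul]; exact (lvlIdeal p M k n).toSubmodule.smul_mem c hx.2⟩
        lie_mem := fun {x y} hy => ⟨(lvlIdeal p M k n).lie_mem hy.1, by
          rw [hD, freeEuler_lie]
          exact add_mem ((lvlIdeal p M k n).lie_mem hy.1) ((lvlIdeal p M k n).lie_mem hy.2)⟩ }
    suffices h : lvlIdeal p M k n ≤ K from fun x hx => (h hx).2
    refine sup_le (LieSubmodule.lieSpan_le.mpr ?_) ?_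
    · intro x hx
      have hx' : x ∈ lvlIdeal p M k n :=
        (le_sup_left : _ ≤ lvlIdeal p M k n) (LieSubmodule.subset_lieSpan hx)
      refine ⟨hx', ?_⟩
      have : D x = x := by
        rcases hx with ⟨u, v, rfl⟩ | ⟨u, _, rfl⟩
        · rw [map_sub, map_add, hD, freeEuler_of, freeEuler_of, freeEuler_of]
        · rw [hD, freeEuler_of]
      rwa [this]
    · intro x hx
      exact ⟨(le_sup_right : _ ≤ lvlIdeal p M k n) hx,
        (le_sup_right : _ ≤ lvlIdeal p M k n) (hDlcs _ x hx)⟩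
  let E : Lvl p M k n →ₗ[ZMod (p ^ M)] Lvl p M k n :=
    (lvlIdeal p M k n).toSubmodule.mapQ (lvlIdeal p M k n).toSubmodule D hDI.2
  have hEm : ∀ z, E (toLvl p M k n z) = toLvl p M k n (D z) := fun z => rfl
  have hE : ∀ x y, E ⁅x, y⁆ = ⁅E x, y⁆ + ⁅x, E y⁆ := by
    intro x y
    obtain ⟨x, rfl⟩ := toLvl_surjective p M k n x
    obtain ⟨y, rfl⟩ := toLvl_surjective p M k n y
    rw [← LieHom.map_lie, hEm, hEm, hEm, hD, freeEuler_lie, map_add, LieHom.map_lie, LieHom.map_lie]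
  refine ⟨E, hE, fun x => ?_⟩
  induction x using lvl_induction with
  | gen u =>
    rw [← toLvl_of, hEm, hD, freeEuler_of, sub_self]
    exact zero_mem _
  | zero => rw [map_zero, sub_self]; exact zero_mem _
  | add a b ha hb => rw [map_add, add_sub_add_comm]; exact add_mem ha hb
  | smul c a ha =>
    rw [map_smul, ← smul_sub]
    exact (lcs (ZMod (p ^ M)) (Lvl p M k n) 1).toSubmodule.smul_mem c ha
  | lie a b ha hb =>
    rw [hE]
    exact sub_mem (add_mem (lie_mem_lcs_succ _ trivial) (lie_mem_lcs_succ _ trivial))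
      (lie_mem_lcs_succ _ trivial)

/-- In `O(𝒦) ⊗ Lvl n`, the relation `IsCHProd` is the graph of the Campbell–Hausdorff operation. -/
theorem isCHProd_three_iff (n : ℕ) (A : Type*) [CommRing A] [Algebra (ZMod (p ^ M)) A]
    (a b c z : A ⊗[ZMod (p ^ M)] Lvl p M k n) (hp : 2 ≤ p) :
    IsCHProd A (A ⊗[ZMod (p ^ M)] Lvl p M k n) p [a, b, c] z ↔
      z = CH (ZMod (p ^ M)) p (CH (ZMod (p ^ M)) p a b) c := by
  obtain ⟨E, hE, hE1⟩ := exists_lvl_euler p M k n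
  have h := isCHProd_three (O := A) hp (fun j h1 h2 => isUnit_natCast_zmod p M h1 h2) a b c
  refine ⟨fun hz => ?_, fun hz => hz ▸ h⟩
  exact IsCHProd.unique_baseChange A hE hE1 hp (fun j h1 h2 => isUnit_natCast_zmod p M h1 h2)
    (lcs_lvl_eq_bot p M k n) hz h

end Layers

/-! ### The isogeny `[p]` -/

section Isogeny

open PowerSeries

variable (p : ℕ) [Fact p.Prime]

theorem coeff_logSeries_pow (n : ℕ) : coeff (p ^ n) (logSeries p) = ((p : ℚ_[p]) ^ n)⁻¹ := by
  have hp : 1 < p := (Fact.out : p.Prime).one_lt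
  simp [logSeries, Nat.log_pow hp]

theorem coeff_logSeries_of_forall_ne (d : ℕ) (h : ∀ n, d ≠ p ^ n) : coeff d (logSeries p) = 0 := by
  simp only [logSeries, coeff_mk]
  exact if_neg (h _)

theorem constantCoeff_logSeries : constantCoeff (logSeries p) = 0 := by
  rw [← coeff_zero_eq_constantCoeff_apply]
  exact coeff_logSeries_of_forall_ne p 0 fun n => (pow_pos (Fact.out : p.Prime).pos n).ne

theorem coeff_one_logSeries : coeff 1 (logSeries p) = 1 := by
  simpa using coeff_logSeries_pow p 0

/-- The functional equation of the logarithm; it allows a series close to `X ^ p` to be compared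
with `p log X`. -/
theorem logSeries_subst_X_pow :
    (logSeries p).subst (X ^ p : ℚ_[p]⟦X⟧) = (p : ℚ_[p]) • (logSeries p - X) := by
  have hp : 1 < p := (Fact.out : p.Prime).one_lt
  have hp0 : (p : ℚ_[p]) ≠ 0 := by exact_mod_cast (by omega : p ≠ 0)
  ext n
  rw [coeff_subst_X_pow (by omega)]
  simp only [map_smul, map_sub, smul_eq_mul, Algebra.algebraMap_self, RingHom.id_apply]
  by_cases h : ∃ j, n = p ^ j
  · obtain ⟨j, rfl⟩ := h
    cases j with
    | zero =>
      rw [if_neg (by simpa using (Fact.out : p.Prime).ne_one)]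
      simp [coeff_one_logSeries]
    | succ j =>
      rw [if_pos (dvd_pow_self p (by omega)), pow_succ, Nat.mul_div_cancel _ (by omega),
        coeff_logSeries_pow, ← pow_succ, coeff_logSeries_pow, coeff_X,
        if_neg (Nat.one_lt_pow (by omega) hp).ne', sub_zero, pow_succ]
      field_simp
  · push Not at h
    rw [coeff_logSeries_of_forall_ne p n h, coeff_X, if_neg (show n ≠ 1 by simpa using h 0)]
    split_ifs with hd
    · obtain ⟨m, rfl⟩ := hd
      rw [Nat.mul_div_cancel_left _ (by omega)]
      rw [coeff_logSeries_of_forall_ne p m fun j hj => h (j + 1) (by rw [hj, pow_succ, mul_comm])]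
      simp
    · simp

/-- A functional equation argument. In `log Q - log X^p` the term of degree `d = p ^ (j + 1)` is a
difference of `d`-th powers divided by `d`. If `Q ≡ X^p` modulo `p` in lower degrees, the numerator
is divisible by `p ^ (j + 2)`, so a factor `p` remains. The `N`-th coefficient of `Q` itself enters
only through the linear term, which permits strong induction on `N`. -/
theorem exists_integral_of_log {Q : ℚ_[p]⟦X⟧} (hQ : constantCoeff Q = 0)
    (h : (logSeries p).subst Q = (p : ℚ_[p]) • logSeries p) (N : ℕ) :
    ∃ c : ℤ_[p], coeff N (Q - X ^ p) = (p : ℚ_[p]) * (c : ℚ_[p]) := by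
  have hp : 1 < p := (Fact.out : p.Prime).one_lt
  have hp0 : (p : ℚ_[p]) ≠ 0 := by exact_mod_cast (by omega : p ≠ 0)
  induction N using Nat.strong_induction_on with
  | _ N ih =>
  rcases Nat.eq_zero_or_pos N with rfl | hN
  · have : p ≠ 0 := by omega
    exact ⟨0, by simp [hQ, this]⟩
  choose! c hc using ih
  set U : ℤ_[p]⟦X⟧ := mk fun m => if m < N then c m else 0 with hU
  set ι := PadicInt.Coe.ringHom (p := p)
  set A : ℤ_[p]⟦X⟧ := X ^ p + C (p : ℤ_[p]) * U with hA
  have hQA : X ^ N ∣ Q - A.map ι := by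
    rw [X_pow_dvd_iff]
    intro m hm
    have := hc m hm
    rw [map_sub] at this
    rw [map_sub, hA, coeff_map, map_add, coeff_C_mul, hU, coeff_mk, if_pos hm, map_add, map_mul,
      ← coeff_map ι, map_pow, map_X]
    have e1 : ι ((p : ℤ_[p])) = p := by simp
    rw [e1]
    change coeff m Q - (coeff m (X ^ p) + p * (c m : ℚ_[p])) = 0
    rw [← this]; ring
  have hQX : X ∣ Q := X_dvd_iff.mpr hQ
  have hAX : X ∣ A.map ι := by
    have h1 : X ∣ Q - A.map ι := (dvd_pow_self X hN.ne').trans hQA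
    exact (dvd_sub_right hQX).mp h1
  -- `A` is the integral truncation of `Q`. Neither series has a constant term, so their higher
  -- powers agree to one more order, and the `N`-th coefficient of `Q ^ d` can be computed with `A`.
  have hpow : ∀ d, 2 ≤ d → X ^ (N + 1) ∣ Q ^ d - (A.map ι) ^ d := by
    intro d hd
    rw [← Commute.mul_geom_sum₂ (Commute.all _ _), pow_succ]
    refine mul_dvd_mul hQA (Finset.dvd_sum fun i hi => ?_)
    rcases Nat.eq_zero_or_pos i with rfl | hi0
    · exact Dvd.dvd.mul_left (hAX.trans (dvd_pow_self _ (by omega))) _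
    · exact Dvd.dvd.mul_right (hQX.trans (dvd_pow_self _ (by omega))) _
  have hsQ : HasSubst Q := HasSubst.of_constantCoeff_zero' hQ
  have hsX : HasSubst (X ^ p : ℚ_[p]⟦X⟧) := HasSubst.X_pow (by omega)
  -- Subtract `log(X^p) = p (log X - X)` from `log Q = p log X`; the linear parts of the logarithms
  -- contribute `Q - X^p`.
  have key : Q - X ^ p = C (p : ℚ_[p]) * X - ((logSeries p - X).subst Q -
      (logSeries p - X).subst (X ^ p : ℚ_[p]⟦X⟧)) := by
    rw [subst_sub hsQ, subst_sub hsX, subst_X hsQ, subst_X hsX, h, logSeries_subst_X_pow,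
      smul_sub, smul_eq_C_mul, smul_eq_C_mul]
    ring
  rw [key, map_sub, map_sub, coeff_subst' hsQ, coeff_subst' hsX,
    ← finsum_sub_distrib (coeff_subst_finite' hsQ _ _) (coeff_subst_finite' hsX _ _)]
  have h1 : ∃ z : ℤ_[p], coeff N (C (p : ℚ_[p]) * X) = (p : ℚ_[p]) * (z : ℚ_[p]) := by
    rw [coeff_C_mul, coeff_X]
    exact ⟨if N = 1 then 1 else 0, by split_ifs <;> simp⟩
  have h2 : ∃ z : ℤ_[p], (∑ᶠ d, (coeff d (logSeries p - X) • coeff N (Q ^ d) -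
      coeff d (logSeries p - X) • coeff N ((X ^ p : ℚ_[p]⟦X⟧) ^ d))) = (p : ℚ_[p]) * (z : ℚ_[p]) := by
    refine finsum_induction (p := fun x : ℚ_[p] => ∃ z : ℤ_[p], x = (p : ℚ_[p]) * (z : ℚ_[p])) ⟨0, by simp⟩ ?_ ?_
    · rintro _ _ ⟨a, rfl⟩ ⟨b, rfl⟩
      exact ⟨a + b, by push_cast; ring⟩
    · intro d
      by_cases hd : ∃ j, d = p ^ j
      · obtain ⟨j, rfl⟩ := hd
        cases j with
        | zero => exact ⟨0, by simp [coeff_one_logSeries]⟩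
        | succ j =>
          have e1 : coeff (p ^ (j + 1)) (X : ℚ_[p]⟦X⟧) = 0 := by
            rw [coeff_X, if_neg (Nat.one_lt_pow (by omega) hp).ne']
          have e2 : coeff N (Q ^ p ^ (j + 1)) = coeff N ((A.map ι) ^ p ^ (j + 1)) := by
            have := X_pow_dvd_iff.mp (hpow (p ^ (j + 1)) (Nat.one_lt_pow (by omega) hp)) N
              (by omega)
            rwa [map_sub, sub_eq_zero] at this
          have e3 : (p : ℤ_[p]⟦X⟧) ^ (j + 1 + 1) ∣ A ^ p ^ (j + 1) - (X ^ p) ^ p ^ (j + 1) := by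
            refine dvd_sub_pow_of_dvd_sub ⟨U, ?_⟩ _
            rw [hA, ← map_natCast C]; ring
          obtain ⟨B, hB⟩ := e3
          have e4 := congrArg (fun f => coeff N (f.map ι)) hB
          simp only [map_sub, map_pow, map_X, map_mul, map_natCast] at e4
          rw [← smul_sub, map_sub, e1, e2, coeff_logSeries_pow, sub_zero, e4, ← map_natCast C,
            ← map_pow, coeff_C_mul, coeff_map]
          refine ⟨coeff N B, ?_⟩
          change _ = (p : ℚ_[p]) * ι (coeff N B)
          rw [smul_eq_mul, pow_succ]
          field_simp
          ring
      · push Not at hd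
        rw [map_sub, coeff_logSeries_of_forall_ne p d hd, coeff_X, if_neg (by simpa using hd 0)]
        exact ⟨0, by simp⟩
  obtain ⟨a, ha⟩ := h1
  obtain ⟨b, hb⟩ := h2
  exact ⟨a - b, by rw [ha, hb]; push_cast; ring⟩

/-- `mulP` is a choice, so existence has to be supplied: over `ℚ_p` the series is `log⁻¹(p log X)`,
and `exists_integral_of_log` makes its coefficients integral. -/
theorem mulP_spec : constantCoeff (mulP p) = 0 ∧
    (logSeries p).subst ((mulP p).map PadicInt.Coe.ringHom) = (p : ℚ_[p]) • logSeries p := by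
  refine Classical.epsilon_spec (p := fun P : ℤ_[p]⟦X⟧ => constantCoeff P = 0 ∧
    (logSeries p).subst (P.map PadicInt.Coe.ringHom) = (p : ℚ_[p]) • logSeries p) ?_
  have hu : IsUnit (coeff 1 (logSeries p)) := by rw [coeff_one_logSeries]; exact isUnit_one
  have h0 := constantCoeff_logSeries p
  have hpl : constantCoeff ((p : ℚ_[p]) • logSeries p) = 0 := by simp [h0]
  set Q := ((logSeries p).substInvOfIsUnit hu).subst ((p : ℚ_[p]) • logSeries p) with hQ
  have hs := HasSubst.of_constantCoeff_zero' hpl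
  have hQ0 : constantCoeff Q = 0 := constantCoeff_subst_eq_zero hpl _ (by simp)
  have hQl : (logSeries p).subst Q = (p : ℚ_[p]) • logSeries p := by
    rw [hQ, ← subst_comp_subst_apply (HasSubst.substInvOfIsUnit _ hu) hs,
      subst_substInvOfIsUnit_right _ h0 hu, subst_X hs]
  choose c hc using exists_integral_of_log p hQ0 hQl
  refine ⟨X ^ p + mk fun n => p * c n, ?_, ?_⟩
  · have h1 := hc 0
    have hpp : p ≠ 0 := (Fact.out : p.Prime).ne_zero
    have h2 : (c 0 : ℚ_[p]) = 0 := by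
      simpa [hQ0, hpp] using h1
    have h3 : c 0 = 0 := Subtype.ext h2
    rw [← coeff_zero_eq_constantCoeff_apply]
    simp [hpp, h3]
  · convert hQl using 2
    ext n
    have h1 := hc n
    rw [map_sub, sub_eq_iff_eq_add] at h1
    rw [h1, coeff_map, map_add, map_add, ← coeff_map, map_pow, map_X, coeff_mk, add_comm, map_mul, map_natCast]
    rfl

theorem exists_mulP_eq : ∃ U : ℤ_[p]⟦X⟧, mulP p = X ^ p + C (p : ℤ_[p]) * U := by
  obtain ⟨h0, h1⟩ := mulP_spec p
  choose c hc using exists_integral_of_log p (Q := (mulP p).map PadicInt.Coe.ringHom)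
    (by rw [← coeff_zero_eq_constantCoeff_apply, coeff_map, coeff_zero_eq_constantCoeff_apply, h0,
      map_zero]) h1
  refine ⟨mk c, ?_⟩
  have hinj : Function.Injective (PadicInt.Coe.ringHom (p := p)) := Subtype.val_injective
  ext n
  have h1 := hc n
  rw [map_sub, sub_eq_iff_eq_add, coeff_map] at h1
  apply hinj
  rw [h1, map_add, map_add, ← coeff_map, map_pow (PowerSeries.map _), map_X, coeff_C_mul, coeff_mk,
    map_mul, add_comm, map_natCast]
  rfl

end Isogeny

/-! ### Arithmetic of `W_M(k)` -/

section Coeffs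

variable (p : ℕ) [Fact p.Prime] (M : ℕ) (k : Type*) [Field k] [CharP k p] [PerfectRing k p]

theorem frobWM_toWM (x : WittVector p k) :
    frobWM p M k (toWM p M k x) = toWM p M k (WittVector.frobenius x) := rfl

theorem toWM_eq_zero {x : WittVector p k} : toWM p M k x = 0 ↔ (p : WittVector p k) ^ M ∣ x :=
  Ideal.Quotient.eq_zero_iff_mem.trans Ideal.mem_span_singleton

theorem WM_p_pow_eq_zero : (p : WM p M k) ^ M = 0 := by
  have := WM_cast_eq_zero p M k
  rwa [Nat.cast_pow] at this

theorem frobWM_algebraMap (c : ZMod (p ^ M)) :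
    frobWM p M k (algebraMap _ _ c) = algebraMap (ZMod (p ^ M)) (WM p M k) c :=
  RingHom.congr_fun (RingHom.ext_zmod ((frobWM p M k).comp (algebraMap _ _)) _) c

theorem frobWM_smul (c : ZMod (p ^ M)) (w : WM p M k) :
    frobWM p M k (c • w) = c • frobWM p M k w := by
  rw [Algebra.smul_def, map_mul, frobWM_algebraMap, ← Algebra.smul_def]

theorem WittVector_p_dvd_iff {x : WittVector p k} : (p : WittVector p k) ∣ x ↔ x.coeff 0 = 0 := by
  rw [← Ideal.mem_span_singleton, WittVector.mem_span_p_iff_coeff_zero_eq_zero]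

theorem WM_isUnit_of_not_dvd {x : WM p M k} (hx : ¬ (p : WM p M k) ∣ x) : IsUnit x := by
  obtain ⟨w, rfl⟩ := toWM_surjective p M k x
  refine (WittVector.isUnit_of_coeff_zero_ne_zero w fun h => hx ?_).map (toWM p M k)
  simpa using map_dvd (toWM p M k) ((WittVector_p_dvd_iff p k).mpr h)

theorem WM_dvd_or_dvd {x y : WM p M k} (h : (p : WM p M k) ∣ x * y) :
    (p : WM p M k) ∣ x ∨ (p : WM p M k) ∣ y := by
  by_contra! hc
  exact hc.2 ((WM_isUnit_of_not_dvd p M k hc.1).dvd_mul_left.mp h)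

theorem WM_span_isPrime (h : ∃ x : WM p M k, ¬ (p : WM p M k) ∣ x) :
    (Ideal.span {(p : WM p M k)}).IsPrime := by
  obtain ⟨x, hx⟩ := h
  refine ⟨fun hc => hx ?_, fun {x y} hxy => ?_⟩
  · rw [← Ideal.mem_span_singleton, hc]; trivial
  · simp only [Ideal.mem_span_singleton] at hxy ⊢
    exact WM_dvd_or_dvd p M k hxy

theorem p_dvd_frobenius_sub_pow (w : WittVector p k) :
    (p : WittVector p k) ∣ WittVector.frobenius w - w ^ p := by
  rw [WittVector_p_dvd_iff]
  change (WittVector.constantCoeff : WittVector p k →+* k) (WittVector.frobenius w - w ^ p) = 0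
  rw [map_sub, map_pow]
  change (WittVector.frobenius w).coeff 0 - w.coeff 0 ^ p = 0
  rw [WittVector.coeff_frobenius_charP, sub_self]

theorem p_dvd_frobWM_sub_pow (x : WM p M k) : (p : WM p M k) ∣ frobWM p M k x - x ^ p := by
  obtain ⟨w, rfl⟩ := toWM_surjective p M k x
  rw [frobWM_toWM, ← map_pow, ← map_sub]
  simpa using map_dvd (toWM p M k) (p_dvd_frobenius_sub_pow p k w)

theorem frobWM_bijective : Function.Bijective (frobWM p M k) := by
  obtain ⟨hi, hs⟩ := WittVector.frobenius_bijective p k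
  constructor
  · rw [injective_iff_map_eq_zero]
    intro x hx
    obtain ⟨w, rfl⟩ := toWM_surjective p M k x
    rw [frobWM_toWM, toWM_eq_zero] at hx
    obtain ⟨c, hc⟩ := hx
    obtain ⟨c, rfl⟩ := hs c
    rw [toWM_eq_zero]
    exact ⟨c, hi (by rw [hc, map_mul, map_pow, map_natCast])⟩
  · intro x
    obtain ⟨w, rfl⟩ := toWM_surjective p M k x
    obtain ⟨w, rfl⟩ := hs w
    exact ⟨_, frobWM_toWM p M k w⟩

theorem frobWM_iterate_card [Finite k] {N₀ : ℕ} (hk : Nat.card k = p ^ N₀) (x : WM p M k) :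
    (frobWM p M k)^[N₀] x = x := by
  obtain ⟨w, rfl⟩ := toWM_surjective p M k x
  have h : ∀ n, (frobWM p M k)^[n] (toWM p M k w) =
      toWM p M k ((WittVector.frobenius : WittVector p k →+* WittVector p k)^[n] w) := by
    intro n
    induction n with
    | zero => rfl
    | succ n ih => rw [Function.iterate_succ_apply', Function.iterate_succ_apply', ih, frobWM_toWM]
  rw [h]
  congr 1
  ext i
  rw [WittVector.iterate_frobenius_coeff]
  let := Fintype.ofFinite k
  rw [← hk, Nat.card_eq_fintype_card, FiniteField.pow_card]

end Coeffs

/-! ### The element `S` -/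

section SeriesS

open PowerSeries

variable (p : ℕ) [Fact p.Prime] (M : ℕ) (k : Type*) [Field k] [CharP k p]

/-- `σ` on `W_M(k)[[t]]`. -/
def frobPS : (WM p M k)⟦X⟧ →+* (WM p M k)⟦X⟧ :=
  (expand p (Fact.out : p.Prime).ne_zero).toRingHom.comp (map (frobWM p M k))

theorem frobPS_apply (f : (WM p M k)⟦X⟧) :
    frobPS p M k f = expand p (Fact.out : p.Prime).ne_zero (map (frobWM p M k) f) := rfl

theorem coeff_frobPS (f : (WM p M k)⟦X⟧) (n : ℕ) :
    coeff n (frobPS p M k f) = if p ∣ n then frobWM p M k (coeff (n / p) f) else 0 := by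
  rw [frobPS_apply, coeff_expand, coeff_map]

theorem coeff_mul_frobPS (f : (WM p M k)⟦X⟧) (n : ℕ) :
    coeff (p * n) (frobPS p M k f) = frobWM p M k (coeff n f) := by
  rw [frobPS_apply, coeff_expand_mul, coeff_map]

variable {p M k}

theorem natCast_pow_dvd_iff {R : Type*} [CommRing R] {n j : ℕ} {f : R⟦X⟧} :
    (n : R⟦X⟧) ^ j ∣ f ↔ ∀ i, (n : R) ^ j ∣ coeff i f := by
  rw [← map_natCast C, ← map_pow]
  constructor
  · rintro ⟨g, rfl⟩ i
    rw [coeff_C_mul]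
    exact dvd_mul_right _ _
  · intro h
    choose g hg using h
    exact ⟨mk g, by ext i; rw [coeff_C_mul, coeff_mk, hg]⟩

theorem natCast_dvd_iff {R : Type*} [CommRing R] {n : ℕ} {f : R⟦X⟧} :
    (n : R⟦X⟧) ∣ f ↔ ∀ i, (n : R) ∣ coeff i f := by
  simpa using natCast_pow_dvd_iff (R := R) (n := n) (j := 1) (f := f)

theorem dvd_subst_sub_subst {R : Type*} [CommRing R] {n j : ℕ} {f g U : R⟦X⟧}
    (hf : constantCoeff f = 0) (hg : constantCoeff g = 0) (h : (n : R⟦X⟧) ^ j ∣ f - g) :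
    (n : R⟦X⟧) ^ j ∣ (U.subst f : R⟦X⟧) - U.subst g := by
  have hsf := HasSubst.of_constantCoeff_zero' hf
  have hsg := HasSubst.of_constantCoeff_zero' hg
  rw [natCast_pow_dvd_iff]
  intro i
  rw [map_sub, coeff_subst' hsf, coeff_subst' hsg,
    ← finsum_sub_distrib (coeff_subst_finite' hsf _ _) (coeff_subst_finite' hsg _ _)]
  refine finsum_induction (p := fun x : R => (n : R) ^ j ∣ x) (dvd_zero _)
    (fun _ _ => dvd_add) fun d => ?_
  rw [← smul_sub, smul_eq_mul, ← map_sub]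
  exact Dvd.dvd.mul_left (natCast_pow_dvd_iff.mp (h.trans (sub_dvd_pow_sub_pow f g d)) i) _

theorem pow_sub_pow_dvd_succ {R : Type*} [CommRing R] {n j : ℕ} (hj : 1 ≤ j) {f g : R}
    (h : (n : R) ^ j ∣ f - g) : (n : R) ^ (j + 1) ∣ f ^ n - g ^ n := by
  rw [← Commute.mul_geom_sum₂ (Commute.all f g), pow_succ]
  refine mul_dvd_mul h ?_
  have h1 : (n : R) ∣ f - g := (dvd_pow_self _ (by omega)).trans h
  have h2 : ∑ i ∈ Finset.range n, g ^ i * g ^ (n - 1 - i) = n * g ^ (n - 1) := by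
    rw [Finset.sum_congr rfl (g := fun _ => g ^ (n - 1)), Finset.sum_const, Finset.card_range,
      nsmul_eq_mul]
    intro i hi
    rw [← pow_add]
    congr 1
    have := Finset.mem_range.mp hi
    omega
  have h3 : (n : R) ∣ ∑ i ∈ Finset.range n, f ^ i * g ^ (n - 1 - i) -
      ∑ i ∈ Finset.range n, g ^ i * g ^ (n - 1 - i) := by
    rw [← Finset.sum_sub_distrib]
    refine Finset.dvd_sum fun i _ => ?_
    rw [← sub_mul]
    exact Dvd.dvd.mul_right (h1.trans (sub_dvd_pow_sub_pow f g i)) _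
  rw [h2] at h3
  exact (dvd_sub_left (dvd_mul_right _ _)).mp h3

variable (p M k)

theorem exists_mulPWM_eq : ∃ U : (WM p M k)⟦X⟧, mulPWM p M k = X ^ p + (p : (WM p M k)⟦X⟧) * U := by
  obtain ⟨U, hU⟩ := exists_mulP_eq p
  refine ⟨U.map ((zmodToWM p M k).comp (PadicInt.toZModPow M)), ?_⟩
  rw [mulPWM, hU, map_natCast, map_add, map_mul, map_natCast, map_pow, map_X]

theorem constantCoeff_mulPWM : constantCoeff (mulPWM p M k) = 0 := by
  rw [mulPWM, ← coeff_zero_eq_constantCoeff_apply, coeff_map, coeff_zero_eq_constantCoeff_apply,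
    (mulP_spec p).1, map_zero]

theorem map_frob_mulPWM [PerfectRing k p] : (mulPWM p M k).map (frobWM p M k) = mulPWM p M k := by
  ext n
  rw [mulPWM, coeff_map, coeff_map]
  exact frobWM_algebraMap p M k _

/-- The operation `f ↦ [p](f)`. -/
def mulPSubst (f : (WM p M k)⟦X⟧) : (WM p M k)⟦X⟧ := (mulPWM p M k).subst f

variable {p M k}

theorem constantCoeff_mulPSubst {f : (WM p M k)⟦X⟧} (hf : constantCoeff f = 0) :
    constantCoeff (mulPSubst p M k f) = 0 :=
  constantCoeff_subst_eq_zero hf _ (constantCoeff_mulPWM p M k)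

theorem serS_eq_iterate (S₀ : (WM p M k)⟦X⟧) : serS p M k S₀ = (mulPSubst p M k)^[M] S₀ := rfl

theorem constantCoeff_iterate_mulPSubst {f : (WM p M k)⟦X⟧} (hf : constantCoeff f = 0) (n : ℕ) :
    constantCoeff ((mulPSubst p M k)^[n] f) = 0 := by
  induction n with
  | zero => exact hf
  | succ n ih => rw [Function.iterate_succ_apply']; exact constantCoeff_mulPSubst ih

theorem exists_mulPSubst_eq {f : (WM p M k)⟦X⟧} (hf : constantCoeff f = 0) :
    ∃ V, mulPSubst p M k f = f ^ p + (p : (WM p M k)⟦X⟧) * V := by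
  obtain ⟨U, hU⟩ := exists_mulPWM_eq p M k
  have hs := HasSubst.of_constantCoeff_zero' hf
  refine ⟨U.subst f, ?_⟩
  rw [mulPSubst, hU, subst_add hs, subst_mul hs, subst_pow hs, subst_X hs, ← map_natCast C,
    subst_C]
  rfl

/-- Writing `[p] = X^p + pU`, both the `p`-th power and the multiplication by `p` gain one factor
`p`. -/
theorem mulPSubst_congr {f g : (WM p M k)⟦X⟧} (hf : constantCoeff f = 0)
    (hg : constantCoeff g = 0) {j : ℕ} (hj : 1 ≤ j) (h : (p : (WM p M k)⟦X⟧) ^ j ∣ f - g) :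
    (p : (WM p M k)⟦X⟧) ^ (j + 1) ∣ mulPSubst p M k f - mulPSubst p M k g := by
  obtain ⟨U, hU⟩ := exists_mulPWM_eq p M k
  have hsf := HasSubst.of_constantCoeff_zero' hf
  have hsg := HasSubst.of_constantCoeff_zero' hg
  have e : mulPSubst p M k f - mulPSubst p M k g =
      (f ^ p - g ^ p) + (p : (WM p M k)⟦X⟧) * ((U.subst f : (WM p M k)⟦X⟧) - U.subst g) := by
    have e1 : ∀ {f : (WM p M k)⟦X⟧}, HasSubst f →
        mulPSubst p M k f = f ^ p + (p : (WM p M k)⟦X⟧) * (U.subst f : (WM p M k)⟦X⟧) := by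
      intro f hs
      rw [mulPSubst, hU, subst_add hs, subst_mul hs, subst_pow hs, subst_X hs, ← map_natCast C,
        subst_C]
      rfl
    rw [e1 hsf, e1 hsg]; ring
  rw [e]
  refine dvd_add (pow_sub_pow_dvd_succ hj h) ?_
  rw [pow_succ']
  exact mul_dvd_mul_left _ (dvd_subst_sub_subst hf hg h)

theorem frobPS_mulPSubst [PerfectRing k p] {f : (WM p M k)⟦X⟧} (hf : constantCoeff f = 0) :
    frobPS p M k (mulPSubst p M k f) = mulPSubst p M k (frobPS p M k f) := by
  have hs := HasSubst.of_constantCoeff_zero' hf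
  have hf' : constantCoeff (map (frobWM p M k) f) = 0 := by
    rw [← coeff_zero_eq_constantCoeff_apply, coeff_map, coeff_zero_eq_constantCoeff_apply, hf,
      map_zero]
  have hs' := HasSubst.of_constantCoeff_zero' hf'
  have e : map (frobWM p M k) ((mulPWM p M k).subst f : (WM p M k)⟦X⟧) =
      (map (frobWM p M k) (mulPWM p M k)).subst (map (frobWM p M k) f) := map_subst hs _
  rw [frobPS_apply, mulPSubst, e, map_frob_mulPWM, frobPS_apply, expand_apply,
    expand_apply, subst_comp_subst_apply hs' (HasSubst.X_pow (Fact.out : p.Prime).ne_zero),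
    mulPSubst]

theorem frobPS_injective [PerfectRing k p] : Function.Injective (frobPS p M k) := by
  intro f g h
  ext n
  apply (frobWM_bijective p M k).1
  rw [← coeff_mul_frobPS, h, coeff_mul_frobPS]

theorem constantCoeff_frobPS {f : (WM p M k)⟦X⟧} (hf : constantCoeff f = 0) :
    constantCoeff (frobPS p M k f) = 0 := by
  rw [← coeff_zero_eq_constantCoeff_apply, coeff_frobPS, if_pos (dvd_zero _), Nat.zero_div,
    coeff_zero_eq_constantCoeff_apply, hf, map_zero]

/-- Reduce modulo `p`: in characteristic `p` a `p`-th power of a series is obtained by applying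
Frobenius to the coefficients and substituting `X^p`. When `p` is invertible the quotient is zero
and has no characteristic `p`, so that case is split off. -/
theorem p_dvd_expand_map_sub_pow {R : Type*} [CommRing R] (s : R →+* R)
    (hs : ∀ x, (p : R) ∣ s x - x ^ p) (f : R⟦X⟧) :
    (p : R⟦X⟧) ∣ expand p (Fact.out : p.Prime).ne_zero (map s f) - f ^ p := by
  by_cases h1 : (p : R) ∣ 1
  · rw [natCast_dvd_iff]
    exact fun i => h1.trans (one_dvd _)
  set I := Ideal.span {(p : R)} with hI
  have : Nontrivial (R ⧸ I) := Ideal.Quotient.nontrivial_iff.mpr fun hc => h1 (by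
    rw [← Ideal.mem_span_singleton, ← hI, hc]; trivial)
  set π := Ideal.Quotient.mk I
  have hpI : ((p : ℕ) : R ⧸ I) = 0 := by
    rw [← map_natCast π, Ideal.Quotient.eq_zero_iff_mem]
    exact Ideal.mem_span_singleton_self _
  have : CharP (R ⧸ I) p := ringChar.of_eq (CharP.ringChar_of_prime_eq_zero Fact.out hpI)
  have : ExpChar (R ⧸ I) p := .prime Fact.out
  have hcomm : ∀ x, π (s x) = frobenius _ p (π x) := by
    intro x
    rw [frobenius_def, ← map_pow, ← sub_eq_zero, ← map_sub, Ideal.Quotient.eq_zero_iff_mem,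
      Ideal.mem_span_singleton]
    exact hs x
  have e1 : map π (expand p (Fact.out : p.Prime).ne_zero (map s f) - f ^ p) = 0 := by
    have h2 : map (frobenius _ p) (expand p (Fact.out : p.Prime).ne_zero (map π f)) = map π f ^ p :=
      MvPowerSeries.map_frobenius_expand p _
    rw [map_sub, map_pow, ← h2, map_expand, map_expand, sub_eq_zero]
    congr 1
    ext i
    simp only [coeff_map]
    exact hcomm _
  rw [natCast_dvd_iff]
  intro i
  rw [← Ideal.mem_span_singleton, ← Ideal.Quotient.eq_zero_iff_mem]
  have := congrArg (coeff i) e1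
  rwa [coeff_map, map_zero] at this

theorem p_dvd_frobPS_sub_pow [PerfectRing k p] (f : (WM p M k)⟦X⟧) :
    (p : (WM p M k)⟦X⟧) ∣ frobPS p M k f - f ^ p :=
  p_dvd_expand_map_sub_pow _ (p_dvd_frobWM_sub_pow p M k) f

theorem eq_zero_of_pow_dvd [PerfectRing k p] {f : (WM p M k)⟦X⟧} {j : ℕ} (hj : M ≤ j)
    (h : (p : (WM p M k)⟦X⟧) ^ j ∣ f) : f = 0 := by
  ext i
  obtain ⟨c, hc⟩ := (pow_dvd_pow _ hj).trans (natCast_pow_dvd_iff.mp h i)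
  rw [hc, WM_p_pow_eq_zero, zero_mul, map_zero]

/-- Modulo `p` one has `σS₀ ≡ S₀^p ≡ [p](S₀)`. Each of the `M` applications of `[p]` improves the
congruence by one power of `p`, ending modulo `p ^ (M + 1)`, which is an equality. -/
theorem frobPS_serS [PerfectRing k p] {S₀ : (WM p M k)⟦X⟧} (hS₀ : constantCoeff S₀ = 0) :
    frobPS p M k (serS p M k S₀) = mulPSubst p M k (serS p M k S₀) := by
  have h1 : ∀ n, frobPS p M k ((mulPSubst p M k)^[n] S₀) =
      (mulPSubst p M k)^[n] (frobPS p M k S₀) := by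
    intro n
    induction n with
    | zero => rfl
    | succ n ih =>
      rw [Function.iterate_succ_apply', Function.iterate_succ_apply', ← ih,
        frobPS_mulPSubst (constantCoeff_iterate_mulPSubst hS₀ n)]
  have h2 : ∀ n, (p : (WM p M k)⟦X⟧) ^ (n + 1) ∣ (mulPSubst p M k)^[n] (frobPS p M k S₀) -
      (mulPSubst p M k)^[n] (mulPSubst p M k S₀) := by
    intro n
    induction n with
    | zero =>
      obtain ⟨V, hV⟩ := exists_mulPSubst_eq hS₀
      rw [zero_add, pow_one, Function.iterate_zero, id, id, hV, ← sub_sub]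
      exact dvd_sub (p_dvd_frobPS_sub_pow S₀) (dvd_mul_right _ _)
    | succ n ih =>
      rw [Function.iterate_succ_apply', Function.iterate_succ_apply']
      exact mulPSubst_congr (constantCoeff_iterate_mulPSubst (constantCoeff_frobPS hS₀) n)
        (constantCoeff_iterate_mulPSubst (constantCoeff_mulPSubst hS₀) n) (by omega) ih
  rw [serS_eq_iterate, h1, ← Function.iterate_succ_apply' (mulPSubst p M k), Function.iterate_succ_apply]
  exact sub_eq_zero.mp (eq_zero_of_pow_dvd (by omega) (h2 M))

theorem p_dvd_mulPSubst_sub_pow {f : (WM p M k)⟦X⟧} (hf : constantCoeff f = 0) :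
    (p : (WM p M k)⟦X⟧) ∣ mulPSubst p M k f - f ^ p := by
  obtain ⟨V, hV⟩ := exists_mulPSubst_eq hf
  rw [hV, add_sub_cancel_left]
  exact dvd_mul_right _ _

theorem exists_not_dvd_coeff_serS [PerfectRing k p] {S₀ : (WM p M k)⟦X⟧}
    (hS₀ : constantCoeff S₀ = 0)
    (h : ∃ n, ¬ (p : WM p M k) ∣ coeff n S₀) : ∃ n, ¬ (p : WM p M k) ∣ coeff n (serS p M k S₀) := by
  have hmul : ∀ f g : (WM p M k)⟦X⟧, ¬ (p : (WM p M k)⟦X⟧) ∣ f → ¬ (p : (WM p M k)⟦X⟧) ∣ g →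
      ¬ (p : (WM p M k)⟦X⟧) ∣ f * g := by
    have := WM_span_isPrime p M k (by obtain ⟨n, hn⟩ := h; exact ⟨_, hn⟩)
    set π := Ideal.Quotient.mk (Ideal.span {(p : WM p M k)})
    have hπ : ∀ f : (WM p M k)⟦X⟧, (p : (WM p M k)⟦X⟧) ∣ f ↔ f.map π = 0 := by
      intro f
      rw [natCast_dvd_iff, PowerSeries.ext_iff]
      refine forall_congr' fun i => ?_
      rw [coeff_map, map_zero, Ideal.Quotient.eq_zero_iff_mem, Ideal.mem_span_singleton]
    intro f g hf hg
    rw [hπ] at hf hg ⊢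
    rw [map_mul]
    exact mul_ne_zero hf hg
  have hpow : ∀ (f : (WM p M k)⟦X⟧), ¬ (p : (WM p M k)⟦X⟧) ∣ f → ∀ n,
      ¬ (p : (WM p M k)⟦X⟧) ∣ f ^ (n + 1) := by
    intro f hf n
    induction n with
    | zero => simpa using hf
    | succ n ih => rw [pow_succ]; exact hmul _ _ ih hf
  have h' : ∀ n, ¬ (p : (WM p M k)⟦X⟧) ∣ (mulPSubst p M k)^[n] S₀ := by
    intro n
    induction n with
    | zero => rw [natCast_dvd_iff]; push Not; exact h
    | succ n ih =>
      rw [Function.iterate_succ_apply']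
      intro hd
      have := (dvd_sub_right hd).mp
        (p_dvd_mulPSubst_sub_pow (constantCoeff_iterate_mulPSubst hS₀ n))
      obtain ⟨q, hq⟩ := Nat.exists_eq_succ_of_ne_zero (Fact.out : p.Prime).ne_zero
      exact hpow _ ih q (by rw [← Nat.succ_eq_add_one, ← hq]; exact this)
  have := h' M
  rw [natCast_dvd_iff] at this
  push Not at this
  exact this

/-- The derivative of `[p] = X^p + pU` is divisible by `p`, so the chain rule yields one factor `p`
per iteration. For `n = M` the derivative of `S` vanishes. -/
theorem dvd_derivative_iterate_mulPSubst {f : (WM p M k)⟦X⟧} (hf : constantCoeff f = 0) (n : ℕ) :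
    (p : (WM p M k)⟦X⟧) ^ n ∣ derivative (WM p M k) ((mulPSubst p M k)^[n] f) := by
  induction n with
  | zero => simp
  | succ n ih =>
    rw [Function.iterate_succ_apply', mulPSubst,
      derivative_subst (HasSubst.of_constantCoeff_zero' (constantCoeff_iterate_mulPSubst hf n)),
      pow_succ']
    refine mul_dvd_mul ?_ ih
    obtain ⟨U, hU⟩ := exists_mulPWM_eq p M k
    have e : derivative (WM p M k) (mulPWM p M k) = (p : (WM p M k)⟦X⟧) *
        (X ^ (p - 1) + derivative (WM p M k) U) := by
      rw [hU, map_add, Derivation.leibniz_pow, Derivation.leibniz]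
      simp
      ring
    have hs := HasSubst.of_constantCoeff_zero' (constantCoeff_iterate_mulPSubst hf n)
    rw [e, subst_mul hs]
    have e2 : ((p : (WM p M k)⟦X⟧).subst ((mulPSubst p M k)^[n] f) : (WM p M k)⟦X⟧) = p := by
      rw [← map_natCast C, subst_C]
      rfl
    rw [e2]
    exact dvd_mul_right _ _

/-- A zero derivative leaves only exponents divisible by `p`, so `S = σS'`. Then `σ([p](S')) =
[p](S) = σS`, whence `S = [p](S')`, and `[p]` has no constant term. The divisibility `S' ∣ S` is
what makes `ψ`, and the removal of exponents divisible by `p`, respect poles along `S`. -/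
theorem exists_frobPS_eq_serS [PerfectRing k p] {S₀ : (WM p M k)⟦X⟧} (hS₀ : constantCoeff S₀ = 0) :
    ∃ S', frobPS p M k S' = serS p M k S₀ ∧ S' ∣ serS p M k S₀ ∧ constantCoeff S' = 0 := by
  set S := serS p M k S₀ with hS
  have hS0 : constantCoeff S = 0 := constantCoeff_iterate_mulPSubst hS₀ M
  have h1 : ∀ n, ¬ p ∣ n → coeff n S = 0 := by
    intro n hn
    have h := eq_zero_of_pow_dvd le_rfl (dvd_derivative_iterate_mulPSubst hS₀ M)
    rw [← serS_eq_iterate] at h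
    cases n with
    | zero => simp at hn
    | succ n =>
      have h2 := congrArg (coeff n) h
      rw [coeff_derivative, map_zero] at h2
      have hu : IsUnit ((n + 1 : ℕ) : WM p M k) := by
        have h3 : IsUnit ((n + 1 : ℕ) : ZMod (p ^ M)) := by
          rw [ZMod.isUnit_iff_coprime]
          exact Nat.Coprime.pow_right _ ((Nat.Prime.coprime_iff_not_dvd Fact.out).mpr hn).symm
        simpa using h3.map (algebraMap (ZMod (p ^ M)) (WM p M k))
      push_cast at hu
      exact (hu.mul_left_eq_zero).mp h2
  choose r hr using (frobWM_bijective p M k).2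
  set S' : (WM p M k)⟦X⟧ := mk fun n => r (coeff (p * n) S) with hS'
  have h2 : frobPS p M k S' = S := by
    ext n
    rw [coeff_frobPS]
    split_ifs with h
    · obtain ⟨m, rfl⟩ := h
      rw [Nat.mul_div_cancel_left _ (Fact.out : p.Prime).pos, hS', coeff_mk, hr]
    · rw [h1 n h]
  have h3 : constantCoeff S' = 0 := by
    apply (frobWM_bijective p M k).1
    rw [map_zero, ← coeff_zero_eq_constantCoeff_apply, ← coeff_mul_frobPS, h2, mul_zero,
      coeff_zero_eq_constantCoeff_apply, hS0]
  refine ⟨S', h2, ?_, h3⟩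
  have h4 : mulPSubst p M k S' = S := by
    apply frobPS_injective
    rw [frobPS_mulPSubst h3, h2, frobPS_serS hS₀]
  obtain ⟨Q, hQ⟩ := X_dvd_iff.mpr (constantCoeff_mulPWM p M k)
  have hs := HasSubst.of_constantCoeff_zero' h3
  rw [← h4, mulPSubst, hQ, subst_mul hs, subst_X hs]
  exact dvd_mul_right _ _

theorem frobPS_dvd_serS_pow [PerfectRing k p] {S₀ : (WM p M k)⟦X⟧} (hS₀ : constantCoeff S₀ = 0)
    {m n : ℕ} (hn : ¬ p ∣ n) : coeff n (serS p M k S₀ ^ m) = 0 := by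
  obtain ⟨S', hS', -⟩ := exists_frobPS_eq_serS hS₀
  rw [← hS', ← map_pow, coeff_frobPS, if_neg hn]

end SeriesS

/-! ### Exponentials of power series without constant term -/

section Exponential

open PowerSeries

variable {K : Type*} [Field K] [CharZero K]

/-- `exp h`, for a power series `h` without constant term. -/
def expOf (h : K⟦X⟧) : K⟦X⟧ := (mk fun n => ((n.factorial : K))⁻¹ : K⟦X⟧).subst h

theorem derivative_mk_inv_factorial :
    derivative K (mk fun n => ((n.factorial : K))⁻¹) = mk fun n => ((n.factorial : K))⁻¹ := by
  ext n
  rw [coeff_derivative, coeff_mk, coeff_mk, Nat.factorial_succ]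
  push_cast
  have : (n : K) + 1 ≠ 0 := by exact_mod_cast n.succ_ne_zero
  field_simp

theorem derivative_expOf {h : K⟦X⟧} (hh : constantCoeff h = 0) :
    derivative K (expOf h) = expOf h * derivative K h := by
  rw [expOf, derivative_subst (HasSubst.of_constantCoeff_zero' hh), derivative_mk_inv_factorial]

theorem constantCoeff_expOf {h : K⟦X⟧} (hh : constantCoeff h = 0) :
    constantCoeff (expOf h) = 1 := by
  have hs := HasSubst.of_constantCoeff_zero' hh
  have h1 : ((1 : K⟦X⟧).subst h : K⟦X⟧) = 1 := by rw [← coe_substAlgHom hs, map_one]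
  have h2 : expOf h = ((mk fun n => ((n.factorial : K))⁻¹) - 1 : K⟦X⟧).subst h + 1 := by
    rw [subst_sub hs, h1, expOf, sub_add_cancel]
  have h3 : constantCoeff (((mk fun n => ((n.factorial : K))⁻¹) - 1 : K⟦X⟧).subst h) = 0 :=
    constantCoeff_subst_eq_zero hh _ (by rw [← coeff_zero_eq_constantCoeff_apply]; simp)
  rw [h2, map_add, map_one]
  exact add_eq_right.mpr h3

/-- The product of a solution with `exp(-h)` has zero derivative and constant term `1`; applying
this to both `G` and `exp h` identifies them. -/
theorem eq_expOf {G h : K⟦X⟧} (hh : constantCoeff h = 0) (hG : constantCoeff G = 1)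
    (hd : derivative K G = G * derivative K h) : G = expOf h := by
  have hn : constantCoeff (-h) = 0 := by rw [map_neg, hh, neg_zero]
  have key : ∀ F : K⟦X⟧, constantCoeff F = 1 → derivative K F = F * derivative K h →
      F * expOf (-h) = 1 := by
    intro F hF hFd
    refine derivative.ext ?_ ?_
    · rw [Derivation.leibniz, derivative_expOf hn, hFd, map_neg]
      simp only [smul_eq_mul, Derivation.map_one_eq_zero]
      ring
    · rw [map_mul, hF, constantCoeff_expOf hn, map_one, one_mul]
  have h1 := key G hG hd
  have h2 := key (expOf h) (constantCoeff_expOf hh) (derivative_expOf hh)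
  calc G = G * (expOf h * expOf (-h)) := by rw [h2, mul_one]
    _ = expOf h * (G * expOf (-h)) := by ring
    _ = expOf h := by rw [h1, mul_one]

theorem expOf_add {g h : K⟦X⟧} (hg : constantCoeff g = 0) (hh : constantCoeff h = 0) :
    expOf (g + h) = expOf g * expOf h := by
  refine (eq_expOf (by rw [map_add, hg, hh, add_zero]) ?_ ?_).symm
  · rw [map_mul, constantCoeff_expOf hg, constantCoeff_expOf hh, one_mul]
  · rw [Derivation.leibniz, derivative_expOf hg, derivative_expOf hh, map_add]
    simp only [smul_eq_mul]
    ring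

theorem expOf_natCast_mul {h : K⟦X⟧} (hh : constantCoeff h = 0) (n : ℕ) :
    expOf ((n : K⟦X⟧) * h) = expOf h ^ n := by
  induction n with
  | zero => rw [Nat.cast_zero, zero_mul, pow_zero]
            exact (eq_expOf (map_zero _) (map_one _) (by simp)).symm
  | succ n ih => rw [Nat.cast_succ, add_mul, one_mul,
      expOf_add (by rw [map_mul, hh, mul_zero]) hh, ih, pow_succ]

theorem expOf_map {K' : Type*} [Field K'] [CharZero K'] (s : K →+* K') {h : K⟦X⟧}
    (hh : constantCoeff h = 0) : map s (expOf h) = expOf (map s h) := by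
  have e : map s (expOf h) = (map s (mk fun n => ((n.factorial : K))⁻¹)).subst (map s h) :=
    map_subst (HasSubst.of_constantCoeff_zero' hh) _
  rw [e, expOf]
  congr 1
  ext n
  simp

theorem expOf_expand {h : K⟦X⟧} (hh : constantCoeff h = 0) {q : ℕ} (hq : q ≠ 0) :
    expand q hq (expOf h) = expOf (expand q hq h) := by
  rw [expand_apply, expand_apply, expOf, subst_comp_subst_apply
    (HasSubst.of_constantCoeff_zero' hh) (HasSubst.X_pow hq), expOf]

end Exponential

/-! ### The Shafarevich function -/

section Shafarevich

open PowerSeries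

variable (p : ℕ) [Fact p.Prime] (k : Type*) [Field k] [CharP k p] [PerfectRing k p]

instance : CharZero (WittVector p k) := by
  refine charZero_of_inj_zero fun n hn => ?_
  by_contra h0
  obtain ⟨v, u, hu, rfl⟩ := Nat.exists_eq_pow_mul_and_not_dvd h0 p (Fact.out : p.Prime).ne_one
  rw [Nat.cast_mul, Nat.cast_pow, mul_eq_zero] at hn
  rcases hn with hn | hn
  · exact pow_ne_zero _ (WittVector.p_nonzero p k) hn
  · have h2 : (WittVector.constantCoeff : WittVector p k →+* k) (u : WittVector p k) = 0 := by
      rw [hn, map_zero]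
    rw [map_natCast, CharP.cast_eq_zero_iff k p] at h2
    exact hu h2

instance : CharZero (FractionRing (WittVector p k)) :=
  charZero_of_injective_algebraMap (IsFractionRing.injective (WittVector p k) _)

/-- By Legendre's formula the `p`-adic valuation of `n!` is less than `n`, and its part prime to `p`
is a unit of `W(k)`. The spare factor `p` makes `exp(pαX) ≡ 1` modulo `p`. -/
theorem exists_p_mul_eq_pow_div_factorial {n : ℕ} (hn : n ≠ 0) :
    ∃ z : WittVector p k, (p : WittVector p k) ^ n = n.factorial * (p * z) := by
  have hp := (Fact.out : p.Prime)
  obtain ⟨v, u, hu, huv⟩ := Nat.exists_eq_pow_mul_and_not_dvd (Nat.factorial_ne_zero n) p hp.ne_one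
  have hv : v < n := by
    have h1 := sub_one_mul_padicValNat_factorial_lt_of_ne_zero p hn
    have h2 : padicValNat p n.factorial = v := by
      have hu0 : u ≠ 0 := by rintro rfl; exact hu (dvd_zero _)
      rw [huv, padicValNat.mul (pow_ne_zero _ hp.ne_zero) hu0, padicValNat.prime_pow,
        padicValNat.eq_zero_of_not_dvd hu, add_zero]
    rw [h2] at h1
    have h3 : 1 ≤ p - 1 := by have := hp.two_le; omega
    nlinarith
  have hun : IsUnit (u : WittVector p k) := by
    refine WittVector.isUnit_of_coeff_zero_ne_zero _ fun h => hu ?_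
    change (WittVector.constantCoeff : WittVector p k →+* k) (u : WittVector p k) = 0 at h
    rwa [map_natCast, CharP.cast_eq_zero_iff k p] at h
  obtain ⟨w, hw⟩ := hun.exists_right_inv
  refine ⟨p ^ (n - 1 - v) * w, ?_⟩
  rw [huv]
  push_cast
  calc (p : WittVector p k) ^ n = p ^ (v + 1 + (n - 1 - v)) := by congr 1; omega
    _ = p ^ v * (p * p ^ (n - 1 - v)) * (u * w) := by rw [hw]; ring
    _ = _ := by ring

/-- `σ` on the fraction field of `W(k)`. -/
def frobFrac : FractionRing (WittVector p k) →+* FractionRing (WittVector p k) :=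
  IsFractionRing.map (WittVector.frobenius_bijective p k).1

theorem frobFrac_algebraMap (x : WittVector p k) :
    frobFrac p k (algebraMap _ _ x) = algebraMap _ _ (WittVector.frobenius x) := by
  simp [frobFrac, IsFractionRing.map]

variable {p k}

theorem coeff_shafExponent_pow (α : WittVector p k) (n : ℕ) :
    coeff (p ^ n) (shafExponent p k α) = algebraMap _ _
      ((WittVector.frobenius : WittVector p k →+* WittVector p k)^[n] α) *
        ((p : FractionRing (WittVector p k)) ^ n)⁻¹ := by
  have hp : 1 < p := (Fact.out : p.Prime).one_lt
  simp [shafExponent, Nat.log_pow hp]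

theorem coeff_shafExponent_of_forall_ne (α : WittVector p k) (d : ℕ) (h : ∀ n, d ≠ p ^ n) :
    coeff d (shafExponent p k α) = 0 := by
  simp only [shafExponent, coeff_mk]
  exact if_neg (h _)

theorem constantCoeff_shafExponent (α : WittVector p k) :
    constantCoeff (shafExponent p k α) = 0 := by
  rw [← coeff_zero_eq_constantCoeff_apply]
  exact coeff_shafExponent_of_forall_ne α 0 fun n => (pow_pos (Fact.out : p.Prime).pos n).ne

theorem shafExponent_add (α β : WittVector p k) :
    shafExponent p k (α + β) = shafExponent p k α + shafExponent p k β := by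
  ext d
  by_cases hd : ∃ n, d = p ^ n
  · obtain ⟨n, rfl⟩ := hd
    rw [map_add, coeff_shafExponent_pow, coeff_shafExponent_pow, coeff_shafExponent_pow,
      iterate_map_add, map_add, add_mul]
  · push Not at hd
    rw [map_add, coeff_shafExponent_of_forall_ne _ d hd, coeff_shafExponent_of_forall_ne _ d hd,
      coeff_shafExponent_of_forall_ne _ d hd, add_zero]

/-- Exponentiated, this becomes `F^p = exp(pαX) · (σF)(X^p)`, the relation behind Dwork's
integrality argument. -/
theorem p_mul_shafExponent (α : WittVector p k) :
    (p : (FractionRing (WittVector p k))⟦X⟧) * shafExponent p k α =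
      C ((p : FractionRing (WittVector p k)) * algebraMap _ _ α) * X + expand p (Fact.out : p.Prime).ne_zero
        (map (frobFrac p k) (shafExponent p k α)) := by
  have hp : 1 < p := (Fact.out : p.Prime).one_lt
  have hp0 := WittVector.FractionRing.p_nonzero p k
  ext d
  rw [← map_natCast C, coeff_C_mul, map_add, coeff_C_mul, coeff_X, coeff_expand]
  by_cases hd : ∃ n, d = p ^ n
  · obtain ⟨n, rfl⟩ := hd
    cases n with
    | zero =>
      rw [pow_zero, if_pos rfl, if_neg (by simpa using (Fact.out : p.Prime).ne_one),
        ← pow_zero p, coeff_shafExponent_pow]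
      simp
    | succ n =>
      rw [if_neg (Nat.one_lt_pow (by omega) hp).ne', if_pos (dvd_pow_self p (by omega)),
        pow_succ, Nat.mul_div_cancel _ (by omega), ← pow_succ, coeff_shafExponent_pow, coeff_map,
        coeff_shafExponent_pow, map_mul, frobFrac_algebraMap, map_inv₀, map_pow, map_natCast,
        Function.iterate_succ_apply', pow_succ]
      field_simp
      ring
  · push Not at hd
    rw [coeff_shafExponent_of_forall_ne _ d hd, if_neg (show d ≠ 1 by simpa using hd 0)]
    split_ifs with h
    · obtain ⟨m, rfl⟩ := h
      rw [Nat.mul_div_cancel_left _ (by omega), coeff_map, coeff_shafExponent_of_forall_ne _ m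
        (fun j hj => hd (j + 1) (by rw [hj, pow_succ, mul_comm])), map_zero]
      simp
    · simp

theorem expOf_shafExponent_pow (α : WittVector p k) :
    expOf (shafExponent p k α) ^ p = expOf (C ((p : FractionRing (WittVector p k)) * algebraMap _ _ α) * X) *
      expand p (Fact.out : p.Prime).ne_zero
        (map (frobFrac p k) (expOf (shafExponent p k α))) := by
  have h0 := constantCoeff_shafExponent α
  have h1 : constantCoeff (map (frobFrac p k) (shafExponent p k α)) = 0 := by
    rw [← coeff_zero_eq_constantCoeff_apply, coeff_map, coeff_zero_eq_constantCoeff_apply, h0,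
      map_zero]
  rw [← expOf_natCast_mul h0, p_mul_shafExponent, expOf_add (by simp) (by
    rw [constantCoeff_expand, h1]), expOf_map _ h0, expOf_expand h1]

theorem exists_expOf_p_mul (α : WittVector p k) : ∃ V : (WittVector p k)⟦X⟧,
    expOf (C (p * algebraMap _ (FractionRing (WittVector p k)) α) * X) =
      map (algebraMap _ _) (1 + (p : (WittVector p k)⟦X⟧) * V) := by
  choose! z hz using fun n : ℕ => exists_p_mul_eq_pow_div_factorial p k (n := n)
  refine ⟨mk fun n => if n = 0 then 0 else z n * α ^ n, ?_⟩
  have e : C (p * algebraMap _ (FractionRing (WittVector p k)) α) * X =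
      (p * algebraMap _ (FractionRing (WittVector p k)) α) • X := by rw [smul_eq_C_mul]
  ext n
  rw [e, expOf, ← rescale_eq_subst, coeff_rescale, coeff_mk, coeff_map, map_add, ← map_natCast C,
    coeff_C_mul, coeff_mk, coeff_one]
  by_cases hn : n = 0
  · simp [hn]
  · rw [if_neg hn, if_neg hn, zero_add, mul_pow]
    have h1 := congrArg (algebraMap (WittVector p k) (FractionRing (WittVector p k))) (hz n hn)
    have h2 : ((n.factorial : ℕ) : FractionRing (WittVector p k)) ≠ 0 :=
      Nat.cast_ne_zero.mpr (Nat.factorial_ne_zero n)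
    simp only [map_mul, map_pow, map_natCast] at h1 ⊢
    rw [h1]
    field_simp

/-- Compare coefficients of `X^N` in `F^p = (1 + pV) · (σF)(X^p)`. On the left, `F_N` appears only
as `p F_N`, next to `A^p` for the truncation `A` of `F` below `N`. On the right, only coefficients
of index at most `N / p < N` of `F` occur. Since `(σA)(X^p) ≡ A^p` modulo `p`, the number `p F_N`
lies in `p W(k)`. -/
theorem exists_integral_expOf_shafExponent (α : WittVector p k) (N : ℕ) :
    ∃ c : WittVector p k, coeff N (expOf (shafExponent p k α)) = algebraMap _ _ c := by
  have hp : 1 < p := (Fact.out : p.Prime).one_lt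
  set φ := algebraMap (WittVector p k) (FractionRing (WittVector p k)) with hφ
  set F := expOf (shafExponent p k α) with hF
  have hF0 : constantCoeff F = 1 := constantCoeff_expOf (constantCoeff_shafExponent α)
  induction N using Nat.strong_induction_on with
  | _ N ih =>
  rcases Nat.eq_zero_or_pos N with rfl | hN
  · exact ⟨1, by rw [coeff_zero_eq_constantCoeff_apply, hF0, map_one]⟩
  choose! c hc using ih
  set A : (WittVector p k)⟦X⟧ := mk fun m => if m < N then c m else 0 with hA
  have hcoef : ∀ m < N, coeff m (map φ A) = coeff m F := by
    intro m hm
    rw [coeff_map, hA, coeff_mk, if_pos hm, hc m hm]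
  have hA0 : constantCoeff (map φ A) = 1 := by
    rw [← coeff_zero_eq_constantCoeff_apply, hcoef 0 hN, coeff_zero_eq_constantCoeff_apply, hF0]
  obtain ⟨B, hB⟩ : X ^ N ∣ F - map φ A := by
    rw [X_pow_dvd_iff]
    intro m hm
    rw [map_sub, hcoef m hm, sub_self]
  have hBN : constantCoeff B = coeff N F := by
    have := congrArg (coeff N) hB
    rw [map_sub, coeff_map, hA, coeff_mk, if_neg (lt_irrefl N), map_zero, sub_zero] at this
    rw [this, ← coeff_zero_eq_constantCoeff_apply]
    simpa using (coeff_X_pow_mul B N 0).symm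
  obtain ⟨V, hV⟩ := exists_expOf_p_mul α
  have hfun := expOf_shafExponent_pow α
  rw [← hF, hV] at hfun
  have hleft : coeff N (F ^ p) = coeff N (map φ (A ^ p)) + p * coeff N F := by
    rw [map_pow (map φ), ← sub_eq_iff_eq_add', ← map_sub (coeff N), ← Commute.mul_geom_sum₂ (Commute.all _ _), hB,
      mul_assoc]
    have := coeff_X_pow_mul (B * ∑ i ∈ Finset.range p, F ^ i * map φ A ^ (p - 1 - i)) N 0
    rw [zero_add] at this
    rw [this, coeff_zero_eq_constantCoeff_apply, map_mul, hBN, map_sum]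
    simp [hF0, hA0, mul_comm]
  have hright : coeff N (map φ (1 + (p : (WittVector p k)⟦X⟧) * V) *
      expand p (Fact.out : p.Prime).ne_zero (map (frobFrac p k) F)) =
      coeff N (map φ ((1 + (p : (WittVector p k)⟦X⟧) * V) *
        expand p (Fact.out : p.Prime).ne_zero (map WittVector.frobenius A))) := by
    rw [map_mul (map φ), map_expand, coeff_mul, coeff_mul]
    refine Finset.sum_congr rfl fun ij hij => ?_
    congr 1
    rw [coeff_expand, coeff_expand]
    split_ifs with h
    · have hlt : ij.2 / p < N := by
        have h1 := Finset.HasAntidiagonal.mem_antidiagonal.mp hij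
        rcases Nat.eq_zero_or_pos ij.2 with h0 | h0
        · rw [h0, Nat.zero_div]; exact hN
        · exact (Nat.div_lt_self h0 hp).trans_le (by omega)
      rw [coeff_map, ← hcoef _ hlt, coeff_map, coeff_map, coeff_map, frobFrac_algebraMap]
    · rfl
  obtain ⟨Y, hY⟩ := p_dvd_expand_map_sub_pow (p := p)
    (WittVector.frobenius : WittVector p k →+* WittVector p k) (p_dvd_frobenius_sub_pow p k) A
  have hZ : (1 + (p : (WittVector p k)⟦X⟧) * V) *
      expand p (Fact.out : p.Prime).ne_zero (map WittVector.frobenius A) = A ^ p +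
      (p : (WittVector p k)⟦X⟧) * (Y + V *
        expand p (Fact.out : p.Prime).ne_zero (map WittVector.frobenius A)) := by
    linear_combination hY
  have := congrArg (coeff N) hfun
  rw [hright, hleft, hZ, map_add (map φ), map_add (coeff N), add_right_inj, map_mul, map_natCast,
    ← map_natCast C, coeff_C_mul, coeff_map] at this
  exact ⟨_, mul_left_cancel₀ (WittVector.FractionRing.p_nonzero p k) this⟩

theorem shaf_spec (α : WittVector p k) :
    (shaf p k α).map (algebraMap _ (FractionRing (WittVector p k))) =
      expOf (shafExponent p k α) := by
  refine Classical.epsilon_spec (p := fun F : (WittVector p k)⟦X⟧ =>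
    F.map (algebraMap (WittVector p k) (FractionRing (WittVector p k))) =
      (PowerSeries.mk fun n => ((n.factorial : FractionRing (WittVector p k)))⁻¹).subst
        (shafExponent p k α)) ?_
  choose c hc using exists_integral_expOf_shafExponent α
  refine ⟨mk c, ?_⟩
  ext n
  rw [coeff_map, coeff_mk, ← hc]
  rfl

theorem map_algebraMap_injective : Function.Injective
    (map (algebraMap (WittVector p k) (FractionRing (WittVector p k)))) := by
  intro f g h
  ext1 n
  apply IsFractionRing.injective (WittVector p k) (FractionRing (WittVector p k))
  rw [← coeff_map, h, coeff_map]

theorem shaf_add (α β : WittVector p k) : shaf p k (α + β) = shaf p k α * shaf p k β := by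
  apply map_algebraMap_injective
  rw [map_mul, shaf_spec, shaf_spec, shaf_spec, shafExponent_add,
    expOf_add (constantCoeff_shafExponent α) (constantCoeff_shafExponent β)]

theorem constantCoeff_shaf (α : WittVector p k) : constantCoeff (shaf p k α) = 1 := by
  apply IsFractionRing.injective (WittVector p k) (FractionRing (WittVector p k))
  rw [← coeff_zero_eq_constantCoeff_apply, ← coeff_map, shaf_spec,
    coeff_zero_eq_constantCoeff_apply, constantCoeff_expOf (constantCoeff_shafExponent α), map_one]

theorem coeff_one_shaf (α : WittVector p k) : coeff 1 (shaf p k α) = α := by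
  apply IsFractionRing.injective (WittVector p k) (FractionRing (WittVector p k))
  rw [← coeff_map, shaf_spec]
  have h1 := congrArg (coeff 0) (derivative_expOf (constantCoeff_shafExponent α))
  rw [coeff_derivative, coeff_zero_eq_constantCoeff_apply, map_mul,
    ← coeff_zero_eq_constantCoeff_apply (derivative _ _), coeff_derivative] at h1
  have h2 := coeff_shafExponent_pow α 0
  rw [pow_zero] at h2
  simpa [constantCoeff_expOf (constantCoeff_shafExponent α), h2] using h1

end Shafarevich

/-! ### The units `E(α, t₀^a)` -/

section ShafarevichUnits

open PowerSeries

variable {p : ℕ} [Fact p.Prime] {k : Type*} [Field k] [CharP k p] [PerfectRing k p]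

/-- The indices `1 ≤ a ≤ N` prime to `p`. -/
abbrev copr (p N : ℕ) : Finset ℕ := (Finset.Icc 1 N).filter (fun a => a.Coprime p)

/-- `∏_{a ≤ N} E(α_a, t₀^a)`. -/
abbrev shafProd (p : ℕ) [Fact p.Prime] (k : Type*) [Field k] [CharP k p] (N : ℕ)
    (α : ℕ → WittVector p k) : k⟦X⟧ := ∏ a ∈ copr p N, shafAt p k (α a) a

theorem mem_copr {N a : ℕ} : a ∈ copr p N ↔ 1 ≤ a ∧ a ≤ N ∧ a.Coprime p := by
  simp [copr, and_assoc]

theorem coeff_shafAt (α : WittVector p k) {a : ℕ} (ha : a ≠ 0) (n : ℕ) :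
    coeff n (shafAt p k α a) =
      if a ∣ n then WittVector.constantCoeff (coeff (n / a) (shaf p k α)) else 0 := by
  rw [shafAt, coeff_subst_X_pow ha]
  rfl

theorem constantCoeff_shafAt (α : WittVector p k) {a : ℕ} (ha : a ≠ 0) :
    constantCoeff (shafAt p k α a) = 1 := by
  rw [← coeff_zero_eq_constantCoeff_apply, coeff_shafAt α ha, if_pos (dvd_zero _), Nat.zero_div,
    coeff_zero_eq_constantCoeff_apply, constantCoeff_shaf, map_one]

theorem shafAt_add (α β : WittVector p k) {a : ℕ} (ha : a ≠ 0) :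
    shafAt p k (α + β) a = shafAt p k α a * shafAt p k β a := by
  rw [shafAt, shaf_add, map_mul, subst_mul (HasSubst.X_pow ha), shafAt, shafAt]

theorem shafAt_zero {a : ℕ} (ha : a ≠ 0) : shafAt p k 0 a = 1 := by
  have h := shafAt_add (0 : WittVector p k) 0 ha
  rw [add_zero] at h
  have h0 : shafAt p k 0 a ≠ 0 := by
    intro h0
    have := constantCoeff_shafAt (p := p) (k := k) 0 ha
    rw [h0, map_zero] at this
    exact zero_ne_one this
  exact (mul_eq_left₀ h0).mp h.symm

theorem shafAt_natCast_mul (n : ℕ) (α : WittVector p k) {a : ℕ} (ha : a ≠ 0) :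
    shafAt p k (n * α) a = shafAt p k α a ^ n := by
  induction n with
  | zero => rw [Nat.cast_zero, zero_mul, pow_zero, shafAt_zero ha]
  | succ n ih => rw [Nat.cast_succ, add_mul, one_mul, shafAt_add _ _ ha, ih, pow_succ]

/-- Additivity gives `E(p^v α, t^a) = E(α, t^a)^{p^v}`, and in characteristic `p` this power is
taken term by term in `1 + α₀ t^a + …`, where `α₀` is the zeroth Witt component. -/
theorem X_pow_dvd_shafAt_p_pow_mul_sub (v : ℕ) (α : WittVector p k) {a : ℕ} (ha : a ≠ 0) :
    X ^ (a * p ^ v + 1) ∣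
      shafAt p k (p ^ v * α) a - 1 - C (α.coeff 0 ^ p ^ v) * X ^ (a * p ^ v) := by
  have h1 : X ^ (a + 1) ∣ shafAt p k α a - 1 - C (α.coeff 0) * X ^ a := by
    rw [X_pow_dvd_iff]
    intro m hm
    rw [map_sub, map_sub, coeff_shafAt α ha, coeff_C_mul, coeff_X_pow, coeff_one]
    rcases Nat.eq_zero_or_pos m with rfl | hm0
    · rw [if_pos (dvd_zero _), Nat.zero_div, coeff_zero_eq_constantCoeff_apply, constantCoeff_shaf,
        if_neg ha.symm]
      simp
    rcases (Nat.lt_succ_iff_lt_or_eq.mp hm) with h | rfl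
    · rw [if_neg (Nat.not_dvd_of_pos_of_lt hm0 h), if_neg hm0.ne', if_neg h.ne]
      simp
    · rw [if_pos dvd_rfl, Nat.div_self hm0, coeff_one_shaf, if_neg hm0.ne', if_pos rfl]
      simp
  obtain ⟨g, hg⟩ := h1
  have h2 : shafAt p k α a = 1 + (C (α.coeff 0) * X ^ a + X ^ (a + 1) * g) := by
    rw [← hg]; ring
  have : CharP k⟦X⟧ p := charP_of_injective_ringHom (C_injective (R := k)) p
  have h3 : ((p ^ v : ℕ) : WittVector p k) = p ^ v := by push_cast; rfl
  rw [← h3, shafAt_natCast_mul _ _ ha, h2, add_pow_char_pow, add_pow_char_pow, one_pow, mul_pow,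
    mul_pow, ← map_pow, ← pow_mul, ← pow_mul]
  refine Dvd.intro (X ^ ((a + 1) * p ^ v - (a * p ^ v + 1)) * g ^ p ^ v) ?_
  have h4 : a * p ^ v + 1 ≤ (a + 1) * p ^ v := by
    rw [add_mul, one_mul]
    have := pow_pos (Fact.out : p.Prime).pos v
    omega
  rw [← mul_assoc, ← pow_add, Nat.add_sub_cancel' h4]
  ring

theorem X_pow_dvd_shafAt_sub_one {v : ℕ} {α : WittVector p k} (h : (p : WittVector p k) ^ v ∣ α)
    {a j : ℕ} (ha : a ≠ 0) (hj : j ≤ a * p ^ v) : X ^ j ∣ shafAt p k α a - 1 := by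
  obtain ⟨β, rfl⟩ := h
  have h1 := (pow_dvd_pow X (hj.trans (Nat.le_succ _))).trans
    (X_pow_dvd_shafAt_p_pow_mul_sub v β ha)
  exact (dvd_sub_left ((pow_dvd_pow X hj).trans (dvd_mul_left _ _))).mp h1

theorem dvd_mul_sub_one {R : Type*} [CommRing R] {d x y : R} (hx : d ∣ x - 1) (hy : d ∣ y - 1) :
    d ∣ x * y - 1 := by
  have : x * y - 1 = x * (y - 1) + (x - 1) := by ring
  rw [this]
  exact dvd_add (Dvd.dvd.mul_left hy _) hx

theorem dvd_prod_sub_one {R ι : Type*} [CommRing R] {d : R} {s : Finset ι} {f : ι → R}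
    (h : ∀ i ∈ s, d ∣ f i - 1) : d ∣ ∏ i ∈ s, f i - 1 := by
  classical
  induction s using Finset.induction_on with
  | empty => simp
  | insert i s hi ih =>
    rw [Finset.prod_insert hi]
    exact dvd_mul_sub_one (h i (Finset.mem_insert_self _ _))
      (ih fun j hj => h j (Finset.mem_insert_of_mem hj))

theorem constantCoeff_shafProd (N : ℕ) (α : ℕ → WittVector p k) :
    constantCoeff (shafProd p k N α) = 1 := by
  rw [map_prod]
  exact Finset.prod_eq_one fun a ha => constantCoeff_shafAt _ (by have := mem_copr.mp ha; omega)

theorem shafProd_add (N : ℕ) (α β : ℕ → WittVector p k) :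
    shafProd p k N (α + β) = shafProd p k N α * shafProd p k N β := by
  rw [← Finset.prod_mul_distrib]
  exact Finset.prod_congr rfl fun a ha => shafAt_add _ _ (by have := mem_copr.mp ha; omega)

theorem shafProd_zero (N : ℕ) : shafProd p k N 0 = 1 :=
  Finset.prod_eq_one fun a ha => shafAt_zero (by have := mem_copr.mp ha; omega)

theorem shafProd_single {N a : ℕ} (ha : a ∈ copr p N) (w : WittVector p k) :
    shafProd p k N (Pi.single a w) = shafAt p k w a := by
  rw [shafProd, Finset.prod_eq_single a, Pi.single_eq_same]
  · intro b hb hba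
    rw [Pi.single_eq_of_ne hba]
    exact shafAt_zero (by have := mem_copr.mp hb; omega)
  · exact fun h => absurd ha h

theorem exists_coprime_mul_pow {j : ℕ} (hj : j ≠ 0) :
    ∃ a v, a.Coprime p ∧ 1 ≤ a ∧ j = a * p ^ v := by
  obtain ⟨v, a, ha, h⟩ := Nat.exists_eq_pow_mul_and_not_dvd hj p (Fact.out : p.Prime).ne_one
  refine ⟨a, v, ((Nat.Prime.coprime_iff_not_dvd Fact.out).mpr ha).symm, ?_, by rw [h, mul_comm]⟩
  rcases Nat.eq_zero_or_pos a with rfl | h0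
  · simp at ha
  · exact h0

theorem coprime_mul_pow_inj {a b v w : ℕ} (ha : a.Coprime p) (hb : b.Coprime p)
    (h : a * p ^ v = b * p ^ w) : a = b ∧ v = w := by
  have hp := (Fact.out : p.Prime)
  have aux : ∀ {a b v w : ℕ}, a.Coprime p → a * p ^ v = b * p ^ w → w ≤ v := by
    intro a b v w ha h
    exact (Nat.pow_dvd_pow_iff_le_right hp.one_lt).mp
      ((Nat.Coprime.pow_left w ha.symm).dvd_of_dvd_mul_left ⟨b, by rw [h, mul_comm]⟩)
  have hvw : v = w := le_antisymm (aux hb h.symm) (aux ha h)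
  subst hvw
  exact ⟨Nat.eq_of_mul_eq_mul_right (pow_pos hp.pos v) h, rfl⟩

/-- Every principal unit is a product of the `E(α_a, t₀^a)`, to any given precision. -/
theorem exists_shafProd (f : k⟦X⟧) (hf : constantCoeff f = 1) (N : ℕ) :
    ∃ α, X ^ (N + 1) ∣ f - shafProd p k N α := by
  have hp := (Fact.out : p.Prime)
  suffices H : ∀ j ≤ N, ∃ α, X ^ (j + 1) ∣ f - shafProd p k N α from H N le_rfl
  intro j
  induction j with
  | zero =>
    intro _
    refine ⟨0, ?_⟩
    rw [zero_add, pow_one, shafProd_zero, X_dvd_iff, map_sub, hf, map_one, sub_self]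
  | succ j ih =>
    intro hj
    obtain ⟨α, hα⟩ := ih (by omega)
    obtain ⟨g, hg⟩ := hα
    -- The next exponent is `j + 1 = a p^v`. Its coefficient is corrected by a factor `E(p^v w,
    -- t^a)`, whose leading coefficient is the `p^v`-th power of the zeroth component of `w`; the
    -- root needed exists because `k` is perfect.
    obtain ⟨a, v, hac, ha1, hav⟩ := exists_coprime_mul_pow (p := p) (show j + 1 ≠ 0 by omega)
    obtain ⟨c, hc⟩ := (bijective_iterateFrobenius k p v).2 (constantCoeff g)
    rw [iterateFrobenius_def] at hc
    obtain ⟨w, hw⟩ := WittVector.constantCoeff_surjective (p := p) c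
    have haN : a ∈ copr p N := by
      refine mem_copr.mpr ⟨ha1, ?_, hac⟩
      have := Nat.le_mul_of_pos_right a (pow_pos hp.pos v)
      omega
    refine ⟨α + Pi.single a (p ^ v * w), ?_⟩
    rw [shafProd_add, shafProd_single haN]
    obtain ⟨q, hq⟩ := X_pow_dvd_shafAt_p_pow_mul_sub v w (a := a) (by omega)
    have hw' : w.coeff 0 = c := hw
    rw [hw', hc, ← hav] at hq
    have e1 : f - shafProd p k N α * shafAt p k (p ^ v * w) a =
        X ^ (j + 1) * (g - C (constantCoeff g)) -
          (shafProd p k N α - 1) * C (constantCoeff g) * X ^ (j + 1) -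
            shafProd p k N α * (X ^ (j + 1 + 1) * q) := by
      rw [← hq, mul_sub, ← hg]; ring
    rw [e1]
    refine dvd_sub (dvd_sub ?_ ?_) (Dvd.dvd.mul_left (dvd_mul_right _ _) _)
    · rw [pow_succ]
      exact mul_dvd_mul_left _ (X_dvd_iff.mpr (by simp))
    · rw [pow_succ' X (j + 1)]
      exact mul_dvd_mul (Dvd.dvd.mul_right (X_dvd_iff.mpr (by
        rw [map_sub, constantCoeff_shafProd, map_one, sub_self])) _) dvd_rfl

/-- Distinct pairs `(a, v)` have distinct leading exponents `a p^v`, so nothing can cancel at `t^j`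
with `j = a p^i`. By induction all factors other than the `a`-th are trivial up to `t^j`, and the
leading coefficient of the `a`-th must vanish. -/
theorem p_pow_dvd_of_shafProd {N : ℕ} {α : ℕ → WittVector p k}
    (h : X ^ (N + 1) ∣ shafProd p k N α - 1) {a i : ℕ} (ha : a.Coprime p) (ha1 : 1 ≤ a)
    (hi : a * p ^ i ≤ N) : (p : WittVector p k) ^ (i + 1) ∣ α a := by
  have hp := (Fact.out : p.Prime)
  obtain ⟨j, hj⟩ : ∃ j, j = a * p ^ i := ⟨_, rfl⟩
  induction j using Nat.strong_induction_on generalizing a i with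
  | _ j ih =>
  have hpi := pow_pos hp.pos i
  have hadiv : (p : WittVector p k) ^ i ∣ α a := by
    rcases Nat.eq_zero_or_pos i with rfl | hi0
    · simp
    · obtain ⟨i, rfl⟩ : ∃ i', i = i' + 1 := ⟨i - 1, by omega⟩
      have hlt : a * p ^ i < a * p ^ (i + 1) := by
        rw [pow_succ, ← mul_assoc]
        have := Nat.mul_le_mul_left (a * p ^ i) hp.two_le
        have := Nat.mul_pos ha1 (pow_pos hp.pos i)
        omega
      exact ih (a * p ^ i) (by omega) ha ha1 (by omega) rfl
  have haN : a ∈ copr p N := mem_copr.mpr ⟨ha1, (Nat.le_mul_of_pos_right a hpi).trans hi, ha⟩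
  obtain ⟨w, hw⟩ := hadiv
  have hothers : X ^ (j + 1) ∣ ∏ b ∈ (copr p N).erase a, shafAt p k (α b) b - 1 := by
    refine dvd_prod_sub_one fun b hb => ?_
    obtain ⟨hba, hbN⟩ := Finset.mem_erase.mp hb
    obtain ⟨hb1, hbN, hbc⟩ := mem_copr.mp hbN
    have hex : ∃ v, j ≤ b * p ^ v := ⟨j, (Nat.lt_pow_self hp.one_lt).le.trans
      (Nat.le_mul_of_pos_left _ (by omega))⟩
    -- With `v` least, the induction hypothesis at `b p^(v-1) < j` gives `p^v ∣ α_b`, and `b p^v =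
    -- j` is excluded because it would force `b = a`.
    obtain ⟨v, hv, hvmin⟩ : ∃ v, j ≤ b * p ^ v ∧ ∀ m < v, ¬ j ≤ b * p ^ m := by
      classical exact ⟨Nat.find hex, Nat.find_spec hex, fun m => Nat.find_min hex⟩
    have hne : j ≠ b * p ^ v := fun hjb => hba
      (coprime_mul_pow_inj (v := v) (w := i) hbc ha (by omega)).1
    refine X_pow_dvd_shafAt_sub_one (v := v) ?_ (by omega) (by omega)
    rcases Nat.eq_zero_or_pos v with rfl | hv0
    · simp
    · obtain ⟨v, rfl⟩ : ∃ v', v = v' + 1 := ⟨v - 1, by omega⟩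
      have := hvmin v (by omega)
      exact ih (b * p ^ v) (by omega) hbc hb1 (by omega) rfl
  have hj1 : X ^ (j + 1) ∣ shafAt p k (α a) a - 1 := by
    have h1 := (pow_dvd_pow X (show j + 1 ≤ N + 1 by omega)).trans h
    rw [shafProd, ← Finset.mul_prod_erase _ _ haN] at h1
    set P := ∏ b ∈ (copr p N).erase a, shafAt p k (α b) b
    have e : shafAt p k (α a) a * P - 1 = shafAt p k (α a) a * (P - 1) +
      (shafAt p k (α a) a - 1) := by ring
    rw [e] at h1
    exact (dvd_add_right (Dvd.dvd.mul_left hothers _)).mp h1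
  have h2 := X_pow_dvd_shafAt_p_pow_mul_sub i w (a := a) (by omega)
  rw [← hw, ← hj] at h2
  have h3 := (dvd_sub_right hj1).mp h2
  have h4 := X_pow_dvd_iff.mp h3 j (by omega)
  rw [coeff_C_mul, coeff_X_pow, if_pos rfl, mul_one] at h4
  have h5 : w.coeff 0 = 0 := eq_zero_of_pow_eq_zero h4
  rw [hw, pow_succ]
  exact mul_dvd_mul_left _ ((WittVector_p_dvd_iff p k).mpr h5)

theorem exists_shafProd_limit (α : ℕ → WittVector p k) : ∃ f : k⟦X⟧, constantCoeff f = 1 ∧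
    ∀ n, X ^ (n + 1) ∣ f - shafProd p k n α := by
  have hstep : ∀ n, X ^ (n + 1) ∣ shafProd p k (n + 1) α - shafProd p k n α := by
    intro n
    by_cases hn : (n + 1).Coprime p
    · have : copr p (n + 1) = insert (n + 1) (copr p n) := by
        ext a; rw [Finset.mem_insert, mem_copr, mem_copr]
        constructor
        · rintro ⟨h1, h2, h3⟩
          by_cases h : a = n + 1
          · exact Or.inl h
          · exact Or.inr ⟨h1, by omega, h3⟩
        · rintro (rfl | ⟨h1, h2, h3⟩)
          · exact ⟨by omega, le_rfl, hn⟩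
          · exact ⟨h1, by omega, h3⟩
      rw [shafProd, this, Finset.prod_insert (by rw [mem_copr]; omega), ← sub_one_mul]
      exact Dvd.dvd.mul_right (X_pow_dvd_shafAt_sub_one (v := 0) (by simp) (by omega) (by simp)) _
    · have : copr p (n + 1) = copr p n := by
        ext a; rw [mem_copr, mem_copr]
        constructor
        · rintro ⟨h1, h2, h3⟩
          refine ⟨h1, ?_, h3⟩
          rcases Nat.lt_succ_iff_lt_or_eq.mp (Nat.lt_succ_of_le h2) with h | rfl
          · omega
          · exact absurd h3 hn
        · rintro ⟨h1, h2, h3⟩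
          exact ⟨h1, by omega, h3⟩
      rw [shafProd, this, sub_self]
      exact dvd_zero _
  have hle : ∀ n m, n ≤ m → X ^ (n + 1) ∣ shafProd p k m α - shafProd p k n α := by
    intro n m hnm
    induction m, hnm using Nat.le_induction with
    | base => simp
    | succ m hnm ih =>
      rw [← sub_add_sub_cancel _ (shafProd p k m α)]
      exact dvd_add ((pow_dvd_pow X (by omega)).trans (hstep m)) ih
  have hlim : ∀ n, X ^ (n + 1) ∣ (mk fun m => coeff m (shafProd p k m α)) - shafProd p k n α := by
    intro n
    rw [X_pow_dvd_iff]
    intro m hm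
    rw [map_sub, coeff_mk, ← neg_sub, ← map_sub, neg_eq_zero]
    exact X_pow_dvd_iff.mp (hle m n (by omega)) m (by omega)
  refine ⟨_, ?_, hlim⟩
  rw [← coeff_zero_eq_constantCoeff_apply, coeff_mk, coeff_zero_eq_constantCoeff_apply,
    constantCoeff_shafProd]

end ShafarevichUnits

/-! ### The structure of `𝒦^*` -/

section UnitStructure

open PowerSeries

variable {p : ℕ} [Fact p.Prime] {k : Type*} [Field k] [CharP k p] [PerfectRing k p]

theorem coe_toUnit {f : k⟦X⟧} (hf : f ≠ 0) : (toUnit k f : k⸨X⸩) = HahnSeries.ofPowerSeries ℤ k f := by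
  have h : (HahnSeries.ofPowerSeries ℤ k f : k⸨X⸩) ≠ 0 := by
    rw [Ne, map_eq_zero_iff _ HahnSeries.ofPowerSeries_injective]
    exact hf
  rw [toUnit, dif_pos h, Units.val_mk0]

theorem ne_zero_of_constantCoeff_eq_one {f : k⟦X⟧} (hf : constantCoeff f = 1) : f ≠ 0 := by
  rintro rfl
  rw [map_zero] at hf
  exact zero_ne_one hf

theorem toUnit_mul {f g : k⟦X⟧} (hf : f ≠ 0) (hg : g ≠ 0) :
    toUnit k (f * g) = toUnit k f * toUnit k g := by
  apply Units.ext
  rw [coe_toUnit (mul_ne_zero hf hg), Units.val_mul, coe_toUnit hf, coe_toUnit hg, map_mul]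

/-- `u = c t₀^m f` with `c ∈ k^*` and `f` a principal unit. -/
def IsUnitDecomp (u : (k⸨X⸩)ˣ) (m : ℤ) (c : k) (f : k⟦X⟧) : Prop :=
  c ≠ 0 ∧ constantCoeff f = 1 ∧
    (u : k⸨X⸩) = HahnSeries.single m c * HahnSeries.ofPowerSeries ℤ k f

theorem exists_isUnitDecomp (u : (k⸨X⸩)ˣ) : ∃ m c f, IsUnitDecomp u m c f := by
  set x : k⸨X⸩ := u.val with hx
  have hx0 : x ≠ 0 := u.ne_zero
  set c := constantCoeff x.powerSeriesPart with hc
  have hc0 : c ≠ 0 := by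
    rw [hc, ← coeff_zero_eq_constantCoeff_apply, LaurentSeries.powerSeriesPart_coeff]
    simpa using hx0
  refine ⟨x.order, c, C c⁻¹ * x.powerSeriesPart, hc0, ?_, ?_⟩
  · rw [map_mul, ← hc, constantCoeff_C, inv_mul_cancel₀ hc0]
  · rw [map_mul, HahnSeries.ofPowerSeries_C, HahnSeries.C_apply, ← mul_assoc,
      HahnSeries.single_mul_single, add_zero, mul_inv_cancel₀ hc0,
      LaurentSeries.single_order_mul_powerSeriesPart]

theorem coeff_ofPowerSeries_neg {R : Type*} [CommRing R] (f : R⟦X⟧) {j : ℤ} (hj : j < 0) :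
    (HahnSeries.ofPowerSeries ℤ R f : R⸨X⸩).coeff j = 0 := by
  rw [HahnSeries.ofPowerSeries_apply]
  refine HahnSeries.embDomain_of_notMem_range fun ⟨n, hn⟩ => ?_
  have : (n : ℤ) = j := hn
  omega

theorem coeff_ofPowerSeries_natCast {R : Type*} [CommRing R] (f : R⟦X⟧) (n : ℕ) :
    (HahnSeries.ofPowerSeries ℤ R f : R⸨X⸩).coeff (n : ℤ) = coeff n f :=
  LaurentSeries.coeff_coe_powerSeries f n

theorem IsUnitDecomp.unique {u : (k⸨X⸩)ˣ} {m m' : ℤ} {c c' : k} {f f' : k⟦X⟧}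
    (h : IsUnitDecomp u m c f) (h' : IsUnitDecomp u m' c' f') : m = m' ∧ c = c' ∧ f = f' := by
  obtain ⟨hc, hf, hu⟩ := h
  obtain ⟨hc', hf', hu'⟩ := h'
  have hlead : ∀ {m : ℤ} {c : k} {f : k⟦X⟧}, constantCoeff f = 1 →
      (HahnSeries.single m c * HahnSeries.ofPowerSeries ℤ k f : k⸨X⸩).coeff m = c := by
    intro m c f hf
    rw [HahnSeries.coeff_single_mul, sub_self]
    have := coeff_ofPowerSeries_natCast f 0
    rw [Nat.cast_zero] at this
    rw [this, coeff_zero_eq_constantCoeff_apply, hf, mul_one]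
  have hlow : ∀ {m j : ℤ} {c : k} {f : k⟦X⟧}, j < m →
      (HahnSeries.single m c * HahnSeries.ofPowerSeries ℤ k f : k⸨X⸩).coeff j = 0 := by
    intro m j c f hj
    rw [HahnSeries.coeff_single_mul, coeff_ofPowerSeries_neg _ (by omega), mul_zero]
  have hm : m = m' := by
    rcases lt_trichotomy m m' with h | h | h
    · exact absurd ((hlead hf).symm.trans (by rw [← hu, hu', hlow h])) hc
    · exact h
    · exact absurd ((hlead hf').symm.trans (by rw [← hu', hu, hlow h])) hc'
  subst hm
  have hcc : c = c' := by rw [← hlead (m := m) (c := c) hf, ← hu, hu', hlead hf']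
  subst hcc
  refine ⟨rfl, rfl, HahnSeries.ofPowerSeries_injective (Γ := ℤ) ?_⟩
  have hs : (HahnSeries.single m c : k⸨X⸩) ≠ 0 := by simpa using hc
  exact mul_left_cancel₀ hs (hu.symm.trans hu')

theorem IsUnitDecomp.mul {u v : (k⸨X⸩)ˣ} {m m' : ℤ} {c c' : k} {f f' : k⟦X⟧}
    (h : IsUnitDecomp u m c f) (h' : IsUnitDecomp v m' c' f') :
    IsUnitDecomp (u * v) (m + m') (c * c') (f * f') := by
  refine ⟨mul_ne_zero h.1 h'.1, by rw [map_mul, h.2.1, h'.2.1, mul_one], ?_⟩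
  have e : (HahnSeries.single (m + m') (c * c') : k⸨X⸩) =
    HahnSeries.single m c * HahnSeries.single m' c' := HahnSeries.single_mul_single.symm
  rw [Units.val_mul, h.2.2, h'.2.2, map_mul (HahnSeries.ofPowerSeries ℤ k), e]
  ring

theorem isUnitDecomp_of_eq {u : (k⸨X⸩)ˣ} {f : k⟦X⟧} (hf : constantCoeff f = 1)
    (hu : (u : k⸨X⸩) = HahnSeries.ofPowerSeries ℤ k f) : IsUnitDecomp u 0 1 f := by
  refine ⟨one_ne_zero, hf, ?_⟩
  rw [hu, show (HahnSeries.single (0 : ℤ) (1 : k) : k⸨X⸩) = 1 from rfl, one_mul]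

theorem isUnitDecomp_toUnit {f : k⟦X⟧} (hf : constantCoeff f = 1) :
    IsUnitDecomp (toUnit k f) 0 1 f :=
  isUnitDecomp_of_eq hf (coe_toUnit (ne_zero_of_constantCoeff_eq_one hf))

theorem isUnitDecomp_toUnit_X : IsUnitDecomp (toUnit k (X : k⟦X⟧)) 1 1 1 := by
  refine ⟨one_ne_zero, map_one _, ?_⟩
  rw [coe_toUnit X_ne_zero, map_one (HahnSeries.ofPowerSeries ℤ k), mul_one, HahnSeries.ofPowerSeries_X]

/-- Homomorphisms from `𝒦^*` with prescribed values at `t₀` and at the `E(α, t₀^a)`. -/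
theorem exists_unit_hom (M : ℕ) {H : Type*} [AddCommGroup H] (h₀ : H) (χ : ℕ → WM p M k →+ H)
    {N : ℕ} (hχ : ∀ a, N < a → χ a = 0) : ∃ (δ : (k⸨X⸩)ˣ → H) (n : ℕ),
      (∀ u v, δ (u * v) = δ u + δ v) ∧
      (∀ u : (k⸨X⸩)ˣ, ∀ f : k⟦X⟧, (u : k⸨X⸩) = HahnSeries.ofPowerSeries ℤ k f →
        (X : k⟦X⟧) ^ (n + 1) ∣ f - 1 → δ u = 0) ∧
      δ (toUnit k X) = h₀ ∧
      ∀ a, 1 ≤ a → a.Coprime p → ∀ w, δ (toUnit k (shafAt p k w a)) = χ a (toWM p M k w) := by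
  have hp := (Fact.out : p.Prime)
  -- With this precision, a product that is trivial modulo `t^(n+1)` has every `α_a`, `a ≤ N`,
  -- divisible by `p^M`. The maps `χ_a` see `α_a` only modulo `p^M`, so the value on a unit does not
  -- depend on the chosen exponents.
  set n := N * p ^ M with hn
  have hNn : N ≤ n := Nat.le_mul_of_pos_right N (pow_pos hp.pos M)
  set Φ : (ℕ → WittVector p k) → H := fun α => ∑ a ∈ copr p N, χ a (toWM p M k (α a)) with hΦ
  have hΦadd : ∀ α β, Φ (α + β) = Φ α + Φ β := by
    intro α β
    simp only [hΦ, Pi.add_apply, map_add, Finset.sum_add_distrib]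
  have hΦ0 : ∀ α, X ^ (n + 1) ∣ shafProd p k n α - 1 → Φ α = 0 := by
    intro α hα
    refine Finset.sum_eq_zero fun a ha => ?_
    obtain ⟨ha1, haN, hac⟩ := mem_copr.mp ha
    have := p_pow_dvd_of_shafProd hα hac ha1 (Nat.mul_le_mul_right (p ^ M) haN)
    rw [(toWM_eq_zero p M k).mpr ((pow_dvd_pow _ (Nat.le_succ M)).trans this), map_zero]
  have hwd : ∀ (f : k⟦X⟧) α β, X ^ (n + 1) ∣ f - shafProd p k n α →
      X ^ (n + 1) ∣ f - shafProd p k n β → Φ α = Φ β := by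
    intro f α β hα hβ
    have h1 : X ^ (n + 1) ∣ shafProd p k n α - shafProd p k n β := by
      have := dvd_sub hβ hα
      rwa [sub_sub_sub_cancel_left] at this
    have h2 : shafProd p k n α = shafProd p k n (α - β) * shafProd p k n β := by
      rw [← shafProd_add, sub_add_cancel]
    rw [h2, ← sub_one_mul] at h1
    have hunit : IsUnit (shafProd p k n β) := by
      rw [isUnit_iff_constantCoeff, constantCoeff_shafProd]; exact isUnit_one
    have h3 := hΦ0 _ ((hunit.dvd_mul_right).mp h1)
    have h4 := hΦadd (α - β) β
    rwa [sub_add_cancel, h3, zero_add] at h4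
  choose m c f hd using exists_isUnitDecomp (k := k)
  choose α hα using fun u => exists_shafProd (p := p) (f u) (hd u).2.1 n
  have hval : ∀ {u m' c' f' β}, IsUnitDecomp u m' c' f' → X ^ (n + 1) ∣ f' - shafProd p k n β →
      m u • h₀ + Φ (α u) = m' • h₀ + Φ β := by
    intro u m' c' f' β h h'
    obtain ⟨rfl, -, rfl⟩ := (hd u).unique h
    rw [hwd _ _ _ (hα u) h']
  refine ⟨fun u => m u • h₀ + Φ (α u), n, ?_, ?_, ?_, ?_⟩
  · intro u v
    change m (u * v) • h₀ + Φ (α (u * v)) = (m u • h₀ + Φ (α u)) + (m v • h₀ + Φ (α v))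
    rw [hval (β := α u + α v) ((hd u).mul (hd v)), add_smul, hΦadd]
    · abel
    · rw [shafProd_add]
      have e : f u * f v - shafProd p k n (α u) * shafProd p k n (α v) =
        f u * (f v - shafProd p k n (α v)) + (f u - shafProd p k n (α u)) *
          shafProd p k n (α v) := by ring
      rw [e]
      exact dvd_add (Dvd.dvd.mul_left (hα v) _) (Dvd.dvd.mul_right (hα u) _)
  · intro u g hu hg
    have hg1 : constantCoeff g = 1 := by
      have := X_dvd_iff.mp ((dvd_pow_self X (Nat.succ_ne_zero n)).trans hg)
      rwa [map_sub, map_one, sub_eq_zero] at this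
    change m u • h₀ + Φ (α u) = 0
    rw [hval (β := 0) (isUnitDecomp_of_eq hg1 hu) (by rwa [shafProd_zero]), zero_smul, zero_add]
    exact hΦ0 0 (by rw [shafProd_zero, sub_self]; exact dvd_zero _)
  · change m _ • h₀ + Φ (α _) = h₀
    rw [hval (β := 0) isUnitDecomp_toUnit_X (by rw [shafProd_zero, sub_self]; exact dvd_zero _),
      one_smul, hΦ0 0 (by rw [shafProd_zero, sub_self]; exact dvd_zero _), add_zero]
  · intro a ha hac w
    change m _ • h₀ + Φ (α _) = _
    have ha0 : a ≠ 0 := by omega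
    have hdec := isUnitDecomp_toUnit (constantCoeff_shafAt (p := p) (k := k) w ha0)
    by_cases han : a ≤ n
    · have hmem : a ∈ copr p n := mem_copr.mpr ⟨ha, han, hac⟩
      rw [hval (β := Pi.single a w) hdec (by rw [shafProd_single hmem, sub_self]; exact dvd_zero _),
        zero_smul, zero_add]
      by_cases haN : a ≤ N
      · change ∑ b ∈ copr p N, _ = _
        rw [Finset.sum_eq_single a, Pi.single_eq_same]
        · intro b _ hba
          rw [Pi.single_eq_of_ne hba, map_zero, map_zero]
        · exact fun h => absurd (mem_copr.mpr ⟨ha, haN, hac⟩) h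
      · rw [hχ a (by omega), AddMonoidHom.zero_apply]
        refine Finset.sum_eq_zero fun b hb => ?_
        have := mem_copr.mp hb
        rw [Pi.single_eq_of_ne (by omega), map_zero, map_zero]
    · rw [hval (β := 0) hdec (by
          rw [shafProd_zero]
          exact X_pow_dvd_shafAt_sub_one (v := 0) (by simp) ha0 (by simpa using (by omega))),
        zero_smul, zero_add, hχ a (by omega), AddMonoidHom.zero_apply]
      exact hΦ0 0 (by rw [shafProd_zero, sub_self]; exact dvd_zero _)

end UnitStructure

/-! ### The generators of the finite layers -/

section LayerGenerators

open PowerSeries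

variable (p : ℕ) [Fact p.Prime] (M : ℕ) (k : Type*) [Field k] [CharP k p] [PerfectRing k p]

theorem genLvl_pow (n : ℕ) (u : (k⸨X⸩)ˣ) (m : ℕ) :
    genLvl p M k n (u ^ m) = m • genLvl p M k n u := by
  induction m with
  | zero =>
    rw [pow_zero, zero_smul]
    exact genLvl_eq_zero p M k n 1 1 (by simp) (by simp)
  | succ m ih => rw [pow_succ, genLvl_mul, ih, succ_nsmul]

theorem p_pow_smul_eq_zero {L : Type*} [AddCommGroup L] [Module (ZMod (p ^ M)) L] (x : L) :
    (p ^ M) • x = 0 := by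
  rw [← Nat.cast_smul_eq_nsmul (ZMod (p ^ M)), ZMod.natCast_self, zero_smul]

theorem genLvl_inv (n : ℕ) (u : (k⸨X⸩)ˣ) : genLvl p M k n u⁻¹ = -genLvl p M k n u := by
  rw [eq_neg_iff_add_eq_zero, ← genLvl_mul, inv_mul_cancel, ← pow_zero u, genLvl_pow, zero_smul]

theorem genLvl_zpow (n : ℕ) (u : (k⸨X⸩)ˣ) (m : ℤ) :
    genLvl p M k n (u ^ m) = m • genLvl p M k n u := by
  cases m with
  | ofNat m => simp [genLvl_pow]
  | negSucc m => rw [zpow_negSucc, genLvl_inv, genLvl_pow, negSucc_zsmul]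

theorem genLvl_congr (n : ℕ) {f g : k⟦X⟧} (hf : constantCoeff f = 1) (hg : constantCoeff g = 1)
    (h : X ^ (n + 1) ∣ f - g) : genLvl p M k n (toUnit k f) = genLvl p M k n (toUnit k g) := by
  have hg0 := ne_zero_of_constantCoeff_eq_one hg
  have hf0 := ne_zero_of_constantCoeff_eq_one hf
  obtain ⟨r, hr⟩ := (isUnit_iff_constantCoeff.mpr (by rw [hg]; exact isUnit_one)).exists_right_inv
  have hq : X ^ (n + 1) ∣ f * r - 1 := by
    rw [← hr, ← sub_mul]
    exact Dvd.dvd.mul_right h _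
  have hq1 : constantCoeff (f * r) = 1 := by
    have := X_dvd_iff.mp ((dvd_pow_self X (Nat.succ_ne_zero n)).trans hq)
    rwa [map_sub, map_one, sub_eq_zero] at this
  have e : f = f * r * g := by rw [mul_assoc, mul_comm r, hr, mul_one]
  have hq0 := ne_zero_of_constantCoeff_eq_one hq1
  rw [e, toUnit_mul hq0 hg0, genLvl_mul, genLvl_eq_zero p M k n _ _ (coe_toUnit hq0) hq, zero_add]

/-- A constant is a `p^M`-th power because `k` is perfect, and the layers are killed by `p^M`. -/
theorem genLvl_single_const (n : ℕ) (u : (k⸨X⸩)ˣ) (c : k)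
    (hu : (u : k⸨X⸩) = HahnSeries.single (0 : ℤ) c) : genLvl p M k n u = 0 := by
  obtain ⟨d, hd⟩ := (bijective_iterateFrobenius k p M).2 c
  rw [iterateFrobenius_def] at hd
  have hd0 : (HahnSeries.single (0 : ℤ) d : k⸨X⸩) ≠ 0 := by
    intro h
    have hd1 : d = 0 := by simpa using h
    rw [hd1, zero_pow (pow_pos (Fact.out : p.Prime).pos M).ne'] at hd
    have := u.ne_zero
    rw [hu, ← hd] at this
    simp at this
  have : u = (Units.mk0 _ hd0) ^ (p ^ M) := by
    apply Units.ext
    rw [Units.val_pow_eq_pow_val, Units.val_mk0, HahnSeries.single_pow, hu, hd, smul_zero]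
  rw [this, genLvl_pow, p_pow_smul_eq_zero]

theorem genLvl_of_isUnitDecomp (n : ℕ) {u : (k⸨X⸩)ˣ} {m : ℤ} {c : k} {f : k⟦X⟧}
    (h : IsUnitDecomp u m c f) :
    genLvl p M k n u = m • genLvl p M k n (toUnit k X) + genLvl p M k n (toUnit k f) := by
  obtain ⟨hc, hf, hu⟩ := h
  have hc0 : (HahnSeries.single (0 : ℤ) c : k⸨X⸩) ≠ 0 := by simpa using hc
  have hX : IsUnitDecomp ((toUnit k X) ^ m) m 1 (1 : k⟦X⟧) := by
    refine ⟨one_ne_zero, map_one _, ?_⟩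
    rw [Units.val_zpow_eq_zpow_val, coe_toUnit X_ne_zero, HahnSeries.ofPowerSeries_X,
      map_one (HahnSeries.ofPowerSeries ℤ k), mul_one]
    exact (RatFunc.single_zpow m).symm
  have : u = (toUnit k X) ^ m * (Units.mk0 _ hc0 * toUnit k f) := by
    apply Units.ext
    rw [Units.val_mul, Units.val_mul, Units.val_mk0, hX.2.2, hu,
      coe_toUnit (ne_zero_of_constantCoeff_eq_one hf), map_one (HahnSeries.ofPowerSeries ℤ k),
      mul_one, ← mul_assoc, HahnSeries.single_mul_single, add_zero, one_mul]
  rw [this, genLvl_mul, genLvl_mul, genLvl_zpow, genLvl_single_const p M k n (Units.mk0 _ hc0) c rfl,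
    zero_add]

variable {p M k}

theorem genLvl_shafAt_congr (n : ℕ) {a : ℕ} (ha : a ≠ 0) {w w' : WittVector p k}
    (h : toWM p M k w = toWM p M k w') :
    genLvl p M k n (toUnit k (shafAt p k w a)) = genLvl p M k n (toUnit k (shafAt p k w' a)) := by
  have h1 : toWM p M k (w - w') = 0 := by rw [map_sub, h, sub_self]
  rw [toWM_eq_zero] at h1
  obtain ⟨z, hz⟩ := h1
  have e : w = ((p ^ M : ℕ) : WittVector p k) * z + w' := by
    rw [Nat.cast_pow, ← hz, sub_add_cancel]
  have hne : ∀ v : WittVector p k, shafAt p k v a ≠ 0 := fun v =>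
    ne_zero_of_constantCoeff_eq_one (constantCoeff_shafAt v ha)
  have hpow : ∀ (f : k⟦X⟧) (m : ℕ), f ≠ 0 → toUnit k (f ^ m) = toUnit k f ^ m := by
    intro f m hf
    apply Units.ext
    rw [coe_toUnit (pow_ne_zero m hf), Units.val_pow_eq_pow_val, coe_toUnit hf, map_pow]
  rw [e, shafAt_add _ _ ha, shafAt_natCast_mul _ _ ha, toUnit_mul (pow_ne_zero _ (hne z)) (hne w'),
    genLvl_mul, hpow _ _ (hne z), genLvl_pow, p_pow_smul_eq_zero, zero_add]

/-- The map `W_M(k) → Lvl n`, `α ↦ E(α, t₀^a)`. -/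
def genE (p : ℕ) [Fact p.Prime] (M : ℕ) (k : Type*) [Field k] [CharP k p] [PerfectRing k p]
    (n a : ℕ) : WM p M k →ₗ[ZMod (p ^ M)] Lvl p M k n :=
  AddMonoidHom.toZModLinearMap (p ^ M) <|
    if ha : a = 0 then 0 else AddMonoidHom.mk' (fun w => genLvl p M k n
        (toUnit k (shafAt p k (Function.surjInv (toWM_surjective p M k) w) a))) (by
      intro w w'
      rw [← genLvl_mul, ← toUnit_mul (ne_zero_of_constantCoeff_eq_one (constantCoeff_shafAt _ ha))
        (ne_zero_of_constantCoeff_eq_one (constantCoeff_shafAt _ ha)), ← shafAt_add _ _ ha]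
      exact genLvl_shafAt_congr n ha (by simp only [map_add, Function.surjInv_eq]))

theorem genE_apply (n : ℕ) {a : ℕ} (ha : a ≠ 0) (w : WM p M k) :
    genE p M k n a w = genLvl p M k n
      (toUnit k (shafAt p k (Function.surjInv (toWM_surjective p M k) w) a)) := by
  rw [genE, dif_neg ha]
  rfl

theorem genE_toWM (n : ℕ) {a : ℕ} (ha : a ≠ 0) (w : WittVector p k) :
    genE p M k n a (toWM p M k w) = genLvl p M k n (toUnit k (shafAt p k w a)) := by
  rw [genE_apply n ha]
  exact genLvl_shafAt_congr n ha (Function.surjInv_eq _ _)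

theorem genE_eq_zero {n a : ℕ} (ha : n < a) : genE p M k n a = 0 := by
  ext w
  have ha0 : a ≠ 0 := by omega
  rw [genE_apply n ha0, LinearMap.zero_apply]
  refine genLvl_eq_zero p M k n _ _ (coe_toUnit (ne_zero_of_constantCoeff_eq_one
    (constantCoeff_shafAt _ ha0))) ?_
  exact X_pow_dvd_shafAt_sub_one (v := 0) (by simp) ha0 (by simpa using ha)

theorem genLvl_shafProd (n N : ℕ) (α : ℕ → WittVector p k) :
    genLvl p M k n (toUnit k (shafProd p k N α)) =
      ∑ a ∈ copr p N, genE p M k n a (toWM p M k (α a)) := by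
  have hne : ∀ a ∈ copr p N, a ≠ 0 := fun a ha => by have := mem_copr.mp ha; omega
  have key : ∀ s : Finset ℕ, (∀ a ∈ s, a ≠ 0) →
      constantCoeff (∏ a ∈ s, shafAt p k (α a) a) = 1 ∧
      genLvl p M k n (toUnit k (∏ a ∈ s, shafAt p k (α a) a)) =
        ∑ a ∈ s, genE p M k n a (toWM p M k (α a)) := by
    intro s hs
    induction s using Finset.induction_on with
    | empty =>
      refine ⟨by simp, ?_⟩
      rw [Finset.prod_empty, Finset.sum_empty]
      exact genLvl_eq_zero p M k n _ 1 (coe_toUnit one_ne_zero) (by simp)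
    | insert b s hb ih =>
      obtain ⟨h1, h2⟩ := ih fun a ha => hs a (Finset.mem_insert_of_mem ha)
      have hb0 := hs b (Finset.mem_insert_self b s)
      rw [Finset.prod_insert hb, Finset.sum_insert hb, ← h2, map_mul, h1, constantCoeff_shafAt _ hb0,
        toUnit_mul (ne_zero_of_constantCoeff_eq_one (constantCoeff_shafAt _ hb0))
          (ne_zero_of_constantCoeff_eq_one h1), genLvl_mul, genE_toWM n hb0]
      exact ⟨one_mul 1, rfl⟩
  exact (key _ hne).2

theorem IsShafProd.genLvl_eq {u : (k⸨X⸩)ˣ} {α : ℕ → WittVector p k} (h : IsShafProd p k u α)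
    (n : ℕ) : genLvl p M k n u = ∑ a ∈ copr p n, genE p M k n a (toWM p M k (α a)) := by
  obtain ⟨f, hu, hf⟩ := h
  have hf1 : constantCoeff f = 1 := by
    have := X_dvd_iff.mp ((dvd_pow_self X (Nat.succ_ne_zero n)).trans (hf n))
    rwa [map_sub, constantCoeff_shafProd, sub_eq_zero] at this
  have : u = toUnit k f := by
    apply Units.ext
    rw [hu, coe_toUnit (ne_zero_of_constantCoeff_eq_one hf1)]
  rw [← genLvl_shafProd, this]
  exact genLvl_congr p M k n hf1 (constantCoeff_shafProd _ _) (hf n)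

theorem exists_isShafProd (α : ℕ → WittVector p k) : ∃ u, IsShafProd p k u α := by
  obtain ⟨f, hf, h⟩ := exists_shafProd_limit α
  exact ⟨toUnit k f, f, coe_toUnit (ne_zero_of_constantCoeff_eq_one hf), h⟩

theorem genLvl_mem_of {n : ℕ} {Q : AddSubgroup (Lvl p M k n)}
    (h0 : genLvl p M k n (toUnit k X) ∈ Q)
    (hE : ∀ a, 1 ≤ a → a.Coprime p → ∀ w, genE p M k n a w ∈ Q) (u : (k⸨X⸩)ˣ) :
    genLvl p M k n u ∈ Q := by
  obtain ⟨m, c, f, h⟩ := exists_isUnitDecomp u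
  obtain ⟨α, hα⟩ := exists_shafProd (p := p) f h.2.1 n
  rw [genLvl_of_isUnitDecomp p M k n h, genLvl_congr p M k n h.2.1 (constantCoeff_shafProd _ _) hα,
    genLvl_shafProd]
  refine Q.add_mem (Q.zsmul_mem h0 m) (Q.sum_mem fun a ha => ?_)
  obtain ⟨h1, -, h3⟩ := mem_copr.mp ha
  exact hE a h1 h3 _

end LayerGenerators

/-! ### The trace form -/

/-- The choices made in the construction of `e` and `S`. -/
structure Datum (p : ℕ) [Fact p.Prime] (M : ℕ) (k : Type*) [Field k] [CharP k p] (N₀ : ℕ) where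
  one_le : 1 ≤ N₀
  card : Nat.card k = p ^ N₀
  S₀ : (WM p M k)⟦X⟧
  constantCoeff_S₀ : PowerSeries.constantCoeff S₀ = 0
  exists_coeff_S₀ : ∃ n, ¬ ((p : WM p M k) ∣ PowerSeries.coeff n S₀)
  α₀ : WM p M k
  trWM_α₀ : trWM p M k N₀ α₀ = 1
  β : Module.Basis (Fin N₀) (ZMod (p ^ M)) (WM p M k)
  γ : Module.Basis (Fin N₀) (ZMod (p ^ M)) (WM p M k)
  dual : ∀ i j, trWM p M k N₀ (β i * γ j) = if i = j then 1 else 0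

section Trace

variable {p : ℕ} [Fact p.Prime] {M : ℕ} {k : Type*} [Field k] [CharP k p] [PerfectRing k p]
  {N₀ : ℕ} (D : Datum p M k N₀)

theorem iterate_frobWM_smul (n : ℕ) (c : ZMod (p ^ M)) (w : WM p M k) :
    (frobWM p M k)^[n] (c • w) = c • (frobWM p M k)^[n] w := by
  induction n with
  | zero => rfl
  | succ n ih => rw [Function.iterate_succ_apply', Function.iterate_succ_apply', ih, frobWM_smul]

/-- The trace as a linear map. -/
def trLin (p : ℕ) [Fact p.Prime] (M : ℕ) (k : Type*) [Field k] [CharP k p] [PerfectRing k p]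
    (N₀ : ℕ) : WM p M k →ₗ[ZMod (p ^ M)] WM p M k where
  toFun := trWM p M k N₀
  map_add' x y := by simp only [trWM, iterate_map_add, Finset.sum_add_distrib]
  map_smul' c x := by
    simp only [trWM, iterate_frobWM_smul, Finset.smul_sum, RingHom.id_apply]

theorem trLin_apply (w : WM p M k) : trLin p M k N₀ w = trWM p M k N₀ w := rfl

namespace Datum

theorem finite (D : Datum p M k N₀) : Finite k :=
  Nat.finite_of_card_ne_zero (by rw [D.card]; exact pow_ne_zero _ (Fact.out : p.Prime).ne_zero)

theorem frobWM_iterate (D : Datum p M k N₀) (x : WM p M k) : (frobWM p M k)^[N₀] x = x :=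
  have := D.finite
  frobWM_iterate_card p M k D.card x

theorem trWM_frobWM (D : Datum p M k N₀) (x : WM p M k) : trWM p M k N₀ (frobWM p M k x) = trWM p M k N₀ x := by
  have h1 := Finset.sum_range_succ (fun n => (frobWM p M k)^[n] x) N₀
  have h2 := Finset.sum_range_succ' (fun n => (frobWM p M k)^[n] x) N₀
  rw [h1, D.frobWM_iterate, Function.iterate_zero, id] at h2
  rw [trWM, trWM]
  simp only [← Function.iterate_succ_apply]
  exact (add_right_cancel h2).symm

/-- The trace `W_M(k) → ℤ/p^M`. -/
def tau : WM p M k →ₗ[ZMod (p ^ M)] ZMod (p ^ M) := ∑ i, D.γ.repr 1 i • D.β.coord i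

/-- Expanding `w` in the basis `β` and `1` in the basis `γ`, the orthogonality relations express the
trace of `w · 1` with coefficients in `ℤ/p^M`. This is why the trace has values in `ℤ/p^M`. -/
theorem algebraMap_tau (w : WM p M k) :
    algebraMap (ZMod (p ^ M)) (WM p M k) (D.tau w) = trWM p M k N₀ w := by
  have h1 : w = ∑ i, ∑ j, (D.β.repr w i * D.γ.repr 1 j) • (D.β i * D.γ j) := by
    calc w = w * 1 := (mul_one w).symm
      _ = (∑ i, D.β.repr w i • D.β i) * ∑ j, D.γ.repr 1 j • D.γ j := by
        rw [D.β.sum_repr, D.γ.sum_repr]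
      _ = _ := by
        rw [Finset.sum_mul_sum]
        exact Finset.sum_congr rfl fun i _ => Finset.sum_congr rfl fun j _ => by
          rw [smul_mul_smul_comm]
  conv_rhs => rw [h1]
  rw [← trLin_apply, map_sum]
  simp only [map_sum, map_smul, trLin_apply, D.dual, smul_ite, smul_zero, Finset.sum_ite_eq,
    Finset.mem_univ, if_true, tau, LinearMap.sum_apply, LinearMap.smul_apply, smul_eq_mul,
    Module.Basis.coord_apply]
  exact Finset.sum_congr rfl fun i _ => by rw [mul_comm, Algebra.smul_def, mul_one]

theorem algebraMap_injective (D : Datum p M k N₀) : Function.Injective (algebraMap (ZMod (p ^ M)) (WM p M k)) := by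
  rw [injective_iff_map_eq_zero]
  intro c hc
  have h : c • D.β ⟨0, D.one_le⟩ = 0 := by rw [Algebra.smul_def, hc, zero_mul]
  have := congrArg (fun w => D.β.repr w ⟨0, D.one_le⟩) h
  simpa using this

theorem tau_β_mul_γ (i j : Fin N₀) : D.tau (D.β i * D.γ j) = if i = j then 1 else 0 := by
  apply D.algebraMap_injective
  rw [D.algebraMap_tau, D.dual]
  split_ifs <;> simp

theorem tau_α₀ : D.tau D.α₀ = 1 := by
  apply D.algebraMap_injective
  rw [D.algebraMap_tau, D.trWM_α₀, map_one]

theorem tau_frobWM (w : WM p M k) : D.tau (frobWM p M k w) = D.tau w := by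
  apply D.algebraMap_injective
  rw [D.algebraMap_tau, D.algebraMap_tau, D.trWM_frobWM]

theorem repr_γ (w : WM p M k) (j : Fin N₀) : D.γ.repr w j = D.tau (D.β j * w) := by
  conv_rhs => rw [← D.γ.sum_repr w, Finset.mul_sum, map_sum]
  simp [mul_smul_comm, D.tau_β_mul_γ]

theorem sum_tau_smul (w : WM p M k) : ∑ j, D.tau (D.β j * w) • D.γ j = w := by
  conv_rhs => rw [← D.γ.sum_repr w]
  exact Finset.sum_congr rfl fun j _ => by rw [D.repr_γ]

/-- For `c` fixed by `σ`, the trace of `c α₀` is `c · Tr α₀ = c`, and traces come from `ℤ/p^M`. -/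
theorem exists_algebraMap_eq {c : WM p M k} (hc : frobWM p M k c = c) :
    algebraMap (ZMod (p ^ M)) (WM p M k) (D.tau (c * D.α₀)) = c := by
  have h : ∀ n, (frobWM p M k)^[n] (c * D.α₀) = c * (frobWM p M k)^[n] D.α₀ := by
    intro n
    induction n with
    | zero => rfl
    | succ n ih =>
      rw [Function.iterate_succ_apply', Function.iterate_succ_apply', ih, map_mul, hc]
  rw [D.algebraMap_tau, trWM]
  simp only [h, ← Finset.mul_sum]
  rw [← trWM, D.trWM_α₀, mul_one]

/-- Additive Hilbert 90. Modulo the image of `σ - 1` one has `σ^r z ≡ z`, so `c = ∑ c σ^r(α₀) = ∑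
σ^r(α₀ σ^{N₀-r} c) ≡ α₀ ∑ σ^{N₀-r} c = α₀ Tr c`. -/
theorem exists_frobWM_sub_eq (c : WM p M k) :
    ∃ y, c - D.α₀ * algebraMap (ZMod (p ^ M)) (WM p M k) (D.tau c) = frobWM p M k y - y := by
  set σ := frobWM p M k
  have hmul : ∀ n x y, σ^[n] (x * y) = σ^[n] x * σ^[n] y := fun n x y => iterate_map_mul σ n x y
  have h1 : ∀ r z, ∃ y, σ^[r] z - z = σ y - y := by
    intro r z
    induction r with
    | zero => exact ⟨0, by simp⟩
    | succ r ih =>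
      obtain ⟨y, hy⟩ := ih
      refine ⟨y + σ^[r] z, ?_⟩
      rw [Function.iterate_succ_apply', map_add]
      linear_combination hy
  choose y hy using h1
  set z : ℕ → WM p M k := fun r => D.α₀ * σ^[N₀ - r] c with hz
  refine ⟨∑ r ∈ Finset.range N₀, y r (z r), ?_⟩
  rw [map_sum, ← Finset.sum_sub_distrib, Finset.sum_congr rfl fun r _ => (hy r (z r)).symm,
    Finset.sum_sub_distrib]
  congr 1
  · have : ∀ r ∈ Finset.range N₀, σ^[r] (z r) = c * σ^[r] D.α₀ := by
      intro r hr
      have hr := Finset.mem_range.mp hr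
      rw [hz, hmul, ← Function.iterate_add_apply, Nat.add_sub_cancel' hr.le, D.frobWM_iterate,
        mul_comm]
    rw [Finset.sum_congr rfl this, ← Finset.mul_sum, ← trWM, D.trWM_α₀, mul_one]
  · rw [hz, ← Finset.mul_sum, D.algebraMap_tau, ← D.trWM_frobWM, trWM,
      ← Finset.sum_range_reflect]
    congr 1
    refine Finset.sum_congr rfl fun r hr => ?_
    have hr := Finset.mem_range.mp hr
    rw [← Function.iterate_succ_apply]
    congr 2
    omega

end Datum

end Trace

/-! ### Coefficients of elements of `O(𝒦)` -/

section LaurentCoeff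

variable (p : ℕ) [Fact p.Prime] (M : ℕ) (k : Type*) [Field k] [CharP k p]

theorem smul_OK_eq (c : ZMod (p ^ M)) (f : OK p M k) :
    c • f = constOK p M k (algebraMap (ZMod (p ^ M)) (WM p M k) c) * f := by
  rw [Algebra.smul_def]; rfl

theorem algebraMap_OK (c : ZMod (p ^ M)) :
    algebraMap (ZMod (p ^ M)) (OK p M k) c = constOK p M k (algebraMap _ _ c) := rfl

theorem coeff_C_mul_laurent {R : Type*} [CommRing R] (w : R) (f : R⸨X⸩) (j : ℤ) :
    (HahnSeries.C w * f : R⸨X⸩).coeff j = w * f.coeff j := by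
  rw [HahnSeries.C_apply, HahnSeries.coeff_single_mul, sub_zero]

/-- The `j`-th coefficient. -/
def cf (j : ℤ) : OK p M k →ₗ[ZMod (p ^ M)] WM p M k where
  toFun f := HahnSeries.coeff (f : LaurentSeries (WM p M k)) j
  map_add' f g := rfl
  map_smul' c f := by
    rw [smul_OK_eq, RingHom.id_apply, Algebra.smul_def]
    exact coeff_C_mul_laurent _ _ _

variable {p M k}

theorem mem_mK {f : OK p M k} : f ∈ mK p M k ↔ ∀ j ≤ 0, cf p M k j f = 0 := Iff.rfl

theorem OK_ext {f g : OK p M k} (h : ∀ j, cf p M k j f = cf p M k j g) : f = g :=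
  HahnSeries.ext (funext h)

theorem cf_const_mul (w : WM p M k) (f : OK p M k) (j : ℤ) :
    cf p M k j (constOK p M k w * f) = w * cf p M k j f := coeff_C_mul_laurent _ _ _

theorem cf_tPow_mul (i j : ℤ) (f : OK p M k) :
    cf p M k j (tPow p M k i * f) = cf p M k (j - i) f := by
  refine (HahnSeries.coeff_single_mul (r := (1 : WM p M k)) (a := j) (b := i)
    (x := (f : LaurentSeries (WM p M k)))).trans ?_
  exact one_mul _

theorem cf_const (w : WM p M k) (j : ℤ) :
    cf p M k j (constOK p M k w) = if j = 0 then w else 0 := by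
  refine (HahnSeries.coeff_single (a := (0 : ℤ)) (b := j) (r := w)).trans ?_
  simp

theorem cf_tPow_mul_const (i j : ℤ) (w : WM p M k) :
    cf p M k j (tPow p M k i * constOK p M k w) = if j = i then w else 0 := by
  rw [cf_tPow_mul, cf_const]
  simp [sub_eq_zero]

theorem cf_toOK_natCast (f : (WM p M k)⟦X⟧) (n : ℕ) :
    cf p M k n (toOK p M k f) = PowerSeries.coeff n f := coeff_ofPowerSeries_natCast f n

theorem cf_toOK_neg (f : (WM p M k)⟦X⟧) {j : ℤ} (hj : j < 0) : cf p M k j (toOK p M k f) = 0 :=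
  coeff_ofPowerSeries_neg f hj

theorem toOK_add (f g : (WM p M k)⟦X⟧) : toOK p M k (f + g) = toOK p M k f + toOK p M k g :=
  map_add (HahnSeries.ofPowerSeries ℤ (WM p M k)) f g

theorem toOK_mul (f g : (WM p M k)⟦X⟧) : toOK p M k (f * g) = toOK p M k f * toOK p M k g :=
  map_mul (HahnSeries.ofPowerSeries ℤ (WM p M k)) f g

theorem toOK_pow (f : (WM p M k)⟦X⟧) (n : ℕ) : toOK p M k (f ^ n) = toOK p M k f ^ n :=
  map_pow (HahnSeries.ofPowerSeries ℤ (WM p M k)) f n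

theorem toOK_natCast (n : ℕ) : toOK p M k (n : (WM p M k)⟦X⟧) = n :=
  map_natCast (HahnSeries.ofPowerSeries ℤ (WM p M k)) n

theorem toOK_C (w : WM p M k) : toOK p M k (PowerSeries.C w) = constOK p M k w :=
  HahnSeries.ofPowerSeries_C w

theorem exists_toOK_eq {f : OK p M k} (h : ∀ j < 0, cf p M k j f = 0) :
    ∃ g, toOK p M k g = f := by
  refine ⟨PowerSeries.mk fun n => cf p M k n f, OK_ext fun j => ?_⟩
  rcases lt_or_ge j 0 with hj | hj
  · rw [cf_toOK_neg _ hj, h j hj]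
  · obtain ⟨n, rfl⟩ := Int.eq_ofNat_of_zero_le hj
    rw [cf_toOK_natCast, PowerSeries.coeff_mk]

theorem toOK_mem_mK {g : (WM p M k)⟦X⟧} :
    toOK p M k g ∈ mK p M k ↔ PowerSeries.constantCoeff g = 0 := by
  rw [mem_mK, ← PowerSeries.coeff_zero_eq_constantCoeff_apply]
  constructor
  · intro h
    rw [← cf_toOK_natCast]
    exact h 0 le_rfl
  · intro h j hj
    rcases hj.lt_or_eq with hj | rfl
    · exact cf_toOK_neg g hj
    · rw [← h, ← cf_toOK_natCast]; rfl

theorem exists_of_mem_mK {f : OK p M k} (h : f ∈ mK p M k) :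
    ∃ g, toOK p M k g = f ∧ PowerSeries.constantCoeff g = 0 := by
  obtain ⟨g, rfl⟩ := exists_toOK_eq fun j hj => h j hj.le
  exact ⟨g, rfl, toOK_mem_mK.mp h⟩

theorem toOK_mul_mem_mK (g : (WM p M k)⟦X⟧) {f : OK p M k} (h : f ∈ mK p M k) :
    toOK p M k g * f ∈ mK p M k := by
  obtain ⟨f, rfl, hf⟩ := exists_of_mem_mK h
  rw [← toOK_mul, toOK_mem_mK, map_mul, hf, mul_zero]

theorem cf_frobOK (f : OK p M k) (j : ℤ) :
    cf p M k (p * j) (frobOK p M k f) = frobWM p M k (cf p M k j f) :=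
  HahnSeries.embDomain_coeff (f := OrderEmbedding.ofMapLEIff (fun x : ℤ => (p : ℤ) * x) _)

theorem cf_frobOK_of_not_dvd (f : OK p M k) {j : ℤ} (hj : ¬ (p : ℤ) ∣ j) :
    cf p M k j (frobOK p M k f) = 0 := by
  refine HahnSeries.embDomain_of_notMem_range ?_
  rintro ⟨i, rfl⟩
  exact hj (Dvd.intro i rfl)

theorem frobOK_toOK (f : (WM p M k)⟦X⟧) :
    frobOK p M k (toOK p M k f) = toOK p M k (frobPS p M k f) := by
  have hp : 0 < (p : ℤ) := by exact_mod_cast (Fact.out : p.Prime).pos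
  refine OK_ext fun j => ?_
  by_cases hj : (p : ℤ) ∣ j
  · obtain ⟨i, rfl⟩ := hj
    rw [cf_frobOK]
    rcases lt_or_ge i 0 with hi | hi
    · rw [cf_toOK_neg _ hi, cf_toOK_neg _ (mul_neg_of_pos_of_neg hp hi), map_zero]
    · obtain ⟨n, rfl⟩ := Int.eq_ofNat_of_zero_le hi
      have := cf_toOK_natCast (frobPS p M k f) (p * n)
      push_cast at this
      rw [this, cf_toOK_natCast, coeff_mul_frobPS]
  · rw [cf_frobOK_of_not_dvd _ hj]
    rcases lt_or_ge j 0 with hi | hi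
    · rw [cf_toOK_neg _ hi]
    · obtain ⟨n, rfl⟩ := Int.eq_ofNat_of_zero_le hi
      rw [cf_toOK_natCast, coeff_frobPS, if_neg (by exact_mod_cast hj)]

theorem frobOK_const (w : WM p M k) :
    frobOK p M k (constOK p M k w) = constOK p M k (frobWM p M k w) := by
  rw [← toOK_C, ← toOK_C, frobOK_toOK, frobPS_apply, PowerSeries.map_C, PowerSeries.expand_C]

theorem frobOK_smul (c : ZMod (p ^ M)) (f : OK p M k) :
    frobOK p M k (c • f) = c • frobOK p M k f := by
  rw [smul_OK_eq, smul_OK_eq, map_mul, frobOK_const]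
  congr 2
  exact RingHom.congr_fun (RingHom.ext_zmod ((frobWM p M k).comp (algebraMap _ _)) _) c

theorem exists_bound (f : OK p M k) : ∃ n : ℕ, ∀ j ≤ -(n : ℤ), cf p M k j f = 0 := by
  refine ⟨(-(HahnSeries.order (f : LaurentSeries (WM p M k)))).toNat + 1, fun j hj => ?_⟩
  refine HahnSeries.coeff_eq_zero_of_lt_order ?_
  push_cast at hj
  have := Int.self_le_toNat (-(HahnSeries.order (f : LaurentSeries (WM p M k))))
  omega

theorem exists_OK (F : ℤ → WM p M k) (n : ℕ) (h : ∀ j ≤ -(n : ℤ), F j = 0) :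
    ∃ f : OK p M k, ∀ j, cf p M k j f = F j := by
  refine ⟨HahnSeries.ofSuppBddBelow F ⟨-(n : ℤ), fun j hj => ?_⟩, fun j => rfl⟩
  by_contra hc
  exact hj (h j (by omega))

theorem cf_mul_eq_zero {f g : OK p M k} {j : ℤ}
    (h : ∀ i i', i + i' = j → cf p M k i f * cf p M k i' g = 0) : cf p M k j (f * g) = 0 := by
  refine (HahnSeries.coeff_mul (x := (f : LaurentSeries (WM p M k))) (y := g) (a := j)).trans ?_
  exact Finset.sum_eq_zero fun ij hij => h _ _ (Finset.mem_antidiagonal.mp hij).2.2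

theorem tPow_add (i j : ℤ) : tPow p M k (i + j) = tPow p M k i * tPow p M k j := by
  refine ((HahnSeries.single_mul_single (a := i) (b := j) (r := (1 : WM p M k)) (s := 1)).trans ?_).symm
  rw [mul_one]; rfl

theorem tPow_natCast (n : ℕ) : tPow p M k n = toOK p M k (PowerSeries.X ^ n) := by
  refine OK_ext fun j => ?_
  rw [← mul_one (tPow p M k n), ← map_one (constOK p M k), cf_tPow_mul_const]
  rcases lt_or_ge j 0 with hj | hj
  · rw [cf_toOK_neg _ hj, if_neg (by omega)]
  · obtain ⟨m, rfl⟩ := Int.eq_ofNat_of_zero_le hj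
    rw [cf_toOK_natCast, PowerSeries.coeff_X_pow]
    simp

end LaurentCoeff

/-! ### The operator `ψ`, a left inverse of `σ` -/

section Psi

variable {p : ℕ} [Fact p.Prime] {M : ℕ} {k : Type*} [Field k] [CharP k p] [PerfectRing k p]

/-- The inverse of `σ` on `W_M(k)`. -/
def frobInv (w : WM p M k) : WM p M k := ((frobWM_bijective p M k).2 w).choose

theorem frobWM_frobInv (w : WM p M k) : frobWM p M k (frobInv w) = w :=
  ((frobWM_bijective p M k).2 w).choose_spec

theorem frobInv_frobWM (w : WM p M k) : frobInv (frobWM p M k w) = w :=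
  (frobWM_bijective p M k).1 (frobWM_frobInv _)

theorem frobInv_zero : frobInv (0 : WM p M k) = 0 := by
  have := frobInv_frobWM (0 : WM p M k)
  rwa [map_zero] at this

theorem exists_psi (f : OK p M k) : ∃ g : OK p M k, ∀ j, cf p M k j g = frobInv (cf p M k (p * j) f) := by
  have hp : 1 ≤ (p : ℤ) := by exact_mod_cast (Fact.out : p.Prime).pos
  obtain ⟨n, hn⟩ := exists_bound f
  refine exists_OK _ n fun j hj => ?_
  rw [hn _ (by nlinarith), frobInv_zero]

/-- `ψ (∑ c_j t^j) = ∑ σ^{-1}(c_{pj}) t^j`. -/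
def psi (f : OK p M k) : OK p M k := (exists_psi f).choose

theorem cf_psi (f : OK p M k) (j : ℤ) : frobWM p M k (cf p M k j (psi f)) = cf p M k (p * j) f := by
  rw [psi, (exists_psi f).choose_spec j, frobWM_frobInv]

theorem psi_eq {f g : OK p M k} (h : ∀ j, frobWM p M k (cf p M k j g) = cf p M k (p * j) f) :
    psi f = g :=
  OK_ext fun j => (frobWM_bijective p M k).1 (by rw [cf_psi, h])

theorem psi_add (f g : OK p M k) : psi (f + g) = psi f + psi g :=
  psi_eq fun j => by rw [map_add, map_add, map_add, cf_psi, cf_psi]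

theorem psi_frobOK (f : OK p M k) : psi (frobOK p M k f) = f :=
  psi_eq fun j => by rw [cf_frobOK]

/-- Laurent series with exponents prime to `p` only. -/
def NoP (f : OK p M k) : Prop := ∀ j, cf p M k (p * j) f = 0

theorem NoP.psi_eq_zero {f : OK p M k} (hf : NoP f) : psi f = 0 :=
  psi_eq fun j => by rw [hf j, map_zero, map_zero]

theorem noP_sub (f : OK p M k) : NoP (f - frobOK p M k (psi f)) := fun j => by
  rw [map_sub, cf_frobOK, cf_psi, sub_self]

theorem NoP.frobOK_mul {f : OK p M k} (hf : NoP f) (u : OK p M k) :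
    NoP (frobOK p M k u * f) := fun j => by
  refine cf_mul_eq_zero fun i i' hii => ?_
  by_cases hi : (p : ℤ) ∣ i
  · obtain ⟨m, hm⟩ : (p : ℤ) ∣ i' := (Int.dvd_add_right hi).mp (hii ▸ Dvd.intro j rfl)
    rw [hm, hf m, mul_zero]
  · rw [cf_frobOK_of_not_dvd _ hi, zero_mul]

/-- Split `f` into `σ(ψ f)` and a part without exponents divisible by `p`; multiplication by `σ u`
preserves the second kind, which `ψ` kills. -/
theorem psi_frobOK_mul (u f : OK p M k) : psi (frobOK p M k u * f) = u * psi f := by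
  have h : frobOK p M k u * f = frobOK p M k (u * psi f) +
      frobOK p M k u * (f - frobOK p M k (psi f)) := by rw [map_mul]; ring
  rw [h, psi_add, psi_frobOK, ((noP_sub f).frobOK_mul u).psi_eq_zero, add_zero]

theorem psi_mem_mK {f : OK p M k} (hf : f ∈ mK p M k) : psi f ∈ mK p M k := fun j hj => by
  have hp : 0 ≤ (p : ℤ) := by positivity
  apply (frobWM_bijective p M k).1
  refine (cf_psi f j).trans ?_
  rw [map_zero]
  exact hf _ (mul_nonpos_of_nonneg_of_nonpos hp hj)

theorem noP_tPow_mul_const {b : ℤ} (hb : ¬ (p : ℤ) ∣ b) (w : WM p M k) :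
    NoP (tPow p M k b * constOK p M k w) := fun j => by
  rw [cf_tPow_mul_const, if_neg]
  rintro rfl
  exact hb (Dvd.intro j rfl)

theorem NoP.add {f g : OK p M k} (hf : NoP f) (hg : NoP g) : NoP (f + g) := fun j => by
  rw [map_add, hf j, hg j, add_zero]

theorem NoP.sub {f g : OK p M k} (hf : NoP f) (hg : NoP g) : NoP (f - g) := fun j => by
  rw [map_sub, hf j, hg j, sub_zero]

theorem NoP.sum {ι : Type*} {s : Finset ι} {f : ι → OK p M k} (h : ∀ i ∈ s, NoP (f i)) :
    NoP (∑ i ∈ s, f i) := fun j => by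
  rw [map_sum]
  exact Finset.sum_eq_zero fun i hi => h i hi j

/-- The coefficients of the solution of `σ x - x = q`. -/
def frobSolve (q : ℕ → WM p M k) : ℕ → WM p M k
  | 0 => 0
  | n + 1 => (if p ∣ n + 1 then frobWM p M k (frobSolve q ((n + 1) / p)) else 0) - q (n + 1)
decreasing_by exact Nat.div_lt_self (Nat.succ_pos n) (Fact.out : p.Prime).one_lt

/-- On series without constant term `σ` is topologically nilpotent, so `σ - 1` can be inverted by
solving for the coefficients recursively. -/
theorem exists_frobOK_sub_of_mem_mK {q : OK p M k} (hq : q ∈ mK p M k) :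
    ∃ x ∈ mK p M k, frobOK p M k x - x = q := by
  obtain ⟨g, rfl, hg⟩ := exists_of_mem_mK hq
  refine ⟨toOK p M k (PowerSeries.mk (frobSolve fun n => PowerSeries.coeff n g)), ?_, ?_⟩
  · rw [toOK_mem_mK, ← PowerSeries.coeff_zero_eq_constantCoeff_apply, PowerSeries.coeff_mk, frobSolve]
  · rw [frobOK_toOK, sub_eq_iff_eq_add, ← toOK_add]
    congr 1
    ext n
    rw [coeff_frobPS, map_add, PowerSeries.coeff_mk, PowerSeries.coeff_mk]
    cases n with
    | zero =>
      rw [PowerSeries.coeff_zero_eq_constantCoeff_apply, hg, if_pos (dvd_zero p), Nat.zero_div,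
        frobSolve, map_zero, add_zero]
    | succ n => rw [frobSolve]; ring

end Psi

/-! ### Division by `S` -/

namespace Datum

variable {p : ℕ} [Fact p.Prime] {M : ℕ} {k : Type*} [Field k] [CharP k p] [PerfectRing k p]
  {N₀ : ℕ} (D : Datum p M k N₀)

/-- The series `S`. -/
def S : (WM p M k)⟦X⟧ := serS p M k D.S₀

/-- The number `e*`. -/
def eS : ℕ := eStar p M k D.S

/-- `S` as an element of `O(𝒦)`. -/
def SO : OK p M k := toOK p M k D.S

/-- `S^{-1}` as an element of `O(𝒦)`. -/
def SI : OK p M k := Ring.inverse D.SO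

theorem constantCoeff_S : PowerSeries.constantCoeff D.S = 0 :=
  constantCoeff_iterate_mulPSubst D.constantCoeff_S₀ M

theorem not_dvd_coeff_eS : ¬ (p : WM p M k) ∣ PowerSeries.coeff D.eS D.S :=
  Nat.sInf_mem (s := {n | ¬ (p : WM p M k) ∣ PowerSeries.coeff n D.S})
    (exists_not_dvd_coeff_serS D.constantCoeff_S₀ D.exists_coeff_S₀)

theorem dvd_coeff_of_lt_eS {n : ℕ} (hn : n < D.eS) : (p : WM p M k) ∣ PowerSeries.coeff n D.S :=
  not_not.mp (Nat.notMem_of_lt_sInf (s := {n | ¬ (p : WM p M k) ∣ PowerSeries.coeff n D.S}) hn)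

theorem exists_S_eq : ∃ N U : (WM p M k)⟦X⟧, IsUnit U ∧
    D.S = PowerSeries.X ^ D.eS * U + (p : (WM p M k)⟦X⟧) * N := by
  choose! c hc using fun n (hn : n < D.eS) => D.dvd_coeff_of_lt_eS hn
  refine ⟨PowerSeries.mk fun n => if n < D.eS then c n else 0,
    PowerSeries.mk fun n => PowerSeries.coeff (n + D.eS) D.S, ?_, ?_⟩
  · rw [PowerSeries.isUnit_iff_constantCoeff, ← PowerSeries.coeff_zero_eq_constantCoeff_apply,
      PowerSeries.coeff_mk, zero_add]
    exact WM_isUnit_of_not_dvd p M k D.not_dvd_coeff_eS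
  · ext n
    rw [map_add, PowerSeries.coeff_X_pow_mul', ← map_natCast PowerSeries.C, PowerSeries.coeff_C_mul,
      PowerSeries.coeff_mk, PowerSeries.coeff_mk]
    rcases lt_or_ge n D.eS with h | h
    · rw [if_neg (by omega), if_pos h, hc n h, zero_add]
    · rw [if_pos h, if_neg (by omega), Nat.sub_add_cancel h, mul_zero, add_zero]

theorem p_pow_eq_zero_of_algebra {R : Type*} [CommRing R] [Algebra (ZMod (p ^ M)) R] :
    (p : R) ^ M = 0 := by
  rw [← Nat.cast_pow, ← map_natCast (algebraMap (ZMod (p ^ M)) R), ZMod.natCast_self, map_zero]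

theorem isUnit_SO : IsUnit D.SO := by
  obtain ⟨N, U, hU, hS⟩ := D.exists_S_eq
  have h1 : D.SO = tPow p M k D.eS * toOK p M k U + (p : OK p M k) * toOK p M k N := by
    rw [SO, hS, toOK_add, toOK_mul, toOK_mul, toOK_natCast, tPow_natCast]
  have h2 : IsNilpotent ((p : OK p M k) * toOK p M k N) :=
    ⟨M, by rw [mul_pow, p_pow_eq_zero_of_algebra, zero_mul]⟩
  have h3 : IsUnit (tPow p M k D.eS * toOK p M k U) := by
    refine IsUnit.mul ?_ (hU.map (HahnSeries.ofPowerSeries ℤ (WM p M k)))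
    refine IsUnit.of_mul_eq_one (tPow p M k (-(D.eS : ℤ))) ?_
    rw [← tPow_add, add_neg_cancel]
    rfl
  rw [h1]
  exact h2.isUnit_add_left_of_commute h3 (Commute.all _ _)

theorem SO_mul_SI : D.SO * D.SI = 1 := Ring.mul_inverse_cancel _ D.isUnit_SO

theorem SO_pow_mul_SI_pow (n : ℕ) : D.SO ^ n * D.SI ^ n = 1 := by
  rw [← mul_pow, SO_mul_SI, one_pow]

theorem SO_pow_mul_SI_pow_of_le {m n : ℕ} (h : m ≤ n) : D.SO ^ n * D.SI ^ m = D.SO ^ (n - m) := by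
  obtain ⟨r, rfl⟩ := Nat.exists_eq_add_of_le h
  rw [Nat.add_sub_cancel_left, pow_add, mul_right_comm, SO_pow_mul_SI_pow, one_mul]

/-- Weierstrass division: modulo `p`, `S` is `t^{e*}` times a unit, so one step divides up to a
multiple of `p`, and `M` steps suffice. Remainders of degree `< e*` account for the range of `b`. -/
theorem exists_division (g : (WM p M k)⟦X⟧) : ∃ q r : (WM p M k)⟦X⟧, g = r + D.S * q ∧
    ∀ n, D.eS ≤ n → PowerSeries.coeff n r = 0 := by
  obtain ⟨N, U, hU, hS⟩ := D.exists_S_eq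
  obtain ⟨U', hU'⟩ := hU.exists_right_inv
  have step : ∀ g : (WM p M k)⟦X⟧, ∃ q r g' : (WM p M k)⟦X⟧,
      g = r + D.S * q + (p : (WM p M k)⟦X⟧) * g' ∧
      ∀ n, D.eS ≤ n → PowerSeries.coeff n r = 0 := by
    intro g
    set h : (WM p M k)⟦X⟧ := PowerSeries.mk fun n => PowerSeries.coeff (n + D.eS) g with hh
    refine ⟨U' * h, g - PowerSeries.X ^ D.eS * h, - (N * (U' * h)), ?_, ?_⟩
    · rw [hS]
      linear_combination (-(PowerSeries.X ^ D.eS * h)) * hU'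
    · intro n hn
      rw [map_sub, PowerSeries.coeff_X_pow_mul', if_pos hn, hh, PowerSeries.coeff_mk,
        Nat.sub_add_cancel hn, sub_self]
  have iter : ∀ j, ∃ q r g' : (WM p M k)⟦X⟧, g = r + D.S * q + (p : (WM p M k)⟦X⟧) ^ j * g' ∧
      ∀ n, D.eS ≤ n → PowerSeries.coeff n r = 0 := by
    intro j
    induction j with
    | zero => exact ⟨0, 0, g, by ring, fun n _ => map_zero _⟩
    | succ j ih =>
      obtain ⟨q, r, g', hg, hr⟩ := ih
      obtain ⟨q', r', g'', hg', hr'⟩ := step g'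
      refine ⟨q + (p : (WM p M k)⟦X⟧) ^ j * q', r + (p : (WM p M k)⟦X⟧) ^ j * r', g'', ?_, ?_⟩
      · rw [hg, hg']; ring
      · intro n hn
        rw [map_add, hr n hn, ← map_natCast PowerSeries.C, ← map_pow, PowerSeries.coeff_C_mul,
          hr' n hn, mul_zero, add_zero]
  obtain ⟨q, r, g', hg, hr⟩ := iter M
  refine ⟨q, r, ?_, hr⟩
  have : (p : (WM p M k)⟦X⟧) ^ M = 0 := eq_zero_of_pow_dvd le_rfl dvd_rfl
  rw [hg, this, zero_mul, add_zero]

theorem division_unique {q r : (WM p M k)⟦X⟧} (h : r + D.S * q = 0)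
    (hr : ∀ n, D.eS ≤ n → PowerSeries.coeff n r = 0) : q = 0 ∧ r = 0 := by
  obtain ⟨N, U, hU, hS⟩ := D.exists_S_eq
  have hq : ∀ j, (p : (WM p M k)⟦X⟧) ^ j ∣ q := by
    intro j
    induction j with
    | zero => simp
    | succ j ih =>
      rw [← hU.dvd_mul_left, natCast_pow_dvd_iff]
      intro i
      have h1 := congrArg (PowerSeries.coeff (i + D.eS)) h
      have h2 : (p : (WM p M k)⟦X⟧) ^ (j + 1) ∣ (p : (WM p M k)⟦X⟧) * (N * q) := by
        rw [pow_succ']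
        exact mul_dvd_mul_left _ (Dvd.dvd.mul_left ih _)
      have h3 := natCast_pow_dvd_iff.mp h2 (i + D.eS)
      have h4 : r + D.S * q = r + PowerSeries.X ^ D.eS * (U * q) +
          (p : (WM p M k)⟦X⟧) * (N * q) := by rw [hS]; ring
      rw [h4, map_add, map_add, hr _ (by omega), PowerSeries.coeff_X_pow_mul, zero_add,
        map_zero] at h1
      rw [eq_neg_of_add_eq_zero_left h1, dvd_neg]
      exact h3
  have hq0 := eq_zero_of_pow_dvd le_rfl (hq M)
  refine ⟨hq0, ?_⟩
  rwa [hq0, mul_zero, add_zero] at h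

/-! ### Elements with poles of order at most `s` along `S` -/

/-- `S^{-s} 𝔪(𝒦)`. -/
def Pole (s : ℕ) : Submodule (ZMod (p ^ M)) (OK p M k) where
  carrier := {f | D.SO ^ s * f ∈ mK p M k}
  add_mem' {f g} hf hg j hj := by
    rw [mul_add]
    exact ((cf p M k j).map_add _ _).trans (by
      rw [show cf p M k j _ = 0 from hf j hj, show cf p M k j _ = 0 from hg j hj, add_zero])
  zero_mem' j hj := by rw [mul_zero]; rfl
  smul_mem' c f hf j hj := by
    rw [mul_smul_comm]
    exact ((cf p M k j).map_smul _ _).trans (by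
      rw [show cf p M k j _ = 0 from hf j hj, smul_zero])

theorem mem_Pole {s : ℕ} {f : OK p M k} : f ∈ D.Pole s ↔ D.SO ^ s * f ∈ mK p M k := Iff.rfl

theorem mem_Pole_zero {f : OK p M k} : f ∈ D.Pole 0 ↔ f ∈ mK p M k := by
  rw [mem_Pole, pow_zero, one_mul]

theorem SO_pow (s : ℕ) : D.SO ^ s = toOK p M k (D.S ^ s) := (toOK_pow _ _).symm

theorem toOK_mul_mem_Pole {s : ℕ} (g : (WM p M k)⟦X⟧) {f : OK p M k} (hf : f ∈ D.Pole s) :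
    toOK p M k g * f ∈ D.Pole s := by
  rw [mem_Pole, mul_left_comm]
  exact toOK_mul_mem_mK g hf

theorem Pole_mono {s s' : ℕ} (h : s ≤ s') : D.Pole s ≤ D.Pole s' := by
  intro f hf
  obtain ⟨r, rfl⟩ := Nat.exists_eq_add_of_le' h
  rw [mem_Pole, pow_add, mul_assoc, SO_pow]
  exact toOK_mul_mem_mK _ hf

theorem SO_mul_mem_Pole {s : ℕ} {f : OK p M k} : D.SO * f ∈ D.Pole s ↔ f ∈ D.Pole (s + 1) := by
  rw [mem_Pole, mem_Pole, pow_succ, mul_assoc]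

theorem SI_mul_mem_Pole {s : ℕ} {f : OK p M k} : D.SI * f ∈ D.Pole (s + 1) ↔ f ∈ D.Pole s := by
  rw [← SO_mul_mem_Pole, ← mul_assoc, SO_mul_SI, one_mul]

theorem SI_pow_mul_mem_Pole (s : ℕ) {f : OK p M k} (hf : f ∈ mK p M k) :
    D.SI ^ s * f ∈ D.Pole s := by
  rw [mem_Pole, ← mul_assoc, SO_pow_mul_SI_pow, one_mul]
  exact hf

theorem mul_mem_Pole {s s' : ℕ} {f g : OK p M k} (hf : f ∈ D.Pole s) (hg : g ∈ D.Pole s') :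
    f * g ∈ D.Pole (s + s') := by
  obtain ⟨u, hu, -⟩ := exists_of_mem_mK hf
  rw [mem_Pole, show D.SO ^ (s + s') * (f * g) = (D.SO ^ s * f) * (D.SO ^ s' * g) by ring, ← hu]
  exact toOK_mul_mem_mK _ hg

theorem toOK_mem_Pole_succ (s : ℕ) (g : (WM p M k)⟦X⟧) : toOK p M k g ∈ D.Pole (s + 1) := by
  refine D.Pole_mono (Nat.le_add_left 1 s) ?_
  rw [mem_Pole, pow_one, SO, ← toOK_mul, toOK_mem_mK, map_mul, D.constantCoeff_S, zero_mul]

theorem const_mem_Pole_succ (s : ℕ) (w : WM p M k) : constOK p M k w ∈ D.Pole (s + 1) := by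
  rw [← toOK_C]
  exact D.toOK_mem_Pole_succ s _

theorem exists_mem_Pole (f : OK p M k) : ∃ s, f ∈ D.Pole (s + 1) := by
  obtain ⟨N, U, hU, hS⟩ := D.exists_S_eq
  obtain ⟨n, hn⟩ := exists_bound f
  have key : ∀ m : ℕ, ∃ s, tPow p M k (-(m : ℤ)) ∈ D.Pole (s + 1) := by
    intro m
    obtain ⟨Q, c⟩ := PowerSeries.X_dvd_iff.mpr D.constantCoeff_S
    refine ⟨m, ?_⟩
    have : D.SO ^ (m + 1) * tPow p M k (-(m : ℤ)) = toOK p M k (PowerSeries.X * Q ^ (m + 1)) := by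
      have h1 : tPow p M k (m : ℤ) * tPow p M k (-(m : ℤ)) = 1 := by
        rw [← tPow_add, add_neg_cancel]; rfl
      have h2 : PowerSeries.X * Q ^ (m + 1) * PowerSeries.X ^ m = D.S ^ (m + 1) := by
        rw [c]; ring
      rw [SO_pow, ← h2, toOK_mul _ (PowerSeries.X ^ m), ← tPow_natCast, mul_assoc, h1, mul_one]
    rw [mem_Pole, this, toOK_mem_mK]
    simp
  obtain ⟨s, hs⟩ := key n
  refine ⟨s, ?_⟩
  obtain ⟨g, hg⟩ := exists_toOK_eq (f := tPow p M k n * f) (fun j hj => by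
    rw [cf_tPow_mul]; exact hn _ (by omega))
  have : f = toOK p M k g * tPow p M k (-(n : ℤ)) := by
    rw [hg, mul_right_comm, ← tPow_add, add_neg_cancel]
    exact (one_mul f).symm
  rw [this]
  exact D.toOK_mul_mem_Pole _ hs

theorem exists_frobOK_eq_SO : ∃ S' Q : (WM p M k)⟦X⟧, frobOK p M k (toOK p M k S') = D.SO ∧
    D.S = Q * S' := by
  obtain ⟨S', h1, ⟨Q, h2⟩, -⟩ := exists_frobPS_eq_serS D.constantCoeff_S₀
  exact ⟨S', Q, by rw [frobOK_toOK, h1]; rfl, by rw [mul_comm]; exact h2⟩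

/-- From `S = σS'` one gets `ψ(S^s f) = S'^s ψ f`; since `S'` divides `S`, multiplying `ψ f` by
`S^s` also leaves no pole. -/
theorem psi_mem_Pole {s : ℕ} {f : OK p M k} (hf : f ∈ D.Pole s) : psi f ∈ D.Pole s := by
  obtain ⟨S', Q, h1, h2⟩ := D.exists_frobOK_eq_SO
  have h3 := psi_mem_mK hf
  rw [← h1, ← map_pow, psi_frobOK_mul] at h3
  rw [mem_Pole, SO_pow, h2, mul_pow, toOK_mul, mul_assoc, toOK_pow S']
  exact toOK_mul_mem_mK _ h3

theorem cop_mem_Pole {s : ℕ} {f : OK p M k} (hf : f ∈ D.Pole s) :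
    f - frobOK p M k (psi f) ∈ D.Pole s := by
  obtain ⟨S', Q, h1, h2⟩ := D.exists_frobOK_eq_SO
  have h3 : D.SO ^ s * (f - frobOK p M k (psi f)) =
      D.SO ^ s * f - frobOK p M k (psi (D.SO ^ s * f)) := by
    rw [← h1, ← map_pow, psi_frobOK_mul, map_mul]; ring
  rw [mem_Pole, h3]
  have h4 := psi_mem_mK hf
  obtain ⟨g, hg, hg0⟩ := exists_of_mem_mK h4
  obtain ⟨g', hg', hg0'⟩ := exists_of_mem_mK (show D.SO ^ s * f ∈ mK p M k from hf)
  intro j hj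
  refine ((cf p M k j).map_sub _ _).trans ?_
  rw [show cf p M k j _ = 0 from hf j hj, ← hg, frobOK_toOK,
    show cf p M k j _ = 0 from toOK_mem_mK.mpr (constantCoeff_frobPS hg0) j hj, sub_zero]

theorem noP_SO_mul {f : OK p M k} (hf : NoP f) : NoP (D.SO * f) := by
  obtain ⟨S', Q, h1, h2⟩ := D.exists_frobOK_eq_SO
  rw [← h1]
  exact hf.frobOK_mul _

theorem noP_SI_mul {f : OK p M k} (hf : NoP f) : NoP (D.SI * f) := by
  obtain ⟨S', Q, h1, h2⟩ := D.exists_frobOK_eq_SO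
  have h3 : frobOK p M k (psi (D.SI * f)) = 0 := by
    have h4 : psi (D.SO * (D.SI * f)) = 0 := by
      rw [← mul_assoc, SO_mul_SI, one_mul, hf.psi_eq_zero]
    rw [← h1, psi_frobOK_mul] at h4
    have h5 := congrArg (frobOK p M k) h4
    rw [map_mul, h1, map_zero] at h5
    exact (D.isUnit_SO.mul_right_eq_zero).mp h5
  have := noP_sub (D.SI * f)
  rwa [h3, sub_zero] at this

theorem noP_SI_pow_mul {f : OK p M k} (hf : NoP f) (n : ℕ) : NoP (D.SI ^ n * f) := by
  induction n with
  | zero => rwa [pow_zero, one_mul]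
  | succ n ih => rw [pow_succ', mul_assoc]; exact D.noP_SI_mul ih

end Datum

/-! ### The decomposition `O(𝒦) = ⊕ S^{-m} t^b W_M(k) ⊕ α₀ ℤ/p^M ⊕ (σ - 1) O(𝒦)` -/

section LinearMaps

variable {p : ℕ} [Fact p.Prime] {M : ℕ} {k : Type*} [Field k] [CharP k p]

/-- The inclusion of the constants as a linear map. -/
def constLin : WM p M k →ₗ[ZMod (p ^ M)] OK p M k where
  toFun := constOK p M k
  map_add' := map_add _
  map_smul' c w := by rw [Algebra.smul_def, map_mul, smul_OK_eq, RingHom.id_apply]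

theorem constLin_apply (w : WM p M k) : constLin w = constOK p M k w := rfl

/-- `σ` as a linear map. -/
def frobLin : OK p M k →ₗ[ZMod (p ^ M)] OK p M k where
  toFun := frobOK p M k
  map_add' := map_add _
  map_smul' c f := by rw [frobOK_smul, RingHom.id_apply]

theorem frobLin_apply (f : OK p M k) : frobLin f = frobOK p M k f := rfl

end LinearMaps

namespace Datum

variable {p : ℕ} [Fact p.Prime] {M : ℕ} {k : Type*} [Field k] [CharP k p] [PerfectRing k p]
  {N₀ : ℕ} (D : Datum p M k N₀)

/-- `S^{-m} t^b`. -/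
def B (i : Idx p D.eS) : OK p M k := D.SI ^ i.1.2 * tPow p M k i.1.1

/-- `∑ S^{-m} t^b w_{(b,m)}`. -/
def pol : (Idx p D.eS →₀ WM p M k) →ₗ[ZMod (p ^ M)] OK p M k :=
  Finsupp.lsum (ZMod (p ^ M)) fun i => (LinearMap.mulLeft (ZMod (p ^ M)) (D.B i)).comp constLin

theorem pol_single (i : Idx p D.eS) (w : WM p M k) :
    D.pol (Finsupp.single i w) = D.B i * constOK p M k w := by
  simp [pol, constLin_apply]

theorem pol_apply (w : Idx p D.eS →₀ WM p M k) :
    D.pol w = w.sum fun i c => D.B i * constOK p M k c := by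
  simp [pol, Finsupp.sum, constLin_apply]

/-- The families supported on the pairs `(b, m)` with `m ≤ s`. -/
abbrev supp (s : ℕ) : Submodule (ZMod (p ^ M)) (Idx p D.eS →₀ WM p M k) :=
  Finsupp.supported _ _ {i | i.1.2 ≤ s}

theorem supp_mono {s s' : ℕ} (h : s ≤ s') : D.supp s ≤ D.supp s' :=
  Finsupp.supported_mono fun _ hi => le_trans hi h

theorem tPow_mul_const_mem_mK {b : ℤ} (hb : 0 < b) (w : WM p M k) :
    tPow p M k b * constOK p M k w ∈ mK p M k := fun j hj => by
  refine (cf_tPow_mul_const b j w).trans (if_neg (by omega))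

theorem B_mul_const_mem_Pole (i : Idx p D.eS) (w : WM p M k) :
    D.B i * constOK p M k w ∈ D.Pole i.1.2 := by
  rw [B, mul_assoc]
  exact D.SI_pow_mul_mem_Pole _ (tPow_mul_const_mem_mK (by exact_mod_cast i.2.1) w)

theorem not_dvd_of_coprime {b : ℕ} (hb : b.Coprime p) : ¬ (p : ℤ) ∣ (b : ℤ) := by
  rw [Int.natCast_dvd_natCast]
  exact (Nat.Prime.coprime_iff_not_dvd Fact.out).mp hb.symm

theorem noP_B_mul_const (i : Idx p D.eS) (w : WM p M k) : NoP (D.B i * constOK p M k w) := by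
  rw [B, mul_assoc]
  exact D.noP_SI_pow_mul (noP_tPow_mul_const (not_dvd_of_coprime i.2.2.2.1) w) _

theorem pol_mem_Pole {s : ℕ} {w : Idx p D.eS →₀ WM p M k} (hw : w ∈ D.supp s) :
    D.pol w ∈ D.Pole s := by
  rw [pol_apply]
  exact Submodule.sum_mem _ fun i hi => D.Pole_mono (hw hi) (D.B_mul_const_mem_Pole i _)

theorem noP_pol (w : Idx p D.eS →₀ WM p M k) : NoP (D.pol w) := by
  rw [pol_apply]
  exact NoP.sum fun i _ => D.noP_B_mul_const i _

theorem mem_mK_of_noP {f : OK p M k} (hf : NoP f) (h : ∀ j < 0, cf p M k j f = 0) :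
    f ∈ mK p M k := fun j hj => by
  rcases hj.lt_or_eq with hj | rfl
  · exact h j hj
  · exact (show cf p M k 0 f = 0 by rw [← mul_zero (p : ℤ)]; exact hf 0)

theorem cf_frobOK_psi (f : OK p M k) (j : ℤ) :
    cf p M k j (frobOK p M k (psi f)) = if (p : ℤ) ∣ j then cf p M k j f else 0 := by
  split_ifs with h
  · obtain ⟨i, rfl⟩ := h
    rw [cf_frobOK, cf_psi]
  · exact cf_frobOK_of_not_dvd _ h

/-- Divide by `S`, then discard the exponents divisible by `p` in quotient and remainder. The
discarded part is of the form `σ(y)`, because `S = σS'`; having itself no exponent divisible by `p`,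
it is zero. -/
theorem exists_cop_division {g : (WM p M k)⟦X⟧} (hg : NoP (toOK p M k g)) :
    ∃ (r : ℕ → WM p M k), ∃ q ∈ mK p M k, NoP q ∧ toOK p M k g =
      ∑ b ∈ (Finset.range D.eS).filter (fun b => b.Coprime p),
        tPow p M k b * constOK p M k (r b) + D.SO * q := by
  obtain ⟨S', Q, h1, h2⟩ := D.exists_frobOK_eq_SO
  obtain ⟨q, r, hqr, hr⟩ := D.exists_division g
  set q' := toOK p M k q - frobOK p M k (psi (toOK p M k q)) with hq'
  set r' := toOK p M k r - frobOK p M k (psi (toOK p M k r)) with hr'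
  have hgq : toOK p M k g = r' + D.SO * q' +
      frobOK p M k (psi (toOK p M k r) + toOK p M k S' * psi (toOK p M k q)) := by
    have e1 : toOK p M k g = toOK p M k D.S * toOK p M k q + toOK p M k r := by
      rw [hqr, toOK_add, toOK_mul, add_comm]
    have e2 : frobOK p M k (psi (toOK p M k r) + toOK p M k S' * psi (toOK p M k q)) =
        frobOK p M k (psi (toOK p M k r)) + D.SO * frobOK p M k (psi (toOK p M k q)) := by
      rw [map_add (frobOK p M k), map_mul (frobOK p M k), h1]
    rw [e1, e2, hq', hr', SO]
    generalize frobOK p M k (psi (toOK p M k q)) = y1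
    generalize frobOK p M k (psi (toOK p M k r)) = y2
    ring
  have hz : psi (toOK p M k r) + toOK p M k S' * psi (toOK p M k q) = 0 := by
    have h3 : NoP (frobOK p M k (psi (toOK p M k r) + toOK p M k S' * psi (toOK p M k q))) := by
      rw [← sub_eq_iff_eq_add'.mpr hgq]
      exact hg.sub ((noP_sub _).add (D.noP_SO_mul (noP_sub _)))
    rw [← psi_frobOK (_ + _), h3.psi_eq_zero]
  rw [hz, map_zero, add_zero] at hgq
  refine ⟨fun b => PowerSeries.coeff b r, q', mem_mK_of_noP (noP_sub _) fun j hj => ?_,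
    noP_sub _, ?_⟩
  · rw [map_sub, cf_frobOK_psi, cf_toOK_neg _ hj]
    simp
  · rw [hgq]
    refine congrArg (· + D.SO * q') ?_
    refine OK_ext fun j => ?_
    rw [hr', map_sub, cf_frobOK_psi, map_sum]
    simp only [cf_tPow_mul_const]
    rcases lt_or_ge j 0 with hj | hj
    · rw [cf_toOK_neg _ hj, Finset.sum_eq_zero fun b _ => if_neg (by omega)]
      simp
    obtain ⟨n, rfl⟩ := Int.eq_ofNat_of_zero_le hj
    rw [cf_toOK_natCast]
    by_cases hn : n.Coprime p
    · rw [if_neg (not_dvd_of_coprime hn), sub_zero]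
      by_cases hne : n < D.eS
      · rw [Finset.sum_eq_single n]
        · rw [if_pos rfl]
        · exact fun b _ hb => if_neg (by omega)
        · exact fun h => absurd (Finset.mem_filter.mpr ⟨Finset.mem_range.mpr hne, hn⟩) h
      · rw [hr n (by omega), Finset.sum_eq_zero]
        intro b hb
        have := Finset.mem_range.mp (Finset.mem_filter.mp hb).1
        exact if_neg (by omega)
    · have hd : (p : ℤ) ∣ (n : ℤ) := by
        rw [Int.natCast_dvd_natCast]
        by_contra h
        exact hn ((Nat.Prime.coprime_iff_not_dvd Fact.out).mpr h).symm
      rw [if_pos hd, sub_self, Finset.sum_eq_zero]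
      intro b hb
      refine if_neg fun h => hn ?_
      rw [show n = b by omega]
      exact (Finset.mem_filter.mp hb).2

/-- Peel off the highest pole: the remainder of the division supplies the terms `S^{-(s+1)} t^b`,
and the quotient has order `s`. -/
theorem exists_pol_of_noP {s : ℕ} {f : OK p M k} (hf : f ∈ D.Pole s) (hN : NoP f) :
    ∃ w ∈ D.supp s, ∃ q ∈ mK p M k, f = D.pol w + q := by
  induction s generalizing f with
  | zero => exact ⟨0, Submodule.zero_mem _, f, D.mem_Pole_zero.mp hf, by rw [map_zero, zero_add]⟩
  | succ s ih =>
    obtain ⟨g, hg, -⟩ := exists_of_mem_mK (D.mem_Pole.mp hf)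
    have hNpow : ∀ n, NoP (D.SO ^ n * f) := by
      intro n
      induction n with
      | zero => rwa [pow_zero, one_mul]
      | succ n ih => rw [pow_succ', mul_assoc]; exact D.noP_SO_mul ih
    obtain ⟨r, q, hq, hqN, hgr⟩ := D.exists_cop_division (g := g) (hg ▸ hNpow (s + 1))
    obtain ⟨w, hw, q', hq', hwq⟩ := ih (D.SI_pow_mul_mem_Pole s hq) (D.noP_SI_pow_mul hqN s)
    set R := (Finset.range D.eS).filter (fun b => b.Coprime p) with hR
    have hidx : ∀ b ∈ R, 1 ≤ b ∧ b < D.eS ∧ b.Coprime p ∧ 1 ≤ s + 1 := by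
      intro b hb
      obtain ⟨h1, h2⟩ := Finset.mem_filter.mp hb
      refine ⟨?_, Finset.mem_range.mp h1, h2, by omega⟩
      rcases Nat.eq_zero_or_pos b with rfl | h
      · exact absurd ((Nat.coprime_zero_left p).mp h2) (Fact.out : p.Prime).ne_one
      · exact h
    refine ⟨w + ∑ b ∈ R.attach, Finsupp.single ⟨(b.1, s + 1), hidx b.1 b.2⟩ (r b.1),
      Submodule.add_mem _ (D.supp_mono (Nat.le_succ s) hw) (Submodule.sum_mem _ fun b _ =>
        Finsupp.single_mem_supported _ _ (le_refl (s + 1))), q', hq', ?_⟩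
    have h1 : f = D.SI ^ (s + 1) * toOK p M k g := by
      rw [hg, ← mul_assoc, mul_comm (D.SI ^ _), SO_pow_mul_SI_pow, one_mul]
    have h2 : D.SI ^ (s + 1) * (D.SO * q) = D.SI ^ s * q := by
      rw [pow_succ, mul_assoc, ← mul_assoc D.SI, mul_comm D.SI, SO_mul_SI, one_mul]
    rw [map_add, map_sum, h1, hgr, mul_add, h2, hwq, Finset.mul_sum,
      ← Finset.sum_attach R (fun b => D.SI ^ (s + 1) * (tPow p M k b * constOK p M k (r b)))]
    simp only [pol_single, B, mul_assoc]
    ring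

/-- Write `f = (f - σψf) + (σψf - ψf) + ψf`. The first summand has no exponents divisible by `p` and
is handled by `exists_pol_of_noP`; the second lies in the image of `σ - 1`; the third has a smaller
pole at `t = 0`, so one inducts on the bound `n`. When no negative exponents remain, the constant
term is treated by `exists_frobWM_sub_eq`, and the rest is `σ - 1` of something. -/
theorem exists_frob_decomposition {s n : ℕ} (hn : 1 ≤ n) {f : OK p M k} (hf : f ∈ D.Pole s)
    (hb : ∀ j ≤ -(n : ℤ), cf p M k j f = 0) :
    ∃ w ∈ D.supp s, ∃ c : ZMod (p ^ M), (s = 0 → c = 0) ∧ ∃ x ∈ D.Pole s,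
      f = D.pol w + constOK p M k (D.α₀ * algebraMap _ _ c) + (frobOK p M k x - x) := by
  induction n, hn using Nat.le_induction generalizing f with
  | base =>
    set f₀ := cf p M k 0 f with hf₀
    have hq : f - constOK p M k f₀ ∈ mK p M k := by
      intro j hj
      refine ((cf p M k j).map_sub _ _).trans ?_
      rw [cf_const]
      split_ifs with h
      · rw [h, hf₀, sub_self]
      · rw [hb j (by push_cast; omega), sub_zero]
    obtain ⟨x, hx, hxq⟩ := exists_frobOK_sub_of_mem_mK hq
    have hxs : x ∈ D.Pole s := D.Pole_mono (Nat.zero_le s) (D.mem_Pole_zero.mpr hx)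
    rcases Nat.eq_zero_or_pos s with rfl | hs
    · refine ⟨0, Submodule.zero_mem _, 0, fun _ => rfl, x, hxs, ?_⟩
      have : f₀ = 0 := D.mem_Pole_zero.mp hf 0 le_rfl
      rw [this, map_zero, sub_zero] at hxq
      rw [hxq, map_zero, map_zero, mul_zero, map_zero, zero_add, zero_add]
    · obtain ⟨y, hy⟩ := D.exists_frobWM_sub_eq f₀
      obtain ⟨s, rfl⟩ : ∃ s', s = s' + 1 := ⟨s - 1, by omega⟩
      refine ⟨0, Submodule.zero_mem _, D.tau f₀, fun h => by omega, x + constOK p M k y,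
        Submodule.add_mem _ hxs (D.const_mem_Pole_succ s y), ?_⟩
      have := congrArg (constOK p M k) hy
      rw [map_sub, map_sub] at this
      rw [map_zero, zero_add, map_add, frobOK_const]
      linear_combination (-1 : OK p M k) * hxq + this
  | succ n hn ih =>
    obtain ⟨w, hw, q, hq, hwq⟩ := D.exists_pol_of_noP (D.cop_mem_Pole hf) (noP_sub f)
    obtain ⟨x, hx, hxq⟩ := exists_frobOK_sub_of_mem_mK hq
    obtain ⟨w', hw', c, hc, x', hx', h'⟩ := ih (D.psi_mem_Pole hf) (fun j hj => by
      apply (frobWM_bijective p M k).1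
      rw [cf_psi, map_zero]
      have hp : 2 ≤ (p : ℤ) := by exact_mod_cast (Fact.out : p.Prime).two_le
      refine hb _ ?_
      push_cast
      have h1 : (1 : ℤ) ≤ n := by exact_mod_cast hn
      nlinarith)
    refine ⟨w + w', Submodule.add_mem _ hw hw', c, hc, x + psi f + x', Submodule.add_mem _
      (Submodule.add_mem _ (D.Pole_mono (Nat.zero_le s) (D.mem_Pole_zero.mpr hx))
        (D.psi_mem_Pole hf)) hx', ?_⟩
    rw [map_add, map_add, map_add]
    linear_combination hwq - hxq + h'

/-- Terms of top order `m = s + 1` become a polynomial of degree `< e*`, all others a multiple of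
`S`. Uniqueness of division then kills the top coefficients in `eq_zero_of_pol_mem_mK`. -/
theorem SO_pow_mul_pol {s : ℕ} {w : Idx p D.eS →₀ WM p M k} (hw : w ∈ D.supp (s + 1)) :
    ∃ r h : (WM p M k)⟦X⟧, D.SO ^ (s + 1) * D.pol w = toOK p M k (r + D.S * h) ∧
      (∀ n, D.eS ≤ n → PowerSeries.coeff n r = 0) ∧
      ∀ i : Idx p D.eS, i.1.2 = s + 1 → PowerSeries.coeff i.1.1 r = w i := by
  classical
  refine ⟨w.sum fun i c => if i.1.2 = s + 1 then PowerSeries.monomial i.1.1 c else 0,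
    w.sum fun i c => if i.1.2 = s + 1 then 0 else
      D.S ^ (s - i.1.2) * (PowerSeries.X ^ i.1.1 * PowerSeries.C c), ?_, ?_, ?_⟩
  · have hsum : ∀ (F : Idx p D.eS → WM p M k → (WM p M k)⟦X⟧), toOK p M k (w.sum F) =
        w.sum fun i c => toOK p M k (F i c) := fun F =>
      map_sum (HahnSeries.ofPowerSeries ℤ (WM p M k)) _ _
    rw [toOK_add, toOK_mul, hsum, hsum, pol_apply, Finsupp.mul_sum, Finsupp.mul_sum,
      ← Finsupp.sum_add]
    refine Finsupp.sum_congr fun i hi => ?_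
    have hmon : ∀ (b : ℕ) (c : WM p M k), PowerSeries.monomial b c =
        PowerSeries.X ^ b * PowerSeries.C c := by
      intro b c
      ext n
      rw [PowerSeries.coeff_mul_C, PowerSeries.coeff_X_pow, PowerSeries.coeff_monomial]
      split_ifs <;> simp
    have hle : i.1.2 ≤ s + 1 := hw hi
    rw [B, ← mul_assoc, ← mul_assoc, D.SO_pow_mul_SI_pow_of_le hle]
    split_ifs with h
    · rw [h, Nat.sub_self, pow_zero, one_mul, hmon, toOK_mul, ← tPow_natCast, toOK_C,
        show toOK p M k (0 : (WM p M k)⟦X⟧) = 0 from map_zero (HahnSeries.ofPowerSeries ℤ _),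
        mul_zero, add_zero]
    · rw [show s + 1 - i.1.2 = (s - i.1.2) + 1 by omega,
        show toOK p M k (0 : (WM p M k)⟦X⟧) = 0 from map_zero (HahnSeries.ofPowerSeries ℤ _),
        zero_add, toOK_mul, toOK_mul, ← tPow_natCast, toOK_C, ← SO_pow, pow_succ, SO]
      ring
  · intro n hn
    rw [Finsupp.sum, map_sum]
    refine Finset.sum_eq_zero fun i _ => ?_
    split_ifs
    · rw [PowerSeries.coeff_monomial, if_neg (by have := i.2.2.1; omega)]
    · rw [map_zero]
  · intro i hi
    rw [Finsupp.sum, map_sum, Finset.sum_eq_single i]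
    · rw [if_pos hi, PowerSeries.coeff_monomial, if_pos rfl]
    · intro j _ hji
      split_ifs with h
      · rw [PowerSeries.coeff_monomial, if_neg]
        intro hb
        exact hji (Subtype.ext (Prod.ext hb.symm (by omega)))
      · rw [map_zero]
    · intro h
      rw [Finsupp.notMem_support_iff.mp h]
      split_ifs <;> simp

theorem toOK_injective : Function.Injective (toOK p M k) := HahnSeries.ofPowerSeries_injective

theorem eq_zero_of_pol_mem_mK {w : Idx p D.eS →₀ WM p M k} (h : D.pol w ∈ mK p M k) : w = 0 := by
  have key : ∀ s, w ∈ D.supp s → w = 0 := by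
    intro s
    induction s with
    | zero =>
      intro hw
      ext1 i
      by_contra hi
      have h1 : i.1.2 ≤ 0 := hw (Finsupp.mem_support_iff.mpr hi)
      have := i.2.2.2.2
      omega
    | succ s ih =>
      intro hw
      obtain ⟨r, h', h1, h2, h3⟩ := D.SO_pow_mul_pol hw
      obtain ⟨g, hg, -⟩ := exists_of_mem_mK h
      rw [← hg, SO_pow, ← toOK_mul] at h1
      have h4 : r + D.S * (h' - D.S ^ s * g) = 0 := by
        rw [mul_sub, ← mul_assoc, ← pow_succ', toOK_injective h1]; ring
      have hr := (D.division_unique h4 h2).2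
      refine ih fun i hi => ?_
      have hle : i.1.2 ≤ s + 1 := hw hi
      rcases Nat.lt_succ_iff_lt_or_eq.mp (Nat.lt_succ_of_le hle) with h5 | h5
      · exact Nat.le_of_lt_succ h5
      · have := h3 i h5
        rw [hr, map_zero] at this
        exact absurd this.symm (Finsupp.mem_support_iff.mp hi)
  refine key (w.support.sup fun i => i.1.2) fun i hi => ?_
  exact Finset.le_sup (f := fun i : Idx p D.eS => i.1.2) hi

/-- At exponents `p j ≠ 0` only `σ x - x` contributes, so the coefficient of `x` at `p j` is `σ` of
that at `j`. A nonzero coefficient at a negative exponent would propagate to poles of unbounded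
order, so there is none. Then the polar sum lies in `𝔪(𝒦)` and vanishes, positive coefficients
vanish by descent, and the trace, which kills `σ - 1`, gives `c = 0`. What survives of `x` is a
constant fixed by `σ`. -/
theorem decomposition_unique {w : Idx p D.eS →₀ WM p M k} {c : ZMod (p ^ M)} {x : OK p M k}
    (h : D.pol w + constOK p M k (D.α₀ * algebraMap _ _ c) + (frobOK p M k x - x) = 0) :
    w = 0 ∧ c = 0 ∧ ∃ r : ZMod (p ^ M), x = constOK p M k (algebraMap _ _ r) := by
  have hp : 2 ≤ (p : ℤ) := by exact_mod_cast (Fact.out : p.Prime).two_le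
  have h1 : ∀ j : ℤ, j ≠ 0 → cf p M k (p * j) x = frobWM p M k (cf p M k j x) := by
    intro j hj
    have h2 := congrArg (cf p M k (p * j)) h
    rw [map_add, map_add, map_sub, D.noP_pol w j, cf_const, if_neg (by positivity), cf_frobOK,
      map_zero, zero_add, zero_add] at h2
    exact (sub_eq_zero.mp h2).symm
  have hneg : ∀ j < 0, cf p M k j x = 0 := by
    intro j hj
    obtain ⟨n, hn⟩ := exists_bound x
    have h2 : ∀ m : ℕ, cf p M k (p ^ m * j) x = (frobWM p M k)^[m] (cf p M k j x) := by
      intro m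
      induction m with
      | zero => simp
      | succ m ih =>
        rw [pow_succ', mul_assoc, h1 _ (by
          have : (0 : ℤ) < p ^ m := by positivity
          exact (mul_neg_of_pos_of_neg this hj).ne), ih, Function.iterate_succ_apply']
    have h3 := h2 n
    rw [hn] at h3
    · refine ((frobWM_bijective p M k).1.iterate n) ?_
      rw [← h3, iterate_map_zero]
    · have h4 : (n : ℤ) ≤ p ^ n := by
        exact_mod_cast (Nat.lt_pow_self (Fact.out : p.Prime).one_lt).le
      nlinarith
  have hw : w = 0 := by
    refine D.eq_zero_of_pol_mem_mK (mem_mK_of_noP (D.noP_pol w) fun j hj => ?_)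
    have h2 := congrArg (cf p M k j) h
    have h3 : cf p M k j (frobOK p M k x) = 0 := by
      by_cases hd : (p : ℤ) ∣ j
      · obtain ⟨i, rfl⟩ := hd
        rw [cf_frobOK, hneg i (by nlinarith), map_zero]
      · exact cf_frobOK_of_not_dvd _ hd
    rwa [map_add, map_add, map_sub, cf_const, if_neg hj.ne, hneg j hj, h3, sub_zero, add_zero,
      add_zero, map_zero] at h2
  rw [hw, map_zero, zero_add] at h
  have hpos : ∀ n : ℕ, 0 < n → cf p M k n x = 0 := by
    intro n
    induction n using Nat.strong_induction_on with
    | _ n ih =>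
    intro hn
    have h2 := congrArg (cf p M k n) h
    rw [map_add, map_sub, cf_const, if_neg (by omega), map_zero, zero_add, sub_eq_zero] at h2
    rw [← h2]
    by_cases hd : p ∣ n
    · obtain ⟨m, rfl⟩ := hd
      have hm : 0 < m := Nat.pos_of_mul_pos_left hn
      push_cast
      rw [cf_frobOK, ih m (by nlinarith [(Fact.out : p.Prime).two_le]) hm, map_zero]
    · exact cf_frobOK_of_not_dvd _ (by exact_mod_cast hd)
  have hx : x = constOK p M k (cf p M k 0 x) := by
    refine OK_ext fun j => ?_
    rw [cf_const]
    split_ifs with hj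
    · rw [hj]
    · rcases lt_or_ge j 0 with hj' | hj'
      · exact hneg j hj'
      · obtain ⟨n, rfl⟩ := Int.eq_ofNat_of_zero_le hj'
        exact hpos n (by omega)
  have h0 := congrArg (cf p M k 0) h
  have hf0 : cf p M k 0 (frobOK p M k x) = frobWM p M k (cf p M k 0 x) := by
    have := cf_frobOK x 0
    rwa [mul_zero] at this
  rw [map_add, map_sub, cf_const, if_pos rfl, hf0, map_zero] at h0
  have hc : c = 0 := by
    have h2 := congrArg D.tau h0
    rwa [map_add, map_sub, D.tau_frobWM, sub_self, add_zero, mul_comm, ← Algebra.smul_def, map_smul,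
      D.tau_α₀, map_zero, smul_eq_mul, mul_one] at h2
  refine ⟨hw, hc, D.tau (cf p M k 0 x * D.α₀), ?_⟩
  rw [hc, map_zero, mul_zero, zero_add, sub_eq_zero] at h0
  rw [D.exists_algebraMap_eq h0]
  exact hx

end Datum

/-! ### The group law on the layers -/

section GroupLaw

variable {R L : Type*} [CommRing R] [LieRing L] [LieAlgebra R L] {p : ℕ}

/-- The hypotheses under which the Campbell–Hausdorff operation is a group law. -/
structure CHGroup (R L : Type*) [CommRing R] [LieRing L] [LieAlgebra R L] (p : ℕ) : Prop where
  two_le : 2 ≤ p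
  isUnit : ∀ j, 1 ≤ j → j < p → IsUnit (j : R)
  assoc : ∀ a b c : L, CH R p (CH R p a b) c = CH R p a (CH R p b c)

namespace CHGroup

variable (hG : CHGroup R L p)
include hG

theorem sub_mem {J J' : Submodule R L} {a b : L} (hb : b ∈ J) (haJ : ∀ y ∈ J, ⁅a, y⁆ ∈ J')
    (hJJ : ∀ x ∈ J, ∀ y ∈ J, ⁅x, y⁆ ∈ J') (hJ' : J' ≤ J) : CH R p a b - (a + b) ∈ J' :=
  CH_sub_mem hG.two_le hG.isUnit hb haJ hJJ hJ'

theorem ch_zero (a : L) : CH R p a 0 = a := by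
  have := hG.sub_mem (J := ⊥) (J' := ⊥) (a := a) (b := 0) (zero_mem _)
    (fun y hy => by rw [(Submodule.mem_bot _).mp hy, lie_zero]; exact zero_mem _)
    (fun x _ y hy => by rw [(Submodule.mem_bot _).mp hy, lie_zero]; exact zero_mem _) le_rfl
  rw [Submodule.mem_bot, sub_eq_zero, add_zero] at this
  exact this

theorem zero_ch (a : L) : CH R p 0 a = a := by
  have := hG.sub_mem (J := Submodule.span _ {a}) (J' := ⊥) (a := 0) (b := a)
    (Submodule.mem_span_singleton_self a) (fun y _ => by rw [zero_lie]; exact zero_mem _)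
    (fun x hx y hy => by
      obtain ⟨c, rfl⟩ := Submodule.mem_span_singleton.mp hx
      obtain ⟨d, rfl⟩ := Submodule.mem_span_singleton.mp hy
      rw [smul_lie, lie_smul, lie_self, smul_zero, smul_zero]; exact zero_mem _) bot_le
  rw [Submodule.mem_bot, sub_eq_zero, zero_add] at this
  exact this

theorem ch_neg_self (a : L) : CH R p a (-a) = 0 := by
  have := hG.sub_mem (J := Submodule.span _ {a}) (J' := ⊥) (a := a) (b := -a)
    (neg_mem (Submodule.mem_span_singleton_self a)) (fun y hy => by
      obtain ⟨d, rfl⟩ := Submodule.mem_span_singleton.mp hy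
      rw [lie_smul, lie_self, smul_zero]; exact zero_mem _)
    (fun x hx y hy => by
      obtain ⟨c, rfl⟩ := Submodule.mem_span_singleton.mp hx
      obtain ⟨d, rfl⟩ := Submodule.mem_span_singleton.mp hy
      rw [smul_lie, lie_smul, lie_self, smul_zero, smul_zero]; exact zero_mem _) bot_le
  rw [Submodule.mem_bot, sub_eq_zero, add_neg_cancel] at this
  exact this

theorem neg_ch_self (a : L) : CH R p (-a) a = 0 := by
  have := hG.ch_neg_self (-a)
  rwa [neg_neg] at this

theorem neg_ch (a b : L) : -CH R p a b = CH R p (-b) (-a) := by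
  have h : CH R p (CH R p a b) (CH R p (-b) (-a)) = 0 := by
    rw [hG.assoc, ← hG.assoc b, hG.ch_neg_self, hG.zero_ch, hG.ch_neg_self]
  rw [← hG.zero_ch (CH R p (-b) (-a)), ← hG.neg_ch_self (CH R p a b), hG.assoc, h, hG.ch_zero]

theorem sub_mem' {J J' : Submodule R L}
    {a b : L} (ha : a ∈ J) (hbJ : ∀ y ∈ J, ⁅b, y⁆ ∈ J')
    (hJJ : ∀ x ∈ J, ∀ y ∈ J, ⁅x, y⁆ ∈ J') (hJ' : J' ≤ J) : CH R p a b - (a + b) ∈ J' := by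
  have := hG.sub_mem (neg_mem ha) (a := -b)
    (fun y hy => by rw [neg_lie]; exact neg_mem (hbJ y hy)) hJJ hJ'
  rw [← hG.neg_ch, ← neg_add, ← neg_sub', neg_mem_iff, add_comm] at this
  exact this

/-- In `z = (-y) ∘ e ∘ x`, all brackets are negligible modulo `J'`. -/
theorem sub_mem_of_eq_ch {J J' : Submodule R L}
    {e x y z : L} (h : z = CH R p (CH R p (-y) e) x) (he : e ∈ J) (hx : x ∈ J)
    (hz : z ∈ J) (hJJ : ∀ x ∈ J, ∀ y ∈ J, ⁅x, y⁆ ∈ J') (hJ' : J' ≤ J) :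
    z - (e + x - y) ∈ J' := by
  have h1 : CH R p z (-x) = CH R p (-y) e := by rw [h, hG.assoc, hG.ch_neg_self, hG.ch_zero]
  -- The equation is solved for `-y`, so that only `z`, `x` and `e` need to lie in `J`. This matters
  -- for `y = σx`, since `σ` does not preserve the order of poles along `S`.
  have h2 : CH R p (CH R p z (-x)) (-e) = -y := by rw [h1, hG.assoc, hG.ch_neg_self, hG.ch_zero]
  have h3 := hG.sub_mem (neg_mem hx) (hJJ z hz) hJJ hJ'
  have h4 : CH R p z (-x) ∈ J := by
    have := add_mem (hJ' h3) (add_mem hz (neg_mem hx))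
    rwa [sub_add_cancel] at this
  have h5 := hG.sub_mem (neg_mem he) (hJJ _ h4) hJJ hJ'
  rw [h2] at h5
  have := neg_mem (add_mem h3 h5)
  convert this using 1
  abel

end CHGroup

variable [Fact p.Prime] {M : ℕ} {k : Type*} [Field k] [CharP k p]

/-- The Campbell–Hausdorff operation is a group law on the layers. -/
theorem chGroup_lvl (n : ℕ) (A : Type*) [CommRing A] [Algebra (ZMod (p ^ M)) A] :
    CHGroup (ZMod (p ^ M)) (A ⊗[ZMod (p ^ M)] Lvl p M k n) p where
  two_le := (Fact.out : p.Prime).two_le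
  isUnit _ h1 h2 := isUnit_natCast_zmod p M h1 h2
  assoc a b c := by
    have hp := (Fact.out : p.Prime).two_le
    have hR : ∀ j, 1 ≤ j → j < p → IsUnit (j : ZMod (p ^ M)) :=
      fun _ h1 h2 => isUnit_natCast_zmod p M h1 h2
    refine ((isCHProd_three_iff p M k n A a b c _ hp).mp ?_).symm
    have h1 := mul_mem_pow_left augIdeal_mul_left (by omega)
      (truncExp_mul_truncExp_sub_mem (O := A) hp hR b c) (truncExp A _ p a)
    have h2 := truncExp_mul_truncExp_sub_mem (O := A) hp hR a (CH (ZMod (p ^ M)) p b c)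
    have := add_mem h1 h2
    rw [IsCHProd]
    convert this using 1
    simp only [List.map_cons, List.map_nil, List.prod_cons, List.prod_nil, mul_one, mul_sub]
    abel

end GroupLaw

namespace Datum

variable {p : ℕ} [Fact p.Prime] {M : ℕ} {k : Type*} [Field k] [CharP k p] [PerfectRing k p]
  {N₀ : ℕ} (D : Datum p M k N₀)

/-- `w ↦ tr (α₀ w)`, the retraction of `ℤ/p^M → W_M(k)`. -/
def tau₀ : WM p M k →ₗ[ZMod (p ^ M)] ZMod (p ^ M) := D.tau.comp (LinearMap.mulLeft _ D.α₀)

theorem tau₀_algebraMap (r : ZMod (p ^ M)) : D.tau₀ (algebraMap _ _ r) = r := by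
  rw [tau₀, LinearMap.comp_apply, LinearMap.mulLeft_apply, mul_comm, ← Algebra.smul_def, map_smul,
    D.tau_α₀, smul_eq_mul, mul_one]

/-- The series `x` with `tr (α₀ x₀) = 0`. -/
abbrev normalized : Submodule (ZMod (p ^ M)) (OK p M k) :=
  LinearMap.ker (D.tau₀.comp (cf p M k 0))

/-- `c ↦ α₀ c`. -/
def αLin : ZMod (p ^ M) →ₗ[ZMod (p ^ M)] OK p M k :=
  constLin.comp ((LinearMap.mulLeft _ D.α₀).comp (Algebra.linearMap _ _))

theorem αLin_apply (c : ZMod (p ^ M)) :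
    D.αLin c = constOK p M k (D.α₀ * algebraMap _ _ c) := rfl

/-- The sum map of the decomposition of `O(𝒦)`. -/
def sumMap : ((Idx p D.eS →₀ WM p M k) × ZMod (p ^ M) × D.normalized) →ₗ[ZMod (p ^ M)] OK p M k :=
  D.pol.coprod (D.αLin.coprod ((frobLin - LinearMap.id).comp D.normalized.subtype))

theorem sumMap_apply (w : Idx p D.eS →₀ WM p M k) (c : ZMod (p ^ M)) (x : D.normalized) :
    D.sumMap (w, c, x) = D.pol w + D.αLin c + (frobOK p M k x - x) := by
  simp [sumMap, frobLin_apply, add_assoc]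

theorem frobOK_const_algebraMap (r : ZMod (p ^ M)) :
    frobOK p M k (constOK p M k (algebraMap _ _ r)) = constOK p M k (algebraMap _ _ r) := by
  rw [frobOK_const, frobWM_algebraMap]

theorem exists_decomposition {s : ℕ} {f : OK p M k} (hf : f ∈ D.Pole s) :
    ∃ w ∈ D.supp s, ∃ c : ZMod (p ^ M), (s = 0 → c = 0) ∧ ∃ x : D.normalized,
      (x : OK p M k) ∈ D.Pole s ∧ f = D.pol w + D.αLin c + (frobOK p M k x - x) := by
  obtain ⟨n, hn⟩ := exists_bound f
  obtain ⟨w, hw, c, hc, x, hx, h⟩ := D.exists_frob_decomposition (n := n + 1) (by omega) hf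
    (fun j hj => hn j (by push_cast at hj; omega))
  set r := D.tau₀ (cf p M k 0 x) with hr
  refine ⟨w, hw, c, hc, ⟨x - constOK p M k (algebraMap _ _ r), ?_⟩, ?_, ?_⟩
  · rw [LinearMap.mem_ker, LinearMap.comp_apply, map_sub, map_sub, cf_const, if_pos rfl,
      tau₀_algebraMap, hr, sub_self]
  · refine sub_mem hx ?_
    rcases s with _ | s
    · rw [hr, show cf p M k 0 x = 0 from D.mem_Pole_zero.mp hx 0 le_rfl, map_zero, map_zero,
        map_zero]
      exact zero_mem _
    · exact D.const_mem_Pole_succ s _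
  · rw [h, αLin_apply]
    simp only [map_sub, frobOK_const_algebraMap, sub_sub_sub_cancel_right]

/-- Decompositions determine `x` only up to `ℤ/p^M`, and the normalization `tr(α₀ x₀) = 0` removes
exactly this ambiguity. -/
theorem sumMap_bijective : Function.Bijective D.sumMap := by
  constructor
  · rw [← LinearMap.ker_eq_bot, LinearMap.ker_eq_bot']
    rintro ⟨w, c, x⟩ h
    rw [sumMap_apply, αLin_apply] at h
    obtain ⟨rfl, rfl, r, hr⟩ := D.decomposition_unique h
    have hx := x.2
    rw [LinearMap.mem_ker, LinearMap.comp_apply, hr, cf_const, if_pos rfl, tau₀_algebraMap] at hx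
    have : x = 0 := Subtype.ext (by rw [hr, hx, map_zero, map_zero]; rfl)
    rw [this]; rfl
  · intro f
    obtain ⟨s, hs⟩ := D.exists_mem_Pole f
    obtain ⟨w, -, c, -, x, -, h⟩ := D.exists_decomposition hs
    exact ⟨(w, c, x), by rw [sumMap_apply, h]⟩

/-- The decomposition of `O(𝒦)` as a linear equivalence. -/
def decomp : OK p M k ≃ₗ[ZMod (p ^ M)] ((Idx p D.eS →₀ WM p M k) × ZMod (p ^ M) × D.normalized) :=
  (LinearEquiv.ofBijective D.sumMap D.sumMap_bijective).symm

/-- The coefficients of the `S^{-m} t^b`. -/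
def Pw : OK p M k →ₗ[ZMod (p ^ M)] (Idx p D.eS →₀ WM p M k) :=
  (LinearMap.fst _ _ _).comp D.decomp.toLinearMap

/-- The coefficient of `α₀`. -/
def P0 : OK p M k →ₗ[ZMod (p ^ M)] ZMod (p ^ M) :=
  (LinearMap.fst _ _ _).comp ((LinearMap.snd _ _ _).comp D.decomp.toLinearMap)

/-- The normalized `x` in the term `σ x - x`. -/
def Xm : OK p M k →ₗ[ZMod (p ^ M)] OK p M k :=
  D.normalized.subtype.comp
    ((LinearMap.snd _ _ _).comp ((LinearMap.snd _ _ _).comp D.decomp.toLinearMap))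

/-- The coefficient of `S^{-m} t^b`. -/
def P (i : Idx p D.eS) : OK p M k →ₗ[ZMod (p ^ M)] WM p M k := (Finsupp.lapply i).comp D.Pw

theorem P_apply (i : Idx p D.eS) (f : OK p M k) : D.P i f = D.Pw f i := rfl

theorem decomp_eq (w : Idx p D.eS →₀ WM p M k) (c : ZMod (p ^ M)) (x : D.normalized) :
    D.decomp (D.pol w + D.αLin c + (frobOK p M k x - x)) = (w, c, x) := by
  rw [← sumMap_apply, decomp, LinearEquiv.symm_apply_eq]
  rfl

theorem Pw_eq (w : Idx p D.eS →₀ WM p M k) (c : ZMod (p ^ M)) (x : D.normalized) :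
    D.Pw (D.pol w + D.αLin c + (frobOK p M k x - x)) = w := by
  rw [Pw, LinearMap.comp_apply, LinearEquiv.coe_coe, decomp_eq]; rfl

theorem P0_eq (w : Idx p D.eS →₀ WM p M k) (c : ZMod (p ^ M)) (x : D.normalized) :
    D.P0 (D.pol w + D.αLin c + (frobOK p M k x - x)) = c := by
  rw [P0, LinearMap.comp_apply, LinearMap.comp_apply, LinearEquiv.coe_coe, decomp_eq]; rfl

theorem Xm_eq (w : Idx p D.eS →₀ WM p M k) (c : ZMod (p ^ M)) (x : D.normalized) :
    D.Xm (D.pol w + D.αLin c + (frobOK p M k x - x)) = x := by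
  rw [Xm, LinearMap.comp_apply, LinearMap.comp_apply, LinearMap.comp_apply, LinearEquiv.coe_coe,
    decomp_eq]; rfl

/-- The projection onto the span of the `S^{-m} t^b W_M(k)` and `α₀`. -/
def Pi : OK p M k →ₗ[ZMod (p ^ M)] OK p M k := D.pol.comp D.Pw + D.αLin.comp D.P0

theorem Pi_apply (f : OK p M k) : D.Pi f = D.pol (D.Pw f) + D.αLin (D.P0 f) := rfl

/-- Some decomposition respects the pole order, and by uniqueness it is the one given by the
projections. -/
theorem decomposition_of_mem_Pole {s : ℕ} {f : OK p M k} (hf : f ∈ D.Pole s) :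
    D.Pw f ∈ D.supp s ∧ (s = 0 → D.P0 f = 0) ∧ D.Xm f ∈ D.Pole s := by
  obtain ⟨w, hw, c, hc, x, hx, rfl⟩ := D.exists_decomposition hf
  rw [Pw_eq, P0_eq, Xm_eq]
  exact ⟨hw, hc, hx⟩

theorem Xm_mem_Pole {s : ℕ} {f : OK p M k} (hf : f ∈ D.Pole s) : D.Xm f ∈ D.Pole s :=
  (D.decomposition_of_mem_Pole hf).2.2

theorem P_eq_zero_of_mem_Pole {s : ℕ} {f : OK p M k} (hf : f ∈ D.Pole s) {i : Idx p D.eS}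
    (hi : s < i.1.2) : D.P i f = 0 := by
  by_contra h
  exact absurd ((D.decomposition_of_mem_Pole hf).1 (Finsupp.mem_support_iff.mpr h)) (not_le.mpr hi)

theorem P0_eq_zero_of_mem_mK {f : OK p M k} (hf : f ∈ mK p M k) : D.P0 f = 0 :=
  (D.decomposition_of_mem_Pole (D.mem_Pole_zero.mpr hf)).2.1 rfl

theorem Pi_mem_Pole {s : ℕ} {f : OK p M k} (hf : f ∈ D.Pole s) : D.Pi f ∈ D.Pole s := by
  obtain ⟨h1, h2, -⟩ := D.decomposition_of_mem_Pole hf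
  rw [Pi_apply]
  refine add_mem (D.pol_mem_Pole h1) ?_
  rcases s with _ | s
  · rw [h2 rfl, map_zero]; exact zero_mem _
  · exact D.const_mem_Pole_succ s _

theorem frobOK_Xm_sub (f : OK p M k) : frobOK p M k (D.Xm f) - D.Xm f = f - D.Pi f := by
  obtain ⟨s, hs⟩ := D.exists_mem_Pole f
  obtain ⟨w, -, c, -, x, -, rfl⟩ := D.exists_decomposition hs
  rw [Xm_eq, Pi_apply, Pw_eq, P0_eq, add_sub_cancel_left]

theorem Pw_pol (w : Idx p D.eS →₀ WM p M k) : D.Pw (D.pol w) = w := by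
  simpa using D.Pw_eq w 0 0

theorem P0_pol (w : Idx p D.eS →₀ WM p M k) : D.P0 (D.pol w) = 0 := by
  simpa using D.P0_eq w 0 0

theorem Pw_αLin (c : ZMod (p ^ M)) : D.Pw (D.αLin c) = 0 := by simpa using D.Pw_eq 0 c 0

theorem P0_αLin (c : ZMod (p ^ M)) : D.P0 (D.αLin c) = c := by simpa using D.P0_eq 0 c 0

theorem Pi_Pi (f : OK p M k) : D.Pi (D.Pi f) = D.Pi f := by
  rw [D.Pi_apply (D.Pi f), D.Pi_apply f, map_add D.Pw, map_add D.P0, Pw_pol, P0_pol, Pw_αLin,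
    P0_αLin, add_zero, zero_add]

theorem Xm_Pi (f : OK p M k) : D.Xm (D.Pi f) = 0 := by
  have := D.Xm_eq (D.Pw f) (D.P0 f) 0
  rwa [ZeroMemClass.coe_zero, map_zero, sub_zero, add_zero] at this

theorem Pi_frobOK_sub (x : OK p M k) : D.Pi (frobOK p M k x - x) = 0 := by
  have hx : x - constOK p M k (algebraMap _ _ (D.tau₀ (cf p M k 0 x))) ∈ D.normalized := by
    rw [LinearMap.mem_ker, LinearMap.comp_apply, map_sub, map_sub, cf_const, if_pos rfl,
      tau₀_algebraMap, sub_self]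
  have h1 := D.Pw_eq 0 0 ⟨_, hx⟩
  have h2 := D.P0_eq 0 0 ⟨_, hx⟩
  simp only [map_zero, zero_add, map_sub (frobOK p M k), frobOK_const_algebraMap,
    sub_sub_sub_cancel_right] at h1 h2
  rw [Pi_apply, h1, h2, map_zero, map_zero, add_zero]

theorem Pw_of_mem_mK {q : OK p M k} (hq : q ∈ mK p M k) : D.Pw q = 0 := by
  ext1 i
  exact D.P_eq_zero_of_mem_Pole (D.mem_Pole_zero.mpr hq) i.2.2.2.2

theorem pol_Pw_sub_mem_mK {f : OK p M k} (hf : NoP f) :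
    f - D.pol (D.Pw f) ∈ mK p M k ∧ D.P0 f = 0 := by
  obtain ⟨s, hs⟩ := D.exists_mem_Pole f
  obtain ⟨w, -, q, hq, rfl⟩ := D.exists_pol_of_noP hs hf
  rw [map_add, Pw_pol, D.Pw_of_mem_mK hq, add_zero, add_sub_cancel_left, map_add, P0_pol,
    D.P0_eq_zero_of_mem_mK hq, add_zero]
  exact ⟨hq, rfl⟩

theorem sub_Pi_mem_mK {f : OK p M k} (hf : NoP f) : f - D.Pi f ∈ mK p M k := by
  rw [Pi_apply, (D.pol_Pw_sub_mem_mK hf).2, map_zero, add_zero]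
  exact (D.pol_Pw_sub_mem_mK hf).1

theorem pol_const_mul (w : WM p M k) (f : Idx p D.eS →₀ WM p M k) :
    D.pol (w • f) = constOK p M k w * D.pol f := by
  induction f using Finsupp.induction_linear with
  | zero => simp
  | add f g hf hg => rw [smul_add, map_add, hf, hg, map_add, mul_add]
  | single i c =>
    rw [Finsupp.smul_single, pol_single, pol_single, smul_eq_mul, map_mul]; ring

theorem noP_const_mul (w : WM p M k) {f : OK p M k} (hf : NoP f) : NoP (constOK p M k w * f) :=
  fun j => by rw [cf_const_mul, hf j, mul_zero]

theorem P_const_mul (i : Idx p D.eS) (w : WM p M k) {f : OK p M k} (hf : NoP f) :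
    D.P i (constOK p M k w * f) = w * D.P i f := by
  obtain ⟨s, hs⟩ := D.exists_mem_Pole f
  obtain ⟨v, -, q, hq, rfl⟩ := D.exists_pol_of_noP hs hf
  have hq' : constOK p M k w * q ∈ mK p M k := by rw [← toOK_C]; exact toOK_mul_mem_mK _ hq
  rw [mul_add, ← pol_const_mul, P_apply, P_apply, map_add, map_add, Pw_pol, Pw_pol,
    D.Pw_of_mem_mK hq, D.Pw_of_mem_mK hq', add_zero, add_zero]
  rfl

/-- The index `(b, m)`. -/
abbrev idx {b : ℕ} (hb : 1 ≤ b ∧ b < D.eS ∧ b.Coprime p) (m : ℕ) : Idx p D.eS :=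
  ⟨(b, m + 1), hb.1, hb.2.1, hb.2.2, Nat.succ_pos m⟩

/-- Multiplication by `S` lowers `m` by one; a term with `m = 1` becomes an element of `𝔪(𝒦)`,
invisible to every coefficient functional. -/
theorem P_SO_mul_pol {b : ℕ} (hb : 1 ≤ b ∧ b < D.eS ∧ b.Coprime p) (m : ℕ)
    (v : Idx p D.eS →₀ WM p M k) :
    D.P (D.idx hb m) (D.SO * D.pol v) = v (D.idx hb (m + 1)) := by
  classical
  induction v using Finsupp.induction_linear with
  | zero => rw [map_zero, mul_zero, map_zero]; rfl
  | add f g hf hg => rw [map_add, mul_add, map_add, hf, hg]; rfl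
  | single i c =>
    obtain ⟨⟨b', m'⟩, h1, h2, h3, h4⟩ := i
    rw [pol_single, B, ← mul_assoc, ← mul_assoc]
    rcases m' with _ | _ | m'
    · exact absurd h4 (by simp)
    · have h5 : D.SO * D.SI ^ (0 + 1) = 1 := by rw [zero_add, pow_one, SO_mul_SI]
      dsimp only
      rw [h5, one_mul, P_apply, D.Pw_of_mem_mK
        (tPow_mul_const_mem_mK (by exact_mod_cast h1) c), Finsupp.single_apply, if_neg]
      · rfl
      · intro h
        have := congrArg (fun i => i.1.2) h
        simp at this
    · have h5 : D.SO * D.SI ^ (m' + 1 + 1) = D.SI ^ (m' + 1) := by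
        rw [pow_succ' D.SI (m' + 1), ← mul_assoc, SO_mul_SI, one_mul]
      dsimp only
      rw [h5]
      have := D.pol_single ⟨(b', m' + 1), h1, h2, h3, Nat.succ_pos m'⟩ c
      rw [B] at this
      rw [← this, P_apply, Pw_pol, Finsupp.single_apply, Finsupp.single_apply]
      simp

theorem P_SO_mul {b : ℕ} (hb : 1 ≤ b ∧ b < D.eS ∧ b.Coprime p) (m : ℕ) {f : OK p M k}
    (hf : NoP f) : D.P (D.idx hb m) (D.SO * f) = D.P (D.idx hb (m + 1)) f := by
  obtain ⟨s, hs⟩ := D.exists_mem_Pole f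
  obtain ⟨v, -, q, hq, rfl⟩ := D.exists_pol_of_noP hs hf
  have hq' : D.SO * q ∈ mK p M k := toOK_mul_mem_mK _ hq
  rw [mul_add, map_add, map_add, P_SO_mul_pol, D.P_apply _ (D.pol v), Pw_pol, D.P_apply _ q,
    D.Pw_of_mem_mK hq, D.P_apply _ (D.SO * q), D.Pw_of_mem_mK hq']
  rfl

end Datum

/-! ### Duality between units and Laurent series -/

namespace Datum

variable {p : ℕ} [Fact p.Prime] {M : ℕ} {k : Type*} [Field k] [CharP k p] [PerfectRing k p]
  {N₀ : ℕ} (D : Datum p M k N₀)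

theorem derivative_S_pow (m : ℕ) : PowerSeries.derivative (WM p M k) (D.S ^ m) = 0 := by
  have h : PowerSeries.derivative (WM p M k) D.S = 0 :=
    eq_zero_of_pow_dvd le_rfl (dvd_derivative_iterate_mulPSubst D.constantCoeff_S₀ M)
  rw [Derivation.leibniz_pow, h, smul_zero, smul_zero]

theorem natCast_mul_coeff_S_pow (m j : ℕ) : (j : WM p M k) * PowerSeries.coeff j (D.S ^ m) = 0 := by
  rcases j with _ | j
  · rw [Nat.cast_zero, zero_mul]
  · have := congrArg (PowerSeries.coeff j) (D.derivative_S_pow m)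
    rw [PowerSeries.coeff_derivative, map_zero] at this
    rw [mul_comm]
    exact_mod_cast this

theorem coeff_S_pow_of_not_dvd (m : ℕ) {j : ℕ} (hj : ¬ p ∣ j) :
    PowerSeries.coeff j (D.S ^ m) = 0 := frobPS_dvd_serS_pow D.constantCoeff_S₀ hj

theorem noP_tPow_neg {a : ℕ} (ha : a.Coprime p) : NoP (tPow p M k (-(a : ℤ))) := by
  have h : ¬ (p : ℤ) ∣ -(a : ℤ) := by rw [dvd_neg]; exact not_dvd_of_coprime ha
  have := noP_tPow_mul_const (p := p) (M := M) (k := k) h 1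
  rwa [map_one, mul_one] at this

theorem isUnit_zmod_of_coprime (M : ℕ) {p a : ℕ} (ha : a.Coprime p) :
    IsUnit (a : ZMod (p ^ M)) := by
  rw [ZMod.isUnit_iff_coprime]
  exact Nat.Coprime.pow_right _ ha

theorem inv_natCast_smul (a : ℕ) (ha : a.Coprime p) (w : WM p M k) :
    (a : WM p M k) * ((a : ZMod (p ^ M))⁻¹ • w) = w := by
  rw [mul_smul_comm, ← nsmul_eq_mul, ← Nat.cast_smul_eq_nsmul (ZMod (p ^ M)), smul_smul,
    ZMod.inv_mul_of_unit _ (isUnit_zmod_of_coprime M ha), one_smul]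

theorem P_tPow_mul_const (i : Idx p D.eS) {a : ℕ} (ha : a.Coprime p) (c : WM p M k) :
    D.P i (tPow p M k (-(a : ℤ)) * constOK p M k c) = D.P i (tPow p M k (-(a : ℤ))) * c := by
  rw [mul_comm, D.P_const_mul i c (noP_tPow_neg ha), mul_comm]

theorem P_SO_pow_mul {b : ℕ} (hb : 1 ≤ b ∧ b < D.eS ∧ b.Coprime p) (m r : ℕ) {f : OK p M k}
    (hf : NoP f) : D.P (D.idx hb r) (D.SO ^ m * f) = D.P (D.idx hb (r + m)) f := by
  induction m generalizing r f with
  | zero => rw [pow_zero, one_mul, add_zero]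
  | succ m ih =>
    rw [pow_succ, mul_assoc, ih _ (D.noP_SO_mul hf), P_SO_mul _ _ _ hf, add_assoc]

/-- `∑ a⁻¹ P_{(b,1)}(t^{-a}) t^a`. -/
def dualSeries {b : ℕ} (hb : 1 ≤ b ∧ b < D.eS ∧ b.Coprime p) : (WM p M k)⟦X⟧ :=
  PowerSeries.mk fun a => if p ∣ a then 0 else
    (a : ZMod (p ^ M))⁻¹ • D.P (D.idx hb 0) (tPow p M k (-(a : ℤ)))

theorem coprime_of_not_dvd {a : ℕ} (h : ¬ p ∣ a) : a.Coprime p :=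
  ((Nat.Prime.coprime_iff_not_dvd Fact.out).mpr h).symm

/-- This is where coefficient functionals meet the filtration `(Im ι) S^m`. Multiply by `a = i + j`:
as `S^m` has zero derivative, `j` times its `j`-th coefficient is zero, so `a` acts as `i` and
cancels the `i⁻¹` in `dualSeries`. There remains the `(b, 1)`-coefficient of `S^m t^{-a}`, which is
the `(b, m + 1)`-coefficient of `t^{-a}`. -/
theorem coeff_dualSeries_mul {b : ℕ} (hb : 1 ≤ b ∧ b < D.eS ∧ b.Coprime p) (m a : ℕ) :
    PowerSeries.coeff a (D.dualSeries hb * D.S ^ m) = if p ∣ a then 0 else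
      (a : ZMod (p ^ M))⁻¹ • D.P (D.idx hb m) (tPow p M k (-(a : ℤ))) := by
  rw [PowerSeries.coeff_mul]
  split_ifs with ha
  · refine Finset.sum_eq_zero fun ij hij => ?_
    rw [Finset.HasAntidiagonal.mem_antidiagonal] at hij
    by_cases hj : p ∣ ij.2
    · rw [dualSeries, PowerSeries.coeff_mk, if_pos, zero_mul]
      exact (Nat.dvd_add_left hj).mp (hij ▸ ha)
    · rw [D.coeff_S_pow_of_not_dvd m hj, mul_zero]
  · have hac := coprime_of_not_dvd ha
    have h1 : ∀ ij ∈ Finset.HasAntidiagonal.antidiagonal a,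
        (a : WM p M k) * (PowerSeries.coeff ij.1 (D.dualSeries hb) *
          PowerSeries.coeff ij.2 (D.S ^ m)) = D.P (D.idx hb 0)
            (tPow p M k (-(ij.1 : ℤ)) * constOK p M k (PowerSeries.coeff ij.2 (D.S ^ m))) := by
      rintro ⟨i, j⟩ hij
      rw [Finset.HasAntidiagonal.mem_antidiagonal] at hij
      dsimp only at hij ⊢
      by_cases hj : p ∣ j
      · have hi : ¬ p ∣ i := fun h => ha (hij ▸ dvd_add h hj)
        rw [D.P_tPow_mul_const _ (coprime_of_not_dvd hi), dualSeries, PowerSeries.coeff_mk,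
          if_neg hi, ← hij, Nat.cast_add, add_mul, ← mul_assoc,
          inv_natCast_smul i (coprime_of_not_dvd hi), mul_left_comm, natCast_mul_coeff_S_pow,
          mul_zero, add_zero]
      · rw [D.coeff_S_pow_of_not_dvd m hj, map_zero, mul_zero, mul_zero, mul_zero, map_zero]
    -- Only the terms of `S^m t^{-a}` with exponent `-i ≤ 0` are kept; the others lie in `𝔪(𝒦)`.
    have h2 : D.SO ^ m * tPow p M k (-(a : ℤ)) - ∑ ij ∈ Finset.HasAntidiagonal.antidiagonal a,
        tPow p M k (-(ij.1 : ℤ)) * constOK p M k (PowerSeries.coeff ij.2 (D.S ^ m)) ∈ mK p M k := by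
      intro l hl
      refine ((cf p M k l).map_sub _ _).trans ?_
      rw [map_sum, mul_comm, cf_tPow_mul, SO_pow, sub_eq_zero]
      simp only [cf_tPow_mul_const]
      rcases lt_or_ge (l - -(a : ℤ)) 0 with h | h
      · rw [cf_toOK_neg _ h, Finset.sum_eq_zero]
        rintro ⟨i, j⟩ hij
        rw [Finset.HasAntidiagonal.mem_antidiagonal] at hij
        dsimp only at hij ⊢
        exact if_neg (by omega)
      · obtain ⟨j, hj⟩ := Int.eq_ofNat_of_zero_le h
        obtain ⟨i, hi⟩ := Int.eq_ofNat_of_zero_le (neg_nonneg.mpr hl)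
        rw [hj, cf_toOK_natCast, Finset.sum_eq_single (i, j)]
        · rw [if_pos (by dsimp only; omega)]
        · rintro ⟨i', j'⟩ hij hne
          rw [Finset.HasAntidiagonal.mem_antidiagonal] at hij
          dsimp only at hij ⊢
          refine if_neg fun h => hne (Prod.ext ?_ ?_) <;> dsimp only <;> omega
        · intro h
          refine absurd (Finset.HasAntidiagonal.mem_antidiagonal.mpr ?_) h
          dsimp only
          omega
    have h3 := D.P_eq_zero_of_mem_Pole (i := D.idx hb 0) (D.mem_Pole_zero.mpr h2) Nat.one_pos
    rw [map_sub, D.P_SO_pow_mul hb m 0 (noP_tPow_neg hac), zero_add, sub_eq_zero, map_sum,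
      ← Finset.sum_congr rfl h1, ← Finset.mul_sum] at h3
    rw [h3, ← smul_mul_assoc]
    have := inv_natCast_smul a hac (∑ ij ∈ Finset.HasAntidiagonal.antidiagonal a,
      PowerSeries.coeff ij.1 (D.dualSeries hb) * PowerSeries.coeff ij.2 (D.S ^ m))
    rwa [mul_smul_comm, ← smul_mul_assoc, eq_comm] at this

theorem C_mul_mem_imIota (w : WM p M k) {g : (WM p M k)⟦X⟧} (hg : g ∈ imIota p M k) :
    PowerSeries.C w * g ∈ imIota p M k := fun n hn => by
  rw [PowerSeries.coeff_C_mul, hg n hn, mul_zero]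

/-- The series of exponents is `w · dualSeries · S^(m-1)` by `coeff_dualSeries_mul`, which is the
membership required when `m ≥ 2`; for `m = 1` nothing is required. The right-hand side is the
contraction of `e` computed in `con_e_P`. -/
theorem exists_unit_of_P (i : Idx p D.eS) (w : WM p M k) :
    ∃ u ∈ unitFil p M k D.S i.1.2, ∀ n, genLvl p M k n u = ∑ a ∈ copr p n, genE p M k n a
      ((a : ZMod (p ^ M))⁻¹ • (w * D.P i (tPow p M k (-(a : ℤ))))) := by
  obtain ⟨⟨b, m⟩, h1, h2, h3, h4⟩ := i
  obtain ⟨m, rfl⟩ : ∃ m', m = m' + 1 := ⟨m - 1, by simp at h4; omega⟩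
  set α : ℕ → WittVector p k := fun a => Function.surjInv (toWM_surjective p M k)
    ((a : ZMod (p ^ M))⁻¹ • (w * D.P (D.idx ⟨h1, h2, h3⟩ m) (tPow p M k (-(a : ℤ))))) with hα
  have hαa : ∀ a, toWM p M k (α a) = (a : ZMod (p ^ M))⁻¹ •
      (w * D.P (D.idx ⟨h1, h2, h3⟩ m) (tPow p M k (-(a : ℤ)))) :=
    fun a => Function.surjInv_eq _ _
  obtain ⟨u, hu⟩ := exists_isShafProd α
  refine ⟨u, ?_, fun n => (hu.genLvl_eq n).trans (Finset.sum_congr rfl fun a _ => by rw [hαa])⟩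
  rcases m with _ | m
  · trivial
  · refine ⟨α, hu, PowerSeries.C w * D.dualSeries ⟨h1, h2, h3⟩, C_mul_mem_imIota w fun n hn => ?_, ?_⟩
    · rw [dualSeries, PowerSeries.coeff_mk, if_pos hn]
    · ext a
      rw [mul_assoc, PowerSeries.coeff_C_mul, coeff_dualSeries_mul, iotaSeries,
        PowerSeries.coeff_mk, hαa]
      split_ifs
      · rw [mul_zero]
      · rw [mul_smul_comm]

/-- `t d/dt`. -/
def theta (g : (WM p M k)⟦X⟧) : (WM p M k)⟦X⟧ :=
  PowerSeries.X * PowerSeries.derivative (WM p M k) g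

theorem coeff_theta (g : (WM p M k)⟦X⟧) (a : ℕ) :
    PowerSeries.coeff a (theta g) = (a : WM p M k) * PowerSeries.coeff a g := by
  rcases a with _ | a
  · simp [theta]
  · rw [theta, PowerSeries.coeff_succ_X_mul, PowerSeries.coeff_derivative, mul_comm]
    push_cast
    rfl

theorem theta_mul_S_pow (g : (WM p M k)⟦X⟧) (m : ℕ) :
    theta (g * D.S ^ m) = theta g * D.S ^ m := by
  rw [theta, Derivation.leibniz, derivative_S_pow, smul_zero, zero_add, theta, smul_eq_mul]
  ring

/-- `f ↦ tr` of the constant coefficient of `h f`. -/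
def resid (h : (WM p M k)⟦X⟧) : OK p M k →ₗ[ZMod (p ^ M)] ZMod (p ^ M) :=
  D.tau.comp ((cf p M k 0).comp (LinearMap.mulLeft _ (toOK p M k h)))

theorem resid_apply (h : (WM p M k)⟦X⟧) (f : OK p M k) :
    D.resid h f = D.tau (cf p M k 0 (toOK p M k h * f)) := rfl

theorem resid_tPow_mul_const (h : (WM p M k)⟦X⟧) (a : ℕ) (c : WM p M k) :
    D.resid h (tPow p M k (-(a : ℤ)) * constOK p M k c) = D.tau (PowerSeries.coeff a h * c) := by
  rw [resid_apply, mul_left_comm, cf_tPow_mul, sub_neg_eq_add, zero_add, mul_comm, cf_const_mul,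
    cf_toOK_natCast, mul_comm]

theorem resid_const (h : (WM p M k)⟦X⟧) (hh : PowerSeries.constantCoeff h = 0) (c : WM p M k) :
    D.resid h (constOK p M k c) = 0 := by
  have := cf_toOK_natCast h 0
  rw [PowerSeries.coeff_zero_eq_constantCoeff_apply, hh, Nat.cast_zero] at this
  rw [resid_apply, mul_comm, cf_const_mul, this, mul_zero, map_zero]

theorem resid_mul_S_pow (g : (WM p M k)⟦X⟧) {m s : ℕ} (hs : s ≤ m) {f : OK p M k}
    (hf : f ∈ D.Pole s) : D.resid (g * D.S ^ m) f = 0 := by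
  rw [resid_apply, toOK_mul, ← SO_pow, mul_assoc]
  have := toOK_mul_mem_mK g (D.mem_Pole.mp (D.Pole_mono hs hf))
  rw [show cf p M k 0 _ = 0 from this 0 le_rfl, map_zero]

end Datum

/-! ### Contractions and the element `e` in a layer -/

section Contraction

variable {R X Y L : Type*} [CommRing R] [AddCommGroup X] [Module R X] [AddCommGroup Y] [Module R Y]
  [AddCommGroup L] [Module R L]

/-- `f ⊗ l ↦ Λ(f) l`. -/
def con (L : Type*) [AddCommGroup L] [Module R L] (Λ : X →ₗ[R] R) : X ⊗[R] L →ₗ[R] L :=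
  (TensorProduct.lid R L).toLinearMap.comp (Λ.rTensor L)

theorem con_tmul (Λ : X →ₗ[R] R) (f : X) (l : L) : con L Λ (f ⊗ₜ l) = Λ f • l := by
  simp [con]

theorem con_rTensor (Λ : Y →ₗ[R] R) (T : X →ₗ[R] Y) (z : X ⊗[R] L) :
    con L Λ (T.rTensor L z) = con L (Λ.comp T) z := by
  simp [con, LinearMap.rTensor_comp]

theorem con_lTensor {L' : Type*} [AddCommGroup L'] [Module R L'] (Λ : X →ₗ[R] R) (T : L →ₗ[R] L')
    (z : X ⊗[R] L) : con L' Λ (T.lTensor X z) = T (con L Λ z) := by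
  induction z with
  | zero => simp
  | add x y hx hy => simp only [map_add, hx, hy]
  | tmul x y => simp [con_tmul]

end Contraction

namespace Datum

variable {p : ℕ} [Fact p.Prime] {M : ℕ} {k : Type*} [Field k] [CharP k p] [PerfectRing k p]
  {N₀ : ℕ} (D : Datum p M k N₀)

/-- The image of `e` in the layer `n`. -/
abbrev e (n : ℕ) : OK p M k ⊗[ZMod (p ^ M)] Lvl p M k n := elemE p M k D.α₀ D.β D.γ n

theorem repr_β (w : WM p M k) (j : Fin N₀) : D.β.repr w j = D.tau (D.γ j * w) := by
  conv_rhs => rw [← D.β.sum_repr w, Finset.mul_sum, map_sum]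
  simp [mul_comm (D.γ j), D.tau_β_mul_γ]

theorem sum_tau_smul_β (w : WM p M k) : ∑ j, D.tau (w * D.γ j) • D.β j = w := by
  conv_rhs => rw [← D.β.sum_repr w]
  exact Finset.sum_congr rfl fun j _ => by rw [D.repr_β, mul_comm]

theorem finsum_copr {G : Type*} [AddCommMonoid G] (n : ℕ) (F : ℕ → G)
    (hF : ∀ a, n < a → F a = 0) :
    ∑ᶠ a : {a : ℕ // 1 ≤ a ∧ a.Coprime p}, F a.1 = ∑ a ∈ copr p n, F a := by
  have h := finsum_set_coe_eq_finsum_mem {a : ℕ | 1 ≤ a ∧ a.Coprime p} (f := F)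
  refine Eq.trans h (finsum_mem_eq_sum_of_inter_support_eq _ ?_)
  ext a
  simp only [Set.mem_inter_iff, Set.mem_ofPred_eq, Finset.mem_coe, mem_copr, Function.mem_support]
  constructor
  · rintro ⟨h1, h2⟩
    exact ⟨⟨h1.1, not_lt.mp fun h => h2 (hF a h), h1.2⟩, h2⟩
  · rintro ⟨h1, h2⟩
    exact ⟨⟨h1.1, h1.2.2⟩, h2⟩

theorem e_eq (n : ℕ) : D.e n = constOK p M k D.α₀ ⊗ₜ genLvl p M k n (toUnit k PowerSeries.X) +
    ∑ a ∈ copr p n, ∑ i, (tPow p M k (-(a : ℤ)) * constOK p M k (D.γ i)) ⊗ₜ[ZMod (p ^ M)]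
      ((a : ZMod (p ^ M))⁻¹ • genE p M k n a (D.β i)) := by
  have h1 : ∀ a : ℕ, a ≠ 0 → tPow p M k (-(a : ℤ)) • scalarMap p M k (constOK p M k) n
      (elemD p M k D.β D.γ a n) = ∑ i, (tPow p M k (-(a : ℤ)) * constOK p M k (D.γ i))
        ⊗ₜ[ZMod (p ^ M)] ((a : ZMod (p ^ M))⁻¹ • genE p M k n a (D.β i)) := by
    intro a ha
    rw [elemD, map_sum, Finset.smul_sum]
    refine Finset.sum_congr rfl fun i _ => ?_
    rw [genE_apply n ha]
    rfl
  rw [e, elemE]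
  congr 1
  rw [finsum_copr n (fun a => tPow p M k (-(a : ℤ)) • scalarMap p M k (constOK p M k) n
      (elemD p M k D.β D.γ a n))]
  · exact Finset.sum_congr rfl fun a ha => h1 a (by have := mem_copr.mp ha; omega)
  · intro a ha
    rw [h1 a (by omega)]
    simp [genE_eq_zero ha]

/-- In the sum over `i` the dual bases reassemble `κ a` from its traces against the `γ i`.
Contraction of `e` thus turns a functional, described by its values at the `t^{-a}` and at `α₀`,
into the class of a unit. -/
theorem con_e (n : ℕ) (Λ : OK p M k →ₗ[ZMod (p ^ M)] ZMod (p ^ M)) (κ : ℕ → WM p M k)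
    (h : ∀ a : ℕ, 1 ≤ a → a.Coprime p → ∀ c,
      Λ (tPow p M k (-(a : ℤ)) * constOK p M k c) = D.tau (κ a * c)) :
    con _ Λ (D.e n) = Λ (constOK p M k D.α₀) • genLvl p M k n (toUnit k PowerSeries.X) +
      ∑ a ∈ copr p n, genE p M k n a ((a : ZMod (p ^ M))⁻¹ • κ a) := by
  rw [e_eq, map_add, con_tmul, map_sum]
  congr 1
  refine Finset.sum_congr rfl fun a ha => ?_
  obtain ⟨h1, h2, h3⟩ := mem_copr.mp ha
  conv_rhs => rw [← D.sum_tau_smul_β (κ a), Finset.smul_sum, map_sum]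
  rw [map_sum]
  refine Finset.sum_congr rfl fun i _ => ?_
  rw [con_tmul, h a h1 h3, map_smul, map_smul, smul_comm]

theorem con_e_P (n : ℕ) (i : Idx p D.eS) (w : WM p M k) :
    con _ (D.tau.comp ((LinearMap.mulLeft _ w).comp (D.P i))) (D.e n) =
      ∑ a ∈ copr p n, genE p M k n a
        ((a : ZMod (p ^ M))⁻¹ • (w * D.P i (tPow p M k (-(a : ℤ))))) := by
  rw [D.con_e n _ fun a => w * D.P i (tPow p M k (-(a : ℤ)))]
  · have : constOK p M k D.α₀ = D.αLin 1 := by rw [αLin_apply, map_one, mul_one]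
    rw [this, LinearMap.comp_apply, LinearMap.comp_apply, P_apply, Pw_αLin]
    simp
  · intro a _ ha c
    rw [LinearMap.comp_apply, LinearMap.comp_apply, LinearMap.mulLeft_apply,
      D.P_tPow_mul_const i ha, mul_assoc]

theorem con_e_P0 (n : ℕ) : con _ D.P0 (D.e n) = genLvl p M k n (toUnit k PowerSeries.X) := by
  rw [D.con_e n _ fun a => 0]
  · have : constOK p M k D.α₀ = D.αLin 1 := by rw [αLin_apply, map_one, mul_one]
    rw [this, P0_αLin]
    simp
  · intro a _ ha c
    rw [mul_comm, (D.pol_Pw_sub_mem_mK (noP_const_mul c (noP_tPow_neg ha))).2, zero_mul, map_zero]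

/-- For a unit with series `g S^(m+1)`, take the trace of the constant term of `θ(g) S^(m+1) f`. The
factor `S^(m+1)` kills poles of order at most `m + 1`. Moreover `θ(g) S^(m+1) = θ(g S^(m+1))` has
`a`-th coefficient multiplied by `a`, which cancels the exponent `1/a` in `e`. -/
theorem exists_functional_of_mem_unitFil {m : ℕ} {u : (k⸨X⸩)ˣ}
    (hu : u ∈ unitFil p M k D.S (m + 2)) : ∃ Λ : OK p M k →ₗ[ZMod (p ^ M)] ZMod (p ^ M),
      (∀ s < m + 2, ∀ f ∈ D.Pole s, Λ f = 0) ∧ ∀ n, con _ Λ (D.e n) = genLvl p M k n u := by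
  obtain ⟨α, hα, g, hg, h⟩ := hu
  refine ⟨D.resid (theta g * D.S ^ (m + 1)), fun s hs f hf => D.resid_mul_S_pow _ (by omega) hf,
    fun n => ?_⟩
  rw [D.con_e n _ (fun a => PowerSeries.coeff a (theta g * D.S ^ (m + 1)))
    fun a _ _ c => D.resid_tPow_mul_const _ a c, ← theta_mul_S_pow, resid_const,
    zero_smul, zero_add, hα.genLvl_eq n]
  · refine Finset.sum_congr rfl fun a ha => ?_
    have h3 := (mem_copr.mp ha).2.2
    rw [coeff_theta, ← h, iotaSeries, PowerSeries.coeff_mk, if_neg, ← mul_smul_comm,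
      inv_natCast_smul a h3]
    exact (Nat.Prime.coprime_iff_not_dvd Fact.out).mp h3.symm
  · rw [← PowerSeries.coeff_zero_eq_constantCoeff_apply, coeff_theta, Nat.cast_zero, zero_mul]

theorem exists_functional_genE {a : ℕ} (h1 : 1 ≤ a) (ha : a.Coprime p) (w : WM p M k) :
    ∃ Λ : OK p M k →ₗ[ZMod (p ^ M)] ZMod (p ^ M),
      (∀ f ∈ mK p M k, Λ f = 0) ∧ ∀ n, con _ Λ (D.e n) = genE p M k n a w := by
  refine ⟨D.resid (theta (PowerSeries.monomial a w)), fun f hf => ?_, fun n => ?_⟩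
  · have := D.resid_mul_S_pow (theta (PowerSeries.monomial a w)) le_rfl (D.mem_Pole_zero.mpr hf)
    rwa [pow_zero, mul_one] at this
  rw [D.con_e n _ (fun a' => PowerSeries.coeff a' (theta (PowerSeries.monomial a w)))
    fun a _ _ c => D.resid_tPow_mul_const _ a c, resid_const,
    zero_smul, zero_add]
  · have h2 : ∀ a' ∈ copr p n, genE p M k n a' ((a' : ZMod (p ^ M))⁻¹ •
        PowerSeries.coeff a' (theta (PowerSeries.monomial a w))) =
        if a' = a then genE p M k n a w else 0 := by
      intro a' ha'
      rw [coeff_theta, ← mul_smul_comm, inv_natCast_smul a' (mem_copr.mp ha').2.2,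
        PowerSeries.coeff_monomial]
      split_ifs with h
      · rw [h]
      · rw [map_zero]
    rw [Finset.sum_congr rfl h2, Finset.sum_ite_eq']
    split_ifs with h
    · rfl
    · rw [genE_eq_zero (not_le.mp fun h' => h (mem_copr.mpr ⟨h1, h', ha⟩)),
        LinearMap.zero_apply]
  · rw [← PowerSeries.coeff_zero_eq_constantCoeff_apply, coeff_theta, Nat.cast_zero, zero_mul]

end Datum

/-! ### Filtrations on the layers -/

section TensorLie

variable {R A A' L L' : Type*} [CommRing R] [CommRing A] [Algebra R A] [CommRing A'] [Algebra R A']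
  [LieRing L] [LieAlgebra R L] [LieRing L'] [LieAlgebra R L']

/-- The homomorphism of Lie rings `A ⊗ L → A' ⊗ L'` induced by `f` and `g`. -/
def tensorLieHom (f : A →ₗ[R] A') (hf : ∀ x y, f (x * y) = f x * f y) (g : L →ₗ⁅R⁆ L') :
    A ⊗[R] L →ₗ⁅R⁆ A' ⊗[R] L' where
  __ := TensorProduct.map f (g : L →ₗ[R] L')
  map_lie' {x y} := by
    change TensorProduct.map f (g : L →ₗ[R] L') ⁅x, y⁆ =
      ⁅TensorProduct.map f (g : L →ₗ[R] L') x, TensorProduct.map f (g : L →ₗ[R] L') y⁆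
    induction x using TensorProduct.induction_on with
    | zero => simp only [zero_lie, map_zero]
    | add u v hu hv => simp only [add_lie, map_add, hu, hv]
    | tmul a x =>
      induction y using TensorProduct.induction_on with
      | zero => simp only [lie_zero, map_zero]
      | add u v hu hv => simp only [lie_add, map_add, hu, hv]
      | tmul b y =>
        simp only [LieAlgebra.ExtendScalars.bracket_tmul, TensorProduct.map_tmul, hf,
          LieHom.coe_toLinearMap, LieHom.map_lie]

theorem lie_mem_of_span {S S' : Set (A ⊗[R] L)} {Q : Submodule R (A ⊗[R] L)}
    (h : ∀ x ∈ S, ∀ y ∈ S', ⁅x, y⁆ ∈ Q) {x y : A ⊗[R] L} (hx : x ∈ Submodule.span R S)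
    (hy : y ∈ Submodule.span R S') : ⁅x, y⁆ ∈ Q := by
  induction hx using Submodule.span_induction with
  | mem x hx =>
    induction hy using Submodule.span_induction with
    | mem y hy => exact h x hx y hy
    | zero => rw [lie_zero]; exact Q.zero_mem
    | add u v _ _ hu hv => rw [lie_add]; exact Q.add_mem hu hv
    | smul c u _ hu => rw [lie_smul]; exact Q.smul_mem c hu
  | zero => rw [zero_lie]; exact Q.zero_mem
  | add u v _ _ hu hv => rw [add_lie]; exact Q.add_mem hu hv
  | smul c u _ hu => rw [smul_lie]; exact Q.smul_mem c hu

end TensorLie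

namespace Datum

variable {p : ℕ} [Fact p.Prime] {M : ℕ} {k : Type*} [Field k] [CharP k p] [PerfectRing k p]
  {N₀ : ℕ} (D : Datum p M k N₀) {n : ℕ}

/-- `∑ S^{-s} G(s)_{𝔪(𝒦)}` for `j = 1`, and `S` times this for `j = 0`. -/
def NN (j : ℕ) (G : ℕ → Submodule (ZMod (p ^ M)) (Lvl p M k n)) :
    Submodule (ZMod (p ^ M)) (OK p M k ⊗[ZMod (p ^ M)] Lvl p M k n) :=
  Submodule.span _ {z | ∃ s, ∃ f ∈ D.Pole (s + j), ∃ l ∈ G (s + 1), z = f ⊗ₜ l}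

variable {G G' G'' : ℕ → Submodule (ZMod (p ^ M)) (Lvl p M k n)} {j : ℕ}

theorem tmul_mem_NN {s : ℕ} {f : OK p M k} (hf : f ∈ D.Pole (s + j)) {l : Lvl p M k n}
    (hl : l ∈ G (s + 1)) : f ⊗ₜ l ∈ D.NN j G :=
  Submodule.subset_span ⟨s, f, hf, l, hl, rfl⟩

theorem NN_mono (h : ∀ s, G (s + 1) ≤ G' (s + 1)) : D.NN j G ≤ D.NN j G' := by
  refine Submodule.span_mono ?_
  rintro _ ⟨s, f, hf, l, hl, rfl⟩
  exact ⟨s, f, hf, l, h s hl, rfl⟩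

theorem NN_zero_le : D.NN 0 G ≤ D.NN 1 G := by
  refine Submodule.span_mono ?_
  rintro _ ⟨s, f, hf, l, hl, rfl⟩
  exact ⟨s, f, D.Pole_mono (Nat.le_succ s) hf, l, hl, rfl⟩

/-- Pole orders and filtration indices both add, and the offset `j` of the second factor is kept. In
particular bracketing with `NN 1` preserves the smaller module `NN 0`. -/
theorem lie_mem_NN (h : ∀ s s', ∀ x ∈ G (s + 1), ∀ y ∈ G' (s' + 1), ⁅x, y⁆ ∈ G'' (s + s' + 1 + 1)) :
    ∀ x ∈ D.NN 1 G, ∀ y ∈ D.NN j G', ⁅x, y⁆ ∈ D.NN j G'' := by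
  intro x hx y hy
  refine lie_mem_of_span ?_ hx hy
  rintro _ ⟨s, f, hf, l, hl, rfl⟩ _ ⟨s', f', hf', l', hl', rfl⟩
  rw [LieAlgebra.ExtendScalars.bracket_tmul]
  refine D.tmul_mem_NN (s := s + s' + 1) ?_ (h s s' l hl l' hl')
  have := D.mul_mem_Pole hf hf'
  rwa [show s + 1 + (s' + j) = s + s' + 1 + j by omega] at this

theorem rTensor_mem_NN {i : ℕ} {T : OK p M k →ₗ[ZMod (p ^ M)] OK p M k}
    (hT : ∀ s, ∀ f ∈ D.Pole (s + j), T f ∈ D.Pole (s + i)) {z : OK p M k ⊗[ZMod (p ^ M)] Lvl p M k n}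
    (hz : z ∈ D.NN j G) : T.rTensor _ z ∈ D.NN i G := by
  refine (Submodule.span_le (p := (D.NN i G).comap (T.rTensor _))).mpr ?_ hz
  rintro _ ⟨s, f, hf, l, hl, rfl⟩
  exact D.tmul_mem_NN (hT s f hf) hl

/-- Terms with pole order `< m` are killed by `Λ`; in the remaining ones the Lie factor already lies
in `G m`. -/
theorem con_mem_of_mem_NN {m : ℕ} {Λ : OK p M k →ₗ[ZMod (p ^ M)] ZMod (p ^ M)}
    (hΛ : ∀ s < m, ∀ f ∈ D.Pole s, Λ f = 0) (hG : ∀ s, m ≤ s → G s ≤ G m)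
    {z : OK p M k ⊗[ZMod (p ^ M)] Lvl p M k n} (hz : z ∈ D.NN 1 G) : con _ Λ z ∈ G m := by
  refine (Submodule.span_le (p := (G m).comap (con _ Λ))).mpr ?_ hz
  rintro _ ⟨s, f, hf, l, hl, rfl⟩
  rw [SetLike.mem_coe, Submodule.mem_comap, con_tmul]
  rcases lt_or_ge (s + 1) m with h | h
  · rw [hΛ _ h f hf, zero_smul]; exact zero_mem _
  · exact Submodule.smul_mem _ _ (hG _ h hl)

/-- `w ↦ tr (β_j w)`. -/
def tauβ (i : Fin N₀) : WM p M k →ₗ[ZMod (p ^ M)] ZMod (p ^ M) :=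
  D.tau.comp (LinearMap.mulLeft _ (D.β i))

theorem tauβ_apply (i : Fin N₀) (w : WM p M k) : D.tauβ i w = D.tau (D.β i * w) := rfl

theorem sum_γ_tmul_con {L : Type*} [AddCommGroup L] [Module (ZMod (p ^ M)) L]
    (v : WM p M k ⊗[ZMod (p ^ M)] L) : ∑ i, D.γ i ⊗ₜ con L (D.tauβ i) v = v := by
  induction v with
  | zero => simp
  | add x y hx hy =>
    simp only [map_add, TensorProduct.tmul_add, Finset.sum_add_distrib]
    rw [hx, hy]
  | tmul w l =>
    simp only [con_tmul, ← TensorProduct.smul_tmul, tauβ_apply]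
    rw [← TensorProduct.sum_tmul, D.sum_tau_smul]

/-- The expansion is allowed over every larger index set, so that two expansions can be compared
over a common one. -/
theorem exists_finset_Pi (z : OK p M k ⊗[ZMod (p ^ M)] Lvl p M k n) :
    ∃ F : Finset (Idx p D.eS), (∀ i, i ∉ F → (D.P i).rTensor _ z = 0) ∧ ∀ F', F ⊆ F' →
      D.Pi.rTensor _ z = ∑ i ∈ F', D.B i • constLin.rTensor _ ((D.P i).rTensor _ z) +
        constOK p M k D.α₀ ⊗ₜ con _ D.P0 z := by
  classical
  induction z with
  | zero => exact ⟨∅, fun i _ => map_zero _, fun F' _ => by simp⟩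
  | add x y hx hy =>
    obtain ⟨F, h1, h2⟩ := hx
    obtain ⟨F', h3, h4⟩ := hy
    refine ⟨F ∪ F', fun i hi => ?_, fun F'' h => ?_⟩
    · rw [Finset.notMem_union] at hi
      rw [map_add, h1 i hi.1, h3 i hi.2, add_zero]
    · rw [map_add, h2 F'' (Finset.union_subset_left h), h4 F'' (Finset.union_subset_right h)]
      simp only [map_add, smul_add, Finset.sum_add_distrib, TensorProduct.tmul_add]
      abel
  | tmul f l =>
    refine ⟨(D.Pw f).support, fun i hi => ?_, fun F' hF => ?_⟩
    · rw [LinearMap.rTensor_tmul, P_apply, Finsupp.notMem_support_iff.mp hi,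
        TensorProduct.zero_tmul]
    · rw [LinearMap.rTensor_tmul, Pi_apply, TensorProduct.add_tmul, pol_apply,
        Finsupp.sum_of_support_subset _ hF _ (by simp), TensorProduct.sum_tmul, con_tmul,
        αLin_apply]
      congr 1
      rw [TensorProduct.tmul_smul, TensorProduct.smul_tmul', Algebra.smul_def,
        algebraMap_OK, map_mul, mul_comm]

theorem B_smul_constLin_rTensor (i : Idx p D.eS) (v : WM p M k ⊗[ZMod (p ^ M)] Lvl p M k n) :
    D.B i • constLin.rTensor _ v =
      ∑ j, (D.B i * constOK p M k (D.γ j)) ⊗ₜ[ZMod (p ^ M)] con _ (D.tauβ j) v := by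
  conv_lhs => rw [← D.sum_γ_tmul_con v, map_sum, Finset.smul_sum]
  rfl

theorem B_smul_mem_NN {i : Idx p D.eS} {v : WM p M k ⊗[ZMod (p ^ M)] Lvl p M k n}
    (h : ∀ r, con _ (D.tauβ r) v ∈ G i.1.2) : D.B i • constLin.rTensor _ v ∈ D.NN 1 G := by
  rw [B_smul_constLin_rTensor]
  refine Submodule.sum_mem _ fun r _ => ?_
  have h1 := D.B_mul_const_mem_Pole i (D.γ r)
  obtain ⟨m, hm⟩ : ∃ m, i.1.2 = m + 1 := ⟨i.1.2 - 1, by have := i.2.2.2.2; omega⟩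
  have h2 := h r
  rw [hm] at h1 h2
  exact D.tmul_mem_NN h1 h2

theorem const_tmul_mem_NN (w : WM p M k) {l : Lvl p M k n} (h : l ∈ G 1) :
    constOK p M k w ⊗ₜ l ∈ D.NN 1 G :=
  D.tmul_mem_NN (s := 0) (D.const_mem_Pole_succ 0 w) h

theorem Pi_rTensor_mem_NN {z : OK p M k ⊗[ZMod (p ^ M)] Lvl p M k n}
    (h : ∀ i r, con _ (D.tauβ r) ((D.P i).rTensor _ z) ∈ G i.1.2) (h0 : con _ D.P0 z ∈ G 1) :
    D.Pi.rTensor _ z ∈ D.NN 1 G := by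
  obtain ⟨F, -, hF⟩ := D.exists_finset_Pi z
  rw [hF F subset_rfl]
  exact add_mem (Submodule.sum_mem _ fun i _ => D.B_smul_mem_NN (h i)) (D.const_tmul_mem_NN _ h0)

/-- Each `t^{-a} γ_i` has no exponent divisible by `p`, so `Π` changes it by an element of `𝔪(𝒦)`
only. No poles remain, and `G 1 = ⊤` is all that is asked of the Lie factor. -/
theorem e_sub_Pi_mem_NN (hG : G 1 = ⊤) : D.e n - D.Pi.rTensor _ (D.e n) ∈ D.NN 0 G := by
  have h0 : constOK p M k D.α₀ = D.αLin 1 := by rw [αLin_apply, map_one, mul_one]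
  have h1 : D.Pi (D.αLin 1) = D.αLin 1 := by
    rw [Pi_apply, Pw_αLin, P0_αLin, map_zero, zero_add]
  rw [e_eq, map_add, add_sub_add_comm]
  refine add_mem ?_ ?_
  · rw [LinearMap.rTensor_tmul, h0, h1, sub_self]
    exact zero_mem _
  · rw [map_sum, ← Finset.sum_sub_distrib]
    refine Submodule.sum_mem _ fun a ha => ?_
    rw [map_sum, ← Finset.sum_sub_distrib]
    refine Submodule.sum_mem _ fun i _ => ?_
    rw [LinearMap.rTensor_tmul, ← TensorProduct.sub_tmul]
    have h2 : ¬ (p : ℤ) ∣ -(a : ℤ) := by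
      rw [dvd_neg]
      exact not_dvd_of_coprime (mem_copr.mp ha).2.2
    have h3 := D.mem_Pole_zero.mpr (D.sub_Pi_mem_mK (noP_tPow_mul_const h2 (D.γ i)))
    have h4 : (a : ZMod (p ^ M))⁻¹ • genE p M k n a (D.β i) ∈ G 1 := by rw [hG]; trivial
    exact D.tmul_mem_NN (s := 0) (j := 0) h3 h4

end Datum

/-! ### The filtration `ℒ(s)` on the layers -/

section Eval

variable (p : ℕ) [Fact p.Prime] (M : ℕ) (k : Type*) [Field k] [CharP k p]

/-- The projection `ℒ → Lvl n`. -/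
def ev (n : ℕ) : Lcal p M k →ₗ⁅ZMod (p ^ M)⁆ Lvl p M k n where
  toFun l := l.1 n
  map_add' _ _ := rfl
  map_smul' _ _ := rfl
  map_lie' := rfl

theorem ev_apply (n : ℕ) (l : Lcal p M k) : ev p M k n l = l.1 n := rfl

theorem ev_surjective (n : ℕ) : Function.Surjective (ev p M k n) := by
  intro z
  induction z using lvl_induction with
  | gen u => exact ⟨gen p M k u, rfl⟩
  | zero => exact ⟨0, map_zero _⟩
  | add a b ha hb =>
    obtain ⟨x, rfl⟩ := ha
    obtain ⟨y, rfl⟩ := hb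
    exact ⟨x + y, map_add _ _ _⟩
  | smul c a ha =>
    obtain ⟨x, rfl⟩ := ha
    exact ⟨c • x, map_smul _ _ _⟩
  | lie a b ha hb =>
    obtain ⟨x, rfl⟩ := ha
    obtain ⟨y, rfl⟩ := hb
    exact ⟨⁅x, y⁆, LieHom.map_lie _ _ _⟩

variable {p M k} in
theorem eval_eq_zero_of_le {n n' : ℕ} (h : n ≤ n') {l : Lcal p M k} (hl : l.1 n' = 0) :
    l.1 n = 0 := by
  induction n', h using Nat.le_induction with
  | base => exact hl
  | succ n' _ ih =>
    refine ih ?_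
    rw [← l.2 n', hl, map_zero]

variable {p M k} {S : (WM p M k)⟦X⟧}

theorem Lfil_one : Lfil p M k S 1 = ⊤ := by
  rw [eq_top_iff]
  refine le_sInf ?_
  rintro _ ⟨F, hF, rfl⟩
  rw [hF.one]

theorem Lfil_anti {s s' : ℕ} (hs : 1 ≤ s) (h : s ≤ s') : Lfil p M k S s' ≤ Lfil p M k S s := by
  refine le_sInf ?_
  rintro _ ⟨F, hF, rfl⟩
  refine le_trans (sInf_le ⟨F, hF, rfl⟩) ?_
  induction s', h using Nat.le_induction with
  | base => exact le_rfl
  | succ s' h ih => exact (hF.anti s' (hs.trans h)).trans ih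

theorem mem_Lfil {s : ℕ} {l : Lcal p M k} :
    l ∈ Lfil p M k S s ↔ ∀ F, IsAdmissibleFiltration p M k S F → l ∈ F s := by
  rw [Lfil, ← SetLike.mem_coe, LieSubmodule.coe_sInf, Set.mem_iInter₂]
  exact ⟨fun h F hF => h _ ⟨F, hF, rfl⟩, by rintro h _ ⟨F, hF, rfl⟩; exact h F hF⟩

theorem lie_mem_Lfil {s s' : ℕ} (hs : 1 ≤ s) (hs' : 1 ≤ s') {x y : Lcal p M k}
    (hx : x ∈ Lfil p M k S s) (hy : y ∈ Lfil p M k S s') : ⁅x, y⁆ ∈ Lfil p M k S (s + s') := by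
  rw [mem_Lfil] at hx hy ⊢
  exact fun F hF => hF.central s s' hs hs' x (hx F hF) y (hy F hF)

theorem gen_mem_Lfil {s : ℕ} (hs : 1 ≤ s) {u : (k⸨X⸩)ˣ} (hu : u ∈ unitFil p M k S s) :
    gen p M k u ∈ Lfil p M k S s :=
  mem_Lfil.mpr fun _ hF => hF.contains s hs u hu

theorem isClosedInL_Lfil {s : ℕ} (hs : 1 ≤ s) :
    IsClosedInL p M k (Lfil p M k S s : Set (Lcal p M k)) := by
  intro l hl
  refine mem_Lfil.mpr fun F hF => hF.closed s hs l fun n => ?_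
  obtain ⟨c, hc, h⟩ := hl n
  exact ⟨c, mem_Lfil.mp hc F hF, h⟩

variable (S) in
/-- The image of `ℒ(s)` in the layer `n`. -/
def LL (n s : ℕ) : Submodule (ZMod (p ^ M)) (Lvl p M k n) :=
  (Lfil p M k S s).toSubmodule.map (ev p M k n : Lcal p M k →ₗ[ZMod (p ^ M)] Lvl p M k n)

theorem LL_one (n : ℕ) : LL S n 1 = ⊤ := by
  rw [eq_top_iff]
  intro x _
  obtain ⟨l, hl⟩ := ev_surjective p M k n x
  exact ⟨l, by rw [Lfil_one]; trivial, hl⟩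

theorem LL_anti {n s s' : ℕ} (hs : 1 ≤ s) (h : s ≤ s') : LL S n s' ≤ LL S n s :=
  Submodule.map_mono (Lfil_anti hs h)

theorem lie_mem_LL {n s s' : ℕ} (hs : 1 ≤ s) (hs' : 1 ≤ s') {x y : Lvl p M k n}
    (hx : x ∈ LL S n s) (hy : y ∈ LL S n s') : ⁅x, y⁆ ∈ LL S n (s + s') := by
  obtain ⟨l, hl, rfl⟩ := hx
  obtain ⟨l', hl', rfl⟩ := hy
  exact ⟨⁅l, l'⁆, lie_mem_Lfil hs hs' hl hl', LieHom.map_lie _ _ _⟩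

theorem genLvl_mem_LL {n s : ℕ} (hs : 1 ≤ s) {u : (k⸨X⸩)ˣ} (hu : u ∈ unitFil p M k S s) :
    genLvl p M k n u ∈ LL S n s := ⟨gen p M k u, gen_mem_Lfil hs hu, rfl⟩

end Eval

namespace Datum

variable {p : ℕ} [Fact p.Prime] {M : ℕ} {k : Type*} [Field k] [CharP k p] [PerfectRing k p]
  {N₀ : ℕ} (D : Datum p M k N₀)

/-- The coefficients of `e` at `S^{-m} t^b`, read through the traces against `β`, are classes of
units of the `m`-th step of the unit filtration. -/
theorem Pi_e_mem_NN (n : ℕ) : D.Pi.rTensor _ (D.e n) ∈ D.NN 1 (LL D.S n) := by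
  refine D.Pi_rTensor_mem_NN (fun i r => ?_) ?_
  · obtain ⟨u, hu, h⟩ := D.exists_unit_of_P i (D.β r)
    rw [con_rTensor, tauβ, LinearMap.comp_assoc, con_e_P, ← h n]
    exact genLvl_mem_LL i.2.2.2.2 hu
  · rw [LL_one]; trivial

theorem e_mem_NN (n : ℕ) : D.e n ∈ D.NN 1 (LL D.S n) := by
  have := add_mem (D.NN_zero_le (D.e_sub_Pi_mem_NN (LL_one (S := D.S) n))) (D.Pi_e_mem_NN n)
  rwa [sub_add_cancel] at this

theorem mem_NN_of_mem_Ncal {y : ∀ n, OK p M k ⊗[ZMod (p ^ M)] Lvl p M k n}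
    (hy : y ∈ Ncal p M k D.S) (n : ℕ) : y n ∈ D.NN 1 (LL D.S n) := by
  refine (AddSubgroup.closure_le (K := (D.NN 1 (LL D.S n)).toAddSubgroup)).mpr ?_ (hy.2 n)
  rintro _ ⟨s, hs, f, hf, l, hl, rfl⟩
  obtain ⟨s, rfl⟩ : ∃ s', s = s' + 1 := ⟨s - 1, by omega⟩
  exact D.tmul_mem_NN (D.SI_pow_mul_mem_Pole (s + 1) hf) ⟨l, hl, rfl⟩

theorem mem_Ncal {y : ∀ n, OK p M k ⊗[ZMod (p ^ M)] Lvl p M k n}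
    (h1 : y ∈ LR p M k (OK p M k)) (h2 : ∀ n, y n ∈ D.NN 1 (LL D.S n)) : y ∈ Ncal p M k D.S := by
  refine ⟨h1, fun n => ?_⟩
  refine (Submodule.span_le (p := AddSubgroup.toZModSubmodule (p ^ M) (AddSubgroup.closure _))).mpr
    ?_ (h2 n)
  rintro _ ⟨s, f, hf, _, ⟨l, hl, rfl⟩, rfl⟩
  refine AddSubgroup.subset_closure ⟨s + 1, Nat.succ_pos s, D.SO ^ (s + 1) * f, hf, l, hl, ?_⟩
  have : D.SI ^ (s + 1) * (D.SO ^ (s + 1) * f) = f := by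
    rw [← mul_assoc, mul_comm (D.SI ^ _), SO_pow_mul_SI_pow, one_mul]
  exact congrArg (· ⊗ₜ[ZMod (p ^ M)] l.1 n) this.symm

theorem smul_eq_rTensor {L : Type*} [AddCommGroup L] [Module (ZMod (p ^ M)) L] (a : OK p M k)
    (z : OK p M k ⊗[ZMod (p ^ M)] L) :
    a • z = (LinearMap.mulLeft (ZMod (p ^ M)) a).rTensor L z := by
  induction z with
  | zero => rw [smul_zero, map_zero]
  | add x y hx hy => rw [smul_add, map_add, hx, hy]
  | tmul f l => rfl

theorem SO_smul_mem_NN {n : ℕ} {y : OK p M k ⊗[ZMod (p ^ M)] Lvl p M k n}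
    {G : ℕ → Submodule (ZMod (p ^ M)) (Lvl p M k n)} (hy : y ∈ D.NN 1 G) :
    D.SO • y ∈ D.NN 0 G := by
  rw [smul_eq_rTensor]
  refine D.rTensor_mem_NN (fun s f hf => ?_) hy
  rw [LinearMap.mulLeft_apply]
  exact D.SO_mul_mem_Pole.mpr hf

theorem SI_smul_mem_NN {n : ℕ} {y : OK p M k ⊗[ZMod (p ^ M)] Lvl p M k n}
    {G : ℕ → Submodule (ZMod (p ^ M)) (Lvl p M k n)} (hy : y ∈ D.NN 0 G) :
    D.SI • y ∈ D.NN 1 G := by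
  rw [smul_eq_rTensor]
  refine D.rTensor_mem_NN (fun s f hf => ?_) hy
  rw [LinearMap.mulLeft_apply]
  exact D.SI_mul_mem_Pole.mpr hf

end Datum

/-! ### Existence of the gauge transformation -/

section Naturality

variable {p : ℕ} [Fact p.Prime] {M : ℕ} {k : Type*} [Field k] [CharP k p] {n : ℕ}

theorem scalarMap_frobOK : scalarMap p M k (frobOK p M k) n = frobLin.rTensor (Lvl p M k n) :=
  congrArg (LinearMap.rTensor (Lvl p M k n)) (LinearMap.ext fun _ => rfl)

theorem scalarMap_constOK : scalarMap p M k (constOK p M k) n = constLin.rTensor (Lvl p M k n) :=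
  congrArg (LinearMap.rTensor (Lvl p M k n)) (LinearMap.ext fun _ => rfl)

theorem frobLin_rTensor_CH (a b : OK p M k ⊗[ZMod (p ^ M)] Lvl p M k n) :
    frobLin.rTensor (Lvl p M k n) (CH (ZMod (p ^ M)) p a b) =
      CH (ZMod (p ^ M)) p (frobLin.rTensor _ a) (frobLin.rTensor _ b) :=
  map_CH (tensorLieHom frobLin (fun x y => map_mul (frobOK p M k) x y)
    (LieHom.id : Lvl p M k n →ₗ⁅ZMod (p ^ M)⁆ Lvl p M k n)) a b

/-- The transition maps as homomorphisms of Lie algebras. -/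
def transLie (p : ℕ) [Fact p.Prime] (M : ℕ) (k : Type*) [Field k] [CharP k p] (n : ℕ) :
    Lvl p M k (n + 1) →ₗ⁅ZMod (p ^ M)⁆ Lvl p M k n where
  __ := trans p M k n
  map_lie' {x y} := trans_lie p M k n x y

theorem trans_lTensor_CH (a b : OK p M k ⊗[ZMod (p ^ M)] Lvl p M k (n + 1)) :
    (trans p M k n).lTensor (OK p M k) (CH (ZMod (p ^ M)) p a b) =
      CH (ZMod (p ^ M)) p ((trans p M k n).lTensor _ a) ((trans p M k n).lTensor _ b) :=
  map_CH (tensorLieHom LinearMap.id (fun _ _ => rfl) (transLie p M k n)) a b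

theorem trans_genLvl (u : (k⸨X⸩)ˣ) : trans p M k n (genLvl p M k (n + 1) u) = genLvl p M k n u := rfl

theorem trans_genE [PerfectRing k p] (a : ℕ) (w : WM p M k) :
    trans p M k n (genE p M k (n + 1) a w) = genE p M k n a w := by
  rcases Nat.eq_zero_or_pos a with rfl | ha
  · simp [genE]
  · rw [genE_apply _ ha.ne', genE_apply _ ha.ne', trans_genLvl]

end Naturality

namespace Datum

variable {p : ℕ} [Fact p.Prime] {M : ℕ} {k : Type*} [Field k] [CharP k p] [PerfectRing k p]
  {N₀ : ℕ} (D : Datum p M k N₀) {n : ℕ}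

theorem trans_e : (trans p M k n).lTensor _ (D.e (n + 1)) = D.e n := by
  rw [e_eq, e_eq, map_add, LinearMap.lTensor_tmul, trans_genLvl, map_sum]
  congr 1
  have h1 : ∀ a : ℕ, (trans p M k n).lTensor _ (∑ i, (tPow p M k (-(a : ℤ)) * constOK p M k (D.γ i))
      ⊗ₜ[ZMod (p ^ M)] ((a : ZMod (p ^ M))⁻¹ • genE p M k (n + 1) a (D.β i))) =
      ∑ i, (tPow p M k (-(a : ℤ)) * constOK p M k (D.γ i))
        ⊗ₜ[ZMod (p ^ M)] ((a : ZMod (p ^ M))⁻¹ • genE p M k n a (D.β i)) := by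
    intro a
    rw [map_sum]
    refine Finset.sum_congr rfl fun i _ => ?_
    rw [LinearMap.lTensor_tmul, map_smul, trans_genE]
  rw [Finset.sum_congr rfl fun a _ => h1 a]
  refine (Finset.sum_subset (fun a ha => ?_) fun a h2 ha => ?_).symm
  · rw [mem_copr] at ha ⊢
    exact ⟨ha.1, ha.2.1.trans (Nat.le_succ n), ha.2.2⟩
  · refine Finset.sum_eq_zero fun i _ => ?_
    have : n < a := by
      by_contra h
      rw [mem_copr] at ha h2
      exact ha ⟨h2.1, not_lt.mp h, h2.2.2⟩
    rw [genE_eq_zero this, LinearMap.zero_apply, smul_zero, TensorProduct.tmul_zero]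

theorem rTensor_Pi_Pi (z : OK p M k ⊗[ZMod (p ^ M)] Lvl p M k n) :
    D.Pi.rTensor _ (D.Pi.rTensor _ z) = D.Pi.rTensor _ z := by
  rw [← LinearMap.rTensor_comp_apply]
  congr 2
  exact LinearMap.ext D.Pi_Pi

theorem rTensor_Xm_Pi (z : OK p M k ⊗[ZMod (p ^ M)] Lvl p M k n) :
    D.Xm.rTensor _ (D.Pi.rTensor _ z) = 0 := by
  rw [← LinearMap.rTensor_comp_apply, show D.Xm ∘ₗ D.Pi = 0 from LinearMap.ext D.Xm_Pi,
    LinearMap.rTensor_zero, LinearMap.zero_apply]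

theorem frobLin_rTensor_Xm (z : OK p M k ⊗[ZMod (p ^ M)] Lvl p M k n) :
    frobLin.rTensor _ (D.Xm.rTensor _ z) = D.Xm.rTensor _ z + (z - D.Pi.rTensor _ z) := by
  rw [← LinearMap.rTensor_comp_apply, show frobLin ∘ₗ D.Xm = D.Xm + (LinearMap.id - D.Pi) from
    LinearMap.ext fun f => by
      have := D.frobOK_Xm_sub f
      rw [sub_eq_iff_eq_add'] at this
      exact this]
  rw [LinearMap.rTensor_add, LinearMap.rTensor_sub, LinearMap.rTensor_id]
  rfl

/-- One step `z ↦ (-σ ξ) ∘ z ∘ ξ`, `x ↦ x ∘ ξ` of the construction of `e†`. -/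
def gaugeStep (n : ℕ) (zx : (OK p M k ⊗[ZMod (p ^ M)] Lvl p M k n) ×
      (OK p M k ⊗[ZMod (p ^ M)] Lvl p M k n)) :
    (OK p M k ⊗[ZMod (p ^ M)] Lvl p M k n) × (OK p M k ⊗[ZMod (p ^ M)] Lvl p M k n) :=
  (CH (ZMod (p ^ M)) p (CH (ZMod (p ^ M)) p (-frobLin.rTensor _ (D.Xm.rTensor _ zx.1)) zx.1)
    (D.Xm.rTensor _ zx.1), CH (ZMod (p ^ M)) p zx.2 (D.Xm.rTensor _ zx.1))

/-- The successive approximations of `(e†, x)`. -/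
def gaugeIter (n r : ℕ) :
    (OK p M k ⊗[ZMod (p ^ M)] Lvl p M k n) × (OK p M k ⊗[ZMod (p ^ M)] Lvl p M k n) :=
  (D.gaugeStep n)^[r] (D.e n, 0)

theorem gaugeIter_succ (n r : ℕ) :
    D.gaugeIter n (r + 1) = D.gaugeStep n (D.gaugeIter n r) :=
  Function.iterate_succ_apply' _ _ _

theorem rTensor_lTensor_trans {X Y : Type*} [AddCommGroup X] [Module (ZMod (p ^ M)) X]
    [AddCommGroup Y] [Module (ZMod (p ^ M)) Y] (T : X →ₗ[ZMod (p ^ M)] Y)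
    (z : X ⊗[ZMod (p ^ M)] Lvl p M k (n + 1)) : (trans p M k n).lTensor Y (T.rTensor _ z) =
      T.rTensor _ ((trans p M k n).lTensor X z) := by
  induction z with
  | zero => simp only [map_zero]
  | add x y hx hy => simp only [map_add, hx, hy]
  | tmul f l => rfl

theorem trans_gaugeIter (n r : ℕ) :
    (trans p M k n).lTensor _ (D.gaugeIter (n + 1) r).1 = (D.gaugeIter n r).1 ∧
    (trans p M k n).lTensor _ (D.gaugeIter (n + 1) r).2 = (D.gaugeIter n r).2 := by
  induction r with
  | zero => exact ⟨D.trans_e, map_zero _⟩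
  | succ r ih =>
    rw [gaugeIter_succ, gaugeIter_succ, gaugeStep, gaugeStep]
    dsimp only
    rw [trans_lTensor_CH, trans_lTensor_CH, trans_lTensor_CH, map_neg, rTensor_lTensor_trans,
      rTensor_lTensor_trans, ih.1, ih.2]
    exact ⟨rfl, rfl⟩

/-- `ℒ(s) ∩ C_{r+1}(ℒ)` in the layer `n`. -/
abbrev LC (n r s : ℕ) : Submodule (ZMod (p ^ M)) (Lvl p M k n) :=
  LL D.S n s ⊓ (lcs (ZMod (p ^ M)) (Lvl p M k n) r).toSubmodule

theorem lie_mem_NN_LC (j n r : ℕ) {x y : OK p M k ⊗[ZMod (p ^ M)] Lvl p M k n}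
    (hx : x ∈ D.NN 1 (LL D.S n)) (hy : y ∈ D.NN j (D.LC n r)) :
    ⁅x, y⁆ ∈ D.NN j (D.LC n (r + 1)) := by
  refine D.lie_mem_NN (G' := D.LC n r) (G'' := D.LC n (r + 1)) (fun s s' u hu v hv =>
    Submodule.mem_inf.mpr ⟨?_, lie_mem_lcs_succ u hv.2⟩) x hx y hy
  have := lie_mem_LL (Nat.succ_pos s) (Nat.succ_pos s') hu hv.1
  rwa [show s + 1 + (s' + 1) = s + s' + 1 + 1 by omega] at this

theorem LC_succ_le (j n r : ℕ) : D.NN j (D.LC n (r + 1)) ≤ D.NN j (D.LC n r) :=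
  D.NN_mono fun _ => inf_le_inf_left _ (lcs_antitone (Nat.le_succ r))

theorem LC_le (j n r : ℕ) : D.NN j (D.LC n r) ≤ D.NN j (LL D.S n) :=
  D.NN_mono fun _ => inf_le_left

/-- As `σξ - ξ = z - Πz`, the new element is `Πz` to first order. The higher Campbell–Hausdorff
terms are brackets with `ξ` or `σξ` and lie one step deeper in the lower central series. Although
`σ` does not respect poles, `σξ = ξ + (z - Πz)` lies in the same `NN 0` as `ξ`. -/
theorem gaugeStep_mem {r : ℕ} {z x : OK p M k ⊗[ZMod (p ^ M)] Lvl p M k n}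
    (hz : z ∈ D.NN 1 (LL D.S n)) (hz' : z - D.Pi.rTensor _ z ∈ D.NN 0 (D.LC n r))
    (hx : x ∈ D.NN 0 (LL D.S n)) :
    (D.gaugeStep n (z, x)).1 ∈ D.NN 1 (LL D.S n) ∧
    (D.gaugeStep n (z, x)).1 - D.Pi.rTensor _ (D.gaugeStep n (z, x)).1 ∈ D.NN 0 (D.LC n (r + 1)) ∧
    (D.gaugeStep n (z, x)).2 ∈ D.NN 0 (LL D.S n) := by
  have hG := chGroup_lvl (p := p) (M := M) (k := k) n (OK p M k)
  have hPi : ∀ {j : ℕ} {G : ℕ → Submodule (ZMod (p ^ M)) (Lvl p M k n)} {y}, y ∈ D.NN j G →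
      D.Pi.rTensor _ y ∈ D.NN j G := fun hy => D.rTensor_mem_NN (fun s f hf => D.Pi_mem_Pole hf) hy
  set ξ := D.Xm.rTensor _ z with hξ
  have hξm : ξ ∈ D.NN 0 (D.LC n r) := by
    have h1 : ξ = D.Xm.rTensor _ (z - D.Pi.rTensor _ z) := by
      rw [map_sub, rTensor_Xm_Pi, sub_zero]
    rw [h1]
    exact D.rTensor_mem_NN (fun s f hf => D.Xm_mem_Pole hf) hz'
  have hσ : frobLin.rTensor _ ξ = ξ + (z - D.Pi.rTensor _ z) := D.frobLin_rTensor_Xm z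
  have hσm : -frobLin.rTensor _ ξ ∈ D.NN 0 (D.LC n r) := by
    rw [hσ]
    exact neg_mem (add_mem hξm hz')
  have hJJ : ∀ a ∈ D.NN 0 (D.LC n r), ∀ b ∈ D.NN 0 (D.LC n r),
      ⁅a, b⁆ ∈ D.NN 0 (D.LC n (r + 1)) := fun a ha b hb =>
    D.lie_mem_NN_LC 0 n r (D.NN_zero_le (D.LC_le 0 n r ha)) hb
  have h1 := hG.sub_mem' hσm (fun b hb => D.lie_mem_NN_LC 0 n r hz hb) hJJ (D.LC_succ_le 0 n r)
  set y := CH (ZMod (p ^ M)) p (-frobLin.rTensor _ ξ) z with hy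
  have hym : y ∈ D.NN 1 (LL D.S n) := by
    have := add_mem (D.NN_zero_le (D.LC_le 0 n _ h1))
      (add_mem (D.NN_zero_le (D.LC_le 0 n r hσm)) hz)
    rwa [sub_add_cancel] at this
  have h2 := hG.sub_mem hξm (fun b hb => D.lie_mem_NN_LC 0 n r hym hb) hJJ (D.LC_succ_le 0 n r)
  have h3 : (D.gaugeStep n (z, x)).1 - D.Pi.rTensor _ z ∈ D.NN 0 (D.LC n (r + 1)) := by
    have := add_mem h1 h2
    have e1 : y - (-frobLin.rTensor _ ξ + z) + (CH (ZMod (p ^ M)) p y ξ - (y + ξ)) =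
        (D.gaugeStep n (z, x)).1 - D.Pi.rTensor _ z := by
      rw [hσ, show (D.gaugeStep n (z, x)).1 = CH (ZMod (p ^ M)) p y ξ from rfl]
      abel
    rwa [e1] at this
  refine ⟨?_, ?_, ?_⟩
  · have := add_mem (D.NN_zero_le (D.LC_le 0 n _ h3)) (hPi hz)
    rwa [sub_add_cancel] at this
  · have := sub_mem h3 (hPi h3)
    rwa [map_sub, rTensor_Pi_Pi, sub_sub_sub_cancel_right] at this
  · have hLL : ∀ a ∈ D.NN 0 (LL D.S n), ∀ b ∈ D.NN 0 (LL D.S n), ⁅a, b⁆ ∈ D.NN 0 (LL D.S n) := by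
      intro a ha b hb
      refine D.lie_mem_NN (fun s s' u hu v hv => ?_) a (D.NN_zero_le ha) b hb
      have := lie_mem_LL (Nat.succ_pos s) (Nat.succ_pos s') hu hv
      rwa [show s + 1 + (s' + 1) = s + s' + 1 + 1 by omega] at this
    have h4 := hG.sub_mem (D.LC_le 0 n r hξm) (hLL x hx) hLL le_rfl
    have := add_mem h4 (add_mem hx (D.LC_le 0 n r hξm))
    rwa [sub_add_cancel] at this

/-- Successive gauge transformations compose: since `σ` respects `∘`, applying `x` and then `ξ` is
the single transformation by `x ∘ ξ`. -/
theorem gaugeIter_spec (n r : ℕ) :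
    (D.gaugeIter n r).1 = CH (ZMod (p ^ M)) p (CH (ZMod (p ^ M)) p
      (-frobLin.rTensor _ (D.gaugeIter n r).2) (D.e n)) (D.gaugeIter n r).2 ∧
    (D.gaugeIter n r).1 ∈ D.NN 1 (LL D.S n) ∧
    (D.gaugeIter n r).1 - D.Pi.rTensor _ (D.gaugeIter n r).1 ∈ D.NN 0 (D.LC n r) ∧
    (D.gaugeIter n r).2 ∈ D.NN 0 (LL D.S n) := by
  have hG := chGroup_lvl (p := p) (M := M) (k := k) n (OK p M k)
  induction r with
  | zero =>
    refine ⟨?_, D.e_mem_NN n, ?_, zero_mem _⟩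
    · change D.e n = CH _ p (CH _ p (-frobLin.rTensor _ 0) (D.e n)) 0
      rw [map_zero, neg_zero, hG.zero_ch, hG.ch_zero]
    · refine D.e_sub_Pi_mem_NN ?_
      rw [LC, LL_one, top_inf_eq]
      rfl
  | succ r ih =>
    obtain ⟨h1, h2, h3, h4⟩ := ih
    rw [gaugeIter_succ]
    refine ⟨?_, D.gaugeStep_mem h2 h3 h4⟩
    set ξ := D.Xm.rTensor _ (D.gaugeIter n r).1 with hξ
    change CH _ p (CH _ p (-frobLin.rTensor _ ξ) (D.gaugeIter n r).1) ξ =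
      CH _ p (CH _ p (-frobLin.rTensor _ (CH _ p (D.gaugeIter n r).2 ξ)) (D.e n))
        (CH _ p (D.gaugeIter n r).2 ξ)
    rw [frobLin_rTensor_CH, hG.neg_ch]
    conv_lhs => rw [h1]
    simp only [hG.assoc]

/-- The error after `p - 1` steps has Lie factors in `lcs (p - 1)`, which is zero. -/
theorem Pi_gaugeIter (n : ℕ) :
    D.Pi.rTensor _ (D.gaugeIter n (p - 1)).1 = (D.gaugeIter n (p - 1)).1 := by
  have h := (D.gaugeIter_spec n (p - 1)).2.2.1
  have h2 : D.NN 0 (D.LC n (p - 1)) ≤ ⊥ := by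
    refine Submodule.span_le.mpr ?_
    rintro _ ⟨s, f, hf, l, hl, rfl⟩
    have h3 : l = 0 := by
      have := hl.2
      rw [lcs_lvl_eq_bot] at this
      exact this
    rw [h3, TensorProduct.tmul_zero]
    exact zero_mem _
  exact (sub_eq_zero.mp ((Submodule.mem_bot _).mp (h2 h))).symm

theorem elemEDag_eq {V : Idx p D.eS → LR p M k (WM p M k)} {V₀ : Lcal p M k}
    {F : Finset (Idx p D.eS)} (hF : ∀ i, i ∉ F → (V i).1 n = 0) :
    elemEDag p M k D.S D.α₀ V V₀ n = ∑ i ∈ F, D.B i • constLin.rTensor _ ((V i).1 n) +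
      constOK p M k D.α₀ ⊗ₜ V₀.1 n := by
  refine congrArg (· + constOK p M k D.α₀ ⊗ₜ[ZMod (p ^ M)] V₀.1 n) ?_
  rw [scalarMap_constOK]
  refine finsum_eq_sum_of_support_subset _ fun i hi => ?_
  by_contra h
  refine hi ?_
  dsimp only
  rw [hF i h, map_zero, smul_zero]

/-- The `V` and `V₀` are the coefficients of the fixed vector `Πz = z`. Compatibility between layers
is automatic, because the iteration uses only linear projections of `O(𝒦)` and the natural operation
`CH`, with no choices depending on the layer. -/
theorem exists_gaugeData : ∃ V V₀ x, IsGaugeData p M k D.S D.α₀ D.β D.γ V V₀ x := by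
  have hp := (Fact.out : p.Prime).two_le
  have hmem := fun n => (D.gaugeIter_spec n (p - 1)).2.1
  have htr := fun n => D.trans_gaugeIter n (p - 1)
  choose F hF1 hF2 using fun n => D.exists_finset_Pi (D.gaugeIter n (p - 1)).1
  let V : Idx p D.eS → LR p M k (WM p M k) := fun i =>
    ⟨fun n => (D.P i).rTensor _ (D.gaugeIter n (p - 1)).1, fun n => by
      rw [rTensor_lTensor_trans, (htr n).1]⟩
  let V₀ : Lcal p M k := ⟨fun n => con _ D.P0 (D.gaugeIter n (p - 1)).1, fun n => by
    rw [← con_lTensor, (htr n).1]⟩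
  have hdag : elemEDag p M k D.S D.α₀ V V₀ = fun n => (D.gaugeIter n (p - 1)).1 := by
    funext n
    rw [D.elemEDag_eq (hF1 n), ← D.Pi_gaugeIter n, hF2 n _ subset_rfl]
  refine ⟨V, V₀, fun n => (D.gaugeIter n (p - 1)).2, ?_, ?_, ?_, ?_⟩
  · intro n
    refine (F n).finite_toSet.subset fun i hi => ?_
    by_contra h
    exact hi (hF1 n i h)
  · refine ⟨fun n => D.SI • (D.gaugeIter n (p - 1)).2, D.mem_Ncal (fun n => ?_) fun n =>
      D.SI_smul_mem_NN (D.gaugeIter_spec n (p - 1)).2.2.2, fun n => ?_⟩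
    · rw [smul_eq_rTensor, smul_eq_rTensor, rTensor_lTensor_trans, (htr n).2]
    · rw [smul_smul]
      refine Eq.trans (one_smul (OK p M k) _).symm ?_
      rw [← SO_mul_SI]
      rfl
  · rw [hdag]
    exact D.mem_Ncal (fun n => (htr n).1) hmem
  · intro n
    rw [isCHProd_three_iff p M k n (OK p M k) _ _ _ _ hp, hdag, scalarMap_frobOK]
    exact (D.gaugeIter_spec n (p - 1)).1

end Datum

/-! ### The weight filtration of a family -/

section Weights

variable {p : ℕ} [Fact p.Prime] {M : ℕ} {k : Type*} [Field k] [CharP k p] {ι : Type*}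
  (v : ι → Lcal p M k) (w : ι → ℕ)

/-- The span in the layer `n` of the commutators of weight `≥ s`. -/
def FW (n s : ℕ) : Submodule (ZMod (p ^ M)) (Lvl p M k n) :=
  Submodule.span _ {x | ∃ d l, s ≤ d ∧ IsMonomial v w d l ∧ l.1 n = x}

variable {v w}

theorem IsMonomial.mem_FW {n s d : ℕ} {l : Lcal p M k} (h : IsMonomial v w d l) (hs : s ≤ d) :
    l.1 n ∈ FW v w n s := Submodule.subset_span ⟨d, l, hs, h, rfl⟩

theorem FW_anti {n s s' : ℕ} (h : s ≤ s') : FW v w n s' ≤ FW v w n s := by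
  refine Submodule.span_mono ?_
  rintro _ ⟨d, l, hd, hl, rfl⟩
  exact ⟨d, l, h.trans hd, hl, rfl⟩

theorem lie_mem_span {R L : Type*} [CommRing R] [LieRing L] [LieAlgebra R L] {S S' : Set L}
    {Q : Submodule R L} (h : ∀ x ∈ S, ∀ y ∈ S', ⁅x, y⁆ ∈ Q) {x y : L}
    (hx : x ∈ Submodule.span R S) (hy : y ∈ Submodule.span R S') : ⁅x, y⁆ ∈ Q := by
  induction hx using Submodule.span_induction with
  | mem x hx =>
    induction hy using Submodule.span_induction with
    | mem y hy => exact h x hx y hy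
    | zero => rw [lie_zero]; exact Q.zero_mem
    | add u v _ _ hu hv => rw [lie_add]; exact Q.add_mem hu hv
    | smul c u _ hu => rw [lie_smul]; exact Q.smul_mem c hu
  | zero => rw [zero_lie]; exact Q.zero_mem
  | add u v _ _ hu hv => rw [add_lie]; exact Q.add_mem hu hv
  | smul c u _ hu => rw [smul_lie]; exact Q.smul_mem c hu

theorem lie_mem_FW {n s s' : ℕ} {x y : Lvl p M k n} (hx : x ∈ FW v w n s)
    (hy : y ∈ FW v w n s') : ⁅x, y⁆ ∈ FW v w n (s + s') := by
  refine lie_mem_span ?_ hx hy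
  rintro _ ⟨d, l, hd, hl, rfl⟩ _ ⟨d', l', hd', hl', rfl⟩
  exact (hl.lie hl').mem_FW (n := n) (add_le_add hd hd')

variable (v w) in
/-- The span in the layer `n` of the commutators of weight `≥ s` and of all commutators of order
greater than `r`. -/
def FC (n r s : ℕ) : Submodule (ZMod (p ^ M)) (Lvl p M k n) :=
  FW v w n s ⊔ (lcs (ZMod (p ^ M)) (Lvl p M k n) r).toSubmodule

theorem FC_anti {n r s s' : ℕ} (h : s ≤ s') : FC v w n r s' ≤ FC v w n r s :=
  sup_le_sup_right (FW_anti h) _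

theorem FC_succ_le {n r s : ℕ} : FC v w n (r + 1) s ≤ FC v w n r s :=
  sup_le_sup_left (show (lcs (ZMod (p ^ M)) (Lvl p M k n) (r + 1)).toSubmodule ≤
    (lcs (ZMod (p ^ M)) (Lvl p M k n) r).toSubmodule from
      fun _ hx => lcs_antitone (Nat.le_succ r) hx) _

theorem FC_zero (n s : ℕ) : FC v w n 0 s = ⊤ := by
  rw [FC, eq_top_iff]
  exact le_sup_of_le_right fun _ _ => trivial

theorem FC_eq_FW (n s : ℕ) : FC v w n (p - 1) s = FW v w n s := by
  rw [FC, lcs_lvl_eq_bot]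
  exact sup_bot_eq _

/-- A bracket with one factor in `lcs r` lies in `lcs (r + 1)`, so inclusions known to depth `r`
control brackets to depth `r + 1`. This gain drives the induction in `LL_le_FC`. -/
theorem lie_mem_FC_succ {n r s s' : ℕ} {x y : Lvl p M k n} (hx : x ∈ FC v w n r s)
    (hy : y ∈ FC v w n r s') : ⁅x, y⁆ ∈ FC v w n (r + 1) (s + s') := by
  obtain ⟨a, ha, b, hb, rfl⟩ := Submodule.mem_sup.mp hx
  obtain ⟨c, hc, d, hd, rfl⟩ := Submodule.mem_sup.mp hy
  have h1 : ⁅a, d⁆ ∈ lcs (ZMod (p ^ M)) (Lvl p M k n) (r + 1) := lie_mem_lcs_succ a hd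
  have h2 : ⁅b, c + d⁆ ∈ lcs (ZMod (p ^ M)) (Lvl p M k n) (r + 1) := by
    rw [← lie_skew]
    exact neg_mem (lie_mem_lcs_succ _ hb)
  rw [add_lie, lie_add, add_assoc]
  exact Submodule.add_mem_sup (lie_mem_FW ha hc) (add_mem h1 h2)

theorem lie_mem_FC {n r s s' : ℕ} {x y : Lvl p M k n} (hx : x ∈ FC v w n r s)
    (hy : y ∈ FC v w n r s') : ⁅x, y⁆ ∈ FC v w n r (s + s') :=
  FC_succ_le (lie_mem_FC_succ hx hy)

variable (v w) in
/-- The elements of `ℒ` whose images in all layers lie in `FC v w n r s`. -/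
def FCIdeal (r s : ℕ) (h1 : ∀ n, FC v w n r 1 = ⊤) : LieIdeal (ZMod (p ^ M)) (Lcal p M k) where
  carrier := {l | ∀ n, l.1 n ∈ FC v w n r s}
  add_mem' ha hb n := add_mem (ha n) (hb n)
  zero_mem' n := zero_mem _
  smul_mem' c _ ha n := Submodule.smul_mem _ c (ha n)
  lie_mem {x l} hl n := by
    have hx : x.1 n ∈ FC v w n r 1 := by rw [h1 n]; trivial
    exact FC_anti (Nat.le_add_left s 1) (lie_mem_FC hx (hl n))

theorem mem_FCIdeal {r s : ℕ} {h1 : ∀ n, FC v w n r 1 = ⊤} {l : Lcal p M k} :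
    l ∈ FCIdeal v w r s h1 ↔ ∀ n, l.1 n ∈ FC v w n r s := Iff.rfl

theorem isAdmissible_FCIdeal {S : (WM p M k)⟦X⟧} {r : ℕ} (h1 : ∀ n, FC v w n r 1 = ⊤)
    (hu : ∀ s, 1 ≤ s → ∀ u ∈ unitFil p M k S s, ∀ n, genLvl p M k n u ∈ FC v w n r s) :
    IsAdmissibleFiltration p M k S fun s => FCIdeal v w r s h1 where
  closed s _ l hl n := by
    obtain ⟨c, hc, h⟩ := hl n
    rw [← h]
    exact hc n
  one := by
    rw [eq_top_iff]
    intro l _ n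
    rw [h1 n]; trivial
  anti s _ l hl n := FC_anti (Nat.le_succ s) (hl n)
  central s s' _ _ x hx y hy n := lie_mem_FC (hx n) (hy n)
  contains s hs u hus n := hu s hs u hus n

theorem mem_weightGE {s : ℕ} {l : Lcal p M k} : l ∈ weightGE v w s ↔ ∀ n, l.1 n ∈ FW v w n s := by
  refine forall_congr' fun n => ⟨?_, fun h => ?_⟩
  · rintro ⟨c, hc, h⟩
    rw [← h]
    refine (AddSubgroup.closure_le (K := ((FW v w n s).comap (ev p M k n :
      Lcal p M k →ₗ[ZMod (p ^ M)] Lvl p M k n)).toAddSubgroup)).mpr ?_ hc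
    rintro x ⟨d, hd, hx⟩
    exact hx.mem_FW hd
  · have : FW v w n s ≤ (AddSubgroup.toZModSubmodule (p ^ M)
        (AddSubgroup.closure {x | ∃ d, s ≤ d ∧ IsMonomial v w d x})).map
          (ev p M k n : Lcal p M k →ₗ[ZMod (p ^ M)] Lvl p M k n) := by
      refine Submodule.span_le.mpr ?_
      rintro _ ⟨d, l, hd, hl, rfl⟩
      exact ⟨l, AddSubgroup.subset_closure ⟨d, hd, hl⟩, rfl⟩
    exact this h

/-- The weight is a supremum over a downward closed set of integers: exceeding `s - 1` yields a
member that is at least `s`. This is where `1 ≤ s` enters. -/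
theorem le_wt_iff {s : ℕ} (hs : 1 ≤ s) {l : Lcal p M k} :
    (s : ℕ∞) ≤ wt v w l ↔ l ∈ weightGE v w s := by
  refine ⟨fun h => ?_, fun h => le_sSup ⟨s, rfl, h⟩⟩
  obtain ⟨t, rfl⟩ : ∃ t, s = t + 1 := ⟨s - 1, by omega⟩
  have h2 : ((t : ℕ) : ℕ∞) < wt v w l := lt_of_lt_of_le (by exact_mod_cast Nat.lt_succ_self t) h
  obtain ⟨_, ⟨d, rfl, hd⟩, h3⟩ := lt_sSup_iff.mp h2
  rw [mem_weightGE] at hd ⊢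
  exact fun n => FW_anti (by exact_mod_cast h3) (hd n)

end Weights

/-! ### The generators attached to `e†` -/

namespace Datum

variable {p : ℕ} [Fact p.Prime] {M : ℕ} {k : Type*} [Field k] [CharP k p] [PerfectRing k p]
  {N₀ : ℕ} (D : Datum p M k N₀) {n : ℕ}

theorem con_tau₀_one_tmul (x : Lvl p M k n) : con _ D.tau₀ ((1 : WM p M k) ⊗ₜ x) = x := by
  rw [con_tmul, ← map_one (algebraMap (ZMod (p ^ M)) (WM p M k)), tau₀_algebraMap, one_smul]

/-- On a pure tensor the sum over Frobenius conjugates of `β_i w` is a trace, hence a scalar from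
`ℤ/p^M`, and can be moved to the Lie factor. So the generators are defined over `ℒ`, with components
given by contraction. -/
theorem sum_frob_smul (i : Fin N₀) (z : WM p M k ⊗[ZMod (p ^ M)] Lvl p M k n) :
    ∑ r ∈ Finset.range N₀, (frobWM p M k)^[r] (D.β i) •
      (scalarMap p M k (frobWM p M k) n)^[r] z = (1 : WM p M k) ⊗ₜ con _ (D.tauβ i) z := by
  induction z with
  | zero => simp only [iterate_map_zero, smul_zero, Finset.sum_const_zero, map_zero,
      TensorProduct.tmul_zero]
  | add x y hx hy =>
    simp only [iterate_map_add, smul_add, Finset.sum_add_distrib, map_add, TensorProduct.tmul_add]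
    rw [hx, hy]
  | tmul w l =>
    have h : ∀ r, (scalarMap p M k (frobWM p M k) n)^[r] (w ⊗ₜ l) =
        ((frobWM p M k)^[r] w) ⊗ₜ l := by
      intro r
      induction r with
      | zero => rfl
      | succ r ih => rw [Function.iterate_succ_apply', Function.iterate_succ_apply', ih]; rfl
    have h2 : ∀ r, (frobWM p M k)^[r] (D.β i) • (scalarMap p M k (frobWM p M k) n)^[r] (w ⊗ₜ l) =
        ((frobWM p M k)^[r] (D.β i * w)) ⊗ₜ l := by
      intro r
      rw [h, iterate_map_mul]; rfl
    rw [Finset.sum_congr rfl fun r _ => h2 r, ← TensorProduct.sum_tmul, con_tmul, tauβ_apply,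
      ← TensorProduct.smul_tmul, Algebra.smul_def, mul_one, D.algebraMap_tau]
    rfl

variable {V : Idx p D.eS → LR p M k (WM p M k)} {V₀ : Lcal p M k}
  {v : Option (Idx p D.eS × Fin N₀) → Lcal p M k}

theorem isGeneratorFamily_iff : IsGeneratorFamily p M k D.β V V₀ v ↔ v none = V₀ ∧
    ∀ j i n, (v (some (j, i))).1 n = con _ (D.tauβ i) ((V j).1 n) := by
  refine and_congr_right fun _ => forall₃_congr fun j i n => ?_
  rw [sum_frob_smul]
  refine ⟨fun h => ?_, fun h => by rw [h]⟩
  have := congrArg (con _ D.tau₀) h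
  rwa [con_tau₀_one_tmul, con_tau₀_one_tmul] at this

variable (V V₀) in
theorem existsUnique_generatorFamily : ∃! v, IsGeneratorFamily p M k D.β V V₀ v := by
  simp only [isGeneratorFamily_iff]
  refine ⟨fun o => o.elim V₀ fun ji => ⟨fun n => con _ (D.tauβ ji.2) ((V ji.1).1 n), fun n => ?_⟩,
    ⟨rfl, fun _ _ _ => rfl⟩, ?_⟩
  · rw [← con_lTensor, (V ji.1).2 n]
  · rintro v ⟨h1, h2⟩
    funext o
    rcases o with _ | ⟨j, i⟩
    · exact h1
    · exact Subtype.ext (funext fun n => h2 j i n)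

theorem P_B_mul_const (i j : Idx p D.eS) (w : WM p M k) :
    D.P i (D.B j * constOK p M k w) = if j = i then w else 0 := by
  classical
  rw [← pol_single, P_apply, Pw_pol, Finsupp.single_apply]

theorem P_rTensor_B_smul (i j : Idx p D.eS) (z : WM p M k ⊗[ZMod (p ^ M)] Lvl p M k n) :
    (D.P i).rTensor _ (D.B j • constLin.rTensor _ z) = if j = i then z else 0 := by
  rw [smul_eq_rTensor, ← LinearMap.rTensor_comp_apply, ← LinearMap.rTensor_comp_apply,
    show (D.P i ∘ₗ LinearMap.mulLeft (ZMod (p ^ M)) (D.B j)) ∘ₗ constLin =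
      if j = i then LinearMap.id else 0 from LinearMap.ext fun w => by
        refine (D.P_B_mul_const i j w).trans ?_
        split_ifs <;> rfl]
  split_ifs
  · rw [LinearMap.rTensor_id]; rfl
  · rw [LinearMap.rTensor_zero]; rfl

theorem con_P0_B_smul (j : Idx p D.eS) (z : WM p M k ⊗[ZMod (p ^ M)] Lvl p M k n) :
    con _ D.P0 (D.B j • constLin.rTensor _ z) = 0 := by
  rw [smul_eq_rTensor, con_rTensor, con_rTensor,
    show (D.P0 ∘ₗ LinearMap.mulLeft (ZMod (p ^ M)) (D.B j)) ∘ₗ constLin = 0 from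
      LinearMap.ext fun w => by
        have := D.P0_pol (Finsupp.single j w)
        rw [pol_single] at this
        exact this]
  simp [con]

theorem const_α₀ : constOK p M k D.α₀ = D.αLin 1 := by rw [αLin_apply, map_one, mul_one]

variable {x : ∀ n, OK p M k ⊗[ZMod (p ^ M)] Lvl p M k n}
  (h : IsGaugeData p M k D.S D.α₀ D.β D.γ V V₀ x)
include h

theorem exists_finset_dag (n : ℕ) : ∃ F : Finset (Idx p D.eS), ∀ i, i ∉ F → (V i).1 n = 0 :=
  ⟨(h.tendsto_zero n).toFinset, fun _ hi => not_not.mp fun h' =>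
    hi ((Set.Finite.mem_toFinset _).mpr h')⟩

theorem P_dag (n : ℕ) (i : Idx p D.eS) :
    (D.P i).rTensor _ (elemEDag p M k D.S D.α₀ V V₀ n) = (V i).1 n := by
  classical
  obtain ⟨F, hF⟩ := D.exists_finset_dag h n
  rw [D.elemEDag_eq hF, map_add,
    map_sum, Finset.sum_congr rfl fun j _ => D.P_rTensor_B_smul i j _, LinearMap.rTensor_tmul,
    const_α₀, P_apply, Pw_αLin, Finsupp.coe_zero, Pi.zero_apply, TensorProduct.zero_tmul, add_zero,
    Finset.sum_ite_eq']
  split_ifs with hi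
  · rfl
  · exact (hF i hi).symm

theorem con_P0_dag (n : ℕ) : con _ D.P0 (elemEDag p M k D.S D.α₀ V V₀ n) = V₀.1 n := by
  obtain ⟨F, hF⟩ := D.exists_finset_dag h n
  rw [D.elemEDag_eq hF, map_add,
    map_sum, Finset.sum_congr rfl fun j _ => D.con_P0_B_smul j _, Finset.sum_const_zero, zero_add,
    con_tmul, const_α₀, P0_αLin, one_smul]

theorem Pi_dag (n : ℕ) : D.Pi.rTensor _ (elemEDag p M k D.S D.α₀ V V₀ n) =
    elemEDag p M k D.S D.α₀ V V₀ n := by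
  classical
  obtain ⟨F, -, hF⟩ := D.exists_finset_Pi (elemEDag p M k D.S D.α₀ V V₀ n)
  obtain ⟨F', hF'⟩ := D.exists_finset_dag h n
  have e1 := D.elemEDag_eq (F := F ∪ F') (V₀ := V₀) fun j hj =>
    hF' j fun h' => hj (Finset.mem_union_right _ h')
  rw [hF (F ∪ F') Finset.subset_union_left]
  refine Eq.trans ?_ e1.symm
  refine congrArg₂ (· + ·) (Finset.sum_congr rfl fun i _ => ?_) ?_
  · rw [D.P_dag h n i]
  · rw [D.con_P0_dag h n]

theorem dag_mem_NN_LL (n : ℕ) : elemEDag p M k D.S D.α₀ V V₀ n ∈ D.NN 1 (LL D.S n) :=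
  D.mem_NN_of_mem_Ncal h.dag_mem n

theorem x_mem_NN_LL (n : ℕ) : x n ∈ D.NN 0 (LL D.S n) := by
  obtain ⟨y, hy, hxy⟩ := h.mem_SN
  rw [hxy n]
  exact D.SO_smul_mem_NN (D.mem_NN_of_mem_Ncal hy n)

theorem dag_eq_CH (n : ℕ) : elemEDag p M k D.S D.α₀ V V₀ n = CH (ZMod (p ^ M)) p
    (CH (ZMod (p ^ M)) p (-frobLin.rTensor _ (x n)) (D.e n)) (x n) := by
  have := (isCHProd_three_iff p M k n (OK p M k) _ _ _ _ (Fact.out : p.Prime).two_le).mp (h.gauge n)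
  rwa [scalarMap_frobOK] at this

omit h in
theorem tauβ_P_kills (i : Idx p D.eS) (r : Fin N₀) :
    ∀ s < i.1.2, ∀ f ∈ D.Pole s, ((D.tauβ r).comp (D.P i)) f = 0 := fun s hs f hf => by
  rw [LinearMap.comp_apply, D.P_eq_zero_of_mem_Pole hf hs, map_zero]

variable (hv : IsGeneratorFamily p M k D.β V V₀ v)
include hv

theorem generator_eq (n : ℕ) (i : Idx p D.eS) (r : Fin N₀) : (v (some (i, r))).1 n =
    con _ ((D.tauβ r).comp (D.P i)) (elemEDag p M k D.S D.α₀ V V₀ n) := by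
  rw [← con_rTensor, D.P_dag h, (D.isGeneratorFamily_iff.mp hv).2]

/-- A generator of weight `m` is the contraction of `e† ∈ 𝒩` with a functional killing poles of
order `< m`; closedness of `ℒ(m)` passes from the layers to `ℒ`. -/
theorem generator_mem_Lfil (o : Option (Idx p D.eS × Fin N₀)) :
    v o ∈ Lfil p M k D.S (genWeight o) := by
  rcases o with _ | ⟨i, r⟩
  · rw [genWeight, Lfil_one]; trivial
  · refine isClosedInL_Lfil i.2.2.2.2 _ fun n => ?_
    have := D.con_mem_of_mem_NN (G := LL D.S n) (D.tauβ_P_kills i r) (fun s hs => LL_anti i.2.2.2.2 hs)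
      (D.dag_mem_NN_LL h n)
    rw [← D.generator_eq h hv] at this
    exact this

omit h hv in
theorem one_le_genWeight (o : Option (Idx p D.eS × Fin N₀)) : 1 ≤ genWeight o := by
  rcases o with _ | ⟨i, r⟩
  · exact le_rfl
  · exact i.2.2.2.2

theorem monomial_mem_Lfil {d : ℕ} {l : Lcal p M k} (hl : IsMonomial v genWeight d l) :
    1 ≤ d ∧ l ∈ Lfil p M k D.S d := by
  induction hl with
  | gen o => exact ⟨D.one_le_genWeight o, D.generator_mem_Lfil h hv o⟩
  | lie _ _ ha hb => exact ⟨by omega, lie_mem_Lfil ha.1 hb.1 ha.2 hb.2⟩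

theorem FW_le_LL {s : ℕ} (hs : 1 ≤ s) (n : ℕ) : FW v genWeight n s ≤ LL D.S n s := by
  refine Submodule.span_le.mpr ?_
  rintro _ ⟨d, l, hd, hl, rfl⟩
  exact ⟨l, Lfil_anti hs hd (D.monomial_mem_Lfil h hv hl).2, rfl⟩

theorem dag_mem_NN_FW (n : ℕ) :
    elemEDag p M k D.S D.α₀ V V₀ n ∈ D.NN 1 (FW v genWeight n) := by
  obtain ⟨F, hF⟩ := D.exists_finset_dag h n
  rw [D.elemEDag_eq hF]
  refine add_mem (Submodule.sum_mem _ fun i _ => D.B_smul_mem_NN fun r => ?_)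
    (D.const_tmul_mem_NN _ ?_)
  · rw [← (D.isGeneratorFamily_iff.mp hv).2]
    exact (IsMonomial.gen (some (i, r))).mem_FW le_rfl
  · rw [← (D.isGeneratorFamily_iff.mp hv).1]
    exact (IsMonomial.gen none).mem_FW le_rfl

omit h hv in
theorem con_e_eq_con_Pi_e {Λ : OK p M k →ₗ[ZMod (p ^ M)] ZMod (p ^ M)}
    (hΛ : ∀ f ∈ mK p M k, Λ f = 0) (n : ℕ) : con _ Λ (D.e n) = con _ Λ (D.Pi.rTensor _ (D.e n)) := by
  classical
  rw [← sub_eq_zero, ← map_sub]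
  -- The family that is everything at `s = 1` and zero afterwards records that `e - Πe` has
  -- coefficients in `𝔪(𝒦)`.
  have h1 := D.e_sub_Pi_mem_NN (n := n) (G := fun s => if s = 1 then ⊤ else ⊥) (if_pos rfl)
  refine (Submodule.span_le (p := LinearMap.ker (con _ Λ))).mpr ?_ h1
  rintro _ ⟨s, f, hf, l, hl, rfl⟩
  rw [SetLike.mem_coe, LinearMap.mem_ker, con_tmul]
  rcases s with _ | s
  · rw [hΛ f (D.mem_Pole_zero.mp hf), zero_smul]
  · have hl' : l ∈ (⊥ : Submodule (ZMod (p ^ M)) (Lvl p M k n)) := by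
      have h2 : s + 1 + 1 ≠ 1 := by omega
      simpa only [if_neg h2] using hl
    rw [(Submodule.mem_bot _).mp hl', smul_zero]

/-- `e ≡ e† - x + σ x` modulo brackets. -/
theorem dag_sub_Pi_e_mem {G G' : ℕ → Submodule (ZMod (p ^ M)) (Lvl p M k n)}
    (hG : ∀ s, LL D.S n (s + 1) ≤ G (s + 1)) (hG' : ∀ s, G' (s + 1) ≤ G (s + 1))
    (hGG : ∀ s s', ∀ a ∈ G (s + 1), ∀ b ∈ G (s' + 1), ⁅a, b⁆ ∈ G' (s + s' + 1 + 1)) :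
    elemEDag p M k D.S D.α₀ V V₀ n - D.Pi.rTensor _ (D.e n) ∈ D.NN 1 G' := by
  have h1 := (chGroup_lvl (p := p) (M := M) (k := k) n (OK p M k)).sub_mem_of_eq_ch
    (D.dag_eq_CH h n) (D.NN_mono hG (D.e_mem_NN n))
    (D.NN_mono hG (D.NN_zero_le (D.x_mem_NN_LL h n))) (D.NN_mono hG (D.dag_mem_NN_LL h n))
    (D.lie_mem_NN hGG) (D.NN_mono hG')
  have h2 := D.rTensor_mem_NN (fun s f hf => D.Pi_mem_Pole hf) h1
  -- `Π` kills `σx - x`, so `x` drops out of the linearized gauge equation, and `Πe† = e†`.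
  have h3 : D.Pi.rTensor _ (x n) - D.Pi.rTensor _ (frobLin.rTensor _ (x n)) = 0 := by
    have : D.Pi ∘ₗ (frobLin - LinearMap.id) = 0 := LinearMap.ext D.Pi_frobOK_sub
    have h4 := congrArg (fun T => LinearMap.rTensor (Lvl p M k n) T (x n)) this
    simp only [LinearMap.rTensor_comp_apply, LinearMap.rTensor_sub, LinearMap.rTensor_id,
      LinearMap.rTensor_zero, LinearMap.zero_apply] at h4
    have h5 := neg_eq_zero.mpr h4
    rw [← h5, LinearMap.sub_apply, LinearMap.id_apply, map_sub, neg_sub]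
  rwa [map_sub, map_sub, map_add, D.Pi_dag h, add_sub_assoc, h3, add_zero] at h2

theorem Pi_e_mem_NN_FC {r : ℕ} (hr : ∀ s, LL D.S n (s + 1) ≤ FC v genWeight n r (s + 1)) :
    D.Pi.rTensor _ (D.e n) ∈ D.NN 1 (FC v genWeight n (r + 1)) := by
  have h1 := D.dag_sub_Pi_e_mem h hv hr (fun s => FC_succ_le)
    (fun s s' a ha b hb => by
      have := lie_mem_FC_succ ha hb
      rwa [show s + 1 + (s' + 1) = s + s' + 1 + 1 by omega] at this)
  have h2 : elemEDag p M k D.S D.α₀ V V₀ n ∈ D.NN 1 (FC v genWeight n (r + 1)) :=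
    D.NN_mono (fun s => le_sup_left) (D.dag_mem_NN_FW h hv n)
  have := sub_mem h2 h1
  rwa [sub_sub_cancel] at this

/-- Units are contractions of `e` with functionals killing low poles, and for such functionals `e`
may be replaced by `Πe`. For `s = 1` it is enough to treat `t₀` and the `E(w, t₀^a)`, which generate
the classes of units in the layer. -/
theorem genLvl_mem_FC {r : ℕ} (hr : ∀ s, LL D.S n (s + 1) ≤ FC v genWeight n r (s + 1)) {s : ℕ}
    (hs : 1 ≤ s) {u : (k⸨X⸩)ˣ} (hu : u ∈ unitFil p M k D.S s) :
    genLvl p M k n u ∈ FC v genWeight n (r + 1) s := by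
  have h1 := D.Pi_e_mem_NN_FC h hv hr
  rcases s with _ | _ | s
  · omega
  · refine genLvl_mem_of (Q := (FC v genWeight n (r + 1) 1).toAddSubgroup) ?_
      (fun a h1a ha w => ?_) u
    · rw [← D.con_e_P0, D.con_e_eq_con_Pi_e fun f hf => D.P0_eq_zero_of_mem_mK hf]
      refine D.con_mem_of_mem_NN (G := FC v genWeight n (r + 1)) (fun s hs f hf => ?_) (fun s hs => FC_anti hs) h1
      obtain rfl : s = 0 := by omega
      exact D.P0_eq_zero_of_mem_mK (D.mem_Pole_zero.mp hf)
    · obtain ⟨Λ, hΛ, hΛe⟩ := D.exists_functional_genE h1a ha w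
      rw [← hΛe n, D.con_e_eq_con_Pi_e hΛ]
      refine D.con_mem_of_mem_NN (G := FC v genWeight n (r + 1)) (fun s hs f hf => ?_) (fun s hs => FC_anti hs) h1
      obtain rfl : s = 0 := by omega
      exact hΛ f (D.mem_Pole_zero.mp hf)
  · obtain ⟨Λ, hΛ, hΛe⟩ := D.exists_functional_of_mem_unitFil hu
    rw [← hΛe n, D.con_e_eq_con_Pi_e fun f hf => hΛ 0 (by omega) f (D.mem_Pole_zero.mpr hf)]
    exact D.con_mem_of_mem_NN (G := FC v genWeight n (r + 1)) hΛ (fun s hs => FC_anti hs) h1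

/-- Induction on the depth `r`. The inclusion at depth `r` puts the units of each step of the
filtration in the weight filtration at depth `r + 1`. The latter then defines an admissible
filtration of `ℒ`, and minimality of `ℒ(s)` gives the inclusion at depth `r + 1`. At depth `p - 1`
the lower central series contributes nothing. -/
theorem LL_le_FC (r n s : ℕ) : LL D.S n (s + 1) ≤ FC v genWeight n r (s + 1) := by
  induction r generalizing n s with
  | zero => rw [FC_zero]; exact le_top
  | succ r ih =>
    have hu : ∀ s, 1 ≤ s → ∀ u ∈ unitFil p M k D.S s, ∀ n,
        genLvl p M k n u ∈ FC v genWeight n (r + 1) s :=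
      fun s hs u hu n => D.genLvl_mem_FC h hv (ih n) hs hu
    have h1 : ∀ n, FC v genWeight n (r + 1) 1 = ⊤ := by
      intro n
      rw [eq_top_iff]
      intro z _
      induction z using lvl_induction with
      | gen u => exact hu 1 le_rfl u trivial n
      | zero => exact zero_mem _
      | add a b ha hb => exact add_mem (ha trivial) (hb trivial)
      | smul c a ha => exact Submodule.smul_mem _ c (ha trivial)
      | lie a b ha hb =>
        have hab := lie_mem_FC (v := v) (w := genWeight) (s := 1) (s' := 1) (ha trivial)
          (hb trivial)
        exact FC_anti (s := 1) (s' := 1 + 1) (Nat.le_add_left 1 1) hab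
    rintro _ ⟨l, hl, rfl⟩
    have h2 : IsAdmissibleFiltration p M k D.S (fun s => FCIdeal v genWeight (r + 1) s h1) :=
      isAdmissible_FCIdeal (v := v) (w := genWeight) (S := D.S) (r := r + 1) h1 hu
    have h3 : l ∈ FCIdeal v genWeight (r + 1) (s + 1) h1 := mem_Lfil.mp hl _ h2
    exact mem_FCIdeal.mp h3 n

theorem LL_eq_FW {s : ℕ} (hs : 1 ≤ s) (n : ℕ) : LL D.S n s = FW v genWeight n s := by
  refine le_antisymm ?_ (D.FW_le_LL h hv hs n)
  obtain ⟨s, rfl⟩ : ∃ s', s = s' + 1 := ⟨s - 1, by omega⟩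
  rw [← FC_eq_FW]
  exact D.LL_le_FC h hv (p - 1) n s

theorem Lfil_eq_wt {s : ℕ} (hs : 1 ≤ s) : (Lfil p M k D.S s : Set (Lcal p M k)) =
    {l | (s : ℕ∞) ≤ wt v genWeight l} := by
  ext l
  rw [Set.mem_ofPred_eq, le_wt_iff hs, mem_weightGE]
  constructor
  · intro hl n
    rw [← D.LL_eq_FW h hv hs]
    exact ⟨l, hl, rfl⟩
  · intro hl
    refine isClosedInL_Lfil hs l fun n => ?_
    have := hl n
    rw [← D.LL_eq_FW h hv hs] at this
    exact this

end Datum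

/-! ### Freeness -/

namespace Datum

variable {p : ℕ} [Fact p.Prime] {M : ℕ} {k : Type*} [Field k] [CharP k p] [PerfectRing k p]
  {N₀ : ℕ} (D : Datum p M k N₀)

/-- Modulo `𝔪(𝒦)`, on which coefficient functionals vanish, `f` is the finite sum of its terms in
`t^{-a}` with `a` prime to `p`. -/
theorem P_eq_sum_of_noP (i : Idx p D.eS) {f : OK p M k} (hf : NoP f) {N : ℕ}
    (hN : ∀ a : ℕ, N < a → cf p M k (-(a : ℤ)) f = 0) :
    D.P i f = ∑ a ∈ copr p N, D.P i (tPow p M k (-(a : ℤ))) * cf p M k (-(a : ℤ)) f := by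
  have h1 : f - ∑ a ∈ copr p N, tPow p M k (-(a : ℤ)) *
      constOK p M k (cf p M k (-(a : ℤ)) f) ∈ mK p M k := by
    refine mem_mK_of_noP (hf.sub (NoP.sum fun a ha => noP_tPow_mul_const ?_ _)) fun j hj => ?_
    · rw [dvd_neg]
      exact not_dvd_of_coprime ((mem_copr).mp ha).2.2
    · obtain ⟨b, rfl⟩ : ∃ b : ℕ, j = -(b : ℤ) := ⟨j.natAbs, by omega⟩
      rw [map_sub, map_sum, Finset.sum_congr rfl fun a _ => cf_tPow_mul_const _ _ _, sub_eq_zero]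
      by_cases hb : b ∈ copr p N
      · rw [Finset.sum_eq_single b (fun a _ hab => if_neg (by omega)) fun h => absurd hb h,
          if_pos rfl]
      · rw [Finset.sum_eq_zero fun a ha => if_neg fun h => hb (by
          obtain rfl : b = a := by omega
          exact ha)]
        rw [mem_copr] at hb
        by_cases hbN : N < b
        · exact hN b hbN
        · have hbp : ¬ b.Coprime p := fun h => hb ⟨by omega, by omega, h⟩
          have hpb : p ∣ b := by
            by_contra h
            exact hbp (coprime_of_not_dvd h)
          obtain ⟨c, rfl⟩ := hpb
          have := hf (-(c : ℤ))
          rwa [show -((p * c : ℕ) : ℤ) = p * -(c : ℤ) by push_cast; ring]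
  have h2 := D.Pw_of_mem_mK h1
  rw [map_sub, sub_eq_zero] at h2
  rw [P_apply, h2, ← P_apply, map_sum]
  exact Finset.sum_congr rfl fun a ha => D.P_tPow_mul_const i ((mem_copr).mp ha).2.2 _

/-- A homomorphism from `𝒦^*` with prescribed values on the linear parts of the generators. -/
theorem exists_unit_hom_generators {H : Type*} [AddCommGroup H] [Module (ZMod (p ^ M)) H]
    (g : Option (Idx p D.eS × Fin N₀) → H) (hg : {o | g o ≠ 0}.Finite) :
    ∃ (ε : (k⸨X⸩)ˣ → H) (n : ℕ), (∀ u v, ε (u * v) = ε u + ε v) ∧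
      (∀ u : (k⸨X⸩)ˣ, ∀ f : k⟦X⟧, (u : k⸨X⸩) = HahnSeries.ofPowerSeries ℤ k f →
        (PowerSeries.X : k⟦X⟧) ^ (n + 1) ∣ f - 1 → ε u = 0) ∧
      ε (toUnit k PowerSeries.X) = g none ∧
      ∀ n', n ≤ n' → ∀ i j, ∑ a ∈ copr p n', ε (toUnit k (shafAt p k (Function.surjInv
        (toWM_surjective p M k) ((a : ZMod (p ^ M))⁻¹ •
          (D.β j * D.P i (tPow p M k (-(a : ℤ)))))) a)) = g (some (i, j)) := by
  classical
  obtain ⟨F, hF⟩ : ∃ F : Finset (Idx p D.eS × Fin N₀), ∀ o, o ∉ F → g (some o) = 0 :=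
    ⟨(hg.preimage (Option.some_injective _).injOn).toFinset, fun o ho => not_not.mp fun h' =>
      ho ((Set.Finite.mem_toFinset _).mpr h')⟩
  -- The elements `S^{-m} t^b γ_j` are dual to the functionals `f ↦ tr(β_j P_i(f))` that define the
  -- linear parts of the generators.
  set f : Idx p D.eS × Fin N₀ → OK p M k := fun o => D.B o.1 * constOK p M k (D.γ o.2) with hf
  choose b hb using fun o => exists_bound (f o)
  set N := F.sup b with hN
  have hfN : ∀ o ∈ F, ∀ a : ℕ, N < a → cf p M k (-(a : ℤ)) (f o) = 0 := fun o ho a ha =>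
    hb o _ (by have := Finset.le_sup (f := b) ho; omega)
  -- The factor `a` cancels the exponent `1/a`. With the `t^{-a}`-coefficients of `f o` as weights,
  -- the sum over `a` reassembles `P_i(f o)` by `P_eq_sum_of_noP`, and duality isolates the
  -- prescribed value.
  set χ : ℕ → WM p M k →ₗ[ZMod (p ^ M)] H := fun a => ∑ o ∈ F,
    (D.tau.comp (LinearMap.mulLeft _ ((a : WM p M k) * cf p M k (-(a : ℤ)) (f o)))).smulRight
      (g (some o)) with hχ
  have hχN : ∀ a, N < a → (χ a).toAddMonoidHom = 0 := by
    intro a ha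
    ext w
    simp only [hχ, LinearMap.toAddMonoidHom_coe, LinearMap.sum_apply, AddMonoidHom.zero_apply]
    refine Finset.sum_eq_zero fun o ho => ?_
    rw [LinearMap.smulRight_apply, hfN o ho a ha, mul_zero, LinearMap.comp_apply,
      LinearMap.mulLeft_apply, zero_mul, map_zero, zero_smul]
  obtain ⟨ε, n, hmul, hone, h0, hε⟩ := exists_unit_hom M (g none) (fun a => (χ a).toAddMonoidHom) hχN
  refine ⟨ε, max n N, hmul, fun u e he hd => hone u e he ((pow_dvd_pow _ (by omega)).trans hd), h0,
    fun n' hn' i j => ?_⟩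
  have hfN' : ∀ o ∈ F, ∀ a : ℕ, n' < a → cf p M k (-(a : ℤ)) (f o) = 0 := fun o ho a ha =>
    hfN o ho a (by omega)
  calc _ = ∑ a ∈ copr p n', ∑ o ∈ F, D.tau (D.β j * (D.P i (tPow p M k (-(a : ℤ))) *
        cf p M k (-(a : ℤ)) (f o))) • g (some o) := by
        refine Finset.sum_congr rfl fun a ha => ?_
        obtain ⟨h1, -, h2⟩ := (mem_copr).mp ha
        rw [hε a h1 h2, Function.surjInv_eq (toWM_surjective p M k), LinearMap.toAddMonoidHom_coe, hχ, LinearMap.sum_apply]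
        refine Finset.sum_congr rfl fun o _ => ?_
        rw [LinearMap.smulRight_apply, LinearMap.comp_apply, LinearMap.mulLeft_apply]
        congr 2
        rw [mul_right_comm, inv_natCast_smul a h2]
        ring
    _ = ∑ o ∈ F, D.tau (D.β j * D.P i (f o)) • g (some o) := by
        rw [Finset.sum_comm]
        refine Finset.sum_congr rfl fun o ho => ?_
        rw [← Finset.sum_smul, ← map_sum, ← Finset.mul_sum,
          ← D.P_eq_sum_of_noP i (D.noP_B_mul_const o.1 _) (hfN' o ho)]
    _ = ∑ o ∈ F, if o = (i, j) then g (some (i, j)) else 0 := by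
        refine Finset.sum_congr rfl fun o _ => ?_
        obtain ⟨i', j'⟩ := o
        rw [hf, D.P_B_mul_const]
        by_cases hi : i' = i
        · subst hi
          rw [if_pos rfl, tau_β_mul_γ]
          by_cases hj : j = j'
          · subst hj; rw [if_pos rfl, if_pos rfl, one_smul]
          · rw [if_neg hj, zero_smul, if_neg fun h => hj (congrArg Prod.snd h).symm]
        · rw [if_neg hi, mul_zero, map_zero, zero_smul,
            if_neg fun h => hi (congrArg Prod.fst h)]
    _ = g (some (i, j)) := by
        rw [Finset.sum_ite_eq']
        split_ifs with h
        · rfl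
        · exact (hF _ h).symm

end Datum

section ContinuousHom

variable {p : ℕ} [Fact p.Prime] {M : ℕ} {k : Type*} [Field k] [CharP k p] {H : Type*} [LieRing H]
  [LieAlgebra (ZMod (p ^ M)) H] {φ ψ : Lcal p M k →ₗ⁅ZMod (p ^ M)⁆ H} {n : ℕ}
  (hφ : ∀ l : Lcal p M k, l.1 n = 0 → φ l = 0) (hψ : ∀ l : Lcal p M k, l.1 n = 0 → ψ l = 0)
include hφ hψ

theorem lieHom_sub_congr {l l' : Lcal p M k} (h : l.1 n = l'.1 n) : φ l - ψ l = φ l' - ψ l' := by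
  have h0 : (l - l').1 n = 0 := by
    rw [Submodule.coe_sub, Pi.sub_apply, h, sub_self]
  have h1 := hφ _ h0
  have h2 := hψ _ h0
  rw [map_sub, sub_eq_zero] at h1 h2
  rw [h1, h2]

theorem lieHom_sub_mem_lcs {r : ℕ} (hr : ∀ u, φ (gen p M k u) - ψ (gen p M k u) ∈ lcs (ZMod (p ^ M)) H r)
    (l : Lcal p M k) : φ l - ψ l ∈ lcs (ZMod (p ^ M)) H r := by
  suffices h : ∀ z : Lvl p M k n, ∃ l : Lcal p M k, l.1 n = z ∧ φ l - ψ l ∈ lcs (ZMod (p ^ M)) H r by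
    obtain ⟨l', h1, h2⟩ := h (l.1 n)
    rwa [lieHom_sub_congr hφ hψ h1] at h2
  intro z
  induction z using lvl_induction with
  | gen u => exact ⟨gen p M k u, rfl, hr u⟩
  | zero => exact ⟨0, rfl, by rw [map_zero, map_zero, sub_zero]; exact zero_mem _⟩
  | add a b ha hb =>
    obtain ⟨a, rfl, ha⟩ := ha
    obtain ⟨b, rfl, hb⟩ := hb
    exact ⟨a + b, rfl, by rw [map_add, map_add, add_sub_add_comm]; exact add_mem ha hb⟩
  | smul c a ha =>
    obtain ⟨a, rfl, ha⟩ := ha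
    refine ⟨c • a, rfl, ?_⟩
    rw [map_smul, map_smul, ← smul_sub]
    exact (lcs (ZMod (p ^ M)) H r).toSubmodule.smul_mem c ha
  | lie a b ha hb =>
    obtain ⟨a, rfl, ha⟩ := ha
    obtain ⟨b, rfl, hb⟩ := hb
    refine ⟨⁅a, b⁆, rfl, ?_⟩
    rw [LieHom.map_lie, LieHom.map_lie,
      show ⁅φ a, φ b⁆ - ⁅ψ a, ψ b⁆ = ⁅φ a, φ b - ψ b⁆ - ⁅ψ b, φ a - ψ a⁆ by
        rw [lie_sub, lie_sub, ← lie_skew (ψ b) (φ a), ← lie_skew (ψ b) (ψ a)]; abel]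
    exact sub_mem (LieSubmodule.lie_mem _ hb) (LieSubmodule.lie_mem _ ha)

/-- A difference of images of `[a, b]` is a sum of brackets each containing a difference of images,
so agreement to depth `r` on everything becomes agreement to depth `r + 1` on commutators. -/
theorem lieHom_sub_mem_lcs_succ {r : ℕ} (hr : ∀ l, φ l - ψ l ∈ lcs (ZMod (p ^ M)) H r)
    {l : Lcal p M k} (hl : l.1 n ∈ lcs (ZMod (p ^ M)) (Lvl p M k n) 1) :
    φ l - ψ l ∈ lcs (ZMod (p ^ M)) H (r + 1) := by
  suffices h : ∀ z ∈ lcs (ZMod (p ^ M)) (Lvl p M k n) 1, ∃ l : Lcal p M k, l.1 n = z ∧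
      φ l - ψ l ∈ lcs (ZMod (p ^ M)) H (r + 1) by
    obtain ⟨l', h1, h2⟩ := h _ hl
    rwa [lieHom_sub_congr hφ hψ h1] at h2
  intro z hz
  induction hz using lcs_succ_induction with
  | lie x y hy =>
    obtain ⟨a, rfl⟩ := ev_surjective p M k n x
    obtain ⟨b, rfl⟩ := ev_surjective p M k n y
    refine ⟨⁅a, b⁆, rfl, ?_⟩
    rw [LieHom.map_lie, LieHom.map_lie,
      show ⁅φ a, φ b⁆ - ⁅ψ a, ψ b⁆ = ⁅φ a, φ b - ψ b⁆ - ⁅ψ b, φ a - ψ a⁆ by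
        rw [lie_sub, lie_sub, ← lie_skew (ψ b) (φ a), ← lie_skew (ψ b) (ψ a)]; abel]
    exact sub_mem (lie_mem_lcs_succ _ (hr b)) (lie_mem_lcs_succ _ (hr a))
  | zero => exact ⟨0, rfl, by rw [map_zero, map_zero, sub_zero]; exact zero_mem _⟩
  | add a _ b _ ha hb =>
    obtain ⟨a, rfl, ha⟩ := ha
    obtain ⟨b, rfl, hb⟩ := hb
    exact ⟨a + b, rfl, by rw [map_add, map_add, add_sub_add_comm]; exact add_mem ha hb⟩
  | smul c a _ ha =>
    obtain ⟨a, rfl, ha⟩ := ha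
    refine ⟨c • a, rfl, ?_⟩
    rw [map_smul, map_smul, ← smul_sub]
    exact (lcs (ZMod (p ^ M)) H (r + 1)).toSubmodule.smul_mem c ha

theorem lieHom_eq_of_span {ι : Type*} {v : ι → Lcal p M k} {w : ι → ℕ} {s : ℕ}
    (hv : FW v w n s = ⊤) (h : ∀ i, φ (v i) = ψ (v i)) : φ = ψ := by
  have hmon : ∀ d l, IsMonomial v w d l → φ l = ψ l := by
    intro d l hl
    induction hl with
    | gen i => exact h i
    | lie _ _ ha hb => rw [LieHom.map_lie, LieHom.map_lie, ha, hb]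
  suffices h : ∀ z ∈ FW v w n s, ∃ l : Lcal p M k, l.1 n = z ∧ φ l = ψ l by
    ext l
    obtain ⟨l', h1, h2⟩ := h (l.1 n) (hv ▸ Submodule.mem_top)
    have := lieHom_sub_congr hφ hψ h1
    rwa [h2, sub_self, eq_comm, sub_eq_zero] at this
  intro z hz
  induction hz using Submodule.span_induction with
  | mem z hz =>
    obtain ⟨d, l, -, hl, rfl⟩ := hz
    exact ⟨l, rfl, hmon d l hl⟩
  | zero => exact ⟨0, rfl, by rw [map_zero, map_zero]⟩
  | add a b _ _ ha hb =>
    obtain ⟨a, rfl, ha⟩ := ha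
    obtain ⟨b, rfl, hb⟩ := hb
    exact ⟨a + b, rfl, by rw [map_add, map_add, ha, hb]⟩
  | smul c a _ ha =>
    obtain ⟨a, rfl, ha⟩ := ha
    exact ⟨c • a, rfl, by rw [map_smul, map_smul, ha]⟩

end ContinuousHom

namespace Datum

variable {p : ℕ} [Fact p.Prime] {M : ℕ} {k : Type*} [Field k] [CharP k p] [PerfectRing k p]
  {N₀ : ℕ} (D : Datum p M k N₀)
  {V : Idx p (eStar p M k D.S) → LR p M k (WM p M k)} {V₀ : Lcal p M k}
  {v : Option (Idx p (eStar p M k D.S) × Fin N₀) → Lcal p M k}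
  {x : ∀ n, OK p M k ⊗[ZMod (p ^ M)] Lvl p M k n}
  (h : IsGaugeData p M k D.S D.α₀ D.β D.γ V V₀ x)
  (hv : IsGeneratorFamily p M k D.β V V₀ v)
include h hv

/-- Modulo all brackets `e†` and `Πe` agree, so the linear parts of the generators are contractions
of `e`. Taking `m = 0` and a constant family makes the condition on poles empty. -/
theorem con_dag_sub_con_e_mem {Λ : OK p M k →ₗ[ZMod (p ^ M)] ZMod (p ^ M)}
    (hΛ : ∀ f ∈ mK p M k, Λ f = 0) (n : ℕ) :
    con _ Λ (elemEDag p M k D.S D.α₀ V V₀ n) - con _ Λ (D.e n) ∈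
      lcs (ZMod (p ^ M)) (Lvl p M k n) 1 := by
  rw [D.con_e_eq_con_Pi_e hΛ, ← map_sub]
  exact D.con_mem_of_mem_NN (m := 0)
    (G := fun _ => (lcs (ZMod (p ^ M)) (Lvl p M k n) 1).toSubmodule)
    (fun s hs => absurd hs (Nat.not_lt_zero s)) (fun _ _ => le_rfl)
    (D.dag_sub_Pi_e_mem h hv (G := fun _ => ⊤) (fun _ => le_top) (fun _ => le_top)
      fun _ _ a _ _ _ => lie_mem_lcs_succ (j := 0) a trivial)

theorem generator_none_sub_mem (n : ℕ) :
    (v none).1 n - genLvl p M k n (toUnit k PowerSeries.X) ∈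
      lcs (ZMod (p ^ M)) (Lvl p M k n) 1 := by
  rw [hv.1, ← D.con_P0_dag h n, ← D.con_e_P0]
  exact D.con_dag_sub_con_e_mem h hv (fun f hf => D.P0_eq_zero_of_mem_mK hf) n

theorem generator_some_sub_mem (n : ℕ) (i : Idx p D.eS) (j : Fin N₀) :
    (v (some (i, j))).1 n - ∑ a ∈ copr p n, genE p M k n a
      ((a : ZMod (p ^ M))⁻¹ • (D.β j * D.P i (tPow p M k (-(a : ℤ))))) ∈
      lcs (ZMod (p ^ M)) (Lvl p M k n) 1 := by
  rw [← D.con_e_P]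
  have h1 := D.con_dag_sub_con_e_mem h hv (Λ := (D.tauβ j).comp (D.P i)) (fun f hf => ?_) n
  · rwa [← D.generator_eq h hv] at h1
  rw [LinearMap.comp_apply, P_apply, D.Pw_of_mem_mK hf, Finsupp.coe_zero, Pi.zero_apply, map_zero]

theorem finite_generator (n : ℕ) : {o | (v o).1 n ≠ 0}.Finite := by
  classical
  obtain ⟨F, hF⟩ := D.exists_finset_dag h n
  refine Set.Finite.subset (Finset.finite_toSet
    (insert none ((F ×ˢ (Finset.univ : Finset (Fin N₀))).image some))) ?_
  rintro (_ | ⟨i, j⟩) ho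
  · simp
  · have hi : i ∈ F := by
      by_contra hi
      refine ho ?_
      rw [(D.isGeneratorFamily_iff.mp hv).2, hF i hi, map_zero]
    simpa using hi

variable {H : Type*} [LieRing H] [LieAlgebra (ZMod (p ^ M)) H]

/-- One step of the construction of a homomorphism with prescribed values on the generators. -/
theorem exists_lieHom_improve (hH : lcs (ZMod (p ^ M)) H (p - 1) = ⊥)
    (c : Option (Idx p (eStar p M k D.S) × Fin N₀) → H) (hc : {o | c o ≠ 0}.Finite) {r n : ℕ}
    {φ : Lcal p M k →ₗ⁅ZMod (p ^ M)⁆ H} (hφ : ∀ l : Lcal p M k, l.1 n = 0 → φ l = 0)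
    (hr : ∀ o, c o - φ (v o) ∈ lcs (ZMod (p ^ M)) H r) :
    ∃ (n' : ℕ) (ψ : Lcal p M k →ₗ⁅ZMod (p ^ M)⁆ H), (∀ l : Lcal p M k, l.1 n' = 0 → ψ l = 0) ∧
      ∀ o, c o - ψ (v o) ∈ lcs (ZMod (p ^ M)) H (r + 1) := by
  -- The defects lie in `lcs r`. They are absorbed by adding to `φ` on units a homomorphism `ε` into
  -- `lcs r` taking these values on the linear parts of the generators.
  let g : Option (Idx p D.eS × Fin N₀) → (lcs (ZMod (p ^ M)) H r).toSubmodule :=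
    fun o => ⟨c o - φ (v o), hr o⟩
  have hg : {o | g o ≠ 0}.Finite := by
    refine (hc.union (D.finite_generator h hv n)).subset fun o ho => ?_
    by_contra h'
    rw [Set.mem_union, not_or] at h'
    refine ho (Subtype.ext ?_)
    have h1 : c o = 0 := not_not.mp h'.1
    have h2 : (v o).1 n = 0 := not_not.mp h'.2
    show c o - φ (v o) = 0
    rw [h1, hφ _ h2, sub_zero]
  obtain ⟨ε, m, hmul, hone, hX, hE⟩ := D.exists_unit_hom_generators g hg
  obtain ⟨n', hn, hm⟩ : ∃ n', n ≤ n' ∧ m ≤ n' := ⟨max n m, le_max_left _ _, le_max_right _ _⟩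
  have hφ' : ∀ l : Lcal p M k, l.1 n' = 0 → φ l = 0 := fun l hl => hφ l (eval_eq_zero_of_le hn hl)
  obtain ⟨ψ, hψ⟩ := exists_lvl_lift p M k hH (fun u => φ (gen p M k u) + (ε u : H))
    (fun u u' => by
      have h0 : φ (gen p M k (u * u') - (gen p M k u + gen p M k u')) = 0 := hφ _ (by
        show genLvl p M k n (u * u') - (genLvl p M k n u + genLvl p M k n u') = 0
        rw [genLvl_mul, sub_self])
      rw [map_sub, map_add, sub_eq_zero] at h0
      rw [h0, hmul, Submodule.coe_add]
      abel) n'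
    (fun u f hu hf => by
      rw [hone u f hu ((pow_dvd_pow _ (by omega)).trans hf), hφ' _ (genLvl_eq_zero p M k n' u f hu hf),
        Submodule.coe_zero, add_zero])
  refine ⟨n', ψ.comp (ev p M k n'), fun l hl => ?_, fun o => ?_⟩
  · rw [LieHom.comp_apply, ev_apply, hl, map_zero]
  set ψ' := ψ.comp (ev p M k n') with hψ'
  have hψ0 : ∀ l : Lcal p M k, l.1 n' = 0 → ψ' l = 0 := fun l hl => by
    rw [hψ', LieHom.comp_apply, ev_apply, hl, map_zero]
  have hgen : ∀ u, ψ' (gen p M k u) - φ (gen p M k u) = ε u := fun u => by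
    rw [hψ', LieHom.comp_apply, ev_apply]
    exact sub_eq_of_eq_add' (hψ u)
  have hsub := lieHom_sub_mem_lcs hψ0 hφ' (r := r) fun u => by rw [hgen]; exact (ε u).2
  -- The change from `φ` to `ψ'` alters values on commutators only in `lcs (r + 1)`, so `v o` may be
  -- replaced by a combination of units with the same linear part.
  suffices hl : ∃ l : Lcal p M k, (v o).1 n' - l.1 n' ∈ lcs (ZMod (p ^ M)) (Lvl p M k n') 1 ∧
      ψ' l - φ l = g o by
    obtain ⟨l, h1, h2⟩ := hl
    have h3 := lieHom_sub_mem_lcs_succ hψ0 hφ' hsub (l := v o - l) h1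
    rw [map_sub, map_sub] at h3
    have h4 : c o - ψ' (v o) = -(ψ' (v o) - ψ' l - (φ (v o) - φ l)) := by
      have : ψ' l - φ l = c o - φ (v o) := h2
      rw [show c o = ψ' l - φ l + φ (v o) by rw [this]; abel]
      abel
    rw [h4]
    exact neg_mem h3
  rcases o with _ | ⟨i, j⟩
  · exact ⟨gen p M k (toUnit k PowerSeries.X), D.generator_none_sub_mem h hv n',
      (hgen _).trans (congrArg Subtype.val hX)⟩
  · set u : ℕ → (k⸨X⸩)ˣ := fun a => toUnit k (shafAt p k (Function.surjInv
      (toWM_surjective p M k) ((a : ZMod (p ^ M))⁻¹ •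
        (D.β j * D.P i (tPow p M k (-(a : ℤ)))))) a) with hu
    refine ⟨∑ a ∈ copr p n', gen p M k (u a), ?_, ?_⟩
    · have h1 : (∑ a ∈ copr p n', gen p M k (u a)).1 n' = ∑ a ∈ copr p n', genLvl p M k n' (u a) :=
        map_sum (ev p M k n') _ _
      have h2 := D.generator_some_sub_mem h hv n' i j
      rw [Finset.sum_congr rfl fun a ha => genE_apply n'
        (Nat.one_le_iff_ne_zero.mp (mem_copr.mp ha).1) _] at h2
      rw [h1]
      exact h2
    · rw [map_sum, map_sum, ← Finset.sum_sub_distrib, Finset.sum_congr rfl fun a _ => hgen _,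
        ← Submodule.coe_sum]
      exact congrArg Subtype.val (hE n' hm i j)

/-- Existence starts from the zero homomorphism and improves it `p - 1` times, the class of `H`
being `< p`. Uniqueness holds because the case `s = 1` of `LL_eq_FW` says that the commutators in
`v` span every layer. -/
theorem isFreeTopGenerators : IsFreeTopGenerators p M k v := by
  refine ⟨D.finite_generator h hv, fun H _ _ _ hH c hc => ?_⟩
  have key : ∀ r, ∃ (n : ℕ) (φ : Lcal p M k →ₗ⁅ZMod (p ^ M)⁆ H),
      (∀ l : Lcal p M k, l.1 n = 0 → φ l = 0) ∧ ∀ o, c o - φ (v o) ∈ lcs (ZMod (p ^ M)) H r := by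
    intro r
    induction r with
    | zero => exact ⟨0, 0, fun _ _ => rfl, fun _ => trivial⟩
    | succ r ih =>
      obtain ⟨n, φ, hφ, hr⟩ := ih
      exact D.exists_lieHom_improve h hv hH c hc hφ hr
  obtain ⟨n, φ, hφ, hr⟩ := key (p - 1)
  have hφv : ∀ o, φ (v o) = c o := fun o => by
    have := hr o
    rw [lcs, hH, LieSubmodule.mem_bot, sub_eq_zero] at this
    exact this.symm
  refine ⟨φ, ⟨⟨n, hφ⟩, hφv⟩, ?_⟩
  rintro ψ ⟨⟨m, hψ⟩, hψv⟩
  refine lieHom_eq_of_span (n := max n m) (s := 1) (w := genWeight) (v := v)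
    (fun l hl => hψ l (eval_eq_zero_of_le (le_max_right n m) hl))
    (fun l hl => hφ l (eval_eq_zero_of_le (le_max_left n m) hl)) ?_
    fun o => (hψv o).trans (hφv o).symm
  exact (D.LL_eq_FW h hv le_rfl (max n m)).symm.trans (LL_one _)

end Datum

end NilpotentArtinSchreier

end

open NilpotentArtinSchreier

theorem corollary2p7 (p : ℕ) [Fact p.Prime] (hp : p ≠ 2) (M : ℕ) (hM : 1 ≤ M)
    (k : Type*) [Field k] [CharP k p] (N₀ : ℕ) (hN₀ : 1 ≤ N₀) (hk : Nat.card k = p ^ N₀)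
    (S₀ : (WM p M k)⟦X⟧) (hS₀ : PowerSeries.constantCoeff S₀ = 0)
    (hS₀p : ∃ n, ¬ ((p : WM p M k) ∣ PowerSeries.coeff n S₀))
    (α₀ : WM p M k) (hα₀ : trWM p M k N₀ α₀ = 1)
    (β γ : Module.Basis (Fin N₀) (ZMod (p ^ M)) (WM p M k))
    (hβγ : ∀ i j, trWM p M k N₀ (β i * γ j) = if i = j then 1 else 0) :
    (∃ V V₀ x, IsGaugeData p M k (serS p M k S₀) α₀ β γ V V₀ x) ∧
    ∀ V V₀ x, IsGaugeData p M k (serS p M k S₀) α₀ β γ V V₀ x →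
      (∃! v, IsGeneratorFamily p M k β V V₀ v) ∧
      ∀ v, IsGeneratorFamily p M k β V V₀ v →
        IsFreeTopGenerators p M k v ∧
        ∀ s : ℕ, 1 ≤ s → (Lfil p M k (serS p M k S₀) s : Set (Lcal p M k)) =
          {l | (s : ℕ∞) ≤ wt v genWeight l} := by
  -- Finiteness makes `k` perfect, which is what the arithmetic of `W_M(k)` and of the units
  -- requires.
  have : Finite k := Nat.finite_of_card_ne_zero (by
    rw [hk]; exact pow_ne_zero _ (Fact.out : p.Prime).ne_zero)
  let D : Datum p M k N₀ :=
    { one_le := hN₀, card := hk, S₀ := S₀, constantCoeff_S₀ := hS₀, exists_coeff_S₀ := hS₀p,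
      α₀ := α₀, trWM_α₀ := hα₀, β := β, γ := γ, dual := hβγ }
  exact ⟨D.exists_gaugeData, fun V V₀ x h => ⟨D.existsUnique_generatorFamily V V₀, fun v hv =>
    ⟨D.isFreeTopGenerators h hv, fun s hs => D.Lfil_eq_wt h hv hs⟩⟩⟩
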